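/- **Setting.** Let $\beta\in(0,1)$, $\Gamma>0$, $\gamma>5/\beta$. Put $I(x)=x\,e^{\Gamma x^{1/\gamma}}$, a bijection of $(0,\infty)$, and fix a strictly increasing positive $C^1$ fourth iterative root $I^{-1/4}<\mathrm{id}$ of $I^{-1}$ on $(0,e^{\Gamma})$. For $\epsilon>0$ put $C_{\beta,\epsilon}=3^{-6/\beta}\epsilon^{90/\beta}$ and $\mathcal I=\{(I^{-1/4})^{\ell}(1):\ell\ge 0\}$. Let $M$ be a compact smooth boundaryless Riemannian manifold of dimension $d\ge2$ and $f$ a $C^{1+\beta}$ diffeomorphism of $M$. Fix a finite open cover $\mathcal D$ of $M$ and, for $D\in\mathcal D$, a smooth map $\Theta_D:TD\to\mathbb R^d$ which is a linear isometry on every fibre and for which $(x,u)\mapsto\exp_x((\Theta_D|_{T_xM})^{-1}u)$ is smooth and Lipschitz on $D\times B_2(0)$. A point $x$ is *summable* if there is a unique splitting $T_xM=H^s(x)\oplus H^u(x)$ with $\sup_{\xi\in H^s(x),|\xi|=1}\sum_{m\ge0}|d_xf^m\xi|^2<\infty$ and $\sup_{\xi\in H^u(x),|\xi|=1}\sum_{m\ge0}|d_xf^{-m}\xi|^2<\infty$;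 $s(x)=\dim H^s(x)$. For summable $x$ let $C_0(x):\mathbb R^d=\mathbb R^{s(x)}\times\mathbb R^{d-s(x)}\to T_xM$ be a linear isomorphism that maps $\mathbb R^{s(x)}$ onto $H^s(x)$, $\mathbb R^{d-s(x)}$ onto $H^u(x)$, and is an isometry from the Euclidean inner product to $\langle\xi+\eta,\xi'+\eta'\rangle'=2\sum_{m\ge0}\langle d_xf^m\xi,d_xf^m\xi'\rangle+2\sum_{m\ge0}\langle d_xf^{-m}\eta,d_xf^{-m}\eta'\rangle$ ($\xi,\xi'\in H^s(x)$, $\eta,\eta'\in H^u(x)$). Put $\psi_x=\exp_x\circ C_0(x)$ and $Q_\epsilon(x)=\max\{q\in\mathcal I: q\le C_{\beta,\epsilon}\|C_0(x)^{-1}\|^{-2\gamma}\}$. Below, $|\cdot|$ is the Euclidean norm on each factor $\mathbb R^{s(x)},\mathbb R^{d-s(x)}$, operators carry the corresponding operator norm, and $R_q(0)=\{(v_s,v_u):|v_s|\le q,\ |v_u|\le q\}$. Two charts $\psi_{x_1}^{\eta_1},\psi_{x_2}^{\eta_2}$ ($x_i$ summable, $0<\eta_i\le Q_\epsilon(x_i)$)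 *$I$-overlap* if $I^{-1}(\eta_2)\le\eta_1\le I(\eta_2)$ and for some $D\in\mathcal D$ containing $x_1,x_2$, $d(x_1,x_2)+\|\Theta_DC_0(x_1)-\Theta_DC_0(x_2)\|<\eta_1^4\eta_2^4$. A *double chart* $\psi_x^{p^s,p^u}$ consists of a summable $x$ and $0<p^s,p^u\le Q_\epsilon(x)$. Write $\psi_x^{p^s,p^u}\to\psi_y^{q^s,q^u}$ if $\psi_x^{p^s\wedge p^u}$ and $\psi_{f^{-1}(y)}^{p^s\wedge p^u}$ $I$-overlap, $\psi_{f(x)}^{q^s\wedge q^u}$ and $\psi_y^{q^s\wedge q^u}$ $I$-overlap, $q^u=\min\{I(p^u),Q_\epsilon(y)\}$, $p^s=\min\{I(q^s),Q_\epsilon(x)\}$ and $s(x)=s(y)$. A *chain* is a sequence $(v_i)_{i\in\mathbb Z}$ of double charts with $v_i\to v_{i+1}$ for all $i$. A *$u$-manifold* of size $q$, $0<q\le Q_\epsilon(x)$, in $\psi_x$ is a set $V=\{\psi_x(F(t),t):t\in\mathbb R^{d-s(x)},|t|\le q\}$ with $F$ of class $C^{1+\beta/2}$ and $\max|F|\le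 Q_\epsilon(x)$; $F$ is its representing function. It is *$u$-admissible* in $\psi_x^{p^s,p^u}$ if $q=p^u$, $\max\|dF\|+\mathrm{H\ddot ol}_{\beta/2}(dF)\le\frac12$, $\|d_0F\|\le\frac12(p^s\wedge p^u)^{\beta/2}$ and $|F(0)|\le10^{-3}(p^s\wedge p^u)^2$. The *$s$-manifolds* $\{\psi_x(t,F(t)):t\in\mathbb R^{s(x)},|t|\le q\}$ and the $s$-admissible manifolds ($q=p^s$) are defined in the same way. For $v\to w$, the graph transform $\mathcal F_u(V)$ of a $u$-admissible $V$ in $v$ is the unique $u$-admissible manifold in $w$ contained in $f[V]$, and $\mathcal F_s(V)$ of an $s$-admissible $V$ in $w$ is the unique $s$-admissible manifold in $v$ contained in $f^{-1}[V]$. Manifolds of the same size in the same chart converge if their representing functions converge uniformly, and $\mathrm{dist}_{C^1}(V,W)=\max|F-G|+\max\|dF-dG\|$ for their representing functions $F,G$. The *leaf core* $\check V$ of an admissible manifold $V$ in $\psi_x^{p^s,p^u}$ is its part over $|t|\le(p^s\wedge p^u)^2$. **Statement.** There are $C_1,\tau>0$, depending only on $\beta,\Gamma,\gamma$ (not on $\epsilon$),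 such that $\sum_{N\ge0}[I^{-N}(\eta)]^{\frac1\gamma+\tau}<\infty$ for every $\eta\in(0,1]$ and such that, for all $M,f,\mathcal D,\Theta$ as above, the following holds for every sufficiently small $\epsilon>0$ and every choice of $I^{-1/4}$ and $C_0$. Let $(v_i)_{i\in\mathbb Z}$, $v_i=\psi_{x_i}^{p_i^s,p_i^u}$, be a chain, and for $n\ge0$ let $V^u_{-n}$ be any $u$-admissible manifold in $v_{-n}$ and $V^s_n$ any $s$-admissible manifold in $v_n$. The graph transforms along the chain are well defined, and: 1. The limits $V^u((v_i)_{i\le0})=\lim_n\mathcal F_u^n(V^u_{-n})$ and $V^s((v_i)_{i\ge0})=\lim_n\mathcal F_s^n(V^s_n)$ exist and do not depend on the choice of the $V^u_{-n}$ and $V^s_n$. 2. $V^u((v_i)_{i\le0})$ is $u$-admissible in $v_0$ and $V^s((v_i)_{i\ge0})$ is $s$-admissible in $v_0$. 3. $f[V^s((v_i)_{i\ge0})]\subset V^s((v_{i+1})_{i\ge0})$ and $f^{-1}[V^u((v_i)_{i\le0})]\subset V^u((v_{i-1})_{i\le0})$. 4. $V^s((v_i)_{i\ge0})=\{p\in\psi_{x_0}[R_{p_0^s}(0)]:\forall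 k\ge0,\ f^k(p)\in\psi_{x_k}[R_{10Q_\epsilon(x_k)}(0)]\}$ and $V^u((v_i)_{i\le0})=\{p\in\psi_{x_0}[R_{p_0^u}(0)]:\forall k\ge0,\ f^{-k}(p)\in\psi_{x_{-k}}[R_{10Q_\epsilon(x_{-k})}(0)]\}$. 5. If $(w_i)_{i\in\mathbb Z}$ is a chain with $w_i=v_i$ for all $|i|\le N$, then $\mathrm{dist}_{C^1}(\check V^u((v_i)_{i\le0}),\check V^u((w_i)_{i\le0}))\le C_1[I^{-N}(p_0^u\wedge p_0^s)]^{\frac1\gamma+\tau}$, and the same bound holds for $\mathrm{dist}_{C^1}(\check V^s((v_i)_{i\ge0}),\check V^s((w_i)_{i\ge0}))$. -/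

import Mathlib

open Set Filter Topology Manifold Bundle
open scoped ContDiff

noncomputable section

namespace SummableOrbits

/-- The model space `ℝ^d` with its Euclidean norm. -/
abbrev Euc (d : ℕ) : Type := EuclideanSpace ℝ (Fin d)

/-- The factor `ℝ^s` of `ℝ^d`: the first `s` coordinates. -/
abbrev EucS (d s : ℕ) : Type := EuclideanSpace ℝ {i : Fin d // (i : ℕ) < s}

/-- The factor `ℝ^(d-s)` of `ℝ^d`: the remaining coordinates. -/
abbrev EucU (d s : ℕ) : Type := EuclideanSpace ℝ {i : Fin d // ¬ (i : ℕ) < s}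

/-- The vector `(-a-, -b-)` of `ℝ^d` with stable part `a` and unstable part `b`. -/
def joinSU {d s : ℕ} (a : EucS d s) (b : EucU d s) : Euc d :=
  WithLp.toLp 2 fun i => if h : (i : ℕ) < s then a ⟨i, h⟩ else b ⟨i, h⟩

/-- The window `R_q(0)` in `ℝ^d = ℝ^s × ℝ^(d-s)`. -/
def box (d s : ℕ) (q : ℝ) : Set (Euc d) :=
  {w | ∃ (a : EucS d s) (b : EucU d s), ‖a‖ ≤ q ∧ ‖b‖ ≤ q ∧ w = joinSU a b}

/-! ### Ladder functions and calibration parameters -/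

/-- The ladder function `I(x) = x exp(Γ x^(1/γ))`. -/
def ladder (Γ γ x : ℝ) : ℝ := x * Real.exp (Γ * x ^ (1 / γ))

/-- The inverse `I⁻¹` of the bijection `I` of `(0, ∞)`. -/
def ladderInv (Γ γ : ℝ) : ℝ → ℝ := Function.invFunOn (ladder Γ γ) (Ioi 0)

/-- `root` is a fourth iterative root `I^(-1/4)` of `I⁻¹` on `(0, e^Γ)`: positive, strictly
increasing, `C^1`, below the identity, and `I ∘ root ∘ root ∘ root ∘ root = id`. -/
structure IsLadderRoot (Γ γ : ℝ) (root : ℝ → ℝ) : Prop where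
  pos : ∀ x ∈ Ioo 0 (Real.exp Γ), 0 < root x
  lt_self : ∀ x ∈ Ioo 0 (Real.exp Γ), root x < x
  strictMono : StrictMonoOn root (Ioo 0 (Real.exp Γ))
  contDiff : ContDiffOn ℝ 1 root (Ioo 0 (Real.exp Γ))
  root_four : ∀ x ∈ Ioo 0 (Real.exp Γ), ladder Γ γ (root (root (root (root x)))) = x

/-- The parameters that calibrate the construction, with the chosen fourth root `I^(-1/4)`. -/
structure Calibration where
  β : ℝ
  Γ : ℝ
  γ : ℝ
  ε : ℝ
  root : ℝ → ℝ

/-- The windows' scalar `C_{β,ε} = 3^(-6/β) ε^(90/β)`. -/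
def Calibration.scalar (κ : Calibration) : ℝ := 1 / 3 ^ (6 / κ.β) * κ.ε ^ (90 / κ.β)

/-- The set `{I^(-ℓ/4)(1) : ℓ ≥ 0}` of admitted window sizes. -/
def Calibration.sizes (κ : Calibration) : Set ℝ := range fun ℓ : ℕ => κ.root^[ℓ] 1

/-! ### Representing functions -/

section Functions

variable {A B : Type*} [NormedAddCommGroup A] [NormedSpace ℝ A]
  [NormedAddCommGroup B] [NormedSpace ℝ B]

/-- The derivative of a function on the closed ball of radius `q` (one-sided at the boundary). -/
def dBall (q : ℝ) (F : A → B) (t : A) : A →L[ℝ] B :=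
  fderivWithin ℝ F (Metric.closedBall 0 q) t

/-- `F` is of class `C^(1+α)` on the closed ball of radius `q`, and is bounded by `Q` there. -/
structure IsRepresenting (α q Q : ℝ) (F : A → B) : Prop where
  contDiff : ContDiffOn ℝ 1 F (Metric.closedBall 0 q)
  holder : ∃ K : ℝ, ∀ t₁ ∈ Metric.closedBall (0 : A) q, ∀ t₂ ∈ Metric.closedBall (0 : A) q,
    ‖dBall q F t₁ - dBall q F t₂‖ ≤ K * ‖t₁ - t₂‖ ^ α
  bound : ∀ t ∈ Metric.closedBall (0 : A) q, ‖F t‖ ≤ Q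

/-- The bounds on the three parameters of an admissible manifold of size `q`:
`max ‖dF‖ + Höl_{β/2}(dF) ≤ 1/2`, `‖d_0 F‖ ≤ η^(β/2) / 2` and `|F(0)| ≤ 10⁻³ η²`. -/
structure AdmissibleBounds (β η q : ℝ) (F : A → B) : Prop where
  sigma : ∃ m h : ℝ, 0 ≤ m ∧ 0 ≤ h ∧ m + h ≤ 1 / 2 ∧
    (∀ t ∈ Metric.closedBall (0 : A) q, ‖dBall q F t‖ ≤ m) ∧
    (∀ t₁ ∈ Metric.closedBall (0 : A) q, ∀ t₂ ∈ Metric.closedBall (0 : A) q,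
      ‖dBall q F t₁ - dBall q F t₂‖ ≤ h * ‖t₁ - t₂‖ ^ (β / 2))
  iota : ‖dBall q F 0‖ ≤ 1 / 2 * η ^ (β / 2)
  phi : ‖F 0‖ ≤ 1 / 10 ^ 3 * η ^ 2

/-- `max |F - G| + max ‖dF - dG‖ ≤ δ` on the closed ball of radius `q`. -/
def C1Close (q δ : ℝ) (F G : A → B) : Prop :=
  ∃ m h : ℝ, 0 ≤ m ∧ 0 ≤ h ∧ m + h ≤ δ ∧ ∀ t ∈ Metric.closedBall (0 : A) q,
    ‖F t - G t‖ ≤ m ∧ ‖dBall q F t - dBall q G t‖ ≤ h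

end Functions

/-! ### Geodesics and the exponential map -/

section Manifold

variable {d : ℕ} {M : Type*} [TopologicalSpace M] [ChartedSpace (Euc d) M]
  [RiemannianBundle (fun x : M => TangentSpace (𝓡 d) x)]

/-- The Riemannian metric read in the chart at `x₀`, at the point `y` of the chart's image. -/
def chartMetric (x₀ : M) (y u w : Euc d) : ℝ :=
  inner ℝ (mfderiv 𝓘(ℝ, Euc d) (𝓡 d) (extChartAt (𝓡 d) x₀).symm y u)
    (mfderiv 𝓘(ℝ, Euc d) (𝓡 d) (extChartAt (𝓡 d) x₀).symm y w)

/-- `c` is an affinely parametrised geodesic. In a chart, with `g` the metric and `u` the curve,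
the geodesic equation is `d/dt g_u(u', w) = (1/2) (∂_w g)_u(u', u')` for all vectors `w`. -/
def IsGeodesic (c : ℝ → M) : Prop :=
  ContMDiff 𝓘(ℝ, ℝ) (𝓡 d) 2 c ∧
  ∀ (t₀ : ℝ) (w : Euc d),
    HasDerivAt
      (fun t => chartMetric (c t₀) (extChartAt (𝓡 d) (c t₀) (c t))
        (deriv (fun r => extChartAt (𝓡 d) (c t₀) (c r)) t) w)
      (1 / 2 * fderiv ℝ
        (fun y => chartMetric (c t₀) y
          (deriv (fun r => extChartAt (𝓡 d) (c t₀) (c r)) t₀)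
          (deriv (fun r => extChartAt (𝓡 d) (c t₀) (c r)) t₀))
        (extChartAt (𝓡 d) (c t₀) (c t₀)) w)
      t₀

open Classical in
/-- The Riemannian exponential map: `exp_x(v) = c(1)` for the geodesic `c` with `c(0) = x` and
`c'(0) = v` (which exists and is unique when `M` is compact). -/
def expMap (x : M) (v : TangentSpace (𝓡 d) x) : M :=
  if h : ∃ c : ℝ → M, IsGeodesic (d := d) c ∧
      (⟨c 0, mfderiv 𝓘(ℝ, ℝ) (𝓡 d) c 0 (1 : ℝ)⟩ : TangentBundle (𝓡 d) M) = ⟨x, v⟩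
  then h.choose 1 else x

variable (d M) in
/-- A finite open cover of `M` by sets `D` that carry a smooth map `Θ_D : TD → ℝ^d` which is a
linear isometry on each fibre and for which `(x, u) ↦ exp_x (Θ_D|_{T_xM})⁻¹ u` is smooth and
Lipschitz on `D × B_2(0)`. -/
structure Framing [IsManifold (𝓡 d) ∞ M] where
  card : ℕ
  dom : Fin card → Set M
  isOpen_dom : ∀ j, IsOpen (dom j)
  cover : ∀ x, ∃ j, x ∈ dom j
  Θ : Fin card → ∀ x : M, TangentSpace (𝓡 d) x ≃ₗᵢ[ℝ] Euc d
  smooth : ∀ j, ContMDiffOn (𝓡 d).tangent 𝓘(ℝ, Euc d) ∞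
    (fun p : TangentBundle (𝓡 d) M => Θ j p.1 p.2) {p | p.1 ∈ dom j}
  smooth_exp : ∀ j, ContMDiffOn ((𝓡 d).prod 𝓘(ℝ, Euc d)) (𝓡 d) ∞
    (fun z : M × Euc d => expMap z.1 ((Θ j z.1).symm z.2)) (dom j ×ˢ Metric.ball 0 2)
  lipschitz_exp : ∀ j, ∃ L : ℝ, ∀ x ∈ dom j, ∀ y ∈ dom j,
    ∀ u ∈ Metric.ball (0 : Euc d) 2, ∀ w ∈ Metric.ball (0 : Euc d) 2,
      riemannianEDist (𝓡 d) (expMap x ((Θ j x).symm u)) (expMap y ((Θ j y).symm w)) ≤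
        ENNReal.ofReal L * (riemannianEDist (𝓡 d) x y + ENNReal.ofReal ‖u - w‖)

/-! ### Summable points and the Lyapunov change of coordinates -/

/-- The differential of a `C^1` diffeomorphism is Hölder continuous with exponent `β`. -/
def HolderDifferential (β : ℝ) (f : M ≃ₘ^1⟮𝓡 d, 𝓡 d⟯ M) : Prop :=
  ∀ x : M, ∃ U ∈ 𝓝 (extChartAt (𝓡 d) x x), ∃ K : ℝ, ∀ y ∈ U, ∀ z ∈ U,
    ‖fderiv ℝ (writtenInExtChartAt (𝓡 d) (𝓡 d) x f) y -
      fderiv ℝ (writtenInExtChartAt (𝓡 d) (𝓡 d) x f) z‖ ≤ K * ‖y - z‖ ^ β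

/-- `sup_{ξ ∈ H, |ξ| = 1} ∑_{m ≥ 0} |d_x g^m ξ|² < ∞`. -/
def SummableOn (g : M → M) (x : M) (H : Submodule ℝ (TangentSpace (𝓡 d) x)) : Prop :=
  ∃ K : ℝ, ∀ ξ ∈ H, ‖ξ‖ = 1 →
    Summable (fun m : ℕ => ‖mfderiv (𝓡 d) (𝓡 d) g^[m] x ξ‖ ^ 2) ∧
    ∑' m : ℕ, ‖mfderiv (𝓡 d) (𝓡 d) g^[m] x ξ‖ ^ 2 ≤ K

/-- `T_xM = H^s ⊕ H^u`, where `H^s` is summable in the future and `H^u` in the past. -/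
def IsSummableSplitting (f : M ≃ₘ^1⟮𝓡 d, 𝓡 d⟯ M) (x : M)
    (H : Submodule ℝ (TangentSpace (𝓡 d) x) × Submodule ℝ (TangentSpace (𝓡 d) x)) : Prop :=
  IsCompl H.1 H.2 ∧ SummableOn f x H.1 ∧ SummableOn f.symm x H.2

/-- `x` is a summable point: it has a unique summable splitting. -/
def IsSummablePoint (f : M ≃ₘ^1⟮𝓡 d, 𝓡 d⟯ M) (x : M) : Prop :=
  ∃! H, IsSummableSplitting f x H

/-- The splitting `(H^s(x), H^u(x))` of a summable point. -/
def splitting (f : M ≃ₘ^1⟮𝓡 d, 𝓡 d⟯ M) (x : M) :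
    Submodule ℝ (TangentSpace (𝓡 d) x) × Submodule ℝ (TangentSpace (𝓡 d) x) :=
  Classical.epsilon fun H => IsSummableSplitting f x H

/-- `s(x) = dim H^s(x)`. -/
def sdim (f : M ≃ₘ^1⟮𝓡 d, 𝓡 d⟯ M) (x : M) : ℕ := Module.finrank ℝ (splitting f x).1

/-- `C x = C_0(x) : ℝ^d → T_xM` is, at each summable point, an isometry for the inner product
`⟨ξ + η, ξ' + η'⟩' = 2 ∑ ⟨df^m ξ, df^m ξ'⟩ + 2 ∑ ⟨df^(-m) η, df^(-m) η'⟩` on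
`T_xM = H^s(x) ⊕ H^u(x)`, and maps `ℝ^s(x)` onto `H^s(x)` and `ℝ^(d-s(x))` onto `H^u(x)`. -/
def IsLyapunovChange (f : M ≃ₘ^1⟮𝓡 d, 𝓡 d⟯ M)
    (C : ∀ x : M, Euc d ≃L[ℝ] TangentSpace (𝓡 d) x) : Prop :=
  ∀ x, IsSummablePoint f x →
    (∀ ξ ∈ (splitting f x).1, ∀ ξ' ∈ (splitting f x).1,
      ∀ η ∈ (splitting f x).2, ∀ η' ∈ (splitting f x).2,
      inner ℝ ((C x).symm (ξ + η)) ((C x).symm (ξ' + η')) =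
        2 * ∑' m : ℕ, inner ℝ (mfderiv (𝓡 d) (𝓡 d) f^[m] x ξ)
            (mfderiv (𝓡 d) (𝓡 d) f^[m] x ξ') +
        2 * ∑' m : ℕ, inner ℝ (mfderiv (𝓡 d) (𝓡 d) f.symm^[m] x η)
            (mfderiv (𝓡 d) (𝓡 d) f.symm^[m] x η')) ∧
    (∀ a : Euc d, C x a ∈ (splitting f x).1 ↔ ∀ i : Fin d, ¬ (i : ℕ) < sdim f x → a i = 0) ∧
    (∀ a : Euc d, C x a ∈ (splitting f x).2 ↔ ∀ i : Fin d, (i : ℕ) < sdim f x → a i = 0)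

/-! ### Pesin charts, double charts and chains -/

/-- The objects that are fixed in the construction: the calibration, the diffeomorphism, the
Lyapunov change of coordinates and the framing that is used to compare charts. -/
structure Setup (d : ℕ) (M : Type*) [TopologicalSpace M] [ChartedSpace (Euc d) M]
    [RiemannianBundle (fun x : M => TangentSpace (𝓡 d) x)] [IsManifold (𝓡 d) ∞ M] where
  κ : Calibration
  f : M ≃ₘ^1⟮𝓡 d, 𝓡 d⟯ M
  C : ∀ x : M, Euc d ≃L[ℝ] TangentSpace (𝓡 d) x
  frame : Framing d M

variable [IsManifold (𝓡 d) ∞ M]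

namespace Setup

/-- `Q_ε(x)`: the largest admitted size that is at most `C_{β,ε} / ‖C_0(x)⁻¹‖^(2γ)`. -/
def Q (S : Setup d M) (x : M) : ℝ :=
  sSup {q ∈ S.κ.sizes |
    q ≤ S.κ.scalar / ‖((S.C x).symm : TangentSpace (𝓡 d) x →L[ℝ] Euc d)‖ ^ (2 * S.κ.γ)}

/-- The map `ψ_x = exp_x ∘ C_0(x)`. -/
def ψ (S : Setup d M) (x : M) (a : Euc d) : M := expMap x (S.C x a)

/-- `ψ_x^η` is a Pesin chart. -/
def IsPesinChart (S : Setup d M) (x : M) (η : ℝ) : Prop :=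
  IsSummablePoint S.f x ∧ 0 < η ∧ η ≤ S.Q x

/-- The Pesin charts `ψ_{x₁}^{η₁}` and `ψ_{x₂}^{η₂}` `I`-overlap. -/
def Overlap (S : Setup d M) (x₁ : M) (η₁ : ℝ) (x₂ : M) (η₂ : ℝ) : Prop :=
  S.IsPesinChart x₁ η₁ ∧ S.IsPesinChart x₂ η₂ ∧
  η₁ ≤ ladder S.κ.Γ S.κ.γ η₂ ∧ η₂ ≤ ladder S.κ.Γ S.κ.γ η₁ ∧
  ∃ j, x₁ ∈ S.frame.dom j ∧ x₂ ∈ S.frame.dom j ∧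
    riemannianEDist (𝓡 d) x₁ x₂ +
      ENNReal.ofReal
        ‖((S.frame.Θ j x₁ : TangentSpace (𝓡 d) x₁ →L[ℝ] Euc d) ∘L
            (S.C x₁ : Euc d →L[ℝ] TangentSpace (𝓡 d) x₁)) -
          ((S.frame.Θ j x₂ : TangentSpace (𝓡 d) x₂ →L[ℝ] Euc d) ∘L
            (S.C x₂ : Euc d →L[ℝ] TangentSpace (𝓡 d) x₂))‖ <
      ENNReal.ofReal (η₁ ^ 4 * η₂ ^ 4)

end Setup

/-- The data `ψ_x^{p^s,p^u}` of a double chart. -/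
@[ext] structure DoubleChart (M : Type*) where
  x : M
  ps : ℝ
  pu : ℝ

/-- `p^s ∧ p^u`. -/
def DoubleChart.η (v : DoubleChart M) : ℝ := min v.ps v.pu

namespace Setup

/-- `ψ_x^{p^s,p^u}` is a double chart: both of its components are Pesin charts. -/
def IsDoubleChart (S : Setup d M) (v : DoubleChart M) : Prop :=
  S.IsPesinChart v.x v.ps ∧ S.IsPesinChart v.x v.pu

/-- The edge `v → w` between double charts. -/
structure Edge (S : Setup d M) (v w : DoubleChart M) : Prop where
  overlap_bwd : S.Overlap v.x v.η (S.f.symm w.x) v.η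
  overlap_fwd : S.Overlap (S.f v.x) w.η w.x w.η
  pu_eq : w.pu = min (ladder S.κ.Γ S.κ.γ v.pu) (S.Q w.x)
  ps_eq : v.ps = min (ladder S.κ.Γ S.κ.γ w.ps) (S.Q v.x)
  sdim_eq : sdim S.f v.x = sdim S.f w.x

/-- A chain of double charts. -/
def IsChain (S : Setup d M) (v : ℤ → DoubleChart M) : Prop :=
  ∀ i, S.IsDoubleChart (v i) ∧ S.Edge (v i) (v (i + 1))

/-! ### Admissible manifolds and the graph transform -/

/-- `V` is the `u`-manifold of size `q` in `ψ_x` with representing function `F`. -/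
def IsUManifold (S : Setup d M) (x : M) (q : ℝ)
    (F : EucU d (sdim S.f x) → EucS d (sdim S.f x)) (V : Set M) : Prop :=
  0 < q ∧ q ≤ S.Q x ∧ IsRepresenting (S.κ.β / 2) q (S.Q x) F ∧
  V = (fun t => S.ψ x (joinSU (F t) t)) '' Metric.closedBall 0 q

/-- `V` is the `s`-manifold of size `q` in `ψ_x` with representing function `F`. -/
def IsSManifold (S : Setup d M) (x : M) (q : ℝ)
    (F : EucS d (sdim S.f x) → EucU d (sdim S.f x)) (V : Set M) : Prop :=
  0 < q ∧ q ≤ S.Q x ∧ IsRepresenting (S.κ.β / 2) q (S.Q x) F ∧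
  V = (fun t => S.ψ x (joinSU t (F t))) '' Metric.closedBall 0 q

/-- `V` is a `u`-admissible manifold in `v`. -/
def IsUAdmissible (S : Setup d M) (v : DoubleChart M) (V : Set M) : Prop :=
  ∃ F, S.IsUManifold v.x v.pu F V ∧ AdmissibleBounds S.κ.β v.η v.pu F

/-- `V` is an `s`-admissible manifold in `v`. -/
def IsSAdmissible (S : Setup d M) (v : DoubleChart M) (V : Set M) : Prop :=
  ∃ F, S.IsSManifold v.x v.ps F V ∧ AdmissibleBounds S.κ.β v.η v.ps F

/-- `W` is a graph transform of `V` to `w`: a `u`-admissible manifold in `w` inside `f[V]`. -/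
def IsUTransform (S : Setup d M) (w : DoubleChart M) (V W : Set M) : Prop :=
  S.IsUAdmissible w W ∧ W ⊆ S.f '' V

/-- `W` is a graph transform of `V` to `w`: an `s`-admissible manifold in `w` inside
`f⁻¹[V]`. -/
def IsSTransform (S : Setup d M) (w : DoubleChart M) (V W : Set M) : Prop :=
  S.IsSAdmissible w W ∧ W ⊆ S.f.symm '' V

/-- The graph transform of `u`-admissible manifolds, with values in the chart `w`. -/
def uTransform (S : Setup d M) (w : DoubleChart M) (V : Set M) : Set M :=
  Classical.epsilon fun W => S.IsUTransform w V W

/-- The graph transform of `s`-admissible manifolds, with values in the chart `w`. -/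
def sTransform (S : Setup d M) (w : DoubleChart M) (V : Set M) : Set M :=
  Classical.epsilon fun W => S.IsSTransform w V W

/-- `n` applications of the graph transform to a `u`-admissible manifold in `a n`, along
`a n → a (n-1) → ⋯ → a 0`. -/
def uIter (S : Setup d M) (a : ℕ → DoubleChart M) : ℕ → Set M → Set M
  | 0, V => V
  | n + 1, V => uIter S a n (S.uTransform (a n) V)

/-- `n` applications of the graph transform to an `s`-admissible manifold in `a n`, along
`a 0 → a 1 → ⋯ → a n` (backwards). -/
def sIter (S : Setup d M) (a : ℕ → DoubleChart M) : ℕ → Set M → Set M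
  | 0, V => V
  | n + 1, V => sIter S a n (S.sTransform (a n) V)

/-- Uniform convergence of `u`-manifolds of size `p^u` in `v`: their representing functions
converge uniformly. -/
def UConverges (S : Setup d M) (v : DoubleChart M) (W : ℕ → Set M) (V : Set M) : Prop :=
  ∃ (G : ℕ → EucU d (sdim S.f v.x) → EucS d (sdim S.f v.x))
    (F : EucU d (sdim S.f v.x) → EucS d (sdim S.f v.x)),
    (∀ n, S.IsUManifold v.x v.pu (G n) (W n)) ∧ S.IsUManifold v.x v.pu F V ∧
    TendstoUniformlyOn G F atTop (Metric.closedBall 0 v.pu)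

/-- Uniform convergence of `s`-manifolds of size `p^s` in `v`. -/
def SConverges (S : Setup d M) (v : DoubleChart M) (W : ℕ → Set M) (V : Set M) : Prop :=
  ∃ (G : ℕ → EucS d (sdim S.f v.x) → EucU d (sdim S.f v.x))
    (F : EucS d (sdim S.f v.x) → EucU d (sdim S.f v.x)),
    (∀ n, S.IsSManifold v.x v.ps (G n) (W n)) ∧ S.IsSManifold v.x v.ps F V ∧
    TendstoUniformlyOn G F atTop (Metric.closedBall 0 v.ps)

/-- The leaf core of a `u`-admissible manifold `V` in `v`: the part over `|t| ≤ (p^s ∧ p^u)²`. -/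
def uCore (S : Setup d M) (v : DoubleChart M) (V : Set M) : Set M :=
  {p | ∃ F, S.IsUManifold v.x v.pu F V ∧
    p ∈ (fun t => S.ψ v.x (joinSU (F t) t)) '' Metric.closedBall 0 (v.η ^ 2)}

/-- The leaf core of an `s`-admissible manifold `V` in `v`. -/
def sCore (S : Setup d M) (v : DoubleChart M) (V : Set M) : Set M :=
  {p | ∃ F, S.IsSManifold v.x v.ps F V ∧
    p ∈ (fun t => S.ψ v.x (joinSU t (F t))) '' Metric.closedBall 0 (v.η ^ 2)}

/-- `dist_{C^1}(V, W) ≤ δ` for two `u`-manifolds of the same size `q` in `ψ_x`. -/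
def UC1DistLE (S : Setup d M) (x : M) (q : ℝ) (V W : Set M) (δ : ℝ) : Prop :=
  ∃ F G, S.IsUManifold x q F V ∧ S.IsUManifold x q G W ∧ C1Close q δ F G

/-- `dist_{C^1}(V, W) ≤ δ` for two `s`-manifolds of the same size `q` in `ψ_x`. -/
def SC1DistLE (S : Setup d M) (x : M) (q : ℝ) (V W : Set M) (δ : ℝ) : Prop :=
  ∃ F G, S.IsSManifold x q F V ∧ S.IsSManifold x q G W ∧ C1Close q δ F G

end Setup

end Manifold

/-- The past `(v_i)_{i ≤ 0}` of a two-sided sequence, listed as `v_0, v_{-1}, v_{-2}, …`. -/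
def past {X : Type*} (v : ℤ → X) : ℕ → X := fun n => v (-(n : ℤ))

/-- The future `(v_i)_{i ≥ 0}` of a two-sided sequence. -/
def future {X : Type*} (v : ℤ → X) : ℕ → X := fun n => v (n : ℤ)

end SummableOrbits

end

/-!
In the coordinates `C₀ x` the differential of `f` along a summable orbit is block diagonal. If
`N` bounds `‖C₀⁻¹‖`, the stable block contracts, and the unstable block expands, by a factor at
distance of order `N^(-2)` from `1` (`IsAdapted.exists_blocks`): the new norm of a stable vector
loses the first term of its defining series, and that term is at least `N^(-2)` times the whole.
In the Pesin charts `ψ_x`, on balls of radius comparable to `Q ≤ s N^(-2γ)`, the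
diffeomorphism differs from this linear map by a perturbation of order `N Q^(β/2)`. As
`γ > 5 / β`, this is much smaller than the rate `N^(-2)`, and so is the relative change
`Γ Q^(1/γ)` of sizes under the ladder function `I` (`exists_scalar_small`). Hence every edge of a
chain is a step `IsStep` of a nearly linear hyperbolic map (`IsAdapted.exists_isStep`), although
the rate is not bounded below along the chain.

For one step the graph transform maps admissible functions to admissible functions
(`IsStep.exists_transform`) and contracts the uniform distance by a factor `1 - 10^5 e / 2`
(`IsStep.contraction`). The rate dominates `Γ w^(1/γ)`, where `w` is the current point of the
backward orbit `z_n = I^{-n}(η)` of the ladder function, so this factor is at most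
`(z_{n+1} / z_n)^6` (`factor_le`). The product of the factors telescopes: two graphs that agree
at time `-n` up to order `1` agree at time `0` up to order `(z_n / η)^6`
(`IsStepChain.dist_le`). Since `z_n` tends to `0`, the iterated transforms converge, to a limit that
does not depend on the starting graphs (`IsStepChain.exists_invariant`), and the cone condition
identifies the limit with the set of points whose orbits stay in the balls of radius `10 Q`
(`IsStepChain.eq_of_orbits`). This description by orbits also gives the invariance, and it is
used to define the limit manifolds.

On the leaf core, of radius `η^2`, the bound `(z_n / η)^6` for the uniform distance and the Hölder
bound for the derivatives are interpolated, which gives `C^1`-distance of order `z_n^(β/4)`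
(`IsAdm.core_close`). So `1 / γ + τ = β / 4`, and `τ > 0` because `γ > 4 / β`. The series of the
`z_n^(1/γ + τ)` converges since `z_n^(1/γ)` is at most of order `1 / n`
(`summable_iterate_ladderInv`).

All estimates hold for `f` and its inverse alike (`HasBounds.symm`), so stable manifolds are
treated as the unstable manifolds of `f⁻¹`, with the two factors of the coordinates interchanged.

The rest is Riemannian geometry that the estimates in charts need: geodesics as solutions of a
Hamiltonian system in a chart, their uniqueness and completeness on a compact manifold
(`exists_geodesic_expMap`), injectivity of the exponential maps on balls of a uniform radius
(`exists_expMap_injective`), and uniform `C^(1+β)` bounds for `f` in exponential coordinates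
(`exists_hasTransfer`).
-/

noncomputable section

namespace SummableOrbits

set_option maxSynthPendingDepth 3
set_option linter.unusedSectionVars false

/-! ### The geodesic equation in coordinates -/

section EulerLagrange

variable {E : Type*} [NormedAddCommGroup E] [NormedSpace ℝ E]

/-- The Euler–Lagrange equation of the energy of the metric `G` along the curve `u`, at time
`t₀`. -/
def EulerLagrangeAt (G : E → E →L[ℝ] E →L[ℝ] ℝ) (u : ℝ → E) (t₀ : ℝ) : Prop :=
  ∀ w : E, HasDerivAt (fun t => G (u t) (deriv u t) w)
    (1 / 2 * fderiv ℝ (fun y => G y (deriv u t₀) (deriv u t₀)) (u t₀) w) t₀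

theorem EulerLagrangeAt.congr {G : E → E →L[ℝ] E →L[ℝ] ℝ} {u u' : ℝ → E} {t₀ : ℝ}
    (h : EulerLagrangeAt G u t₀) (hu : u' =ᶠ[𝓝 t₀] u) : EulerLagrangeAt G u' t₀ := by
  intro w
  have h1 : deriv u' t₀ = deriv u t₀ := hu.deriv_eq
  rw [h1, hu.eq_of_nhds]
  refine (h w).congr_of_eventuallyEq ?_
  filter_upwards [hu, hu.deriv] with t h2 h3
  rw [h2, h3]

theorem EulerLagrangeAt.comp_affine {G : E → E →L[ℝ] E →L[ℝ] ℝ} {u : ℝ → E} {s τ t₀ : ℝ}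
    (h : EulerLagrangeAt G u (s * t₀ + τ)) :
    EulerLagrangeAt G (fun t => u (s * t + τ)) t₀ := by
  intro w
  have hd : ∀ t, deriv (fun t => u (s * t + τ)) t = s • deriv u (s * t + τ) := by
    intro t
    have h1 := deriv_comp_mul_left s (fun x => u (x + τ)) t
    simp only [deriv_comp_add_const] at h1
    exact h1
  simp only [hd, map_smul, _root_.smul_apply, smul_eq_mul]
  have h2 : HasDerivAt (fun t : ℝ => s * t + τ) s t₀ := by
    simpa using ((hasDerivAt_id t₀).const_mul s).add_const τ
  have h3 := ((h w).comp t₀ h2).const_mul s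
  refine h3.congr_deriv ?_
  have h4 : (fun y => s * (s * G y (deriv u (s * t₀ + τ)) (deriv u (s * t₀ + τ)))) =
      fun y => (s * s) • G y (deriv u (s * t₀ + τ)) (deriv u (s * t₀ + τ)) := by
    ext y; simp [mul_assoc]
  have h5 : (fun y => (s * s) • G y (deriv u (s * t₀ + τ)) (deriv u (s * t₀ + τ))) =
      (s * s) • (fun y => G y (deriv u (s * t₀ + τ)) (deriv u (s * t₀ + τ))) := rfl
  rw [h4, h5, fderiv_const_smul_field]
  set X := fderiv ℝ (fun y => G y (deriv u (s * t₀ + τ)) (deriv u (s * t₀ + τ)))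
    (u (s * t₀ + τ)) with hX
  change s * (1 / 2 * X w * s) = 1 / 2 * ((s * s) * X w)
  ring

theorem hasDerivAt_of_contDiffAt_two {u : ℝ → E} {t₀ : ℝ} (hu : ContDiffAt ℝ 2 u t₀) :
    HasDerivAt u (deriv u t₀) t₀ ∧ HasDerivAt (deriv u) (deriv (deriv u) t₀) t₀ ∧
      (∀ᶠ t in 𝓝 t₀, HasDerivAt u (deriv u t) t) := by
  have h1 : ∀ᶠ t in 𝓝 t₀, ContDiffAt ℝ 2 u t := hu.eventually (by simp)
  refine ⟨(hu.differentiableAt (by norm_num)).hasDerivAt, ?_,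
    h1.mono fun t ht => (ht.differentiableAt (by norm_num)).hasDerivAt⟩
  have h2 : ContDiffAt ℝ 1 (deriv u) t₀ := by
    have h3 : ContDiffAt ℝ 1 (fun t => fderiv ℝ u t 1) t₀ :=
      (hu.fderiv_right (m := 1) (by norm_num)).clm_apply contDiffAt_const
    exact h3
  exact (h2.differentiableAt (by norm_num)).hasDerivAt

/-- The Euler–Lagrange equation does not depend on the coordinates: `θ` is a change of coordinates
that pulls the metric `G'` back to `G`. -/
theorem EulerLagrangeAt.of_comp {F : Type*} [NormedAddCommGroup F] [NormedSpace ℝ F]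
    {G : E → E →L[ℝ] E →L[ℝ] ℝ} {G' : F → F →L[ℝ] F →L[ℝ] ℝ}
    {θ : E → F} {u : ℝ → E} {t₀ : ℝ}
    (hθ : ContDiffAt ℝ 2 θ (u t₀)) (hu : ContDiffAt ℝ 2 u t₀)
    (hG' : DifferentiableAt ℝ G' (θ (u t₀)))
    (hsymm : ∀ a b, G' (θ (u t₀)) a b = G' (θ (u t₀)) b a)
    (hpull : ∀ᶠ y in 𝓝 (u t₀), ∀ a b, G y a b = G' (θ y) (fderiv ℝ θ y a) (fderiv ℝ θ y b))
    (h : EulerLagrangeAt G' (fun t => θ (u t)) t₀) : EulerLagrangeAt G u t₀ := by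
  intro w
  obtain ⟨hu1, hu2, hu3⟩ := hasDerivAt_of_contDiffAt_two hu
  have hθ1 : ∀ᶠ y in 𝓝 (u t₀), HasFDerivAt θ (fderiv ℝ θ y) y :=
    (hθ.eventually (by simp)).mono fun y hy => (hy.differentiableAt (by norm_num)).hasFDerivAt
  have hθ2 : HasFDerivAt (fderiv ℝ θ) (fderiv ℝ (fderiv ℝ θ) (u t₀)) (u t₀) :=
    ((hθ.fderiv_right (m := 1) (by norm_num)).differentiableAt (by norm_num)).hasFDerivAt
  have hsym2 : ∀ a b, fderiv ℝ (fderiv ℝ θ) (u t₀) a b = fderiv ℝ (fderiv ℝ θ) (u t₀) b a :=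
    fun a b => hθ.isSymmSndFDerivAt (by simp) a b
  have huc : Tendsto u (𝓝 t₀) (𝓝 (u t₀)) := hu1.continuousAt
  have hdu : ∀ᶠ t in 𝓝 t₀, deriv (fun t => θ (u t)) t = fderiv ℝ θ (u t) (deriv u t) := by
    filter_upwards [huc.eventually hθ1, hu3] with t h1 h2
    exact (h1.comp_hasDerivAt t h2).deriv
  set a := deriv u t₀ with ha
  set P := fderiv ℝ θ (u t₀) with hP
  set P2 := fderiv ℝ (fderiv ℝ θ) (u t₀) with hP2
  set D := fderiv ℝ G' (θ (u t₀)) with hD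
  have hdu0 : deriv (fun t => θ (u t)) t₀ = P a := hdu.self_of_nhds
  have hGt : HasDerivAt (fun t => G' (θ (u t))) (D (P a)) t₀ :=
    hG'.hasFDerivAt.comp_hasDerivAt t₀ (hθ1.self_of_nhds.comp_hasDerivAt t₀ hu1)
  -- the vector `w` read in the other coordinates, along the curve
  have hPt : HasDerivAt (fun t => fderiv ℝ θ (u t)) (P2 a) t₀ := hθ2.comp_hasDerivAt t₀ hu1
  have hWt : HasDerivAt (fun t => fderiv ℝ θ (u t) w) (P2 a w) t₀ := by
    simpa using hPt.clm_apply (hasDerivAt_const t₀ w)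
  have hVt : HasDerivAt (fun t => fderiv ℝ θ (u t) (deriv u t))
      (P2 a a + P (deriv (deriv u) t₀)) t₀ := hPt.clm_apply hu2
  have hmt := hGt.clm_apply hVt
  have hfin := hmt.clm_apply hWt
  have hconst := hmt.clm_apply (hasDerivAt_const t₀ (P w))
  have hEL := (h (P w)).congr_of_eventuallyEq
    (f₁ := fun t => G' (θ (u t)) (fderiv ℝ θ (u t) (deriv u t)) (P w))
    (by filter_upwards [hdu] with t ht; rw [ht])
  have huniq := hconst.unique hEL
  simp only [map_zero, add_zero] at huniq
  -- the derivatives of the two energies in the direction of `w`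
  have hE' : HasFDerivAt (fun y => G' y (P a) (P a))
      ((D.flip (P a)).flip (P a)) (θ (u t₀)) := by
    have h1 := (hG'.hasFDerivAt.clm_apply (hasFDerivAt_const (P a) (θ (u t₀)))).clm_apply
      (hasFDerivAt_const (P a) (θ (u t₀)))
    refine h1.congr_fderiv ?_
    ext x; simp [hD]
  have hθ0 := hθ1.self_of_nhds
  have hA : HasFDerivAt (fun y => fderiv ℝ θ y a) (P2.flip a) (u t₀) := by
    refine (hθ2.clm_apply (hasFDerivAt_const a (u t₀))).congr_fderiv ?_
    ext x; simp [hP2]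
  have hE := ((hG'.hasFDerivAt.comp (u t₀) hθ0).clm_apply hA).clm_apply hA
  have hE2 := hE.congr_of_eventuallyEq (f₁ := fun y => G y a a)
    (by filter_upwards [hpull] with y hy; exact hy a a)
  rw [hE2.fderiv]
  have hgoal := hfin.congr_of_eventuallyEq (f₁ := fun t => G (u t) (deriv u t) w)
    (by filter_upwards [huc.eventually hpull] with t ht; exact ht _ _)
  refine hgoal.congr_deriv ?_
  rw [huniq, hdu0, hE'.fderiv]
  simp only [add_apply, ContinuousLinearMap.comp_apply,
    ContinuousLinearMap.flip_apply, Function.comp_apply]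
  rw [hsymm (P2 w a) (P a), hsym2 a w]
  ring

/-! ### The geodesic equation as a Hamiltonian system -/

/-- The velocity that belongs to the momentum `p` at `y`. -/
def hamVelocity (G : E → E →L[ℝ] E →L[ℝ] ℝ) (z : E × (E →L[ℝ] ℝ)) : E := (G z.1).inverse z.2

/-- The Hamiltonian vector field of the energy of the metric `G`. -/
def hamField (G : E → E →L[ℝ] E →L[ℝ] ℝ) (z : E × (E →L[ℝ] ℝ)) : E × (E →L[ℝ] ℝ) :=
  (hamVelocity G z,
    (1 / 2 : ℝ) • ((fderiv ℝ G z.1).flip (hamVelocity G z)).flip (hamVelocity G z))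

/-- A positive form is nondegenerate, so that the metric identifies velocities with momenta. -/
theorem isInvertible_of_pos [FiniteDimensional ℝ E] {B : E →L[ℝ] E →L[ℝ] ℝ}
    (hB : ∀ u, u ≠ 0 → 0 < B u u) : B.IsInvertible := by
  have hinj : Function.Injective (B : E →ₗ[ℝ] E →L[ℝ] ℝ) := by
    rw [← LinearMap.ker_eq_bot, LinearMap.ker_eq_bot']
    intro u hu
    by_contra h0
    have := hB u h0
    have h2 : B u = 0 := hu
    rw [h2] at this
    simp at this
  have hdim : Module.finrank ℝ E = Module.finrank ℝ (E →L[ℝ] ℝ) := by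
    rw [← (LinearMap.toContinuousLinearMap (𝕜 := ℝ) (E := E) (F' := ℝ)).finrank_eq]
    exact (Subspace.dual_finrank_eq).symm
  refine ⟨(LinearEquiv.ofInjectiveOfFinrankEq (B : E →ₗ[ℝ] E →L[ℝ] ℝ) hinj
    hdim).toContinuousLinearEquiv, ?_⟩
  ext u v
  rfl

variable [FiniteDimensional ℝ E] {G : E → E →L[ℝ] E →L[ℝ] ℝ} {Ω : Set E}

theorem contDiffAt_hamVelocity (hΩ : IsOpen Ω) (hG : ContDiffOn ℝ ∞ G Ω)
    (hpos : ∀ y ∈ Ω, ∀ u, u ≠ 0 → 0 < G y u u) {z : E × (E →L[ℝ] ℝ)} (hz : z.1 ∈ Ω) :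
    ContDiffAt ℝ ∞ (hamVelocity G) z := by
  have h1 : ContDiffAt ℝ ∞ G z.1 := hG.contDiffAt (hΩ.mem_nhds hz)
  obtain ⟨e, he⟩ := isInvertible_of_pos (hpos z.1 hz)
  have : CompleteSpace E := FiniteDimensional.complete ℝ E
  have h2 : ContDiffAt ℝ ∞ ContinuousLinearMap.inverse (G z.1) := he ▸ contDiffAt_map_inverse e
  have h3 : ContDiffAt ℝ ∞ (fun z : E × (E →L[ℝ] ℝ) => (G z.1).inverse) z :=
    ContDiffAt.comp (f := fun z : E × (E →L[ℝ] ℝ) => G z.1) (g := ContinuousLinearMap.inverse) z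
      h2 (h1.comp z contDiffAt_fst)
  exact h3.clm_apply contDiffAt_snd

theorem contDiffAt_hamField (hΩ : IsOpen Ω) (hG : ContDiffOn ℝ ∞ G Ω)
    (hpos : ∀ y ∈ Ω, ∀ u, u ≠ 0 → 0 < G y u u) {z : E × (E →L[ℝ] ℝ)} (hz : z.1 ∈ Ω) :
    ContDiffAt ℝ 1 (hamField G) z := by
  have hv : ContDiffAt ℝ 1 (hamVelocity G) z :=
    (contDiffAt_hamVelocity hΩ hG hpos hz).of_le (by simp)
  have h1 : ContDiffAt ℝ ∞ G z.1 := hG.contDiffAt (hΩ.mem_nhds hz)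
  have h2 : ContDiffAt ℝ 1 (fun z : E × (E →L[ℝ] ℝ) => fderiv ℝ G z.1) z :=
    ContDiffAt.comp (f := fun z : E × (E →L[ℝ] ℝ) => z.1) (g := fderiv ℝ G) z
      (h1.fderiv_right (by norm_cast)) contDiffAt_fst
  refine hv.prodMk (ContDiffAt.const_smul (1 / 2 : ℝ) ?_)
  have h3 : ContDiffAt ℝ 1 (fun z : E × (E →L[ℝ] ℝ) => (fderiv ℝ G z.1).flip) z :=
    (ContinuousLinearMap.flipₗᵢ ℝ E E (E →L[ℝ] ℝ)).contDiff.contDiffAt.comp z h2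
  have h4 : ContDiffAt ℝ 1
      (fun z : E × (E →L[ℝ] ℝ) => ((fderiv ℝ G z.1).flip (hamVelocity G z)).flip) z :=
    (ContinuousLinearMap.flipₗᵢ ℝ E E ℝ).contDiff.contDiffAt.comp z (h3.clm_apply hv)
  exact h4.clm_apply hv

/-- A solution of the geodesic equation, together with its momentum, is an integral curve of the
Hamiltonian vector field. -/
theorem EulerLagrangeAt.hasDerivAt_ham {u : ℝ → E} {t₀ : ℝ}
    (hu : ContDiffAt ℝ 2 u t₀) (hG : DifferentiableAt ℝ G (u t₀))
    (hpos : ∀ v, v ≠ 0 → 0 < G (u t₀) v v) (h : EulerLagrangeAt G u t₀) :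
    HasDerivAt (fun t => (u t, G (u t) (deriv u t)))
      (hamField G (u t₀, G (u t₀) (deriv u t₀))) t₀ := by
  obtain ⟨hu1, hu2, hu3⟩ := hasDerivAt_of_contDiffAt_two hu
  obtain ⟨e, he⟩ := isInvertible_of_pos hpos
  have hv : hamVelocity G (u t₀, G (u t₀) (deriv u t₀)) = deriv u t₀ := by
    simp only [hamVelocity, ← he, ContinuousLinearMap.inverse_equiv]
    simp
  refine (hu1.congr_deriv hv.symm).prodMk ?_
  have hm := (hG.hasFDerivAt.comp_hasDerivAt t₀ hu1).clm_apply hu2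
  refine hm.congr_deriv ?_
  ext w
  have h1 := hm.clm_apply (hasDerivAt_const t₀ w)
  simp only [map_zero, add_zero] at h1
  refine (h1.unique (h w)).trans ?_
  rw [hv]
  have hE := (hG.hasFDerivAt.clm_apply (hasFDerivAt_const (deriv u t₀) (u t₀))).clm_apply
      (hasFDerivAt_const (deriv u t₀) (u t₀))
  rw [hE.fderiv]
  simp

/-- An integral curve of the Hamiltonian vector field projects to a solution of the geodesic
equation. -/
theorem eulerLagrangeAt_of_ham (hΩ : IsOpen Ω) (hG : ContDiffOn ℝ ∞ G Ω)
    (hpos : ∀ y ∈ Ω, ∀ u, u ≠ 0 → 0 < G y u u) {z : ℝ → E × (E →L[ℝ] ℝ)} {J : Set ℝ}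
    (hJ : IsOpen J) (hz : ∀ t ∈ J, HasDerivAt z (hamField G (z t)) t)
    (hzΩ : ∀ t ∈ J, (z t).1 ∈ Ω) :
    ∀ t ∈ J, ContDiffAt ℝ 2 (fun t => (z t).1) t ∧ EulerLagrangeAt G (fun t => (z t).1) t ∧
      deriv (fun t => (z t).1) t = hamVelocity G (z t) := by
  have hfst : ∀ t ∈ J, HasDerivAt (fun t => (z t).1) (hamVelocity G (z t)) t := fun t ht =>
    (hz t ht).fst
  have hder : ∀ t ∈ J, deriv (fun t => (z t).1) t = hamVelocity G (z t) := fun t ht =>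
    (hfst t ht).deriv
  have hzc : ContDiffOn ℝ 1 z J := by
    rw [contDiffOn_one_iff_derivWithin hJ.uniqueDiffOn]
    refine ⟨fun t ht => (hz t ht).differentiableAt.differentiableWithinAt, ?_⟩
    have : ∀ t ∈ J, derivWithin z J t = hamField G (z t) := fun t ht => by
      rw [derivWithin_of_isOpen hJ ht, (hz t ht).deriv]
    refine ContinuousOn.congr (fun t ht => ?_) this
    exact ((contDiffAt_hamField hΩ hG hpos (hzΩ t ht)).continuousAt.comp
      (hz t ht).continuousAt).continuousWithinAt
  intro t₀ ht₀
  refine ⟨?_, ?_, hder t₀ ht₀⟩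
  · refine ContDiffOn.contDiffAt (s := J) ?_ (hJ.mem_nhds ht₀)
    have h21 : (2 : ℕ∞ω) = 1 + 1 := by norm_num
    rw [h21, contDiffOn_succ_iff_deriv_of_isOpen hJ]
    refine ⟨fun t ht => (hfst t ht).differentiableAt.differentiableWithinAt, by simp, ?_⟩
    refine ContDiffOn.congr (f := fun t => hamVelocity G (z t)) (fun t ht => ?_) hder
    exact (((contDiffAt_hamVelocity hΩ hG hpos (hzΩ t ht)).of_le (by simp)).comp t
      (hzc.contDiffAt (hJ.mem_nhds ht))).contDiffWithinAt
  · intro w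
    have hmom : ∀ t ∈ J, G (z t).1 (deriv (fun t => (z t).1) t) = (z t).2 := by
      intro t ht
      obtain ⟨e, he⟩ := isInvertible_of_pos (hpos _ (hzΩ t ht))
      rw [hder t ht]
      simp only [hamVelocity, ← he, ContinuousLinearMap.inverse_equiv]
      simp
    have h20 : HasDerivAt (fun t => (z t).2) (hamField G (z t₀)).2 t₀ := (hz t₀ ht₀).snd
    have h2 := h20.clm_apply (hasDerivAt_const t₀ w)
    simp only [map_zero, add_zero] at h2
    have h3 := h2.congr_of_eventuallyEq
      (f₁ := fun t => G (z t).1 (deriv (fun t => (z t).1) t) w)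
      (by filter_upwards [hJ.mem_nhds ht₀] with t ht; rw [hmom t ht])
    refine h3.congr_deriv ?_
    have hGd : DifferentiableAt ℝ G (z t₀).1 :=
      (hG.contDiffAt (hΩ.mem_nhds (hzΩ t₀ ht₀))).differentiableAt (by simp)
    rw [hder t₀ ht₀]
    have hE := (hGd.hasFDerivAt.clm_apply (hasFDerivAt_const (hamVelocity G (z t₀))
      (z t₀).1)).clm_apply (hasFDerivAt_const (hamVelocity G (z t₀)) (z t₀).1)
    rw [hE.fderiv]
    simp [hamField]

/-- The energy is constant along solutions of the geodesic equation. -/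
theorem EulerLagrangeAt.hasDerivAt_energy {u : ℝ → E} {t₀ : ℝ}
    (hu : ContDiffAt ℝ 2 u t₀) (hG : DifferentiableAt ℝ G (u t₀))
    (hsymm : ∀ a b, G (u t₀) a b = G (u t₀) b a) (h : EulerLagrangeAt G u t₀) :
    HasDerivAt (fun t => G (u t) (deriv u t) (deriv u t)) 0 t₀ := by
  obtain ⟨hu1, hu2, hu3⟩ := hasDerivAt_of_contDiffAt_two hu
  have hm := (hG.hasFDerivAt.comp_hasDerivAt t₀ hu1).clm_apply hu2
  have h1 := hm.clm_apply (hasDerivAt_const t₀ (deriv u t₀))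
  have h2 := h1.unique (h (deriv u t₀))
  have hE := (hG.hasFDerivAt.clm_apply (hasFDerivAt_const (deriv u t₀) (u t₀))).clm_apply
      (hasFDerivAt_const (deriv u t₀) (u t₀))
  rw [hE.fderiv] at h2
  refine (hm.clm_apply hu2).congr_deriv ?_
  simp only [add_apply, ContinuousLinearMap.comp_apply,
    ContinuousLinearMap.flip_apply, Function.comp_apply, map_zero, add_zero,
    zero_apply] at h2 ⊢
  have h3 := hsymm (deriv (deriv u) t₀) (deriv u t₀)
  linarith

end EulerLagrange

/-! ### Geodesics on the manifold -/

section Metric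
variable {d : ℕ} {M : Type*} [TopologicalSpace M] [ChartedSpace (Euc d) M]
  [RiemannianBundle (fun x : M => TangentSpace (𝓡 d) x)]

/-- The metric in the chart at `x₀` as a bilinear form. -/
def metricForm (x₀ : M) (y : Euc d) : Euc d →L[ℝ] Euc d →L[ℝ] ℝ :=
  (innerSL ℝ (E := TangentSpace (𝓡 d) ((extChartAt (𝓡 d) x₀).symm y))).bilinearComp
    (mfderiv 𝓘(ℝ, Euc d) (𝓡 d) (extChartAt (𝓡 d) x₀).symm y)
    (mfderiv 𝓘(ℝ, Euc d) (𝓡 d) (extChartAt (𝓡 d) x₀).symm y)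

theorem metricForm_apply (x₀ : M) (y u w : Euc d) :
    metricForm x₀ y u w = chartMetric x₀ y u w := rfl

theorem metricForm_symm (x₀ : M) (y u w : Euc d) :
    metricForm x₀ y u w = metricForm x₀ y w u := by
  rw [metricForm_apply, metricForm_apply]
  exact real_inner_comm _ _

variable [IsManifold (𝓡 d) ∞ M]

theorem metricForm_pos (x₀ : M) {y : Euc d} (hy : y ∈ (extChartAt (𝓡 d) x₀).target) {u : Euc d}
    (hu : u ≠ 0) : 0 < metricForm x₀ y u u := by
  rw [metricForm_apply, chartMetric, real_inner_self_eq_norm_sq]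
  have : IsManifold (𝓡 d) 1 M := IsManifold.of_le (n := ∞) (by simp)
  have h := isInvertible_mfderivWithin_extChartAt_symm (I := 𝓡 d) (x := x₀) hy
  rw [ModelWithCorners.range_eq_univ, mfderivWithin_univ] at h
  have h2 : mfderiv 𝓘(ℝ, Euc d) (𝓡 d) (extChartAt (𝓡 d) x₀).symm y u ≠ 0 := fun h0 =>
    hu (h.injective (h0.trans (map_zero (mfderiv 𝓘(ℝ, Euc d) (𝓡 d)
      (extChartAt (𝓡 d) x₀).symm y)).symm))
  exact pow_pos (norm_pos_iff.mpr h2) 2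

theorem contDiffOn_metricForm
    [IsContMDiffRiemannianBundle (𝓡 d) ∞ (Euc d) (fun x : M => TangentSpace (𝓡 d) x)] (x₀ : M) :
    ContDiffOn ℝ ∞ (metricForm x₀) (extChartAt (𝓡 d) x₀).target := by
  have : IsManifold (𝓡 d) 1 M := IsManifold.of_le (n := ∞) (by simp)
  have hop : IsOpen (extChartAt (𝓡 d) x₀).target := isOpen_extChartAt_target x₀
  have key : ∀ u : Euc d, ContMDiffOn 𝓘(ℝ, Euc d) ((𝓡 d).prod 𝓘(ℝ, Euc d)) ∞
      (fun y => (⟨(extChartAt (𝓡 d) x₀).symm y,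
        mfderiv 𝓘(ℝ, Euc d) (𝓡 d) (extChartAt (𝓡 d) x₀).symm y u⟩ : TangentBundle (𝓡 d) M))
      (extChartAt (𝓡 d) x₀).target := by
    intro u
    have h1 := (contMDiffOn_extChartAt_symm (I := 𝓡 d) (n := ∞) x₀).contMDiffOn_tangentMapWithin
      (m := ∞) (by simp) hop.uniqueMDiffOn
    have h2 : ContMDiff 𝓘(ℝ, Euc d) 𝓘(ℝ, Euc d).tangent ∞
        (fun y => (⟨y, u⟩ : TangentBundle 𝓘(ℝ, Euc d) (Euc d))) :=
      contMDiff_vectorSpace_iff_contDiff (V := fun _ => u) |>.2 contDiff_const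
    have h3 := h1.comp (h2.contMDiffOn (s := (extChartAt (𝓡 d) x₀).target)) (fun y hy => hy)
    refine h3.congr fun y hy => ?_
    simp only [Function.comp, tangentMapWithin]
    rw [mfderivWithin_of_isOpen hop hy]
  rw [contDiffOn_clm_apply]
  intro u
  rw [contDiffOn_clm_apply]
  intro w
  rw [← contMDiffOn_iff_contDiffOn]
  exact (key u).inner_bundle (key w)

theorem tangentBundle_mk_congr {x y : M} {v : TangentSpace (𝓡 d) x} {w : TangentSpace (𝓡 d) y}
    (h : x = y) (hv : (show Euc d from v) = (show Euc d from w)) :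
    (⟨x, v⟩ : TangentBundle (𝓡 d) M) = ⟨y, w⟩ := by
  subst h
  exact congrArg _ hv

/-- The differential at `q` of the chart at `x₀`, with values in the model space. -/
def chartDeriv (x₀ q : M) : TangentSpace (𝓡 d) q →L[ℝ] Euc d :=
  mfderiv (𝓡 d) 𝓘(ℝ, Euc d) (extChartAt (𝓡 d) x₀) q

theorem chartDeriv_invertible (x₀ : M) {q : M} (hq : q ∈ (extChartAt (𝓡 d) x₀).source) :
    (chartDeriv (d := d) x₀ q).IsInvertible := by
  have : IsManifold (𝓡 d) 1 M := IsManifold.of_le (n := ∞) (by simp)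
  exact isInvertible_mfderiv_extChartAt hq

theorem symm_chartDeriv (x₀ : M) {q : M} (hq : q ∈ (extChartAt (𝓡 d) x₀).source)
    (v : TangentSpace (𝓡 d) q) :
    (⟨(extChartAt (𝓡 d) x₀).symm (extChartAt (𝓡 d) x₀ q),
      mfderiv 𝓘(ℝ, Euc d) (𝓡 d) (extChartAt (𝓡 d) x₀).symm (extChartAt (𝓡 d) x₀ q)
        (chartDeriv x₀ q v)⟩ : TangentBundle (𝓡 d) M) = ⟨q, v⟩ := by
  have : IsManifold (𝓡 d) 1 M := IsManifold.of_le (n := ∞) (by simp)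
  have h1 := mfderivWithin_extChartAt_symm_comp_mfderiv_extChartAt' (I := 𝓡 d) hq
  rw [ModelWithCorners.range_eq_univ, mfderivWithin_univ] at h1
  exact tangentBundle_mk_congr ((extChartAt (𝓡 d) x₀).left_inv hq)
    (congrArg (fun L : Euc d →L[ℝ] Euc d => L v) h1)

theorem metricForm_chartDeriv (x₀ : M) {q : M} (hq : q ∈ (extChartAt (𝓡 d) x₀).source)
    (v : TangentSpace (𝓡 d) q) :
    metricForm x₀ (extChartAt (𝓡 d) x₀ q) (chartDeriv x₀ q v) (chartDeriv x₀ q v) = ‖v‖ ^ 2 := by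
  rw [metricForm_apply, chartMetric, real_inner_self_eq_norm_sq]
  exact congrArg (fun p : TangentBundle (𝓡 d) M => ‖p.2‖ ^ 2) (symm_chartDeriv x₀ hq v)

/-- The change of coordinates between two charts is an isometry for the metric. -/
theorem metricForm_change (x₀ x₁ : M) {y : Euc d} (hy : y ∈ (extChartAt (𝓡 d) x₀).target)
    (hy' : (extChartAt (𝓡 d) x₀).symm y ∈ (extChartAt (𝓡 d) x₁).source) (a b : Euc d) :
    metricForm x₀ y a b = metricForm x₁ (extChartAt (𝓡 d) x₁ ((extChartAt (𝓡 d) x₀).symm y))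
      (fderiv ℝ (extChartAt (𝓡 d) x₁ ∘ (extChartAt (𝓡 d) x₀).symm) y a)
      (fderiv ℝ (extChartAt (𝓡 d) x₁ ∘ (extChartAt (𝓡 d) x₀).symm) y b) := by
  have : IsManifold (𝓡 d) 1 M := IsManifold.of_le (n := ∞) (by simp)
  set θ := extChartAt (𝓡 d) x₁ ∘ (extChartAt (𝓡 d) x₀).symm with hθ
  have hd : MDifferentiableAt 𝓘(ℝ, Euc d) (𝓡 d) (extChartAt (𝓡 d) x₀).symm y :=
    ((contMDiffOn_extChartAt_symm (I := 𝓡 d) (n := 1) x₀).contMDiffAt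
      ((isOpen_extChartAt_target x₀).mem_nhds hy)).mdifferentiableAt (by norm_num)
  have hd' : MDifferentiableAt (𝓡 d) 𝓘(ℝ, Euc d) (extChartAt (𝓡 d) x₁)
      ((extChartAt (𝓡 d) x₀).symm y) :=
    mdifferentiableAt_extChartAt (by simpa [extChartAt_source] using hy')
  have hfd : ∀ u, fderiv ℝ θ y u = chartDeriv x₁ ((extChartAt (𝓡 d) x₀).symm y)
      (mfderiv 𝓘(ℝ, Euc d) (𝓡 d) (extChartAt (𝓡 d) x₀).symm y u) := by
    intro u
    rw [← mfderiv_eq_fderiv]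
    have := mfderiv_comp y hd' hd
    exact congrArg (fun L : Euc d →L[ℝ] Euc d => L u) this
  have hquad : ∀ u, metricForm x₀ y u u =
      metricForm x₁ (θ y) (fderiv ℝ θ y u) (fderiv ℝ θ y u) := by
    intro u
    rw [hfd u, hθ, Function.comp_apply, metricForm_chartDeriv x₁ hy', metricForm_apply,
      chartMetric, real_inner_self_eq_norm_sq]
  have h1 := hquad (a + b)
  have h2 := hquad a
  have h3 := hquad b
  simp only [map_add, add_apply] at h1
  have h4 := metricForm_symm x₀ y a b
  have h5 := metricForm_symm x₁ (θ y) (fderiv ℝ θ y a) (fderiv ℝ θ y b)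
  change _ = metricForm x₁ (θ y) _ _
  linarith

/-- The geodesic equation may be checked in any chart. -/
theorem eulerLagrangeAt_change (x₀ x₁ : M) {c : ℝ → M} {t₀ : ℝ}
    (hc : ContMDiffAt 𝓘(ℝ, ℝ) (𝓡 d) 2 c t₀)
    (h₀ : c t₀ ∈ (extChartAt (𝓡 d) x₀).source) (h₁ : c t₀ ∈ (extChartAt (𝓡 d) x₁).source)
    [IsContMDiffRiemannianBundle (𝓡 d) ∞ (Euc d) (fun x : M => TangentSpace (𝓡 d) x)]
    (h : EulerLagrangeAt (metricForm x₁) (fun t => extChartAt (𝓡 d) x₁ (c t)) t₀) :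
    EulerLagrangeAt (metricForm x₀) (fun t => extChartAt (𝓡 d) x₀ (c t)) t₀ := by
  have hsrc : ∀ᶠ t in 𝓝 t₀, c t ∈ (extChartAt (𝓡 d) x₀).source :=
    hc.continuousAt.eventually ((isOpen_extChartAt_source x₀).mem_nhds h₀)
  have ht : extChartAt (𝓡 d) x₀ (c t₀) ∈ (extChartAt (𝓡 d) x₀).target :=
    (extChartAt (𝓡 d) x₀).map_source h₀
  have hinv := (extChartAt (𝓡 d) x₀).left_inv h₀
  have hinv' : (extChartAt (𝓡 d) x₀).symm (extChartAt (𝓡 d) x₀ (c t₀)) ∈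
    (extChartAt (𝓡 d) x₁).source := by rw [hinv]; exact h₁
  have hθ : ContDiffAt ℝ 2 (extChartAt (𝓡 d) x₁ ∘ (extChartAt (𝓡 d) x₀).symm)
      (extChartAt (𝓡 d) x₀ (c t₀)) := by
    rw [← contMDiffAt_iff_contDiffAt]
    refine ContMDiffAt.comp (I' := 𝓡 d) _
      (contMDiffAt_extChartAt' (by simpa [extChartAt_source] using hinv')) ?_
    exact (contMDiffOn_extChartAt_symm x₀).contMDiffAt ((isOpen_extChartAt_target x₀).mem_nhds ht)
      |>.of_le (m := 2) (n := ∞) (by norm_cast)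
  have hu : ContDiffAt ℝ 2 (fun t => extChartAt (𝓡 d) x₀ (c t)) t₀ := by
    rw [← contMDiffAt_iff_contDiffAt]
    exact ContMDiffAt.comp (I' := 𝓡 d) t₀
      ((contMDiffAt_extChartAt' (n := ∞) (by simpa [extChartAt_source] using h₀)).of_le
        (by norm_cast)) hc
  refine EulerLagrangeAt.of_comp (G' := metricForm x₁)
    (θ := extChartAt (𝓡 d) x₁ ∘ (extChartAt (𝓡 d) x₀).symm) hθ hu ?_
    (fun a b => metricForm_symm _ _ _ _) ?_ ?_
  · refine ((contDiffOn_metricForm x₁).contDiffAt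
      ((isOpen_extChartAt_target x₁).mem_nhds ?_)).differentiableAt (by simp)
    exact (extChartAt (𝓡 d) x₁).map_source hinv'
  · have hcont : ContinuousAt (extChartAt (𝓡 d) x₀).symm (extChartAt (𝓡 d) x₀ (c t₀)) :=
      continuousAt_extChartAt_symm' h₀
    filter_upwards [(isOpen_extChartAt_target x₀).mem_nhds ht,
      hcont.eventually ((isOpen_extChartAt_source x₁).mem_nhds hinv')] with y hy hy'
    exact fun a b => metricForm_change x₀ x₁ hy hy' a b
  · refine h.congr ?_
    filter_upwards [hsrc] with t ht
    simp only [Function.comp_apply, (extChartAt (𝓡 d) x₀).left_inv ht]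

/-- `c` satisfies the geodesic equation at the time `t₀`. -/
def IsGeodesicAt (c : ℝ → M) (t₀ : ℝ) : Prop :=
  ContMDiffAt 𝓘(ℝ, ℝ) (𝓡 d) 2 c t₀ ∧
    EulerLagrangeAt (metricForm (c t₀)) (fun t => extChartAt (𝓡 d) (c t₀) (c t)) t₀

/-- The velocity of a curve, as a point of the tangent bundle. -/
def velocity (c : ℝ → M) (t : ℝ) : TangentBundle (𝓡 d) M :=
  ⟨c t, mfderiv 𝓘(ℝ, ℝ) (𝓡 d) c t (1 : ℝ)⟩

theorem isGeodesic_iff {c : ℝ → M} : IsGeodesic (d := d) c ↔ ∀ t, IsGeodesicAt (d := d) c t :=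
  ⟨fun h t => ⟨h.1 t, h.2 t⟩, fun h => ⟨fun t => (h t).1, fun t => (h t).2⟩⟩

end Metric

/-! ### Uniqueness of geodesics -/

section Geodesics

variable {d : ℕ} {M : Type*} [TopologicalSpace M] [ChartedSpace (Euc d) M]
  [RiemannianBundle (fun x : M => TangentSpace (𝓡 d) x)] [IsManifold (𝓡 d) ∞ M]

theorem contDiffAt_chart_comp (x₀ : M) {c : ℝ → M} {t₀ : ℝ}
    (hc : ContMDiffAt 𝓘(ℝ, ℝ) (𝓡 d) 2 c t₀) (h₀ : c t₀ ∈ (extChartAt (𝓡 d) x₀).source) :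
    ContDiffAt ℝ 2 (fun t => extChartAt (𝓡 d) x₀ (c t)) t₀ := by
  rw [← contMDiffAt_iff_contDiffAt]
  exact ContMDiffAt.comp (I' := 𝓡 d) t₀
    ((contMDiffAt_extChartAt' (n := ∞) (by simpa [extChartAt_source] using h₀)).of_le
      (by norm_cast)) hc

theorem deriv_chart_comp (x₀ : M) {c : ℝ → M} {t₀ : ℝ}
    (hc : MDifferentiableAt 𝓘(ℝ, ℝ) (𝓡 d) c t₀) (h₀ : c t₀ ∈ (extChartAt (𝓡 d) x₀).source) :
    deriv (fun t => extChartAt (𝓡 d) x₀ (c t)) t₀ =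
      chartDeriv x₀ (velocity (d := d) c t₀).1 (velocity c t₀).2 := by
  have : IsManifold (𝓡 d) 1 M := IsManifold.of_le (n := ∞) (by simp)
  have hd' : MDifferentiableAt (𝓡 d) 𝓘(ℝ, Euc d) (extChartAt (𝓡 d) x₀) (c t₀) :=
    mdifferentiableAt_extChartAt (by simpa [extChartAt_source] using h₀)
  have h1 := mfderiv_comp t₀ hd' hc
  have h2 : fderiv ℝ (fun t => extChartAt (𝓡 d) x₀ (c t)) t₀ (1 : ℝ) =
      chartDeriv x₀ (c t₀) (mfderiv 𝓘(ℝ, ℝ) (𝓡 d) c t₀ (1 : ℝ)) := by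
    rw [← mfderiv_eq_fderiv]
    exact congrArg (fun L : ℝ →L[ℝ] Euc d => L 1) h1
  rw [← fderiv_apply_one_eq_deriv]
  exact h2

theorem velocity_eq_of_chart (x₀ : M) {c : ℝ → M} {t₀ : ℝ}
    (hc : MDifferentiableAt 𝓘(ℝ, ℝ) (𝓡 d) c t₀) (h₀ : c t₀ ∈ (extChartAt (𝓡 d) x₀).source)
    {v : TangentSpace (𝓡 d) (c t₀)}
    (h : deriv (fun t => extChartAt (𝓡 d) x₀ (c t)) t₀ = chartDeriv x₀ (c t₀) v) :
    velocity (d := d) c t₀ = ⟨c t₀, v⟩ := by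
  rw [deriv_chart_comp x₀ hc h₀] at h
  exact congrArg (fun v => (⟨c t₀, v⟩ : TangentBundle (𝓡 d) M))
    ((chartDeriv_invertible (d := d) x₀ h₀).injective h)

theorem velocity_congr {c c' : ℝ → M} {t : ℝ} (h : c =ᶠ[𝓝 t] c') :
    velocity (d := d) c t = velocity c' t := by
  refine tangentBundle_mk_congr h.eq_of_nhds ?_
  have := h.mfderiv_eq (I := 𝓘(ℝ, ℝ)) (I' := 𝓡 d)
  exact congrArg (fun L : ℝ →L[ℝ] Euc d => L 1) this

theorem velocity_comp_affine {c : ℝ → M} {s τ t : ℝ}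
    (hc : MDifferentiableAt 𝓘(ℝ, ℝ) (𝓡 d) c (s * t + τ)) :
    velocity (d := d) (fun t => c (s * t + τ)) t =
      ⟨c (s * t + τ), s • (velocity (d := d) c (s * t + τ)).2⟩ := by
  have h2 : HasDerivAt (fun t : ℝ => s * t + τ) s t := by
    simpa using ((hasDerivAt_id t).const_mul s).add_const τ
  have h3 : MDifferentiableAt 𝓘(ℝ, ℝ) 𝓘(ℝ, ℝ) (fun t : ℝ => s * t + τ) t :=
    h2.differentiableAt.mdifferentiableAt
  have h1 := mfderiv_comp (f := fun t : ℝ => s * t + τ) (g := c) t hc h3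
  refine tangentBundle_mk_congr rfl ?_
  have h4 := congrArg (fun L : ℝ →L[ℝ] Euc d => L 1) h1
  refine Eq.trans h4 ?_
  have h6 : fderiv ℝ (fun t : ℝ => s * t + τ) t 1 = s := by
    rw [h2.hasFDerivAt.fderiv]
    simp
  have h5 : mfderiv 𝓘(ℝ, ℝ) 𝓘(ℝ, ℝ) (fun t : ℝ => s * t + τ) t (1 : ℝ) = s :=
    (congrArg (fun L : ℝ →L[ℝ] ℝ => L 1) mfderiv_eq_fderiv).trans h6
  have h7 : ∀ L : ℝ →L[ℝ] Euc d, L s = s • L 1 := fun L => by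
    rw [← L.map_smul, smul_eq_mul, mul_one]
  exact (congrArg (mfderiv 𝓘(ℝ, ℝ) (𝓡 d) c (s * t + τ)) h5).trans (h7 _)

theorem IsGeodesicAt.congr {c c' : ℝ → M} {t : ℝ} (hc : IsGeodesicAt (d := d) c t)
    (h : c' =ᶠ[𝓝 t] c) : IsGeodesicAt (d := d) c' t := by
  refine ⟨hc.1.congr_of_eventuallyEq h, ?_⟩
  rw [h.eq_of_nhds]
  refine hc.2.congr ?_
  filter_upwards [h] with s hs
  rw [hs]

theorem IsGeodesicAt.comp_affine {c : ℝ → M} {s τ t : ℝ}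
    (hc : IsGeodesicAt (d := d) c (s * t + τ)) :
    IsGeodesicAt (d := d) (fun t => c (s * t + τ)) t := by
  refine ⟨?_, hc.2.comp_affine⟩
  refine ContMDiffAt.comp (I' := 𝓘(ℝ, ℝ)) (f := fun t : ℝ => s * t + τ) (g := c) t hc.1 ?_
  rw [contMDiffAt_iff_contDiffAt]
  fun_prop

theorem IsGeodesicAt.mdifferentiableAt {c : ℝ → M} {t : ℝ} (hc : IsGeodesicAt (d := d) c t) :
    MDifferentiableAt 𝓘(ℝ, ℝ) (𝓡 d) c t := hc.1.mdifferentiableAt (by norm_num)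

variable [IsContMDiffRiemannianBundle (𝓡 d) ∞ (Euc d) (fun x : M => TangentSpace (𝓡 d) x)]

theorem IsGeodesicAt.eulerLagrangeAt (x₀ : M) {c : ℝ → M} {t : ℝ}
    (hc : IsGeodesicAt (d := d) c t) (h₀ : c t ∈ (extChartAt (𝓡 d) x₀).source) :
    EulerLagrangeAt (metricForm x₀) (fun t => extChartAt (𝓡 d) x₀ (c t)) t :=
  eulerLagrangeAt_change x₀ (c t) hc.1 h₀ (mem_extChartAt_source (c t)) hc.2

/-- The geodesic equation may be checked in any one chart. -/
theorem isGeodesicAt_of_chart (x₀ : M) {c : ℝ → M} {t : ℝ}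
    (hc : ContMDiffAt 𝓘(ℝ, ℝ) (𝓡 d) 2 c t) (h₀ : c t ∈ (extChartAt (𝓡 d) x₀).source)
    (h : EulerLagrangeAt (metricForm x₀) (fun t => extChartAt (𝓡 d) x₀ (c t)) t) :
    IsGeodesicAt (d := d) c t :=
  ⟨hc, eulerLagrangeAt_change (c t) x₀ hc (mem_extChartAt_source (c t)) h₀ h⟩

theorem IsGeodesicAt.differentiableAt_metricForm (x₀ : M) {q : M}
    (h₀ : q ∈ (extChartAt (𝓡 d) x₀).source) :
    DifferentiableAt ℝ (metricForm (d := d) x₀) (extChartAt (𝓡 d) x₀ q) :=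
  ((contDiffOn_metricForm x₀).contDiffAt ((isOpen_extChartAt_target x₀).mem_nhds
    ((extChartAt (𝓡 d) x₀).map_source h₀))).differentiableAt (by simp)

/-- Two geodesics with the same velocity at a time agree around it. -/
theorem geodesic_eventuallyEq {c c' : ℝ → M} {t₀ : ℝ}
    (hc : ∀ᶠ t in 𝓝 t₀, IsGeodesicAt (d := d) c t)
    (hc' : ∀ᶠ t in 𝓝 t₀, IsGeodesicAt (d := d) c' t) {x₀ : M}
    (h₀ : c t₀ ∈ (extChartAt (𝓡 d) x₀).source) (h : c t₀ = c' t₀)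
    (hd : deriv (fun t => extChartAt (𝓡 d) x₀ (c t)) t₀ =
      deriv (fun t => extChartAt (𝓡 d) x₀ (c' t)) t₀) : c =ᶠ[𝓝 t₀] c' := by
  set G := metricForm (d := d) x₀
  set Z : (ℝ → M) → ℝ → Euc d × (Euc d →L[ℝ] ℝ) := fun c t => (extChartAt (𝓡 d) x₀ (c t),
    G (extChartAt (𝓡 d) x₀ (c t)) (deriv (fun t => extChartAt (𝓡 d) x₀ (c t)) t)) with hZ
  have hsrc : ∀ c : ℝ → M, (∀ᶠ t in 𝓝 t₀, IsGeodesicAt (d := d) c t) →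
      c t₀ ∈ (extChartAt (𝓡 d) x₀).source →
      ∀ᶠ t in 𝓝 t₀, c t ∈ (extChartAt (𝓡 d) x₀).source ∧
        HasDerivAt (Z c) (hamField G (Z c t)) t := by
    intro c hc h₀
    filter_upwards [hc, hc.self_of_nhds.1.continuousAt.eventually
      ((isOpen_extChartAt_source x₀).mem_nhds h₀)] with t ht hts
    refine ⟨hts, (ht.eulerLagrangeAt x₀ hts).hasDerivAt_ham (contDiffAt_chart_comp x₀ ht.1 hts)
      (IsGeodesicAt.differentiableAt_metricForm x₀ hts) fun v hv => ?_⟩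
    exact metricForm_pos x₀ ((extChartAt (𝓡 d) x₀).map_source hts) hv
  have h₀' : c' t₀ ∈ (extChartAt (𝓡 d) x₀).source := h ▸ h₀
  have hX : ContDiffAt ℝ 1 (hamField G) (Z c t₀) :=
    contDiffAt_hamField (isOpen_extChartAt_target x₀) (contDiffOn_metricForm x₀)
      (fun y hy u hu => metricForm_pos x₀ hy hu) ((extChartAt (𝓡 d) x₀).map_source h₀)
  obtain ⟨K, s, hs, hL⟩ := hX.exists_lipschitzOnWith
  have hZ0 : Z c t₀ = Z c' t₀ := by simp only [hZ, h, hd]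
  have e1 := hsrc c hc h₀
  have e2 := hsrc c' hc' h₀'
  have key : Z c =ᶠ[𝓝 t₀] Z c' := by
    refine ODE_solution_unique_of_eventually (v := fun _ => hamField G) (s := fun _ => s) (K := K)
      (Eventually.of_forall fun _ => hL) ?_ ?_ hZ0
    · filter_upwards [e1, e1.self_of_nhds.2.continuousAt.eventually hs] with t h1 h2
      exact ⟨h1.2, h2⟩
    · filter_upwards [e2, e2.self_of_nhds.2.continuousAt.eventually (hZ0 ▸ hs)] with t h1 h2
      exact ⟨h1.2, h2⟩
  filter_upwards [key, e1, e2] with t h1 h2 h3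
  exact (extChartAt (𝓡 d) x₀).injOn h2.1 h3.1 (congrArg Prod.fst h1)

/-- Local uniqueness of geodesics with a given velocity. -/
theorem geodesic_eventuallyEq_of_velocity {c c' : ℝ → M} {t₀ : ℝ}
    (hc : ∀ᶠ t in 𝓝 t₀, IsGeodesicAt (d := d) c t)
    (hc' : ∀ᶠ t in 𝓝 t₀, IsGeodesicAt (d := d) c' t)
    (h : velocity (d := d) c t₀ = velocity c' t₀) : c =ᶠ[𝓝 t₀] c' := by
  have h0 : c t₀ = c' t₀ := congrArg (fun p : TangentBundle (𝓡 d) M => p.1) h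
  have hs : c t₀ ∈ (extChartAt (𝓡 d) (c t₀)).source := mem_extChartAt_source (c t₀)
  refine geodesic_eventuallyEq hc hc' hs h0 ?_
  rw [deriv_chart_comp _ hc.self_of_nhds.mdifferentiableAt hs,
    deriv_chart_comp _ hc'.self_of_nhds.mdifferentiableAt (h0 ▸ hs), h]

/-- Geodesics on an interval are determined by the velocity at one time. -/
theorem geodesic_eqOn [T2Space M] {c c' : ℝ → M} {a b t₀ : ℝ} (ht₀ : t₀ ∈ Ioo a b)
    (hc : ∀ t ∈ Ioo a b, IsGeodesicAt (d := d) c t)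
    (hc' : ∀ t ∈ Ioo a b, IsGeodesicAt (d := d) c' t)
    (h : velocity (d := d) c t₀ = velocity c' t₀) : EqOn c c' (Ioo a b) := by
  have hev : ∀ t ∈ Ioo a b, ∀ c : ℝ → M, (∀ t ∈ Ioo a b, IsGeodesicAt (d := d) c t) →
      ∀ᶠ t in 𝓝 t, IsGeodesicAt (d := d) c t := fun t ht c hc => by
    filter_upwards [isOpen_Ioo.mem_nhds ht] with s hs using hc s hs
  set S := {t | c =ᶠ[𝓝 t] c'} with hS
  have hSo : IsOpen S := isOpen_setOfPred_eventually_nhds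
  have hsub : Ioo a b ⊆ S := by
    refine isPreconnected_Ioo.subset_of_closure_inter_subset hSo
      ⟨t₀, ht₀, geodesic_eventuallyEq_of_velocity (hev t₀ ht₀ c hc) (hev t₀ ht₀ c' hc') h⟩ ?_
    rintro t ⟨htc, ht⟩
    have hct := hc t ht
    have hct' := hc' t ht
    have hfr : ∃ᶠ s in 𝓝 t, s ∈ S := mem_closure_iff_frequently.1 htc
    have heq : c t = c' t := by
      by_contra hne
      have h1 : ∀ᶠ s in 𝓝 t, c s ≠ c' s :=
        (hct.1.continuousAt.ne_iff_eventually_ne hct'.1.continuousAt).1 hne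
      obtain ⟨s, hs, hs'⟩ := (hfr.and_eventually h1).exists
      exact hs' (Filter.EventuallyEq.eq_of_nhds hs)
    have hs : c t ∈ (extChartAt (𝓡 d) (c t)).source := mem_extChartAt_source (c t)
    refine geodesic_eventuallyEq (hev t ht c hc) (hev t ht c' hc') hs heq ?_
    by_contra hne
    have hcd : ∀ c'' : ℝ → M, IsGeodesicAt (d := d) c'' t →
        c'' t ∈ (extChartAt (𝓡 d) (c t)).source →
        ContinuousAt (deriv (fun t' => extChartAt (𝓡 d) (c t) (c'' t'))) t := fun c'' h1 h2 =>
      (hasDerivAt_of_contDiffAt_two (contDiffAt_chart_comp (c t) h1.1 h2)).2.1.continuousAt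
    have h1 := ((hcd c hct hs).ne_iff_eventually_ne (hcd c' hct' (heq ▸ hs))).1 hne
    obtain ⟨s, hs, hs'⟩ := (hfr.and_eventually h1).exists
    refine hs' (Filter.EventuallyEq.deriv_eq ?_)
    filter_upwards [hs] with r hr
    rw [hr]
  exact fun t ht => (hsub ht).eq_of_nhds

/-- Geodesics have constant speed. -/
theorem geodesic_speed {c : ℝ → M} {a b : ℝ}
    (hc : ∀ t ∈ Ioo a b, IsGeodesicAt (d := d) c t) {t₀ t₁ : ℝ} (h₀ : t₀ ∈ Ioo a b)
    (h₁ : t₁ ∈ Ioo a b) : ‖(velocity (d := d) c t₀).2‖ = ‖(velocity (d := d) c t₁).2‖ := by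
  have hd : ∀ t ∈ Ioo a b, HasDerivAt (fun t => ‖(velocity (d := d) c t).2‖ ^ 2) 0 t := by
    intro t ht
    have hs : c t ∈ (extChartAt (𝓡 d) (c t)).source := mem_extChartAt_source (c t)
    have h1 := ((hc t ht).eulerLagrangeAt (c t) hs).hasDerivAt_energy
      (contDiffAt_chart_comp (c t) (hc t ht).1 hs)
      (IsGeodesicAt.differentiableAt_metricForm (c t) hs) (fun a b => metricForm_symm _ _ _ _)
    refine h1.congr_of_eventuallyEq ?_
    filter_upwards [isOpen_Ioo.mem_nhds ht, (hc t ht).1.continuousAt.eventually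
      ((isOpen_extChartAt_source (c t)).mem_nhds hs)] with s h2 h3
    rw [deriv_chart_comp (c t) (hc s h2).mdifferentiableAt h3]
    exact (metricForm_chartDeriv (c t) h3 _).symm
  have h2 := isOpen_Ioo.is_const_of_deriv_eq_zero isPreconnected_Ioo
    (fun t ht => (hd t ht).differentiableAt.differentiableWithinAt)
    (fun t ht => (hd t ht).deriv) h₀ h₁
  exact (pow_left_inj₀ (norm_nonneg _) (norm_nonneg _) two_ne_zero).1 h2

end Geodesics

/-! ### Existence of geodesics -/

section GeodesicExistence

variable {d : ℕ} {M : Type*} [TopologicalSpace M] [ChartedSpace (Euc d) M]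
  [RiemannianBundle (fun x : M => TangentSpace (𝓡 d) x)] [IsManifold (𝓡 d) ∞ M]
  [IsContMDiffRiemannianBundle (𝓡 d) ∞ (Euc d) (fun x : M => TangentSpace (𝓡 d) x)]

theorem isContinuousRiemannianBundle :
    IsContinuousRiemannianBundle (Euc d) (fun x : M => TangentSpace (𝓡 d) x) := by
  obtain ⟨g, hg, h⟩ := IsContMDiffRiemannianBundle.exists_contMDiff (IB := 𝓡 d) (n := ∞)
    (F := Euc d) (E := fun x : M => TangentSpace (𝓡 d) x)
  exact ⟨g, hg.continuous, h⟩

theorem eventually_norm_chartDeriv_lt (x₀ : M) :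
    ∃ C > 0, ∀ᶠ q in 𝓝 x₀, ‖chartDeriv (d := d) x₀ q‖ < C := by
  have : IsManifold (𝓡 d) 1 M := IsManifold.of_le (n := ∞) (by simp)
  have : IsContinuousRiemannianBundle (Euc d) (fun x : M => TangentSpace (𝓡 d) x) :=
    isContinuousRiemannianBundle
  obtain ⟨C, hC, h⟩ := eventually_norm_trivializationAt_lt (Euc d)
    (fun x : M => TangentSpace (𝓡 d) x) x₀
  refine ⟨C, hC, ?_⟩
  filter_upwards [h, chart_source_mem_nhds (Euc d) x₀] with q hq h'q
  rw [TangentBundle.continuousLinearMapAt_trivializationAt h'q] at hq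
  exact hq

/-- Short geodesics exist uniformly: near every point, for all small initial velocities, on a
common time interval. -/
theorem exists_geodesic_local (x₀ : M) : ∃ U ∈ 𝓝 x₀, ∃ δ > 0, ∃ ε > 0, ∀ x ∈ U,
    ∀ v : TangentSpace (𝓡 d) x, ‖v‖ ≤ δ → ∃ c : ℝ → M, velocity (d := d) c 0 = ⟨x, v⟩ ∧
      ∀ t ∈ Ioo (-ε) ε, IsGeodesicAt (d := d) c t := by
  set φ := extChartAt (𝓡 d) x₀ with hφ
  set G := metricForm (d := d) x₀ with hG
  set z₀ : Euc d × (Euc d →L[ℝ] ℝ) := (φ x₀, 0) with hz₀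
  have hΩ : IsOpen φ.target := isOpen_extChartAt_target x₀
  have hGs : ContDiffOn ℝ ∞ G φ.target := contDiffOn_metricForm x₀
  have hpos : ∀ y ∈ φ.target, ∀ u, u ≠ 0 → 0 < G y u u := fun y hy u hu =>
    metricForm_pos x₀ hy hu
  have hx₀ : φ x₀ ∈ φ.target := mem_extChartAt_target x₀
  have hX : ContDiffAt ℝ 1 (hamField G) z₀ := contDiffAt_hamField hΩ hGs hpos hx₀
  obtain ⟨ε, hε, a, r, L, K, hr, hPL⟩ := IsPicardLindelof.of_contDiffAt_one hX
  obtain ⟨α, hα, hαc⟩ := (hPL 0).exists_forall_mem_closedBall_eq_hasDerivWithinAt_continuousOn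
  simp only [zero_sub, zero_add] at hα hαc
  -- the flow stays in the chart for a short time
  have hmem : (z₀, (0 : ℝ)) ∈ Metric.closedBall z₀ (r : ℝ) ×ˢ Icc (-ε) ε :=
    ⟨Metric.mem_closedBall_self (by positivity), by constructor <;> linarith⟩
  have hnhds : Metric.closedBall z₀ (r : ℝ) ×ˢ Icc (-ε) ε ∈ 𝓝 (z₀, (0 : ℝ)) :=
    prod_mem_nhds (Metric.closedBall_mem_nhds z₀ (by positivity))
      (Icc_mem_nhds (by linarith) hε)
  have hαat : ContinuousAt α (z₀, 0) := hαc.continuousAt hnhds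
  have hα0 : α (z₀, 0) = z₀ := (hα z₀ hmem.1).1
  have hin : ∀ᶠ p in 𝓝 (z₀, (0 : ℝ)), (α p).1 ∈ φ.target :=
    (continuous_fst.continuousAt.comp hαat).eventually
      (hΩ.mem_nhds (by simp only [Function.comp_apply, hα0]; exact hx₀))
  obtain ⟨ρ, hρ, hball⟩ := Metric.eventually_nhds_iff_ball.1 (hin.and hnhds)
  obtain ⟨C, hC, hCd⟩ := eventually_norm_chartDeriv_lt (d := d) x₀
  have hφc : ContinuousAt φ x₀ := continuousAt_extChartAt (I := 𝓡 d) x₀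
  have hGc : ContinuousAt G (φ x₀) := (hGs.contDiffAt (hΩ.mem_nhds hx₀)).continuousAt
  have hGb : ∀ᶠ q in 𝓝 x₀, ‖G (φ q)‖ < ‖G (φ x₀)‖ + 1 :=
    (hGc.comp hφc).norm.eventually (gt_mem_nhds (by simp))
  have hφb : ∀ᶠ q in 𝓝 x₀, dist (φ q) (φ x₀) < ρ := hφc.eventually (Metric.ball_mem_nhds _ hρ)
  set B := ‖G (φ x₀)‖ + 1 with hB
  have hBpos : 0 < B := by positivity
  refine ⟨_, inter_mem (inter_mem hCd hGb) (inter_mem hφb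
      (extChartAt_source_mem_nhds (I := 𝓡 d) x₀)),
    ρ / (2 * B * C), by positivity, min ρ ε, lt_min hρ hε, ?_⟩
  rintro x ⟨⟨hx1, hx2⟩, hx3, hx4⟩ v hv
  set w := chartDeriv (d := d) x₀ x v with hw
  set z : Euc d × (Euc d →L[ℝ] ℝ) := (φ x, G (φ x) w) with hz
  have hzdist : dist z z₀ < ρ := by
    rw [hz, hz₀, Prod.dist_eq, max_lt_iff]
    refine ⟨hx3, ?_⟩
    rw [dist_zero_right]
    calc ‖G (φ x) w‖ ≤ ‖G (φ x)‖ * ‖w‖ := (G (φ x)).le_opNorm w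
      _ ≤ B * (C * (ρ / (2 * B * C))) := by
          have h1 : ‖w‖ ≤ C * (ρ / (2 * B * C)) :=
            ((chartDeriv (d := d) x₀ x).le_opNorm v).trans
              (mul_le_mul (le_of_lt hx1) hv (norm_nonneg _) hC.le)
          exact mul_le_mul (le_of_lt hx2) h1 (norm_nonneg _) hBpos.le
      _ = ρ / 2 := by field_simp
      _ < ρ := by linarith
  have hzr : z ∈ Metric.closedBall z₀ (r : ℝ) :=
    (hball (z, 0) (by
      rw [Metric.mem_ball, Prod.dist_eq, max_lt_iff]; exact ⟨hzdist, by simpa using hρ⟩)).2.1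
  obtain ⟨hz0, hzd⟩ := hα z hzr
  set J := Ioo (-(min ρ ε)) (min ρ ε) with hJ
  have h0J : (0 : ℝ) ∈ J := by constructor <;> simp [hρ, hε]
  have hJΩ : ∀ t ∈ J, (α (z, t)).1 ∈ φ.target := by
    intro t ht
    refine (hball (z, t) ?_).1
    rw [Metric.mem_ball, Prod.dist_eq, max_lt_iff]
    refine ⟨hzdist, ?_⟩
    rw [Real.dist_eq, sub_zero, abs_lt]
    exact ⟨by have := ht.1; have := min_le_left ρ ε; linarith, ht.2.trans_le (min_le_left _ _)⟩
  have hJd : ∀ t ∈ J, HasDerivAt (fun t => α (z, t)) (hamField G (α (z, t))) t := by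
    intro t ht
    have h1 : -ε < t := by have := ht.1; have := min_le_right ρ ε; linarith
    have h2 : t < ε := ht.2.trans_le (min_le_right _ _)
    exact (hzd t ⟨h1.le, h2.le⟩).hasDerivAt (Icc_mem_nhds h1 h2)
  have hsol := eulerLagrangeAt_of_ham hΩ hGs hpos isOpen_Ioo hJd hJΩ
  set c : ℝ → M := fun t => φ.symm (α (z, t)).1 with hc
  have hcφ : ∀ t ∈ J, φ (c t) = (α (z, t)).1 := fun t ht => φ.right_inv (hJΩ t ht)
  have hcsrc : ∀ t ∈ J, c t ∈ φ.source := fun t ht => φ.map_target (hJΩ t ht)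
  have hceq : ∀ t ∈ J, (fun t => φ (c t)) =ᶠ[𝓝 t] fun t => (α (z, t)).1 := fun t ht => by
    filter_upwards [isOpen_Ioo.mem_nhds ht] with s hs using hcφ s hs
  have hcC : ∀ t ∈ J, ContMDiffAt 𝓘(ℝ, ℝ) (𝓡 d) 2 c t := by
    intro t ht
    have h1 : ContMDiffAt 𝓘(ℝ, Euc d) (𝓡 d) 2 φ.symm (α (z, t)).1 :=
      ((contMDiffOn_extChartAt_symm x₀).contMDiffAt (hΩ.mem_nhds (hJΩ t ht))).of_le
        (n := ∞) (by norm_cast)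
    exact ContMDiffAt.comp (I' := 𝓘(ℝ, Euc d)) t h1
      (contMDiffAt_iff_contDiffAt.2 (hsol t ht).1)
  have hgeo : ∀ t ∈ J, IsGeodesicAt (d := d) c t := fun t ht =>
    isGeodesicAt_of_chart x₀ (hcC t ht) (hcsrc t ht) ((hsol t ht).2.1.congr (hceq t ht))
  have hc0 : c 0 = x := by
    change φ.symm (α (z, 0)).1 = x
    rw [hz0]
    exact φ.left_inv hx4
  have hder : deriv (fun t => φ (c t)) 0 = w := by
    rw [(hceq 0 h0J).deriv_eq, (hsol 0 h0J).2.2, hz0]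
    obtain ⟨e, he⟩ := isInvertible_of_pos (hpos _ (φ.map_source hx4))
    simp only [hamVelocity, hz, ← he, ContinuousLinearMap.inverse_equiv]
    simp
  refine ⟨c, ?_, hgeo⟩
  clear_value c
  subst hc0
  exact velocity_eq_of_chart x₀ (hgeo 0 h0J).mdifferentiableAt hx4 hder

/-- Short geodesics exist uniformly on a compact manifold. -/
theorem exists_geodesic_uniform [CompactSpace M] : ∃ δ > 0, ∃ ε > 0, ∀ x : M,
    ∀ v : TangentSpace (𝓡 d) x, ‖v‖ ≤ δ → ∃ c : ℝ → M, velocity (d := d) c 0 = ⟨x, v⟩ ∧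
      ∀ t ∈ Ioo (-ε) ε, IsGeodesicAt (d := d) c t := by
  have key : ∃ δ > 0, ∃ ε > 0, ∀ x ∈ (univ : Set M),
      ∀ v : TangentSpace (𝓡 d) x, ‖v‖ ≤ δ → ∃ c : ℝ → M, velocity (d := d) c 0 = ⟨x, v⟩ ∧
      ∀ t ∈ Ioo (-ε) ε, IsGeodesicAt (d := d) c t := by
    refine isCompact_univ.induction_on (p := fun s : Set M => ∃ δ > 0, ∃ ε > 0, ∀ x ∈ s,
      ∀ v : TangentSpace (𝓡 d) x, ‖v‖ ≤ δ → ∃ c : ℝ → M, velocity (d := d) c 0 = ⟨x, v⟩ ∧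
      ∀ t ∈ Ioo (-ε) ε, IsGeodesicAt (d := d) c t) ⟨1, one_pos, 1, one_pos, by simp⟩ ?_ ?_ ?_
    · rintro s t hst ⟨δ, hδ, ε, hε, h⟩
      exact ⟨δ, hδ, ε, hε, fun x hx => h x (hst hx)⟩
    · rintro s t ⟨δ, hδ, ε, hε, h⟩ ⟨δ', hδ', ε', hε', h'⟩
      refine ⟨min δ δ', lt_min hδ hδ', min ε ε', lt_min hε hε', ?_⟩
      rintro x (hx | hx) v hv
      · obtain ⟨c, h1, h2⟩ := h x hx v (hv.trans (min_le_left _ _))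
        exact ⟨c, h1, fun t ht => h2 t ⟨(neg_le_neg (min_le_left _ _)).trans_lt ht.1,
          ht.2.trans_le (min_le_left _ _)⟩⟩
      · obtain ⟨c, h1, h2⟩ := h' x hx v (hv.trans (min_le_right _ _))
        exact ⟨c, h1, fun t ht => h2 t ⟨(neg_le_neg (min_le_right _ _)).trans_lt ht.1,
          ht.2.trans_le (min_le_right _ _)⟩⟩
    · intro x _
      obtain ⟨U, hU, h⟩ := exists_geodesic_local (d := d) x
      exact ⟨U, mem_nhdsWithin_of_mem_nhds hU, h⟩
  obtain ⟨δ, hδ, ε, hε, h⟩ := key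
  exact ⟨δ, hδ, ε, hε, fun x => h x (mem_univ x)⟩

theorem velocity_norm_congr {p q : TangentBundle (𝓡 d) M} (h : p = q) : ‖p.2‖ = ‖q.2‖ := by
  rw [h]

/-- A slow geodesic can be prolonged to the right. -/
theorem geodesic_extend_right [T2Space M] {δ ε : ℝ} (hε : 0 < ε)
    (hex : ∀ x : M, ∀ v : TangentSpace (𝓡 d) x, ‖v‖ ≤ δ → ∃ c : ℝ → M,
      velocity (d := d) c 0 = ⟨x, v⟩ ∧ ∀ t ∈ Ioo (-ε) ε, IsGeodesicAt (d := d) c t)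
    {c : ℝ → M} {a b : ℝ} (ha : a < 0) (hb : ε ≤ b)
    (hc : ∀ t ∈ Ioo a b, IsGeodesicAt (d := d) c t) (hv : ‖(velocity (d := d) c 0).2‖ ≤ δ) :
    ∃ c' : ℝ → M, c' =ᶠ[𝓝 0] c ∧ ∀ t ∈ Ioo a (b + ε / 2), IsGeodesicAt (d := d) c' t := by
  set t₁ := b - ε / 2 with ht₁
  have ht₁' : t₁ ∈ Ioo a b := ⟨by linarith, by linarith⟩
  obtain ⟨c₁, hc₁v, hc₁⟩ := hex _ (velocity (d := d) c t₁).2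
    ((geodesic_speed hc ht₁' ⟨ha, by linarith⟩).trans_le hv)
  set c₂ : ℝ → M := fun t => c₁ (1 * t + (-t₁)) with hc₂
  have hc₂g : ∀ t ∈ Ioo (t₁ - ε) (t₁ + ε), IsGeodesicAt (d := d) c₂ t := fun t ht =>
    (hc₁ (1 * t + (-t₁)) ⟨by linarith [ht.1], by linarith [ht.2]⟩).comp_affine
  have hc₂v : velocity (d := d) c₂ t₁ = velocity c t₁ := by
    have h0 : 1 * t₁ + (-t₁) = 0 := by ring
    have h1 := velocity_comp_affine (d := d) (c := c₁) (s := 1) (τ := -t₁) (t := t₁)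
      (by rw [h0]; exact (hc₁ 0 ⟨by linarith, hε⟩).mdifferentiableAt)
    rw [h0, one_smul] at h1
    exact h1.trans hc₁v
  set l := max a (t₁ - ε) with hl
  have hl1 : l < t₁ := max_lt ht₁'.1 (by linarith)
  have heq : EqOn c c₂ (Ioo l b) := by
    refine geodesic_eqOn (d := d) ⟨hl1, ht₁'.2⟩
      (fun t ht => hc t ⟨(le_max_left _ _).trans_lt ht.1, ht.2⟩)
      (fun t ht => hc₂g t ⟨(le_max_right _ _).trans_lt ht.1, by linarith [ht.2]⟩) hc₂v.symm
  classical
  set c' : ℝ → M := fun t => if t < t₁ then c t else c₂ t with hc'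
  have hlt : ∀ t < b, l < t → c' =ᶠ[𝓝 t] c := by
    intro t ht hlt
    filter_upwards [isOpen_Ioo.mem_nhds ⟨hlt, ht⟩] with s hs
    simp only [hc']
    split_ifs with h
    · rfl
    · exact (heq hs).symm
  have hlt' : ∀ t < t₁, c' =ᶠ[𝓝 t] c := by
    intro t ht
    filter_upwards [gt_mem_nhds ht] with s hs
    simp only [hc', if_pos hs]
  refine ⟨c', hlt' 0 (by linarith), fun t ht => ?_⟩
  rcases lt_or_ge t t₁ with h | h
  · exact (hc t ⟨ht.1, h.trans ht₁'.2⟩).congr (hlt' t h)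
  · rcases lt_or_ge t b with h2 | h2
    · exact (hc t ⟨ht.1, h2⟩).congr (hlt t h2 (hl1.trans_le h))
    · refine (hc₂g t ⟨by linarith, by linarith [ht.2]⟩).congr ?_
      filter_upwards [lt_mem_nhds (show t₁ < t by linarith)] with s hs
      simp only [hc', if_neg (not_lt.2 (le_of_lt hs))]

/-- A slow geodesic can be prolonged in both directions. -/
theorem geodesic_extend [T2Space M] {δ ε : ℝ} (hε : 0 < ε)
    (hex : ∀ x : M, ∀ v : TangentSpace (𝓡 d) x, ‖v‖ ≤ δ → ∃ c : ℝ → M,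
      velocity (d := d) c 0 = ⟨x, v⟩ ∧ ∀ t ∈ Ioo (-ε) ε, IsGeodesicAt (d := d) c t)
    {c : ℝ → M} {a : ℝ} (ha : ε ≤ a)
    (hc : ∀ t ∈ Ioo (-a) a, IsGeodesicAt (d := d) c t) (hv : ‖(velocity (d := d) c 0).2‖ ≤ δ) :
    ∃ c' : ℝ → M, c' =ᶠ[𝓝 0] c ∧
      ∀ t ∈ Ioo (-(a + ε / 2)) (a + ε / 2), IsGeodesicAt (d := d) c' t := by
  obtain ⟨c₁, h1, h2⟩ := geodesic_extend_right hε hex (by linarith) ha hc hv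
  -- the reversed curve is prolonged to the right
  have hneg : Tendsto (fun t : ℝ => -1 * t + 0) (𝓝 0) (𝓝 0) := by
    have : Continuous fun t : ℝ => -1 * t + 0 := by fun_prop
    simpa using this.tendsto 0
  have hg0 : IsGeodesicAt (d := d) c₁ (-1 * 0 + 0) := by
    rw [show (-1 * 0 + 0 : ℝ) = 0 by norm_num]
    exact h2 0 ⟨by linarith, by linarith⟩
  have hrev : ‖(velocity (d := d) (fun t => c₁ (-1 * t + 0)) 0).2‖ ≤ δ := by
    have h3 := velocity_comp_affine (d := d) (c := c₁) (s := -1) (τ := 0) (t := 0)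
      hg0.mdifferentiableAt
    rw [velocity_norm_congr h3]
    refine (norm_smul (-1 : ℝ) (velocity (d := d) c₁ (-1 * 0 + 0)).2).trans_le ?_
    rw [show (-1 * 0 + 0 : ℝ) = 0 by norm_num, velocity_norm_congr (velocity_congr h1), norm_neg,
      norm_one, one_mul]
    exact hv
  obtain ⟨c₂, h3, h4⟩ := geodesic_extend_right hε hex (c := fun t => c₁ (-1 * t + 0))
    (a := -(a + ε / 2)) (b := a) (by linarith) ha
    (fun t ht => (h2 _ ⟨by linarith [ht.2], by linarith [ht.1]⟩).comp_affine) hrev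
  refine ⟨fun t => c₂ (-1 * t + 0), ?_, fun t ht =>
    (h4 _ ⟨by linarith [ht.2], by linarith [ht.1]⟩).comp_affine⟩
  filter_upwards [hneg.eventually h3, h1] with t h5 h6
  rw [h5, ← h6]
  congr 1
  ring

/-- Geodesics with a given initial velocity exist for all times. -/
theorem exists_geodesic [CompactSpace M] [T2Space M] (x : M) (v : TangentSpace (𝓡 d) x) :
    ∃ c : ℝ → M, IsGeodesic (d := d) c ∧ velocity (d := d) c 0 = ⟨x, v⟩ := by
  obtain ⟨δ, hδ, ε, hε, hex⟩ := exists_geodesic_uniform (d := d) (M := M)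
  -- slow geodesics
  have slow : ∀ v : TangentSpace (𝓡 d) x, ‖v‖ ≤ δ →
      ∃ c : ℝ → M, IsGeodesic (d := d) c ∧ velocity (d := d) c 0 = ⟨x, v⟩ := by
    intro v hv
    have step : ∀ n : ℕ, ∃ c : ℝ → M, velocity (d := d) c 0 = ⟨x, v⟩ ∧
        ∀ t ∈ Ioo (-(ε + n * (ε / 2))) (ε + n * (ε / 2)), IsGeodesicAt (d := d) c t := by
      intro n
      induction n with
      | zero => simpa using hex x v hv
      | succ n ih =>
        obtain ⟨c, h1, h2⟩ := ih
        obtain ⟨c', h3, h4⟩ := geodesic_extend hε hex (by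
          have : (0 : ℝ) ≤ n * (ε / 2) := by positivity
          linarith) h2 (by rw [velocity_norm_congr h1]; exact hv)
        refine ⟨c', (velocity_congr h3).trans h1, ?_⟩
        have h5 : ε + ((n + 1 : ℕ) : ℝ) * (ε / 2) = ε + n * (ε / 2) + ε / 2 := by
          push_cast; ring
        rw [h5]
        exact h4
    choose C hC1 hC2 using step
    set A : ℕ → ℝ := fun n => ε + n * (ε / 2) with hA
    have hAm : Monotone A := fun m n h => by
      have : (m : ℝ) ≤ n := by exact_mod_cast h
      simp only [hA]
      have := mul_le_mul_of_nonneg_right this (half_pos hε).le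
      linarith
    have hex' : ∀ t : ℝ, ∃ n : ℕ, |t| < A n := by
      intro t
      obtain ⟨n, hn⟩ := exists_nat_gt (|t| / (ε / 2))
      refine ⟨n, ?_⟩
      rw [div_lt_iff₀ (half_pos hε)] at hn
      simp only [hA]
      linarith
    choose N hN using hex'
    have hagree : ∀ m n : ℕ, m ≤ n → EqOn (C m) (C n) (Ioo (-(A m)) (A m)) := by
      intro m n hmn
      have hle := hAm hmn
      have hApos : 0 < A m := by
        have : (0 : ℝ) ≤ m * (ε / 2) := by positivity
        simp only [hA]; linarith
      exact geodesic_eqOn (d := d) (t₀ := 0) ⟨by linarith, hApos⟩ (hC2 m)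
        (fun t ht => hC2 n t ⟨by have := ht.1; simp only [hA] at *; linarith,
          by have := ht.2; simp only [hA] at *; linarith⟩) ((hC1 m).trans (hC1 n).symm)
    have hag : ∀ (m : ℕ) (t : ℝ), |t| < A m → C (N t) t = C m t := by
      intro m t ht
      rcases le_total (N t) m with h | h
      · exact hagree _ _ h (abs_lt.1 (hN t))
      · exact (hagree _ _ h (abs_lt.1 ht)).symm
    have hev : ∀ t, (fun t => C (N t) t) =ᶠ[𝓝 t] C (N t) := by
      intro t
      have : ∀ᶠ s in 𝓝 t, |s| < A (N t) :=
        continuous_abs.continuousAt.eventually (gt_mem_nhds (hN t))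
      filter_upwards [this] with s hs using hag _ s hs
    refine ⟨fun t => C (N t) t, isGeodesic_iff.2 fun t =>
      (hC2 (N t) t (abs_lt.1 (hN t))).congr (hev t), ?_⟩
    exact (velocity_congr (hev 0)).trans (hC1 (N 0))
  -- a fast geodesic is a slow geodesic with another parametrisation
  set s : ℝ := δ / (‖v‖ + 1) with hs
  have hv1 : 0 < ‖v‖ + 1 := by positivity
  have hspos : 0 < s := by positivity
  obtain ⟨c, hc, hcv⟩ := slow (s • v) (by
    rw [norm_smul, Real.norm_of_nonneg hspos.le, hs, div_mul_eq_mul_div, div_le_iff₀ hv1]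
    nlinarith [norm_nonneg v])
  refine ⟨fun t => c (s⁻¹ * t + 0),
    isGeodesic_iff.2 fun t => (isGeodesic_iff.1 hc _).comp_affine, ?_⟩
  have h1 := velocity_comp_affine (d := d) (c := c) (s := s⁻¹) (τ := 0) (t := 0)
    (isGeodesic_iff.1 hc _).mdifferentiableAt
  rw [show s⁻¹ * 0 + 0 = (0 : ℝ) by ring] at h1
  refine h1.trans ?_
  have h2 : (⟨c 0, s⁻¹ • (velocity (d := d) c 0).2⟩ : TangentBundle (𝓡 d) M) =
      (fun p : TangentBundle (𝓡 d) M => ⟨p.1, s⁻¹ • p.2⟩) (velocity (d := d) c 0) := rfl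
  rw [h2, hcv]
  simp only [smul_smul, inv_mul_cancel₀ hspos.ne', one_smul]

/-- `exp_x (s v)` is the position at time `s` of the geodesic with initial velocity `v`. -/
theorem exists_geodesic_expMap [CompactSpace M] [T2Space M] (x : M) (v : TangentSpace (𝓡 d) x) :
    ∃ c : ℝ → M, IsGeodesic (d := d) c ∧ velocity (d := d) c 0 = ⟨x, v⟩ ∧
      ∀ s : ℝ, expMap x (s • v) = c s := by
  obtain ⟨c, hc, hcv⟩ := exists_geodesic x v
  refine ⟨c, hc, hcv, fun s => ?_⟩
  have hex : ∃ c : ℝ → M, IsGeodesic (d := d) c ∧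
      (⟨c 0, mfderiv 𝓘(ℝ, ℝ) (𝓡 d) c 0 (1 : ℝ)⟩ : TangentBundle (𝓡 d) M) = ⟨x, s • v⟩ :=
    exists_geodesic x (s • v)
  have h1 : expMap x (s • v) = hex.choose 1 := dif_pos hex
  obtain ⟨hg, hgv⟩ := hex.choose_spec
  rw [h1]
  have hgeo : ∀ t, IsGeodesicAt (d := d) (fun t => c (s * t + 0)) t := fun t =>
    (isGeodesic_iff.1 hc _).comp_affine
  have h3 := velocity_comp_affine (d := d) (c := c) (s := s) (τ := 0) (t := 0)
    (isGeodesic_iff.1 hc _).mdifferentiableAt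
  rw [show s * 0 + 0 = (0 : ℝ) by ring] at h3
  have h2 : (⟨c 0, s • (velocity (d := d) c 0).2⟩ : TangentBundle (𝓡 d) M) =
      (fun p : TangentBundle (𝓡 d) M => ⟨p.1, s • p.2⟩) (velocity (d := d) c 0) := rfl
  rw [h2, hcv] at h3
  have h4 := geodesic_eqOn (d := d) (a := -2) (b := 2) (t₀ := 0) (by norm_num)
    (fun t _ => isGeodesic_iff.1 hg t) (fun t _ => hgeo t) (hgv.trans h3.symm)
    (show (1 : ℝ) ∈ Ioo (-2) 2 by norm_num)
  simpa using h4

end GeodesicExistence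

/-! ### The Riemannian distance in charts -/

section ChartDistance

variable {d : ℕ} {M : Type*} [TopologicalSpace M] [ChartedSpace (Euc d) M]
  [RiemannianBundle (fun x : M => TangentSpace (𝓡 d) x)] [IsManifold (𝓡 d) ∞ M]
  [IsContMDiffRiemannianBundle (𝓡 d) ∞ (Euc d) (fun x : M => TangentSpace (𝓡 d) x)]

theorem enorm_chart_sub_le (x₀ : M) {C : NNReal} {s : Set M} (hs : s ⊆ (extChartAt (𝓡 d) x₀).source)
    (hC : ∀ q ∈ s, ‖chartDeriv (d := d) x₀ q‖ₑ ≤ C) {γ : ℝ → M}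
    (hγ : ContMDiffOn 𝓘(ℝ, ℝ) (𝓡 d) 1 γ (Icc 0 1)) (hγs : ∀ t ∈ Icc (0 : ℝ) 1, γ t ∈ s) :
    ‖extChartAt (𝓡 d) x₀ (γ 1) - extChartAt (𝓡 d) x₀ (γ 0)‖ₑ ≤
      C * pathELength (𝓡 d) γ 0 1 := by
  have : IsManifold (𝓡 d) 1 M := IsManifold.of_le (n := ∞) (by simp)
  let γ' := extChartAt (𝓡 d) x₀ ∘ γ
  have hs' : s ⊆ (chartAt (Euc d) x₀).source := by simpa [extChartAt_source] using hs
  have hC1 : ContMDiffOn 𝓘(ℝ, ℝ) 𝓘(ℝ, Euc d) 1 γ' (Icc 0 1) :=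
    contMDiffOn_extChartAt.comp (I' := 𝓡 d) (t := (chartAt (Euc d) x₀).source) hγ
      (fun t ht => hs' (hγs t ht))
  calc ‖γ' 1 - γ' 0‖ₑ
    _ ≤ ∫⁻ t' in Icc 0 1, ‖derivWithin γ' (Icc 0 1) t'‖ₑ := by
      apply enorm_sub_le_lintegral_derivWithin_Icc_of_contDiffOn_Icc _ zero_le_one
      rwa [← contMDiffOn_iff_contDiffOn]
    _ ≤ ∫⁻ t' in Icc 0 1, C * ‖mfderivWithin 𝓘(ℝ, ℝ) (𝓡 d) γ (Icc 0 1) t' (1 : ℝ)‖ₑ := by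
      apply MeasureTheory.setLIntegral_mono' measurableSet_Icc (fun t' ht' => ?_)
      have h1 : mfderivWithin 𝓘(ℝ, ℝ) 𝓘(ℝ, Euc d) γ' (Icc 0 1) t' =
          (mfderiv (𝓡 d) 𝓘(ℝ, Euc d) (extChartAt (𝓡 d) x₀) (γ t')) ∘L
            (mfderivWithin 𝓘(ℝ, ℝ) (𝓡 d) γ (Icc 0 1) t') := by
        apply mfderiv_comp_mfderivWithin
        · exact mdifferentiableAt_extChartAt (hs' (hγs t' ht'))
        · exact hγ.mdifferentiableOn one_ne_zero _ ht'
        · rw [uniqueMDiffWithinAt_iff_uniqueDiffWithinAt]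
          exact uniqueDiffOn_Icc zero_lt_one _ ht'
      have h2 : derivWithin γ' (Icc 0 1) t' = chartDeriv x₀ (γ t')
          (mfderivWithin 𝓘(ℝ, ℝ) (𝓡 d) γ (Icc 0 1) t' (1 : ℝ)) := by
        rw [← fderivWithin_derivWithin, ← mfderivWithin_eq_fderivWithin]
        exact congrArg (fun L : ℝ →L[ℝ] Euc d => L 1) h1
      rw [h2]
      refine (ContinuousLinearMap.le_opENorm _ _).trans ?_
      gcongr
      exact hC _ (hγs t' ht')
    _ = C * pathELength (𝓡 d) γ 0 1 := by
      rw [MeasureTheory.lintegral_const_mul' _ _ ENNReal.coe_ne_top,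
          pathELength_eq_lintegral_mfderivWithin_Icc]
      rfl

/-- Charts are locally Lipschitz for the Riemannian distance. -/
theorem exists_chart_lipschitz [RegularSpace M] (x₀ : M) : ∃ U ∈ 𝓝 x₀, ∃ C : ℝ, 0 < C ∧
    ∀ p ∈ U, ∀ q ∈ U, riemannianEDist (𝓡 d) p q ≠ ⊤ ∧
      ‖extChartAt (𝓡 d) x₀ p - extChartAt (𝓡 d) x₀ q‖ ≤
        C * (riemannianEDist (𝓡 d) p q).toReal := by
  have : IsManifold (𝓡 d) 1 M := IsManifold.of_le (n := ∞) (by simp)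
  have : IsContinuousRiemannianBundle (Euc d) (fun x : M => TangentSpace (𝓡 d) x) :=
    isContinuousRiemannianBundle
  obtain ⟨C, hC, hCd⟩ := eventually_norm_chartDeriv_lt (d := d) x₀
  obtain ⟨c, hc, hcs⟩ := setOfPred_riemannianEDist_lt_subset_nhds (𝓡 d)
    (inter_mem hCd (extChartAt_source_mem_nhds (I := 𝓡 d) x₀))
  have hc3 : (0 : ENNReal) < (c / 3 : NNReal) :=
    ENNReal.coe_pos.2 (by positivity)
  refine ⟨{y | riemannianEDist (𝓡 d) x₀ y < (c / 3 : NNReal)},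
    eventually_riemannianEDist_lt (𝓡 d) x₀ hc3, C, hC, ?_⟩
  intro p hp q hq
  have hpq : riemannianEDist (𝓡 d) p q < (c / 3 : NNReal) + (c / 3 : NNReal) := by
    refine (riemannianEDist_triangle (y := x₀)).trans_lt ?_
    rw [riemannianEDist_comm (x := p)]
    exact ENNReal.add_lt_add hp hq
  have hne : riemannianEDist (𝓡 d) p q ≠ ⊤ := (hpq.trans_le le_top).ne
  refine ⟨hne, ?_⟩
  lift C to NNReal using hC.le
  have key : ∀ r : ENNReal, riemannianEDist (𝓡 d) p q < r →
      r ≤ (c / 3 : NNReal) + (c / 3 : NNReal) →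
      ‖extChartAt (𝓡 d) x₀ q - extChartAt (𝓡 d) x₀ p‖ₑ ≤ C * r := by
    intro r hr hrc
    obtain ⟨γ, hγ0, hγ1, hγ, hlen⟩ := exists_lt_of_riemannianEDist_lt hr
    have hin : ∀ t ∈ Icc (0 : ℝ) 1, γ t ∈ {y | riemannianEDist (𝓡 d) x₀ y < c} := by
      intro t ht
      have h1 : riemannianEDist (𝓡 d) p (γ t) ≤ pathELength (𝓡 d) γ 0 t :=
        riemannianEDist_le_pathELength (hγ.mono (Icc_subset_Icc_right ht.2)) hγ0 rfl ht.1
      have h2 : pathELength (𝓡 d) γ 0 t ≤ pathELength (𝓡 d) γ 0 1 :=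
        pathELength_mono le_rfl ht.2
      have h3 : riemannianEDist (𝓡 d) x₀ (γ t) <
          (c / 3 : NNReal) + ((c / 3 : NNReal) + (c / 3 : NNReal)) :=
        (riemannianEDist_triangle (y := p)).trans_lt
          (ENNReal.add_lt_add hp (((h1.trans h2).trans_lt hlen).trans_le hrc))
      refine h3.trans_le ?_
      rw [← ENNReal.coe_add, ← ENNReal.coe_add]
      refine ENNReal.coe_le_coe.2 (le_of_eq ?_)
      ring
    have h4 := enorm_chart_sub_le x₀ (C := C) (s := {y | riemannianEDist (𝓡 d) x₀ y < c})
      (fun y hy => (hcs hy).2) (fun y hy => by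
        have h5 : ‖chartDeriv (d := d) x₀ y‖ < C := (hcs hy).1
        rw [← ofReal_norm, ← ENNReal.ofReal_coe_nnreal]
        exact ENNReal.ofReal_le_ofReal h5.le) hγ hin
    rw [hγ0, hγ1] at h4
    exact h4.trans (by gcongr)
  have h6 : ‖extChartAt (𝓡 d) x₀ q - extChartAt (𝓡 d) x₀ p‖ₑ ≤
      C * riemannianEDist (𝓡 d) p q := by
    have hC0 : (C : ENNReal) ≠ 0 := by simpa using (NNReal.coe_pos.1 hC).ne'
    rw [mul_comm, ← ENNReal.div_le_iff_le_mul (Or.inl hC0) (Or.inl ENNReal.coe_ne_top)]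
    refine le_of_forall_gt_imp_ge_of_dense fun r hr => ?_
    rw [ENNReal.div_le_iff_le_mul (Or.inl hC0) (Or.inl ENNReal.coe_ne_top), mul_comm]
    rcases le_total r ((c / 3 : NNReal) + (c / 3 : NNReal)) with h | h
    · exact key r hr h
    · exact (key _ hpq le_rfl).trans (by gcongr)
  rw [norm_sub_rev]
  have h7 := ENNReal.toReal_mono (ENNReal.mul_ne_top ENNReal.coe_ne_top hne) h6
  rwa [ENNReal.toReal_mul, toReal_enorm, ENNReal.coe_toReal] at h7

end ChartDistance

/-! ### The exponential map near the zero section -/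

section Exp

variable {d : ℕ} {M : Type*} [TopologicalSpace M] [CompactSpace M] [T2Space M]
  [ChartedSpace (Euc d) M]
  [RiemannianBundle (fun x : M => TangentSpace (𝓡 d) x)] [IsManifold (𝓡 d) ∞ M]
  [IsContMDiffRiemannianBundle (𝓡 d) ∞ (Euc d) (fun x : M => TangentSpace (𝓡 d) x)]

theorem expMap_zero (x : M) : expMap (d := d) x 0 = x := by
  obtain ⟨c, hc, hcv, h⟩ := exists_geodesic_expMap (d := d) x 0
  have h1 := h 0
  rw [smul_zero] at h1
  rw [h1]
  exact congrArg (fun p : TangentBundle (𝓡 d) M => p.1) hcv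

/-- The derivative at `0` of the curve `s ↦ exp_x (s v)`, in a chart, is `v`. -/
theorem hasDerivAt_expMap (x₀ : M) {x : M} (hx : x ∈ (extChartAt (𝓡 d) x₀).source)
    (v : TangentSpace (𝓡 d) x) :
    HasDerivAt (fun s : ℝ => extChartAt (𝓡 d) x₀ (expMap x (s • v))) (chartDeriv x₀ x v) 0 := by
  obtain ⟨c, hc, hcv, h⟩ := exists_geodesic_expMap (d := d) x v
  have h0 : c 0 = x := congrArg (fun p : TangentBundle (𝓡 d) M => p.1) hcv
  simp only [h]
  have hsrc : c 0 ∈ (extChartAt (𝓡 d) x₀).source := h0 ▸ hx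
  have hg := isGeodesic_iff.1 hc 0
  have h1 := (hasDerivAt_of_contDiffAt_two (contDiffAt_chart_comp x₀ hg.1 hsrc)).1
  rw [deriv_chart_comp x₀ hg.mdifferentiableAt hsrc, hcv] at h1
  exact h1

/-- The exponential map in a framing. -/
def expFrame (F : Framing d M) (j : Fin F.card) (x : M) (u : Euc d) : M :=
  expMap x ((F.Θ j x).symm u)

/-- The exponential map in a chart and in a framing. -/
def expChart (F : Framing d M) (j : Fin F.card) (x₀ : M) (p : Euc d × Euc d) : Euc d :=
  extChartAt (𝓡 d) x₀ (expFrame F j ((extChartAt (𝓡 d) x₀).symm p.1) p.2)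

theorem expFrame_zero (F : Framing d M) (j : Fin F.card) (x : M) : expFrame F j x 0 = x := by
  rw [expFrame, map_zero, expMap_zero]

theorem contMDiffAt_exp (F : Framing d M) {j : Fin F.card} {x : M} (hx : x ∈ F.dom j) :
    ContMDiffAt ((𝓡 d).prod 𝓘(ℝ, Euc d)) (𝓡 d) ∞
      (fun z : M × Euc d => expFrame F j z.1 z.2) (x, 0) :=
  (F.smooth_exp j).contMDiffAt (prod_mem_nhds ((F.isOpen_dom j).mem_nhds hx)
    (Metric.ball_mem_nhds _ two_pos))

theorem contDiffAt_expChart (F : Framing d M) {j : Fin F.card} {x₀ : M} (hx : x₀ ∈ F.dom j) :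
    ContDiffAt ℝ ∞ (expChart F j x₀) (extChartAt (𝓡 d) x₀ x₀, 0) := by
  have hinv : (extChartAt (𝓡 d) x₀).symm (extChartAt (𝓡 d) x₀ x₀) = x₀ :=
    extChartAt_to_inv x₀
  have hsymm : ContMDiffAt 𝓘(ℝ, Euc d) (𝓡 d) ∞ (extChartAt (𝓡 d) x₀).symm
      (extChartAt (𝓡 d) x₀ x₀) :=
    (contMDiffOn_extChartAt_symm x₀).contMDiffAt
      ((isOpen_extChartAt_target x₀).mem_nhds (mem_extChartAt_target x₀))
  have h1 : ContMDiffAt 𝓘(ℝ, Euc d × Euc d) ((𝓡 d).prod 𝓘(ℝ, Euc d)) ∞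
      (fun p : Euc d × Euc d => ((extChartAt (𝓡 d) x₀).symm p.1, p.2))
      (extChartAt (𝓡 d) x₀ x₀, 0) :=
    (ContMDiffAt.comp (I' := 𝓘(ℝ, Euc d)) (f := fun p : Euc d × Euc d => p.1)
      (extChartAt (𝓡 d) x₀ x₀, (0 : Euc d)) hsymm
      (contMDiffAt_iff_contDiffAt.2 contDiffAt_fst)).prodMk
      (contMDiffAt_iff_contDiffAt.2 contDiffAt_snd)
  have hE := contMDiffAt_exp F hx
  have hφ : ContMDiffAt (𝓡 d) 𝓘(ℝ, Euc d) ∞ (extChartAt (𝓡 d) x₀) x₀ := contMDiffAt_extChartAt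
  rw [← contMDiffAt_iff_contDiffAt]
  have h2 : ContMDiffAt 𝓘(ℝ, Euc d × Euc d) (𝓡 d) ∞ (fun p : Euc d × Euc d =>
      expFrame F j ((extChartAt (𝓡 d) x₀).symm p.1) p.2)
      (extChartAt (𝓡 d) x₀ x₀, 0) := by
    refine ContMDiffAt.comp (I' := (𝓡 d).prod 𝓘(ℝ, Euc d))
      (g := fun z : M × Euc d => expFrame F j z.1 z.2)
      (f := fun p : Euc d × Euc d => ((extChartAt (𝓡 d) x₀).symm p.1, p.2))
      (extChartAt (𝓡 d) x₀ x₀, (0 : Euc d)) ?_ h1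
    simp only [hinv]
    exact hE
  refine ContMDiffAt.comp (I' := 𝓡 d) (g := extChartAt (𝓡 d) x₀) (f := fun p : Euc d × Euc d =>
      expFrame F j ((extChartAt (𝓡 d) x₀).symm p.1) p.2)
      (extChartAt (𝓡 d) x₀ x₀, (0 : Euc d)) ?_ h2
  simp only [hinv, expFrame_zero]
  exact hφ

theorem expChart_zero (F : Framing d M) (j : Fin F.card) (x₀ : M) {y : Euc d}
    (hy : y ∈ (extChartAt (𝓡 d) x₀).target) : expChart F j x₀ (y, 0) = y := by
  simp only [expChart, expFrame_zero]
  exact (extChartAt (𝓡 d) x₀).right_inv hy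

theorem expChart_apply (F : Framing d M) (j : Fin F.card) (x₀ : M) {x : M}
    (hx : x ∈ (extChartAt (𝓡 d) x₀).source) (u : Euc d) :
    expChart F j x₀ (extChartAt (𝓡 d) x₀ x, u) =
      extChartAt (𝓡 d) x₀ (expFrame F j x u) := by
  simp only [expChart, (extChartAt (𝓡 d) x₀).left_inv hx]

/-- The differential of the exponential map at `0` is the identity: in a chart and in a framing,
it is the differential of the chart. -/
theorem fderiv_expChart (F : Framing d M) (j : Fin F.card) (x₀ : M) {x : M}
    (hx : x ∈ (extChartAt (𝓡 d) x₀).source)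
    (hd : DifferentiableAt ℝ (expChart F j x₀) (extChartAt (𝓡 d) x₀ x, 0))
    (v : TangentSpace (𝓡 d) x) :
    fderiv ℝ (expChart F j x₀) (extChartAt (𝓡 d) x₀ x, 0) (0, F.Θ j x v) = chartDeriv x₀ x v := by
  have h1 : HasDerivAt (fun s : ℝ => ((extChartAt (𝓡 d) x₀ x, s • F.Θ j x v) : Euc d × Euc d))
      (0, F.Θ j x v) 0 := by
    refine (hasDerivAt_const _ _).prodMk ?_
    simpa using (hasDerivAt_id (0 : ℝ)).smul_const (F.Θ j x v)
  have h2 : HasFDerivAt (expChart F j x₀)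
      (fderiv ℝ (expChart F j x₀) (extChartAt (𝓡 d) x₀ x, 0))
      ((extChartAt (𝓡 d) x₀ x, (0 : ℝ) • F.Θ j x v) : Euc d × Euc d) := by
    rw [zero_smul]; exact hd.hasFDerivAt
  have h3 := h2.comp_hasDerivAt (0 : ℝ) h1
  refine h3.unique ?_
  refine (hasDerivAt_expMap x₀ hx v).congr_of_eventuallyEq (Eventually.of_forall fun s => ?_)
  simp only [Function.comp_apply]
  rw [expChart_apply F j x₀ hx, expFrame, map_smul, LinearIsometryEquiv.symm_apply_apply]

end Exp

/-! ### Fibrewise inverses and transfer maps in Euclidean space -/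

section Transfer

variable {E : Type*} [NormedAddCommGroup E] [NormedSpace ℝ E]

/-- If `e (y, 0) = y` and the partial derivative of `e` in the second variable is injective, then
`u ↦ e (y, u)` has, locally and for each `y`, an inverse that depends smoothly on `y`. -/
theorem exists_fibre_inverse [FiniteDimensional ℝ E] {e : E × E → E} {b : E}
    (he : ContDiffAt ℝ 2 e (b, 0)) (h0 : e (b, 0) = b)
    (hinj : ∀ u : E, fderiv ℝ e (b, 0) (0, u) = 0 → u = 0) :
    ∃ ι : E × E → E, ContDiffAt ℝ 2 ι (b, b) ∧ (∀ᶠ p in 𝓝 ((b, 0) : E × E), ι (p.1, e p) = p.2) ∧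
      ∀ᶠ p in 𝓝 ((b, b) : E × E), e (p.1, ι p) = p.2 := by
  have : CompleteSpace E := FiniteDimensional.complete ℝ E
  let Φ : E × E → E × E := fun p => (p.1, e p)
  have hΦ : ContDiffAt ℝ 2 Φ (b, 0) := contDiffAt_fst.prodMk he
  let L : E × E →L[ℝ] E × E := (ContinuousLinearMap.fst ℝ E E).prod (fderiv ℝ e (b, 0))
  have hL : HasFDerivAt Φ L (b, 0) :=
    hasFDerivAt_fst.prodMk (he.differentiableAt (by norm_num)).hasFDerivAt
  have hLinj : Function.Injective (L : E × E →ₗ[ℝ] E × E) := by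
    rw [injective_iff_map_eq_zero]
    rintro ⟨v, w⟩ hvw
    have h1 : v = 0 := congrArg Prod.fst hvw
    have h2 : fderiv ℝ e (b, 0) (v, w) = 0 := congrArg Prod.snd hvw
    subst h1
    rw [hinj w h2]; rfl
  let Le : (E × E) ≃L[ℝ] (E × E) :=
    (LinearEquiv.ofInjectiveEndo (L : E × E →ₗ[ℝ] E × E) hLinj).toContinuousLinearEquiv
  have hLe : (Le : E × E →L[ℝ] E × E) = L := by ext <;> rfl
  have hΦ' : HasFDerivAt Φ (Le : E × E →L[ℝ] E × E) (b, 0) := hLe ▸ hL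
  have hst : HasStrictFDerivAt Φ (Le : E × E →L[ℝ] E × E) (b, 0) :=
    hΦ.hasStrictFDerivAt' hΦ' (by norm_num)
  have hb : Φ (b, 0) = (b, b) := by simp only [Φ, h0]
  let ψ := hst.localInverse Φ Le (b, 0)
  have hψ : ContDiffAt ℝ 2 ψ (Φ (b, 0)) := hΦ.to_localInverse hΦ' (by norm_num)
  have hl : ∀ᶠ p in 𝓝 ((b, 0) : E × E), ψ (Φ p) = p := hst.eventually_left_inverse
  have hr : ∀ᶠ p in 𝓝 (Φ (b, 0)), Φ (ψ p) = p := hst.eventually_right_inverse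
  rw [hb] at hψ hr
  refine ⟨fun p => (ψ p).2, hψ.snd, ?_, ?_⟩
  · filter_upwards [hl] with p hp
    exact congrArg Prod.snd hp
  · filter_upwards [hr] with p hp
    have h1 : (Φ (ψ p)).1 = p.1 := congrArg Prod.fst hp
    have h2 : (Φ (ψ p)).2 = p.2 := congrArg Prod.snd hp
    simp only [Φ] at h1 h2
    have h3 : (p.1, (ψ p).2) = ψ p := Prod.ext h1.symm rfl
    rw [h3, h2]

/-- A function of class `C^2` is locally differentiable with a bounded Lipschitz derivative. -/
theorem ContDiffAt.exists_lipschitz_fderiv {E' G : Type*} [NormedAddCommGroup E']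
    [NormedSpace ℝ E'] [NormedAddCommGroup G] [NormedSpace ℝ G] {F : E' → G} {b : E'}
    (hF : ContDiffAt ℝ 2 F b) : ∃ ρ > 0, ∃ K > 0, ∀ p ∈ Metric.ball b ρ,
      DifferentiableAt ℝ F p ∧ ‖fderiv ℝ F p‖ ≤ K ∧ ∀ q ∈ Metric.ball b ρ,
        ‖F p - F q‖ ≤ K * ‖p - q‖ ∧ ‖fderiv ℝ F p - fderiv ℝ F q‖ ≤ K * ‖p - q‖ := by
  have h1 : ContDiffAt ℝ 1 (fderiv ℝ F) b := hF.fderiv_right (by norm_num)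
  have h2 : ∀ᶠ p in 𝓝 b, DifferentiableAt ℝ F p :=
    (hF.eventually (by simp)).mono fun p hp => hp.differentiableAt (by norm_num)
  obtain ⟨K₁, t₁, ht₁, hK₁⟩ := h1.exists_lipschitzOnWith
  obtain ⟨K₂, t₂, ht₂, hK₂⟩ := (hF.of_le (m := 1) (by norm_num)).exists_lipschitzOnWith
  have h3 : ∀ᶠ p in 𝓝 b, ‖fderiv ℝ F p‖ < ‖fderiv ℝ F b‖ + 1 :=
    h1.continuousAt.norm.eventually_lt continuousAt_const (lt_add_one _)
  obtain ⟨ρ, hρ, hball⟩ := Metric.eventually_nhds_iff_ball.1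
    (h2.and (h3.and (Filter.Eventually.and ht₁ ht₂)))
  refine ⟨ρ, hρ, ‖fderiv ℝ F b‖ + 1 + K₁ + K₂, by positivity, fun p hp => ?_⟩
  obtain ⟨hp1, hp2, hp3, hp4⟩ := hball p hp
  refine ⟨hp1, by linarith [K₁.2, K₂.2, K₁.coe_nonneg, K₂.coe_nonneg], fun q hq => ?_⟩
  obtain ⟨hq1, hq2, hq3, hq4⟩ := hball q hq
  have h5 := hK₁.dist_le_mul p hp3 q hq3
  have h6 := hK₂.dist_le_mul p hp4 q hq4
  rw [dist_eq_norm, dist_eq_norm] at h5 h6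
  constructor
  · refine h6.trans ?_
    gcongr
    linarith [K₁.coe_nonneg, norm_nonneg (fderiv ℝ F b)]
  · refine h5.trans ?_
    gcongr
    linarith [K₂.coe_nonneg, norm_nonneg (fderiv ℝ F b)]

theorem norm_comp_sub_comp_le {E₁ E₂ E₃ : Type*} [NormedAddCommGroup E₁] [NormedSpace ℝ E₁]
    [NormedAddCommGroup E₂] [NormedSpace ℝ E₂] [NormedAddCommGroup E₃] [NormedSpace ℝ E₃]
    (A A' : E₂ →L[ℝ] E₃) (B B' : E₁ →L[ℝ] E₂) :
    ‖A ∘L B - A' ∘L B'‖ ≤ ‖A - A'‖ * ‖B‖ + ‖A'‖ * ‖B - B'‖ := by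
  have : A ∘L B - A' ∘L B' = (A - A') ∘L B + A' ∘L (B - B') := by
    ext v; simp
  rw [this]
  exact (norm_add_le _ _).trans
    (add_le_add (ContinuousLinearMap.opNorm_comp_le _ _) (ContinuousLinearMap.opNorm_comp_le _ _))

theorem le_rpow_of_le_one {t β : ℝ} (h0 : 0 ≤ t) (h1 : t ≤ 1) (hβ1 : β ≤ 1) (hβ : 0 < β) :
    t ≤ t ^ β := by
  rcases h0.eq_or_lt with rfl | h
  · rw [Real.zero_rpow hβ.ne']
  · simpa using Real.rpow_le_rpow_of_exponent_ge h h1 hβ1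

theorem norm_comp_inr_le (A : E × E →L[ℝ] E) : ‖A ∘L (ContinuousLinearMap.inr ℝ E E)‖ ≤ ‖A‖ :=
  (ContinuousLinearMap.opNorm_comp_le _ _).trans
    (mul_le_of_le_one_right (norm_nonneg _) (ContinuousLinearMap.norm_inr_le_one ℝ E E))

/-- Uniform estimates on the maps `u ↦ ι (y, h (e (x, u)))`, for `x` near `b` and `y` near
`h b`, when `h` has a Hölder continuous derivative. -/
theorem exists_transfer_bounds {β : ℝ} (hβ : 0 < β) (hβ1 : β ≤ 1) {e ι : E × E → E} {h : E → E}
    {b b' : E} (he : ContDiffAt ℝ 2 e (b, 0)) (heb : e (b, 0) = b) (hι : ContDiffAt ℝ 2 ι (b', b'))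
    (hιb : ι (b', b') = 0) (hιd : ∀ᶠ y in 𝓝 b', ι (y, y) = 0)
    (hez : ∀ᶠ x in 𝓝 b, e (x, 0) = x)
    (hhb : h b = b') (hhd : ∀ᶠ x in 𝓝 b, DifferentiableAt ℝ h x)
    (hhc : ContinuousAt (fderiv ℝ h) b)
    (hhol : ∃ U ∈ 𝓝 b, ∃ K : ℝ, ∀ y ∈ U, ∀ z ∈ U,
      ‖fderiv ℝ h y - fderiv ℝ h z‖ ≤ K * ‖y - z‖ ^ β)
    {P : E × E → Prop} (hP : ∀ᶠ q in 𝓝 (b', b'), P q)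
    {r₀ : ℝ} (hr₀ : 0 < r₀) :
    ∃ r > 0, ∃ H > 0, ∀ x ∈ Metric.ball b r, ∀ y ∈ Metric.ball b' r, ∃ dg : E → E →L[ℝ] E,
      (∀ u ∈ Metric.ball (0 : E) r, P (y, h (e (x, u))) ∧
        ‖ι (y, h (e (x, u)))‖ < r₀ ∧
        HasFDerivAt (fun u => ι (y, h (e (x, u)))) (dg u) u ∧
        ∀ u' ∈ Metric.ball (0 : E) r, ‖dg u - dg u'‖ ≤ H * ‖u - u'‖ ^ β) ∧
      ‖ι (y, h (e (x, 0)))‖ ≤ H * ‖h x - y‖ ∧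
      ‖dg 0 - (fderiv ℝ ι (h x, h x) ∘L ContinuousLinearMap.inr ℝ E E) ∘L fderiv ℝ h x ∘L
        (fderiv ℝ e (x, 0) ∘L ContinuousLinearMap.inr ℝ E E)‖ ≤ H * ‖h x - y‖ := by
  obtain ⟨ρ₁, hρ₁, K₁, hK₁, he'⟩ := ContDiffAt.exists_lipschitz_fderiv he
  obtain ⟨ρ₂, hρ₂, K₂, hK₂, hι'⟩ := ContDiffAt.exists_lipschitz_fderiv hι
  obtain ⟨U, hU, K₃', hK₃'⟩ := hhol
  have hhc' : ∀ᶠ x in 𝓝 b, ‖fderiv ℝ h x‖ < ‖fderiv ℝ h b‖ + 1 :=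
    hhc.norm.eventually_lt continuousAt_const (lt_add_one _)
  have hcont : ContinuousAt h b := hhd.self_of_nhds.continuousAt
  have htend : Tendsto h (𝓝 b) (𝓝 b') := hhb ▸ hcont
  set K₃ := max (‖fderiv ℝ h b‖ + 1) K₃' with hK₃
  have hK₃0 : 0 < K₃ := lt_of_lt_of_le (by positivity) (le_max_left _ _)
  obtain ⟨ρ₃, hρ₃, hh'⟩ := Metric.eventually_nhds_iff_ball.1
    (hhd.and (hhc'.and (Filter.Eventually.and hU (hez.and (htend.eventually hιd)))))
  -- the composite is continuous at the base point, which gives a common radius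
  have hec : ContinuousAt e (b, 0) := he.continuousAt
  have c1 : Tendsto e (𝓝 (b, 0)) (𝓝 b) := by
    have := hec.tendsto; rwa [heb] at this
  have c2 : Tendsto (fun z : (E × E) × E => (z.1.2, h (e (z.1.1, z.2)))) (𝓝 ((b, b'), 0))
      (𝓝 (b', b')) := by
    refine Tendsto.prodMk_nhds ?_ ?_
    · exact (continuous_snd.comp continuous_fst).tendsto' _ _ rfl
    · refine htend.comp (c1.comp ?_)
      exact ((continuous_fst.comp continuous_fst).prodMk continuous_snd).tendsto' _ _ rfl
  have c3 : Tendsto (fun z : (E × E) × E => (z.1.1, z.2)) (𝓝 ((b, b'), 0)) (𝓝 (b, 0)) :=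
    ((continuous_fst.comp continuous_fst).prodMk continuous_snd).tendsto' _ _ rfl
  have c4 : Tendsto (fun z : (E × E) × E => ‖ι (z.1.2, h (e (z.1.1, z.2)))‖)
      (𝓝 ((b, b'), 0)) (𝓝 0) := by
    have h1 := (hι.continuousAt.tendsto.comp c2).norm
    rw [hιb, norm_zero] at h1
    exact h1
  have c5 : Tendsto (fun z : (E × E) × E => (h z.1.1, h z.1.1)) (𝓝 ((b, b'), 0)) (𝓝 (b', b')) := by
    have : Tendsto (fun z : (E × E) × E => z.1.1) (𝓝 ((b, b'), 0)) (𝓝 b) :=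
      (continuous_fst.comp continuous_fst).tendsto' _ _ rfl
    exact (htend.comp this).prodMk_nhds (htend.comp this)
  have hev : ∀ᶠ z in 𝓝 (((b, b'), 0) : (E × E) × E),
      (z.1.1, z.2) ∈ Metric.ball ((b, 0) : E × E) ρ₁ ∧ e (z.1.1, z.2) ∈ Metric.ball b ρ₃ ∧
      (z.1.2, h (e (z.1.1, z.2))) ∈ Metric.ball ((b', b') : E × E) ρ₂ ∧
      (h z.1.1, h z.1.1) ∈ Metric.ball ((b', b') : E × E) ρ₂ ∧ P (z.1.2, h (e (z.1.1, z.2))) ∧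
      ‖ι (z.1.2, h (e (z.1.1, z.2)))‖ < r₀ :=
    (c3.eventually (Metric.ball_mem_nhds _ hρ₁)).and
      (((c1.comp c3).eventually (Metric.ball_mem_nhds _ hρ₃)).and
      ((c2.eventually (Metric.ball_mem_nhds _ hρ₂)).and
      ((c5.eventually (Metric.ball_mem_nhds _ hρ₂)).and
      ((c2.eventually hP).and (c4.eventually_lt_const hr₀)))))
  obtain ⟨ρ, hρ, hball⟩ := Metric.eventually_nhds_iff_ball.1 hev
  set r := min (min ρ (1 / 2)) ρ₃ with hr
  have hr0 : 0 < r := by positivity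
  have hrρ : r ≤ ρ := (min_le_left _ _).trans (min_le_left _ _)
  have hr1 : r ≤ 1 / 2 := (min_le_left _ _).trans (min_le_right _ _)
  have hr3 : r ≤ ρ₃ := min_le_right _ _
  let HH : ℝ := (K₂ * (K₃ * K₁)) * (K₃ * K₁) + K₂ * (K₃ * K₁ ^ β * K₁ + K₃ * K₁)
    + K₂ + K₂ * (K₃ * K₁)
  have hHH : 0 < HH := by positivity
  refine ⟨r, hr0, HH, hHH, fun x hx y hy => ?_⟩
  have hz : ∀ u ∈ Metric.ball (0 : E) r, (((x, y), u) : (E × E) × E) ∈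
      Metric.ball (((b, b'), 0) : (E × E) × E) ρ := by
    intro u hu
    rw [Metric.mem_ball, Prod.dist_eq, Prod.dist_eq]
    exact max_lt (max_lt ((Metric.mem_ball.1 hx).trans_le hrρ)
      ((Metric.mem_ball.1 hy).trans_le hrρ)) ((Metric.mem_ball.1 hu).trans_le hrρ)
  have h00 : (0 : E) ∈ Metric.ball (0 : E) r := Metric.mem_ball_self hr0
  have hxρ := hh' x (Metric.ball_subset_ball hr3 hx)
  have hex : e (x, 0) = x := hxρ.2.2.2.1
  let J : E →L[ℝ] E × E := ContinuousLinearMap.inr ℝ E E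
  let dE : E → E →L[ℝ] E := fun u => fderiv ℝ e (x, u) ∘L J
  let dH : E → E →L[ℝ] E := fun u => fderiv ℝ h (e (x, u))
  let dI : E → E →L[ℝ] E := fun u => fderiv ℝ ι (y, h (e (x, u))) ∘L J
  have bE : ∀ u ∈ Metric.ball (0 : E) r, ‖dE u‖ ≤ K₁ := fun u hu =>
    (norm_comp_inr_le _).trans (he' _ (hball _ (hz u hu)).1).2.1
  have bH : ∀ u ∈ Metric.ball (0 : E) r, ‖dH u‖ ≤ K₃ := fun u hu =>
    (hh' _ (hball _ (hz u hu)).2.1).2.1.le.trans (le_max_left _ _)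
  have bI : ∀ u ∈ Metric.ball (0 : E) r, ‖dI u‖ ≤ K₂ := fun u hu =>
    (norm_comp_inr_le _).trans (hι' _ (hball _ (hz u hu)).2.2.1).2.1
  have hjoin : ∀ u u' : E, ‖((x, u) : E × E) - (x, u')‖ = ‖u - u'‖ := by
    intro u u'
    simp [Prod.norm_def]
  have hjoin2 : ∀ q q' : E, ‖((y, q) : E × E) - (y, q')‖ = ‖q - q'‖ := by
    intro u u'
    simp [Prod.norm_def]
  have lE : ∀ u ∈ Metric.ball (0 : E) r, ∀ u' ∈ Metric.ball (0 : E) r,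
      ‖e (x, u) - e (x, u')‖ ≤ K₁ * ‖u - u'‖ := fun u hu u' hu' => by
    rw [← hjoin u u']
    exact ((he' _ (hball _ (hz u hu)).1).2.2 _ (hball _ (hz u' hu')).1).1
  have lHE : ∀ u ∈ Metric.ball (0 : E) r, ∀ u' ∈ Metric.ball (0 : E) r,
      ‖h (e (x, u)) - h (e (x, u'))‖ ≤ K₃ * (K₁ * ‖u - u'‖) := fun u hu u' hu' => by
    refine le_trans ?_ (mul_le_mul_of_nonneg_left (lE u hu u' hu') hK₃0.le)
    exact (convex_ball b ρ₃).norm_image_sub_le_of_norm_fderiv_le (𝕜 := ℝ)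
      (fun q hq => (hh' q hq).1) (fun q hq => (hh' q hq).2.1.le.trans (le_max_left _ _))
      (hball _ (hz u' hu')).2.1 (hball _ (hz u hu)).2.1
  have dEl : ∀ u ∈ Metric.ball (0 : E) r, ∀ u' ∈ Metric.ball (0 : E) r,
      ‖dE u - dE u'‖ ≤ K₁ * ‖u - u'‖ := fun u hu u' hu' => by
    rw [← hjoin]
    refine le_trans ?_ ((he' _ (hball _ (hz u hu)).1).2.2 _ (hball _ (hz u' hu')).1).2
    simp only [dE]
    rw [← ContinuousLinearMap.sub_comp]
    exact norm_comp_inr_le _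
  have dHl : ∀ u ∈ Metric.ball (0 : E) r, ∀ u' ∈ Metric.ball (0 : E) r,
      ‖dH u - dH u'‖ ≤ K₃ * (K₁ ^ β * ‖u - u'‖ ^ β) := fun u hu u' hu' => by
    refine (hK₃' _ (hh' _ (hball _ (hz u hu)).2.1).2.2.1 _
      (hh' _ (hball _ (hz u' hu')).2.1).2.2.1).trans ?_
    rw [← Real.mul_rpow hK₁.le (norm_nonneg _)]
    refine mul_le_mul (le_max_right _ _) ?_ (by positivity) hK₃0.le
    exact Real.rpow_le_rpow (norm_nonneg _) (lE u hu u' hu') hβ.le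
  have dIl : ∀ u ∈ Metric.ball (0 : E) r, ∀ u' ∈ Metric.ball (0 : E) r,
      ‖dI u - dI u'‖ ≤ K₂ * (K₃ * (K₁ * ‖u - u'‖)) := fun u hu u' hu' => by
    refine le_trans ?_ (mul_le_mul_of_nonneg_left (lHE u hu u' hu') hK₂.le)
    rw [← hjoin2]
    refine le_trans ?_
      ((hι' _ (hball _ (hz u hu)).2.2.1).2.2 _ (hball _ (hz u' hu')).2.2.1).2
    simp only [dI]
    rw [← ContinuousLinearMap.sub_comp]
    exact norm_comp_inr_le _
  refine ⟨fun u => dI u ∘L dH u ∘L dE u, fun u hu => ?_, ?_, ?_⟩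
  · have hb := hball _ (hz u hu)
    refine ⟨hb.2.2.2.2.1, hb.2.2.2.2.2, ?_, fun u' hu' => ?_⟩
    · have d1 : HasFDerivAt (fun u : E => ((x, u) : E × E)) J u := hasFDerivAt_prodMk_right x u
      have d2 : HasFDerivAt (fun u => e (x, u)) (dE u) u :=
        (he' _ hb.1).1.hasFDerivAt.comp u d1
      have d3 : HasFDerivAt (fun u => h (e (x, u))) (dH u ∘L dE u) u :=
        HasFDerivAt.comp (g := h) u (hh' _ hb.2.1).1.hasFDerivAt d2
      have d4 : HasFDerivAt (fun q : E => ι (y, q)) (dI u) (h (e (x, u))) :=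
        HasFDerivAt.comp (g := ι) _ (hι' _ hb.2.2.1).1.hasFDerivAt
          (hasFDerivAt_prodMk_right y _)
      exact HasFDerivAt.comp (g := fun q : E => ι (y, q)) u d4 d3
    · have hle : ‖u - u'‖ ≤ 1 := by
        have h1 := mem_ball_zero_iff.1 hu
        have h2 := mem_ball_zero_iff.1 hu'
        linarith [norm_sub_le u u']
      have hp := le_rpow_of_le_one (norm_nonneg (u - u')) hle hβ1 hβ
      have hp0 : 0 ≤ ‖u - u'‖ ^ β := by positivity
      have s1 : ‖dH u ∘L dE u‖ ≤ K₃ * K₁ :=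
        (ContinuousLinearMap.opNorm_comp_le _ _).trans
          (mul_le_mul (bH u hu) (bE u hu) (norm_nonneg _) hK₃0.le)
      have s2 : ‖dH u ∘L dE u - dH u' ∘L dE u'‖ ≤
          (K₃ * K₁ ^ β * K₁ + K₃ * K₁) * ‖u - u'‖ ^ β := by
        refine (norm_comp_sub_comp_le _ _ _ _).trans ?_
        calc _ ≤ K₃ * (K₁ ^ β * ‖u - u'‖ ^ β) * K₁ + K₃ * (K₁ * ‖u - u'‖) :=
              add_le_add (mul_le_mul (dHl u hu u' hu') (bE u hu) (norm_nonneg _) (by positivity))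
                (mul_le_mul (bH u' hu') (dEl u hu u' hu') (norm_nonneg _) hK₃0.le)
          _ ≤ K₃ * (K₁ ^ β * ‖u - u'‖ ^ β) * K₁ + K₃ * (K₁ * ‖u - u'‖ ^ β) := by gcongr
          _ = _ := by ring
      refine (norm_comp_sub_comp_le _ _ _ _).trans ?_
      calc _ ≤ K₂ * (K₃ * (K₁ * ‖u - u'‖)) * (K₃ * K₁) +
            K₂ * ((K₃ * K₁ ^ β * K₁ + K₃ * K₁) * ‖u - u'‖ ^ β) :=
              add_le_add (mul_le_mul (dIl u hu u' hu') s1 (norm_nonneg _) (by positivity))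
                (mul_le_mul (bI u' hu') s2 (norm_nonneg _) hK₂.le)
        _ ≤ K₂ * (K₃ * (K₁ * ‖u - u'‖ ^ β)) * (K₃ * K₁) +
            K₂ * ((K₃ * K₁ ^ β * K₁ + K₃ * K₁) * ‖u - u'‖ ^ β) := by gcongr
        _ = ((K₂ * (K₃ * K₁)) * (K₃ * K₁) + K₂ * (K₃ * K₁ ^ β * K₁ + K₃ * K₁)) *
            ‖u - u'‖ ^ β := by ring
        _ ≤ HH * ‖u - u'‖ ^ β := by
            refine mul_le_mul_of_nonneg_right ?_ hp0
            simp only [HH]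
            have : 0 < K₂ * (K₃ * K₁) := by positivity
            linarith
  · have hb := hball _ (hz 0 h00)
    have h1 := ((hι' _ hb.2.2.1).2.2 _ hb.2.2.2.1).1
    simp only [hex] at h1 ⊢
    have h2 : ι (h x, h x) = 0 := hxρ.2.2.2.2
    rw [h2, sub_zero] at h1
    refine h1.trans ?_
    have h3 : ‖((y, h x) : E × E) - (h x, h x)‖ = ‖h x - y‖ := by
      simp [Prod.norm_def, norm_sub_rev]
    rw [h3]
    refine mul_le_mul_of_nonneg_right ?_ (norm_nonneg _)
    simp only [HH]
    have : 0 < (K₂ * (K₃ * K₁)) * (K₃ * K₁) + K₂ * (K₃ * K₁ ^ β * K₁ + K₃ * K₁) := by positivity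
    have : 0 < K₂ * (K₃ * K₁) := by positivity
    linarith
  · have hb := hball _ (hz 0 h00)
    have h1 := ((hι' _ hb.2.2.1).2.2 _ hb.2.2.2.1).2
    have bH0 := bH 0 h00
    have bE0 := bE 0 h00
    simp only [dI, dH, dE, J, hex] at h1 bH0 bE0 ⊢
    have h3 : ‖((y, h x) : E × E) - (h x, h x)‖ = ‖h x - y‖ := by
      simp [Prod.norm_def, norm_sub_rev]
    rw [h3] at h1
    rw [← ContinuousLinearMap.sub_comp]
    refine (ContinuousLinearMap.opNorm_comp_le _ _).trans ?_
    rw [← ContinuousLinearMap.sub_comp]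
    calc _ ≤ (K₂ * ‖h x - y‖) * (K₃ * K₁) := by
          refine mul_le_mul ((norm_comp_inr_le _).trans h1) ?_ (norm_nonneg _) (by positivity)
          exact (ContinuousLinearMap.opNorm_comp_le _ _).trans
            (mul_le_mul bH0 bE0 (norm_nonneg _) hK₃0.le)
      _ = (K₂ * (K₃ * K₁)) * ‖h x - y‖ := by ring
      _ ≤ HH * ‖h x - y‖ := by
          refine mul_le_mul_of_nonneg_right ?_ (norm_nonneg _)
          simp only [HH]
          have : 0 < (K₂ * (K₃ * K₁)) * (K₃ * K₁) + K₂ * (K₃ * K₁ ^ β * K₁ + K₃ * K₁) := by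
            positivity
          linarith

end Transfer

/-! ### Uniform estimates for the exponential map -/

section ExpUniform

variable {d : ℕ} {M : Type*} [TopologicalSpace M] [CompactSpace M] [T2Space M]
  [ChartedSpace (Euc d) M]
  [RiemannianBundle (fun x : M => TangentSpace (𝓡 d) x)] [IsManifold (𝓡 d) ∞ M]
  [IsContMDiffRiemannianBundle (𝓡 d) ∞ (Euc d) (fun x : M => TangentSpace (𝓡 d) x)]

/-- In a chart and a frame, `(y, u) ↦ (y, exp_y u)` has a local `C^2` inverse near the zero section;
`ι (y, q)` is the vector at `y` whose exponential is `q`. -/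
theorem exists_exp_inverse (F : Framing d M) {j : Fin F.card} {x₀ : M} (hx : x₀ ∈ F.dom j) :
    ∃ ι : Euc d × Euc d → Euc d,
      ContDiffAt ℝ 2 ι (extChartAt (𝓡 d) x₀ x₀, extChartAt (𝓡 d) x₀ x₀) ∧
      (∀ᶠ p in 𝓝 ((extChartAt (𝓡 d) x₀ x₀, 0) : Euc d × Euc d),
        ι (p.1, expChart F j x₀ p) = p.2) ∧
      (∀ᶠ p in 𝓝 ((extChartAt (𝓡 d) x₀ x₀, extChartAt (𝓡 d) x₀ x₀) : Euc d × Euc d),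
        expChart F j x₀ (p.1, ι p) = p.2) ∧
      ∀ᶠ y in 𝓝 (extChartAt (𝓡 d) x₀ x₀), ι (y, y) = 0 := by
  have he := contDiffAt_expChart F hx
  have h0 : ∀ᶠ y in 𝓝 (extChartAt (𝓡 d) x₀ x₀), expChart F j x₀ (y, 0) = y := by
    filter_upwards [extChartAt_target_mem_nhds (I := 𝓡 d) x₀] with y hy
    exact expChart_zero F j x₀ hy
  obtain ⟨ι, h1, h2, h3⟩ := exists_fibre_inverse (contDiffAt_infty.1 he 2) h0.self_of_nhds
    (fun u hu => by
      have h4 := fderiv_expChart F j x₀ (mem_extChartAt_source (I := 𝓡 d) x₀)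
        (he.differentiableAt (by simp)) ((F.Θ j x₀).symm u)
      rw [LinearIsometryEquiv.apply_symm_apply, hu] at h4
      have h5 := (chartDeriv_invertible (d := d) x₀ (mem_extChartAt_source (I := 𝓡 d) x₀)).injective
        (h4.symm.trans (map_zero (chartDeriv (d := d) x₀ x₀)).symm)
      simpa using h5)
  refine ⟨ι, h1, h2, h3, ?_⟩
  have h4 : Tendsto (fun y : Euc d => (y, (0 : Euc d))) (𝓝 (extChartAt (𝓡 d) x₀ x₀))
      (𝓝 (extChartAt (𝓡 d) x₀ x₀, 0)) :=
    (continuous_id.prodMk continuous_const).tendsto' _ _ rfl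
  filter_upwards [h0, h4.eventually h2] with y hy hy2
  rwa [hy] at hy2

/-- A neighbourhood property of the zero section, in product form. -/
theorem exists_nhds_radius {X : Type*} [TopologicalSpace X] {x₀ : X} {p : X × Euc d → Prop}
    (h : ∀ᶠ z in 𝓝 ((x₀, 0) : X × Euc d), p z) :
    ∃ U ∈ 𝓝 x₀, ∃ s > 0, ∀ x ∈ U, ∀ u ∈ Metric.ball (0 : Euc d) s, p (x, u) := by
  rw [nhds_prod_eq, Filter.eventually_prod_iff] at h
  obtain ⟨pa, ha, pb, hb, hab⟩ := h
  obtain ⟨s, hs, hball⟩ := Metric.eventually_nhds_iff_ball.1 hb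
  exact ⟨{x | pa x}, ha, s, hs, fun x hx u hu => hab hx (hball u hu)⟩

theorem tendsto_fst_base {X : Type*} [TopologicalSpace X] (x₀ : X) :
    Tendsto (fun z : X × Euc d => z.1) (𝓝 (x₀, 0)) (𝓝 x₀) :=
  continuous_fst.tendsto' _ _ rfl

theorem tendsto_chart_prod (x₀ : M) :
    Tendsto (fun z : M × Euc d => (extChartAt (𝓡 d) x₀ z.1, z.2)) (𝓝 (x₀, 0))
      (𝓝 (extChartAt (𝓡 d) x₀ x₀, 0)) := by
  exact ((continuousAt_extChartAt x₀).tendsto.comp (tendsto_fst_base x₀)).prodMk_nhds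
    (continuous_snd.tendsto' _ _ rfl)

theorem tendsto_expFrame (F : Framing d M) {j : Fin F.card} {x₀ : M} (hx : x₀ ∈ F.dom j) :
    Tendsto (fun z : M × Euc d => expFrame F j z.1 z.2) (𝓝 (x₀, 0)) (𝓝 x₀) := by
  have h := (contMDiffAt_exp F hx).continuousAt.tendsto
  simp only [expFrame_zero] at h
  exact h

theorem expMap_eq_expFrame (F : Framing d M) (j : Fin F.card) (x : M) (v : TangentSpace (𝓡 d) x) :
    expMap x v = expFrame F j x (F.Θ j x v) := by
  rw [expFrame, LinearIsometryEquiv.symm_apply_apply]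

/-- The injectivity radius is positive. -/
theorem exists_expMap_injective (F : Framing d M) : ∃ r > 0, ∀ (x : M) (v w : TangentSpace (𝓡 d) x),
    ‖v‖ < r → ‖w‖ < r → expMap x v = expMap x w → v = w := by
  suffices h : ∃ r > 0, ∀ x ∈ (univ : Set M), ∀ (v w : TangentSpace (𝓡 d) x),
      ‖v‖ < r → ‖w‖ < r → expMap x v = expMap x w → v = w by
    obtain ⟨r, hr, h⟩ := h
    exact ⟨r, hr, fun x => h x (mem_univ x)⟩
  refine isCompact_univ.induction_on (p := fun s : Set M => ∃ r > 0, ∀ x ∈ s,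
    ∀ (v w : TangentSpace (𝓡 d) x), ‖v‖ < r → ‖w‖ < r → expMap x v = expMap x w → v = w) ?_ ?_ ?_ ?_
  · exact ⟨1, one_pos, by simp⟩
  · rintro s t hst ⟨r, hr, h⟩
    exact ⟨r, hr, fun x hx => h x (hst hx)⟩
  · rintro s t ⟨r, hr, h⟩ ⟨r', hr', h'⟩
    refine ⟨min r r', lt_min hr hr', ?_⟩
    rintro x (hx | hx) v w hv hw
    · exact h x hx v w (hv.trans_le (min_le_left _ _)) (hw.trans_le (min_le_left _ _))
    · exact h' x hx v w (hv.trans_le (min_le_right _ _)) (hw.trans_le (min_le_right _ _))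
  · intro x₀ _
    rw [nhdsWithin_univ]
    obtain ⟨j, hj⟩ := F.cover x₀
    obtain ⟨ι, -, h2, -, -⟩ := exists_exp_inverse F hj
    obtain ⟨U, hU, s, hs, h⟩ := exists_nhds_radius (((tendsto_chart_prod x₀).eventually h2).and
      ((tendsto_fst_base x₀).eventually (extChartAt_source_mem_nhds (I := 𝓡 d) x₀)))
    refine ⟨U, hU, s, hs, fun x hx v w hv hw hvw => ?_⟩
    have key : ∀ v : TangentSpace (𝓡 d) x, ‖v‖ < s →
        ι (extChartAt (𝓡 d) x₀ x, extChartAt (𝓡 d) x₀ (expMap x v)) = F.Θ j x v := by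
      intro v hv
      have h1 := h x hx (F.Θ j x v) (by rwa [mem_ball_zero_iff, LinearIsometryEquiv.norm_map])
      have h3 := h1.1
      simp only at h3
      rwa [expChart_apply F j x₀ h1.2, ← expMap_eq_expFrame] at h3
    have h3 := key v hv
    rw [hvw, key w hw] at h3
    exact (F.Θ j x).injective h3.symm

/-- The transition maps between two frames are Lipschitz functions of the base point, with a
constant that is uniform up to the boundary of the domain of the second frame. -/
theorem exists_frame_lipschitz (F : Framing d M) {i : Fin F.card} {x₀ : M} (hx : x₀ ∈ F.dom i) :
    ∃ U ∈ 𝓝 x₀, ∃ H > 0, ∀ j, ∀ y₁ ∈ U, y₁ ∈ F.dom j → ∀ y₂ ∈ U, y₂ ∈ F.dom j → ∀ u : Euc d,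
      ‖F.Θ i y₁ ((F.Θ j y₁).symm u) - F.Θ i y₂ ((F.Θ j y₂).symm u)‖ ≤
        H * (riemannianEDist (𝓡 d) y₁ y₂).toReal * ‖u‖ := by
  choose L hL using F.lipschitz_exp
  obtain ⟨U₁, hU₁, C, hC, hlip⟩ := exists_chart_lipschitz (d := d) x₀
  obtain ⟨ι, h1, h2, -, -⟩ := exists_exp_inverse F hx
  obtain ⟨ρ, hρ, K, hK, hι⟩ := ContDiffAt.exists_lipschitz_fderiv h1
  have c1 : Tendsto (fun z : M × Euc d => (extChartAt (𝓡 d) x₀ z.1,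
      extChartAt (𝓡 d) x₀ (expFrame F i z.1 z.2))) (𝓝 (x₀, 0))
      (𝓝 (extChartAt (𝓡 d) x₀ x₀, extChartAt (𝓡 d) x₀ x₀)) := by
    exact ((continuousAt_extChartAt x₀).tendsto.comp (tendsto_fst_base x₀)).prodMk_nhds
      ((continuousAt_extChartAt x₀).tendsto.comp (tendsto_expFrame F hx))
  obtain ⟨U, hU, s', hs', h⟩ := exists_nhds_radius (((tendsto_chart_prod x₀).eventually h2).and
      (((tendsto_fst_base x₀).eventually (extChartAt_source_mem_nhds (I := 𝓡 d) x₀)).and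
      (((tendsto_fst_base x₀).eventually hU₁).and (((tendsto_expFrame F hx).eventually hU₁).and
      (c1.eventually (Metric.ball_mem_nhds _ hρ))))))
  let s := min s' 2
  have hs : 0 < s := lt_min hs' two_pos
  let L' : ℝ := 1 + ∑ j, |L j|
  have hL' : 1 ≤ L' := le_add_of_nonneg_right (Finset.sum_nonneg fun _ _ => abs_nonneg _)
  refine ⟨U, hU, K * (C * L') * (2 / s), by positivity, fun j y₁ hy₁ hj₁ y₂ hy₂ hj₂ u => ?_⟩
  rcases eq_or_ne u 0 with rfl | hu
  · simp
  have hu0 : 0 < ‖u‖ := norm_pos_iff.2 hu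
  have hfin : ∀ u : Euc d, ‖u‖ = s / 2 →
      ‖F.Θ i y₁ ((F.Θ j y₁).symm u) - F.Θ i y₂ ((F.Θ j y₂).symm u)‖ ≤
        K * (C * L') * (riemannianEDist (𝓡 d) y₁ y₂).toReal := by
    intro u hu
    have hus : ‖u‖ < s := by rw [hu]; linarith
    have hu2 : u ∈ Metric.ball (0 : Euc d) 2 :=
      mem_ball_zero_iff.2 (hus.trans_le (min_le_right _ _))
    have key : ∀ y ∈ U, F.Θ i y ((F.Θ j y).symm u) ∈ Metric.ball (0 : Euc d) s' := by
      intro y _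
      rw [mem_ball_zero_iff, LinearIsometryEquiv.norm_map, LinearIsometryEquiv.norm_map]
      exact hus.trans_le (min_le_left _ _)
    have heq : ∀ y : M, expFrame F i y (F.Θ i y ((F.Θ j y).symm u)) =
        expMap y ((F.Θ j y).symm u) := fun y => (expMap_eq_expFrame F i y _).symm
    obtain ⟨a1, a2, a3, a4, a5⟩ := h y₁ hy₁ _ (key y₁ hy₁)
    obtain ⟨b1, b2, b3, b4, b5⟩ := h y₂ hy₂ _ (key y₂ hy₂)
    simp only at a1 b1
    rw [expChart_apply F i x₀ a2] at a1
    rw [expChart_apply F i x₀ b2] at b1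
    have h3 := ((hι _ a5).2.2 _ b5).1
    simp only [a1, b1] at h3
    refine h3.trans ?_
    rw [mul_assoc]
    refine mul_le_mul_of_nonneg_left ?_ hK.le
    have hd := hlip y₁ a3 y₂ b3
    have hd' := hlip _ a4 _ b4
    have h5 : riemannianEDist (𝓡 d) (expMap y₁ ((F.Θ j y₁).symm u))
        (expMap y₂ ((F.Θ j y₂).symm u)) ≤ ENNReal.ofReal L' * riemannianEDist (𝓡 d) y₁ y₂ := by
      refine (hL j y₁ hj₁ y₂ hj₂ u hu2 u hu2).trans ?_
      simp only [sub_self, norm_zero, ENNReal.ofReal_zero, add_zero]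
      gcongr
      calc L j ≤ |L j| := le_abs_self _
        _ ≤ ∑ j, |L j| := Finset.single_le_sum (f := fun j => |L j|)
            (fun _ _ => abs_nonneg _) (Finset.mem_univ j)
        _ ≤ L' := by simp [L']
    have h6 := ENNReal.toReal_mono (ENNReal.mul_ne_top ENNReal.ofReal_ne_top hd.1) h5
    rw [ENNReal.toReal_mul, ENNReal.toReal_ofReal (by linarith)] at h6
    simp only [heq] at hd'
    rw [Prod.mk_sub_mk, Prod.norm_def]
    simp only [heq]
    refine max_le ?_ ?_
    · refine hd.2.trans ?_
      rw [mul_assoc]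
      refine mul_le_mul_of_nonneg_left ?_ hC.le
      exact le_mul_of_one_le_left ENNReal.toReal_nonneg hL'
    · refine hd'.2.trans ?_
      rw [mul_assoc]
      exact mul_le_mul_of_nonneg_left h6 hC.le
  have hv : u = (‖u‖ * (2 / s)) • ((s / 2 / ‖u‖) • u) := by
    rw [smul_smul]
    have : ‖u‖ * (2 / s) * (s / 2 / ‖u‖) = 1 := by field_simp
    rw [this, one_smul]
  have hvn : ‖(s / 2 / ‖u‖) • u‖ = s / 2 := by
    rw [norm_smul, Real.norm_of_nonneg (by positivity)]
    field_simp
  have h7 := hfin _ hvn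
  have h8 : F.Θ i y₁ ((F.Θ j y₁).symm u) - F.Θ i y₂ ((F.Θ j y₂).symm u) =
      (‖u‖ * (2 / s)) • (F.Θ i y₁ ((F.Θ j y₁).symm ((s / 2 / ‖u‖) • u)) -
        F.Θ i y₂ ((F.Θ j y₂).symm ((s / 2 / ‖u‖) • u))) := by
    conv_lhs => rw [hv]
    simp only [map_smul]
    rw [smul_sub]
  rw [h8, norm_smul, Real.norm_of_nonneg (by positivity)]
  calc _ ≤ ‖u‖ * (2 / s) * (K * (C * L') * (riemannianEDist (𝓡 d) y₁ y₂).toReal) := by gcongr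
    _ = _ := by ring

end ExpUniform

/-! ### The diffeomorphism in exponential coordinates -/

section ChartTransfer

variable {d : ℕ} {M : Type*} [TopologicalSpace M] [CompactSpace M] [T2Space M]
  [ChartedSpace (Euc d) M]
  [RiemannianBundle (fun x : M => TangentSpace (𝓡 d) x)] [IsManifold (𝓡 d) ∞ M]
  [IsContMDiffRiemannianBundle (𝓡 d) ∞ (Euc d) (fun x : M => TangentSpace (𝓡 d) x)]

theorem contDiffAt_written (f : M ≃ₘ^1⟮𝓡 d, 𝓡 d⟯ M) (x₀ : M) :
    ContDiffAt ℝ 1 (writtenInExtChartAt (𝓡 d) (𝓡 d) x₀ f) (extChartAt (𝓡 d) x₀ x₀) := by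
  have h := (contMDiffAt_iff.1 (f.contMDiff x₀)).2
  rwa [ModelWithCorners.range_eq_univ, contDiffWithinAt_univ] at h

theorem written_apply (f : M ≃ₘ^1⟮𝓡 d, 𝓡 d⟯ M) (x₀ : M) {x : M}
    (hx : x ∈ (extChartAt (𝓡 d) x₀).source) :
    writtenInExtChartAt (𝓡 d) (𝓡 d) x₀ f (extChartAt (𝓡 d) x₀ x) =
      extChartAt (𝓡 d) (f x₀) (f x) := by
  simp only [writtenInExtChartAt, Function.comp_apply, (extChartAt (𝓡 d) x₀).left_inv hx]

theorem fderiv_written (f : M ≃ₘ^1⟮𝓡 d, 𝓡 d⟯ M) (x₀ : M) {x : M}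
    (hx : x ∈ (extChartAt (𝓡 d) x₀).source) (hfx : f x ∈ (extChartAt (𝓡 d) (f x₀)).source)
    (hd : DifferentiableAt ℝ (writtenInExtChartAt (𝓡 d) (𝓡 d) x₀ f) (extChartAt (𝓡 d) x₀ x))
    (v : TangentSpace (𝓡 d) x) :
    fderiv ℝ (writtenInExtChartAt (𝓡 d) (𝓡 d) x₀ f) (extChartAt (𝓡 d) x₀ x)
      (chartDeriv x₀ x v) = chartDeriv (f x₀) (f x) (mfderiv (𝓡 d) (𝓡 d) f x v) := by
  have : IsManifold (𝓡 d) 1 M := IsManifold.of_le (n := ∞) (by simp)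
  have hx' : x ∈ (chartAt (Euc d) x₀).source := by simpa [extChartAt_source] using hx
  have hfx' : f x ∈ (chartAt (Euc d) (f x₀)).source := by simpa [extChartAt_source] using hfx
  have h1 : mfderiv (𝓡 d) 𝓘(ℝ, Euc d) (extChartAt (𝓡 d) (f x₀) ∘ f) x =
      (mfderiv (𝓡 d) 𝓘(ℝ, Euc d) (extChartAt (𝓡 d) (f x₀)) (f x)) ∘L
        (mfderiv (𝓡 d) (𝓡 d) f x) :=
    mfderiv_comp x (mdifferentiableAt_extChartAt hfx')
      ((f.contMDiff x).mdifferentiableAt one_ne_zero)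
  have h2 : mfderiv (𝓡 d) 𝓘(ℝ, Euc d)
      (writtenInExtChartAt (𝓡 d) (𝓡 d) x₀ f ∘ extChartAt (𝓡 d) x₀) x =
      (mfderiv 𝓘(ℝ, Euc d) 𝓘(ℝ, Euc d) (writtenInExtChartAt (𝓡 d) (𝓡 d) x₀ f)
        (extChartAt (𝓡 d) x₀ x)) ∘L
        (mfderiv (𝓡 d) 𝓘(ℝ, Euc d) (extChartAt (𝓡 d) x₀) x) :=
    mfderiv_comp x hd.mdifferentiableAt (mdifferentiableAt_extChartAt hx')
  have h3 : (extChartAt (𝓡 d) (f x₀) ∘ f) =ᶠ[𝓝 x]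
      (writtenInExtChartAt (𝓡 d) (𝓡 d) x₀ f ∘ extChartAt (𝓡 d) x₀) := by
    filter_upwards [(isOpen_extChartAt_source (I := 𝓡 d) x₀).mem_nhds hx] with y hy
    exact (written_apply f x₀ hy).symm
  have h4 := h3.mfderiv_eq (I := 𝓡 d) (I' := 𝓘(ℝ, Euc d))
  rw [mfderiv_eq_fderiv] at h2
  exact (congrArg (fun L : TangentSpace (𝓡 d) x →L[ℝ] Euc d => L v)
    (h2.symm.trans (h4.symm.trans h1)))

/-- Estimates on `f` in exponential coordinates at `x` and at a point `y` near `f x`: in suitable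
isometric identifications `θx`, `θf`, `θy` of the tangent spaces at `x`, `f x`, `y` with `ℝ^d`,
the map `f` is `g`. All the errors are controlled by the distance from `f x` to `y`; the last
clause compares `θf`, `θy` to the framing. -/
def HasTransfer (f : M ≃ₘ^1⟮𝓡 d, 𝓡 d⟯ M) (F : Framing d M) (β r₀ r H : ℝ) (x y : M) : Prop :=
  ∃ (θx : TangentSpace (𝓡 d) x ≃ₗᵢ[ℝ] Euc d) (θf : TangentSpace (𝓡 d) (f x) ≃ₗᵢ[ℝ] Euc d)
    (θy : TangentSpace (𝓡 d) y ≃ₗᵢ[ℝ] Euc d) (g : Euc d → Euc d) (dg : Euc d → Euc d →L[ℝ] Euc d),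
    (∀ u ∈ Metric.ball (0 : Euc d) r,
      expMap y (θy.symm (g u)) = f (expMap x (θx.symm u)) ∧ ‖g u‖ < r₀ ∧ HasFDerivAt g (dg u) u ∧
      ∀ u' ∈ Metric.ball (0 : Euc d) r, ‖dg u - dg u'‖ ≤ H * ‖u - u'‖ ^ β) ∧
    ‖g 0‖ ≤ H * (riemannianEDist (𝓡 d) (f x) y).toReal ∧
    (∀ v : TangentSpace (𝓡 d) x, ‖dg 0 (θx v) - θf (mfderiv (𝓡 d) (𝓡 d) f x v)‖ ≤
      H * (riemannianEDist (𝓡 d) (f x) y).toReal * ‖v‖) ∧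
    ∀ j, f x ∈ F.dom j → y ∈ F.dom j → ∀ u : Euc d,
      ‖θf ((F.Θ j (f x)).symm u) - θy ((F.Θ j y).symm u)‖ ≤
        H * (riemannianEDist (𝓡 d) (f x) y).toReal * ‖u‖

theorem HasTransfer.mono {f : M ≃ₘ^1⟮𝓡 d, 𝓡 d⟯ M} {F : Framing d M} {β r₀ r H r' H' : ℝ} {x y : M}
    (h : HasTransfer f F β r₀ r H x y) (hr : r' ≤ r) (hH : H ≤ H') :
    HasTransfer f F β r₀ r' H' x y := by
  obtain ⟨θx, θf, θy, g, dg, h1, h2, h3, h4⟩ := h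
  have hsub : Metric.ball (0 : Euc d) r' ⊆ Metric.ball 0 r := Metric.ball_subset_ball hr
  have hd : 0 ≤ (riemannianEDist (𝓡 d) (f x) y).toReal := ENNReal.toReal_nonneg
  refine ⟨θx, θf, θy, g, dg, fun u hu => ?_, h2.trans (by gcongr), fun v => (h3 v).trans ?_,
    fun j hj hj' u => (h4 j hj hj' u).trans ?_⟩
  · obtain ⟨a1, a2, a3, a4⟩ := h1 u (hsub hu)
    refine ⟨a1, a2, a3, fun u' hu' => (a4 u' (hsub hu')).trans ?_⟩
    gcongr
  · gcongr
  · gcongr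

/-- Near a point `x₀`, the estimates in exponential coordinates follow from those of `f` in charts at
`x₀` and `f x₀`; the frames `θx`, `θf`, `θy` are those of a fixed member of the cover near each of the
two points. -/
theorem exists_hasTransfer_local {β : ℝ} (hβ : 0 < β) (hβ1 : β ≤ 1) (f : M ≃ₘ^1⟮𝓡 d, 𝓡 d⟯ M)
    (hf : HolderDifferential β f) (F : Framing d M) {r₀ : ℝ} (hr₀ : 0 < r₀) (x₀ : M) :
    ∃ U ∈ 𝓝 x₀, ∃ r > 0, ∃ H > 0, ∀ x ∈ U, ∀ y,
      riemannianEDist (𝓡 d) (f x) y < ENNReal.ofReal r → HasTransfer f F β r₀ r H x y := by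
  have : IsManifold (𝓡 d) 1 M := IsManifold.of_le (n := ∞) (by simp)
  have : IsContinuousRiemannianBundle (Euc d) (fun x : M => TangentSpace (𝓡 d) x) :=
    isContinuousRiemannianBundle
  obtain ⟨i, hi⟩ := F.cover x₀
  obtain ⟨j, hj⟩ := F.cover (f x₀)
  obtain ⟨ι, hι, hι1, hι2, hι3⟩ := exists_exp_inverse F hj
  obtain ⟨U₁, hU₁, C, hC, hlip⟩ := exists_chart_lipschitz (d := d) (f x₀)
  obtain ⟨U₂, hU₂, H₂, hH₂, hfr⟩ := exists_frame_lipschitz F hj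
  set h := writtenInExtChartAt (𝓡 d) (𝓡 d) x₀ f with hh
  set b := extChartAt (𝓡 d) x₀ x₀ with hb
  set b' := extChartAt (𝓡 d) (f x₀) (f x₀) with hb'
  have hcd : ContDiffAt ℝ 1 h b := contDiffAt_written f x₀
  have hhb : h b = b' := written_apply f x₀ (mem_extChartAt_source x₀)
  have hhd : ∀ᶠ y in 𝓝 b, DifferentiableAt ℝ h y :=
    (hcd.eventually (by simp)).mono fun p hp => hp.differentiableAt (by simp)
  have hhc : ContinuousAt (fderiv ℝ h) b :=
    (hcd.fderiv_right (m := 0) (by simp)).continuousAt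
  have he := contDiffAt_expChart F hi
  have he' := contDiffAt_expChart F hj
  -- radius for the exponential map at the target
  obtain ⟨U₃, hU₃, s₃, hs₃, h₃⟩ := exists_nhds_radius ((tendsto_expFrame F hj).eventually
    (extChartAt_source_mem_nhds (I := 𝓡 d) (f x₀)))
  have cf : Tendsto f (𝓝 x₀) (𝓝 (f x₀)) := f.continuous.continuousAt
  obtain ⟨U₄, hU₄, s₄, hs₄, h₄⟩ := exists_nhds_radius
    (((tendsto_expFrame F hi).eventually (extChartAt_source_mem_nhds (I := 𝓡 d) x₀)).and
    ((cf.comp (tendsto_expFrame F hi)).eventually (extChartAt_source_mem_nhds (I := 𝓡 d) (f x₀))))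
  have hez : ∀ᶠ x in 𝓝 b, expChart F i x₀ (x, 0) = x := by
    filter_upwards [extChartAt_target_mem_nhds (I := 𝓡 d) x₀] with y hy
    exact expChart_zero F i x₀ hy
  obtain ⟨r, hr, H, hH, hmain⟩ := exists_transfer_bounds hβ hβ1 (contDiffAt_infty.1 he 2)
    hez.self_of_nhds hι hι3.self_of_nhds hι3 hez hhb hhd hhc (hf x₀) hι2
    (lt_min hr₀ hs₃)
  -- differentiability of the exponential map and of its fibre inverse
  have hed : ∀ᶠ x in 𝓝 x₀, DifferentiableAt ℝ (expChart F i x₀) (extChartAt (𝓡 d) x₀ x, 0) := by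
    have h1 : ∀ᶠ p in 𝓝 ((b, 0) : Euc d × Euc d), DifferentiableAt ℝ (expChart F i x₀) p :=
      ((contDiffAt_infty.1 he 2).eventually (by simp)).mono fun p hp =>
        hp.differentiableAt (by simp)
    have h2 : Tendsto (fun x : M => (extChartAt (𝓡 d) x₀ x, (0 : Euc d))) (𝓝 x₀) (𝓝 (b, 0)) :=
      (continuousAt_extChartAt x₀).tendsto.prodMk_nhds tendsto_const_nhds
    exact h2.eventually h1
  have hed' : ∀ᶠ y in 𝓝 (f x₀), DifferentiableAt ℝ (expChart F j (f x₀))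
      (extChartAt (𝓡 d) (f x₀) y, 0) ∧ DifferentiableAt ℝ ι (extChartAt (𝓡 d) (f x₀) y,
        extChartAt (𝓡 d) (f x₀) y) ∧ ∀ᶠ u in 𝓝 (0 : Euc d),
          ι (extChartAt (𝓡 d) (f x₀) y, expChart F j (f x₀) (extChartAt (𝓡 d) (f x₀) y, u)) =
            u := by
    have h2 : Tendsto (fun x : M => (extChartAt (𝓡 d) (f x₀) x, (0 : Euc d))) (𝓝 (f x₀))
        (𝓝 (b', 0)) :=
      (continuousAt_extChartAt (f x₀)).tendsto.prodMk_nhds tendsto_const_nhds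
    have h1 : ∀ᶠ p in 𝓝 ((b', 0) : Euc d × Euc d), DifferentiableAt ℝ (expChart F j (f x₀)) p :=
      ((contDiffAt_infty.1 he' 2).eventually (by simp)).mono fun p hp =>
        hp.differentiableAt (by simp)
    have h3 : ∀ᶠ p in 𝓝 ((b', b') : Euc d × Euc d), DifferentiableAt ℝ ι p :=
      (hι.eventually (by simp)).mono fun p hp => hp.differentiableAt (by simp)
    have h4 : Tendsto (fun x : M => (extChartAt (𝓡 d) (f x₀) x, extChartAt (𝓡 d) (f x₀) x))
        (𝓝 (f x₀)) (𝓝 (b', b')) :=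
      (continuousAt_extChartAt (f x₀)).tendsto.prodMk_nhds
        (continuousAt_extChartAt (f x₀)).tendsto
    refine (h2.eventually h1).and ((h4.eventually h3).and ?_)
    refine (h2.eventually hι1.eventually_nhds).mono fun y hy => ?_
    have h5 : Tendsto (fun u : Euc d => (extChartAt (𝓡 d) (f x₀) y, u)) (𝓝 0)
        (𝓝 (extChartAt (𝓡 d) (f x₀) y, 0)) :=
      (continuous_const.prodMk continuous_id).tendsto' _ _ rfl
    exact h5.eventually hy
  have hdiff : ∀ᶠ x in 𝓝 x₀, DifferentiableAt ℝ h (extChartAt (𝓡 d) x₀ x) :=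
    (continuousAt_extChartAt x₀).tendsto.eventually hhd
  -- a neighbourhood of `f x₀` on which everything holds, and a Riemannian ball inside it
  have hV : U₁ ∩ (U₂ ∩ (U₃ ∩ ((extChartAt (𝓡 d) (f x₀)).source ∩
      (extChartAt (𝓡 d) (f x₀)) ⁻¹' Metric.ball b' r))) ∈ 𝓝 (f x₀) :=
    inter_mem hU₁ (inter_mem hU₂ (inter_mem hU₃ (inter_mem (extChartAt_source_mem_nhds _)
      ((continuousAt_extChartAt (f x₀)).preimage_mem_nhds (Metric.ball_mem_nhds _ hr)))))
  obtain ⟨c, hc, hcs⟩ := setOfPred_riemannianEDist_lt_subset_nhds (𝓡 d) hV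
  have hc2 : (0 : ENNReal) < (c / 2 : NNReal) := ENNReal.coe_pos.2 (by positivity)
  have hball : ∀ᶠ x in 𝓝 x₀, riemannianEDist (𝓡 d) (f x₀) (f x) < (c / 2 : NNReal) :=
    cf.eventually (eventually_riemannianEDist_lt (𝓡 d) (f x₀) hc2)
  let r' := min (min r s₄) (c / 2 : NNReal)
  have hr' : 0 < r' := lt_min (lt_min hr hs₄) (by positivity)
  have hUx := (continuousAt_extChartAt (I := 𝓡 d) x₀).preimage_mem_nhds (Metric.ball_mem_nhds b hr)
  refine ⟨_, hball.and (hdiff.and (hed.and ((cf.eventually hed').and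
    (Filter.Eventually.and hU₄ (Filter.Eventually.and hUx
      (extChartAt_source_mem_nhds (I := 𝓡 d) x₀)))))), r', hr', H * (C + 1) + H₂, by positivity,
    fun x hx y hy => ?_⟩
  obtain ⟨x1, x2, x3, ⟨x4, x4', x4''⟩, x5, x6, x7⟩ := hx
  have hfxV := hcs (show riemannianEDist (𝓡 d) (f x₀) (f x) < c from x1.trans_le (by
    refine ENNReal.coe_le_coe.2 ?_
    exact NNReal.half_le_self c))
  have hyV := hcs (show riemannianEDist (𝓡 d) (f x₀) y < c by
    refine (riemannianEDist_triangle (y := f x)).trans_lt ((ENNReal.add_lt_add x1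
      (hy.trans_le (ENNReal.ofReal_le_ofReal (min_le_right _ _)))).trans_le ?_)
    rw [ENNReal.ofReal_coe_nnreal, ← ENNReal.coe_add]
    exact ENNReal.coe_le_coe.2 (add_halves c).le)
  obtain ⟨f1, f2, f3, f4, f5⟩ := hfxV
  obtain ⟨y1, y2, y3, y4, y5⟩ := hyV
  obtain ⟨dg, hdg, hg0, hdg0⟩ := hmain _ x6 _ y5
  have hhx : h (extChartAt (𝓡 d) x₀ x) = extChartAt (𝓡 d) (f x₀) (f x) := written_apply f x₀ x7
  have hcl := (hlip _ f1 _ y1).2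
  have hd0 : 0 ≤ (riemannianEDist (𝓡 d) (f x) y).toReal := ENNReal.toReal_nonneg
  have hHle : H * ‖h (extChartAt (𝓡 d) x₀ x) - extChartAt (𝓡 d) (f x₀) y‖ ≤
      (H * (C + 1) + H₂) * (riemannianEDist (𝓡 d) (f x) y).toReal := by
    rw [hhx]
    calc _ ≤ H * (C * (riemannianEDist (𝓡 d) (f x) y).toReal) := by gcongr
      _ = (H * C) * (riemannianEDist (𝓡 d) (f x) y).toReal := by ring
      _ ≤ _ := by gcongr; linarith
  let G : Euc d → Euc d := fun u => ι (extChartAt (𝓡 d) (f x₀) y,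
    h (expChart F i x₀ (extChartAt (𝓡 d) x₀ x, u)))
  refine ⟨F.Θ i x, F.Θ j (f x), F.Θ j y, G, dg, fun u hu => ?_, hg0.trans hHle, fun v => ?_,
    fun k hk hk' u => ?_⟩
  · have hur : u ∈ Metric.ball (0 : Euc d) r :=
      Metric.ball_subset_ball ((min_le_left _ _).trans (min_le_left _ _)) hu
    have hus : u ∈ Metric.ball (0 : Euc d) s₄ :=
      Metric.ball_subset_ball ((min_le_left _ _).trans (min_le_right _ _)) hu
    obtain ⟨g1, g2, g3, g4⟩ := hdg u hur
    obtain ⟨k1, k2⟩ := h₄ x x5 u hus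
    refine ⟨?_, g2.trans_le (min_le_left _ _), g3, fun u' hu' => (g4 u'
      (Metric.ball_subset_ball ((min_le_left _ _).trans (min_le_left _ _)) hu')).trans ?_⟩
    · have k3 := h₃ y y3 (G u) (mem_ball_zero_iff.2 (g2.trans_le (min_le_right _ _)))
      refine (extChartAt (𝓡 d) (f x₀)).injOn k3 k2 ?_
      have k4 : expChart F j (f x₀) (extChartAt (𝓡 d) (f x₀) y, G u) =
        h (expChart F i x₀ (extChartAt (𝓡 d) x₀ x, u)) := g1
      rw [expChart_apply F j (f x₀) y4, expChart_apply F i x₀ x7] at k4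
      rw [k4]
      exact written_apply f x₀ k1
    · gcongr
      nlinarith
  · have e1 := ContinuousLinearMap.le_of_opNorm_le _ (hdg0.trans hHle) (F.Θ i x v)
    rw [LinearIsometryEquiv.norm_map] at e1
    refine le_trans (le_of_eq ?_) e1
    congr 1
    change _ = dg 0 (F.Θ i x v) - _
    congr 1
    have e2 : fderiv ℝ (expChart F i x₀) (extChartAt (𝓡 d) x₀ x, 0) (0, F.Θ i x v) =
      chartDeriv x₀ x v := fderiv_expChart F i x₀ x7 x3 v
    have e3 := fderiv_written f x₀ x7 f4 x2 v
    have e4 : fderiv ℝ (expChart F j (f x₀)) (extChartAt (𝓡 d) (f x₀) (f x), 0)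
        (0, F.Θ j (f x) (mfderiv (𝓡 d) (𝓡 d) f x v)) = chartDeriv (f x₀) (f x)
          (mfderiv (𝓡 d) (𝓡 d) f x v) :=
      fderiv_expChart F j (f x₀) f4 x4 _
    have e5 : ∀ w : Euc d, fderiv ℝ ι (extChartAt (𝓡 d) (f x₀) (f x),
        extChartAt (𝓡 d) (f x₀) (f x))
        (0, fderiv ℝ (expChart F j (f x₀)) (extChartAt (𝓡 d) (f x₀) (f x), 0) (0, w)) = w := by
      intro w
      set q := extChartAt (𝓡 d) (f x₀) (f x) with hq
      have hq0 : expChart F j (f x₀) (q, 0) = q :=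
        expChart_zero F j (f x₀) ((extChartAt (𝓡 d) (f x₀)).map_source f4)
      have d1 : HasFDerivAt (fun u : Euc d => expChart F j (f x₀) (q, u))
          (fderiv ℝ (expChart F j (f x₀)) (q, 0) ∘L ContinuousLinearMap.inr ℝ (Euc d) (Euc d)) 0 :=
        HasFDerivAt.comp (g := expChart F j (f x₀)) (0 : Euc d) x4.hasFDerivAt
          (hasFDerivAt_prodMk_right q 0)
      have d2 : HasFDerivAt (fun p : Euc d => ι (q, p))
          (fderiv ℝ ι (q, q) ∘L ContinuousLinearMap.inr ℝ (Euc d) (Euc d))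
            (expChart F j (f x₀) (q, 0)) := by
        rw [hq0]
        exact HasFDerivAt.comp (g := ι) q x4'.hasFDerivAt (hasFDerivAt_prodMk_right q q)
      have d3 := HasFDerivAt.comp (g := fun p : Euc d => ι (q, p)) (0 : Euc d) d2 d1
      have d4 : HasFDerivAt (fun u : Euc d => u) (ContinuousLinearMap.id ℝ (Euc d)) (0 : Euc d) :=
        hasFDerivAt_id _
      have d5 := d3.unique (d4.congr_of_eventuallyEq x4'')
      exact congrArg (fun L : Euc d →L[ℝ] Euc d => L w) d5
    change F.Θ j (f x) (mfderiv (𝓡 d) (𝓡 d) f x v) = fderiv ℝ ι (h _, h _) (0, fderiv ℝ h _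
      (fderiv ℝ (expChart F i x₀) (extChartAt (𝓡 d) x₀ x, 0) (0, F.Θ i x v)))
    rw [e2, hhx]
    refine (e5 (F.Θ j (f x) (mfderiv (𝓡 d) (𝓡 d) f x v))).symm.trans ?_
    rw [e4]
    exact congrArg (fun w : Euc d => fderiv ℝ ι (extChartAt (𝓡 d) (f x₀) (f x),
        extChartAt (𝓡 d) (f x₀) (f x)) (0, w)) e3.symm
  · refine (hfr k _ f2 hk _ y2 hk' u).trans ?_
    gcongr
    have : 0 < H * (C + 1) := by positivity
    linarith

/-- Uniform estimates in exponential coordinates, by compactness. -/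
theorem exists_hasTransfer {β : ℝ} (hβ : 0 < β) (hβ1 : β ≤ 1) (f : M ≃ₘ^1⟮𝓡 d, 𝓡 d⟯ M)
    (hf : HolderDifferential β f) (F : Framing d M) {r₀ : ℝ} (hr₀ : 0 < r₀) :
    ∃ r > 0, ∃ H > 0, ∀ x y,
      riemannianEDist (𝓡 d) (f x) y < ENNReal.ofReal r → HasTransfer f F β r₀ r H x y := by
  suffices h : ∃ r > 0, ∃ H > 0, ∀ x ∈ (univ : Set M), ∀ y,
      riemannianEDist (𝓡 d) (f x) y < ENNReal.ofReal r → HasTransfer f F β r₀ r H x y by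
    obtain ⟨r, hr, H, hH, h⟩ := h
    exact ⟨r, hr, H, hH, fun x => h x (mem_univ x)⟩
  refine isCompact_univ.induction_on (p := fun s : Set M => ∃ r > 0, ∃ H > 0, ∀ x ∈ s, ∀ y,
      riemannianEDist (𝓡 d) (f x) y < ENNReal.ofReal r → HasTransfer f F β r₀ r H x y) ?_ ?_ ?_ ?_
  · exact ⟨1, one_pos, 1, one_pos, by simp⟩
  · rintro s t hst ⟨r, hr, H, hH, h⟩
    exact ⟨r, hr, H, hH, fun x hx => h x (hst hx)⟩
  · rintro s t ⟨r, hr, H, hH, h⟩ ⟨r', hr', H', hH', h'⟩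
    refine ⟨min r r', lt_min hr hr', max H H', lt_max_of_lt_left hH, ?_⟩
    rintro x (hx | hx) y hy
    · exact (h x hx y (hy.trans_le (ENNReal.ofReal_le_ofReal (min_le_left _ _)))).mono
        (min_le_left _ _) (le_max_left _ _)
    · exact (h' x hx y (hy.trans_le (ENNReal.ofReal_le_ofReal (min_le_right _ _)))).mono
        (min_le_right _ _) (le_max_right _ _)
  · intro x₀ _
    rw [nhdsWithin_univ]
    exact exists_hasTransfer_local hβ hβ1 f hf F hr₀ x₀

/-- The inverse of a diffeomorphism with a Hölder continuous differential has a Hölder continuous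
differential. -/
theorem HolderDifferential.symm {β : ℝ} (hβ : 0 < β) {f : M ≃ₘ^1⟮𝓡 d, 𝓡 d⟯ M}
    (hf : HolderDifferential β f) : HolderDifferential β f.symm := by
  intro x'
  obtain ⟨x, rfl⟩ := f.surjective x'
  obtain ⟨U, hU, K, hK⟩ := hf x
  have hcd := contDiffAt_written f x
  have hcd' := contDiffAt_written f.symm (f x)
  set h := writtenInExtChartAt (𝓡 d) (𝓡 d) x f with hh
  set g := writtenInExtChartAt (𝓡 d) (𝓡 d) (f x) f.symm with hg
  have hgdef : g = extChartAt (𝓡 d) x ∘ f.symm ∘ (extChartAt (𝓡 d) (f x)).symm := by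
    simp only [hg, writtenInExtChartAt, Diffeomorph.symm_apply_apply]
  set b := extChartAt (𝓡 d) x x with hb
  set b' := extChartAt (𝓡 d) (f x) (f x) with hb'
  have hinv' : (extChartAt (𝓡 d) (f x)).symm b' = f x := extChartAt_to_inv (f x)
  have hgb : g b' = b := by
    simp only [hgdef, Function.comp_apply, hinv', Diffeomorph.symm_apply_apply, hb]
  have hgc : Tendsto g (𝓝 b') (𝓝 b) := by
    have := hcd'.continuousAt.tendsto
    rwa [hgb] at this
  have htend : Tendsto (extChartAt (𝓡 d) (f x)).symm (𝓝 b') (𝓝 (f x)) := by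
    have := (continuousAt_extChartAt_symm (I := 𝓡 d) (f x)).tendsto
    rwa [hinv'] at this
  have htend2 : Tendsto (fun y => f.symm ((extChartAt (𝓡 d) (f x)).symm y)) (𝓝 b') (𝓝 x) := by
    have h1 : Tendsto f.symm (𝓝 (f x)) (𝓝 x) := by
      have := f.symm.continuous.continuousAt (x := f x) |>.tendsto
      rwa [Diffeomorph.symm_apply_apply] at this
    exact h1.comp htend
  have hhg : ∀ᶠ y in 𝓝 b', h (g y) = y := by
    filter_upwards [htend2.eventually (extChartAt_source_mem_nhds (I := 𝓡 d) x),
      extChartAt_target_mem_nhds (I := 𝓡 d) (f x)] with y hy hy'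
    have h1 : g y = extChartAt (𝓡 d) x (f.symm ((extChartAt (𝓡 d) (f x)).symm y)) := by
      rw [hgdef]; rfl
    rw [h1, hh, written_apply f x hy, Diffeomorph.apply_symm_apply,
      (extChartAt (𝓡 d) (f x)).right_inv hy']
  have hgh : ∀ᶠ y in 𝓝 b, g (h y) = y := by
    have h2 : Tendsto (extChartAt (𝓡 d) x).symm (𝓝 b) (𝓝 x) := by
      have := (continuousAt_extChartAt_symm (I := 𝓡 d) x).tendsto
      rwa [extChartAt_to_inv x] at this
    filter_upwards [(f.continuous.continuousAt.tendsto.comp h2).eventually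
      (extChartAt_source_mem_nhds (I := 𝓡 d) (f x)),
      extChartAt_target_mem_nhds (I := 𝓡 d) x] with y hy hy'
    have h1 : h y = extChartAt (𝓡 d) (f x) (f ((extChartAt (𝓡 d) x).symm y)) := rfl
    rw [h1, hgdef]
    simp only [Function.comp_apply] at hy ⊢
    rw [(extChartAt (𝓡 d) (f x)).left_inv hy, Diffeomorph.symm_apply_apply,
      (extChartAt (𝓡 d) x).right_inv hy']
  have hdh : ∀ᶠ y in 𝓝 b, DifferentiableAt ℝ h y :=
    (hcd.eventually (by simp)).mono fun p hp => hp.differentiableAt (by simp)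
  have hdg : ∀ᶠ y in 𝓝 b', DifferentiableAt ℝ g y :=
    (hcd'.eventually (by simp)).mono fun p hp => hp.differentiableAt (by simp)
  have hgh' : ∀ᶠ y in 𝓝 b', ∀ᶠ z in 𝓝 (g y), g (h z) = z :=
    hgc.eventually hgh.eventually_nhds
  have hbd : ∀ᶠ y in 𝓝 b', ‖fderiv ℝ g y‖ < ‖fderiv ℝ g b'‖ + 1 :=
    (hcd'.fderiv_right (m := 0) (by simp)).continuousAt.norm.eventually_lt continuousAt_const
      (lt_add_one _)
  obtain ⟨L, t, ht, hL⟩ := hcd'.exists_lipschitzOnWith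
  obtain ⟨ρ, hρ, hball⟩ := Metric.eventually_nhds_iff_ball.1 (hhg.eventually_nhds.and (hgh'.and
    (hdg.and ((hgc.eventually hdh).and (hbd.and (Filter.Eventually.and ht
      (hgc.eventually hU)))))))
  refine ⟨Metric.ball b' ρ, Metric.ball_mem_nhds _ hρ,
    (‖fderiv ℝ g b'‖ + 1) * (|K| * L ^ β) * (‖fderiv ℝ g b'‖ + 1), fun y hy z hz => ?_⟩
  obtain ⟨y1, y2, y3, y4, y5, y6, y7⟩ := hball y hy
  obtain ⟨z1, z2, z3, z4, z5, z6, z7⟩ := hball z hz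
  have left : (fderiv ℝ g y) ∘L (fderiv ℝ h (g y)) = ContinuousLinearMap.id ℝ (Euc d) := by
    have e1 : HasFDerivAt g (fderiv ℝ g y) (h (g y)) := by
      rw [y1.self_of_nhds]; exact y3.hasFDerivAt
    exact (e1.comp (g y) y4.hasFDerivAt).unique
      ((hasFDerivAt_id (g y)).congr_of_eventuallyEq y2)
  have right : (fderiv ℝ h (g z)) ∘L (fderiv ℝ g z) = ContinuousLinearMap.id ℝ (Euc d) :=
    (HasFDerivAt.comp (g := h) z z4.hasFDerivAt z3.hasFDerivAt).unique
      ((hasFDerivAt_id z).congr_of_eventuallyEq z1)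
  have e : fderiv ℝ g y - fderiv ℝ g z =
      fderiv ℝ g y ∘L (fderiv ℝ h (g z) - fderiv ℝ h (g y)) ∘L fderiv ℝ g z := by
    rw [ContinuousLinearMap.sub_comp, ContinuousLinearMap.comp_sub, right,
      ← ContinuousLinearMap.comp_assoc, left, ContinuousLinearMap.comp_id,
      ContinuousLinearMap.id_comp]
  change ‖fderiv ℝ g y - fderiv ℝ g z‖ ≤ _
  rw [e]
  have e2 : ‖fderiv ℝ h (g z) - fderiv ℝ h (g y)‖ ≤ |K| * L ^ β * ‖y - z‖ ^ β := by
    refine (hK _ z7 _ y7).trans ?_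
    have e3 := hL.dist_le_mul y y6 z z6
    rw [dist_eq_norm, dist_eq_norm] at e3
    rw [norm_sub_rev (g z), mul_assoc, ← Real.mul_rpow L.coe_nonneg (norm_nonneg _)]
    exact mul_le_mul (le_abs_self K) (Real.rpow_le_rpow (norm_nonneg _) e3 hβ.le)
      (by positivity) (abs_nonneg _)
  calc _ ≤ ‖fderiv ℝ g y‖ * (‖fderiv ℝ h (g z) - fderiv ℝ h (g y)‖ * ‖fderiv ℝ g z‖) :=
        (ContinuousLinearMap.opNorm_comp_le _ _).trans
          (mul_le_mul_of_nonneg_left (ContinuousLinearMap.opNorm_comp_le _ _) (norm_nonneg _))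
    _ ≤ (‖fderiv ℝ g b'‖ + 1) * ((|K| * L ^ β * ‖y - z‖ ^ β) * (‖fderiv ℝ g b'‖ + 1)) := by
        gcongr
    _ = _ := by ring

end ChartTransfer

/-! ### Admissible functions -/

section Admissible

variable {A B : Type*} [NormedAddCommGroup A] [NormedSpace ℝ A]
  [NormedAddCommGroup B] [NormedSpace ℝ B]

/-- `F`, with derivative `P` on the closed ball of radius `p`, satisfies the bounds on the
parameters of an admissible manifold. The bound `max ‖P‖ + Höl_α P ≤ 1/2` is spelled out pointwise,
in a form that is stable under pointwise limits. -/
structure IsAdm (α η p : ℝ) (F : B → A) (P : B → B →L[ℝ] A) : Prop where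
  deriv : ∀ t ∈ Metric.closedBall (0 : B) p,
    HasFDerivWithinAt F (P t) (Metric.closedBall 0 p) t
  norm_le : ∀ t ∈ Metric.closedBall (0 : B) p, ‖P t‖ ≤ 1 / 2
  holder : ∀ t ∈ Metric.closedBall (0 : B) p, ∀ t₁ ∈ Metric.closedBall (0 : B) p,
    ∀ t₂ ∈ Metric.closedBall (0 : B) p, ‖P t₁ - P t₂‖ ≤ (1 / 2 - ‖P t‖) * ‖t₁ - t₂‖ ^ α
  iota : ‖P 0‖ ≤ 1 / 2 * η ^ α
  phi : ‖F 0‖ ≤ 1 / 10 ^ 3 * η ^ 2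

namespace IsAdm

variable {α η p : ℝ} {F : B → A} {P : B → B →L[ℝ] A}

theorem exists_bounds (hF : IsAdm α η p F P) (hp : 0 ≤ p) : ∃ m h : ℝ,
    0 ≤ m ∧ 0 ≤ h ∧ m + h ≤ 1 / 2 ∧ (∀ t ∈ Metric.closedBall (0 : B) p, ‖P t‖ ≤ m) ∧
    (∀ t₁ ∈ Metric.closedBall (0 : B) p, ∀ t₂ ∈ Metric.closedBall (0 : B) p,
      ‖P t₁ - P t₂‖ ≤ h * ‖t₁ - t₂‖ ^ α) := by
  have h0 : (0 : B) ∈ Metric.closedBall (0 : B) p := Metric.mem_closedBall_self hp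
  set S : Set ℝ := (fun t => ‖P t‖) '' Metric.closedBall 0 p with hS
  have hbdd : BddAbove S := ⟨1 / 2, by rintro _ ⟨t, ht, rfl⟩; exact hF.norm_le t ht⟩
  have hne : S.Nonempty := ⟨_, 0, h0, rfl⟩
  have hm : ∀ t ∈ Metric.closedBall (0 : B) p, ‖P t‖ ≤ sSup S := fun t ht =>
    le_csSup hbdd ⟨t, ht, rfl⟩
  have hm2 : sSup S ≤ 1 / 2 := csSup_le hne (by rintro _ ⟨t, ht, rfl⟩; exact hF.norm_le t ht)
  refine ⟨sSup S, 1 / 2 - sSup S, (norm_nonneg _).trans (hm 0 h0), by linarith, by linarith, hm,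
    fun t₁ h₁ t₂ h₂ => ?_⟩
  have hX0 : 0 ≤ ‖t₁ - t₂‖ ^ α := by positivity
  rcases hX0.eq_or_lt with hX | hX
  · have := hF.holder 0 h0 t₁ h₁ t₂ h₂
    rw [← hX, mul_zero] at this
    rw [← hX, mul_zero]
    exact this
  · rw [← div_le_iff₀ hX]
    have : sSup S ≤ 1 / 2 - ‖P t₁ - P t₂‖ / ‖t₁ - t₂‖ ^ α := by
      refine csSup_le hne ?_
      rintro _ ⟨t, ht, rfl⟩
      have h3 := hF.holder t ht t₁ h₁ t₂ h₂
      rw [← div_le_iff₀ hX] at h3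
      linarith
    linarith

/-- The usual form of the bounds, with separate constants for the derivative and its Hölder
seminorm. -/
theorem of_bounds {m h : ℝ} (hmh : m + h ≤ 1 / 2)
    (hd : ∀ t ∈ Metric.closedBall (0 : B) p,
      HasFDerivWithinAt F (P t) (Metric.closedBall 0 p) t)
    (hm : ∀ t ∈ Metric.closedBall (0 : B) p, ‖P t‖ ≤ m) (hh0 : 0 ≤ h)
    (hh : ∀ t₁ ∈ Metric.closedBall (0 : B) p, ∀ t₂ ∈ Metric.closedBall (0 : B) p,
      ‖P t₁ - P t₂‖ ≤ h * ‖t₁ - t₂‖ ^ α)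
    (hι : ‖P 0‖ ≤ 1 / 2 * η ^ α) (hφ : ‖F 0‖ ≤ 1 / 10 ^ 3 * η ^ 2) : IsAdm α η p F P where
  deriv := hd
  norm_le t ht := by linarith [hm t ht]
  holder t ht t₁ h₁ t₂ h₂ := (hh t₁ h₁ t₂ h₂).trans
    (mul_le_mul_of_nonneg_right (by linarith [hm t ht]) (by positivity))
  iota := hι
  phi := hφ

theorem lipschitz (hF : IsAdm α η p F P) {t t' : B} (ht : t ∈ Metric.closedBall (0 : B) p)
    (ht' : t' ∈ Metric.closedBall (0 : B) p) : ‖F t - F t'‖ ≤ 1 / 2 * ‖t - t'‖ :=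
  (convex_closedBall 0 p).norm_image_sub_le_of_norm_hasFDerivWithin_le hF.deriv hF.norm_le ht' ht

theorem holder_half (hF : IsAdm α η p F P) {t t' : B} (ht : t ∈ Metric.closedBall (0 : B) p)
    (ht' : t' ∈ Metric.closedBall (0 : B) p) : ‖P t - P t'‖ ≤ 1 / 2 * ‖t - t'‖ ^ α :=
  (hF.holder t ht t ht t' ht').trans
    (mul_le_mul_of_nonneg_right (by linarith [norm_nonneg (P t)]) (by positivity))

theorem norm_le_phi (hF : IsAdm α η p F P) (hp : 0 ≤ p) {t : B}
    (ht : t ∈ Metric.closedBall (0 : B) p) : ‖F t‖ ≤ 1 / 10 ^ 3 * η ^ 2 + 1 / 2 * ‖t‖ := by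
  have h1 := hF.lipschitz ht (Metric.mem_closedBall_self hp)
  rw [sub_zero] at h1
  have h2 := norm_le_norm_add_norm_sub (F 0) (F t)
  rw [norm_sub_rev] at h2
  linarith [hF.phi]

/-- Taylor's formula with a Hölder remainder. -/
theorem remainder (hF : IsAdm α η p F P) (hα : 0 ≤ α) {t t' : B}
    (ht : t ∈ Metric.closedBall (0 : B) p) (ht' : t' ∈ Metric.closedBall (0 : B) p) :
    ‖F t' - F t - P t (t' - t)‖ ≤ 1 / 2 * ‖t' - t‖ ^ α * ‖t' - t‖ := by
  set s : Set B := Metric.closedBall 0 p ∩ Metric.closedBall t ‖t' - t‖ with hs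
  have hconv : Convex ℝ s := (convex_closedBall 0 p).inter (convex_closedBall t _)
  refine hconv.norm_image_sub_le_of_norm_hasFDerivWithin_le' (f' := P)
    (fun x hx => (hF.deriv x hx.1).mono inter_subset_left) (fun x hx => ?_)
    ⟨ht, Metric.mem_closedBall_self (norm_nonneg _)⟩
    ⟨ht', by rw [Metric.mem_closedBall, dist_eq_norm]⟩
  refine (hF.holder_half hx.1 ht).trans ?_
  have h2 : ‖x - t‖ ≤ ‖t' - t‖ := by
    have := hx.2; rwa [Metric.mem_closedBall, dist_eq_norm] at this
  gcongr

/-- Interpolation: two admissible functions that are uniformly close have close derivatives. -/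
theorem interpolate {F₂ : B → A} {P₂ : B → B →L[ℝ] A} {η₂ : ℝ} (hF : IsAdm α η p F P)
    (hF₂ : IsAdm α η₂ p F₂ P₂) (hα : 0 < α) {D : ℝ} (hD0 : 0 ≤ D)
    (hD : ∀ t ∈ Metric.closedBall (0 : B) p, ‖F t - F₂ t‖ ≤ D) {s : ℝ} (hs : 0 < s) (hsp : s ≤ p)
    {t : B} (ht : t ∈ Metric.closedBall (0 : B) p) : ‖P t - P₂ t‖ ≤ 2 * D / s + 2 * s ^ α := by
  have hp : 0 < p := hs.trans_le hsp
  have htn := mem_closedBall_zero_iff.1 ht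
  -- a point within `s` of `t`, around which the ball of radius `s` is in the domain
  set t' := (1 - s / p) • t with ht'
  have hsp1 : s / p ≤ 1 := (div_le_one hp).2 hsp
  have hsp0 : 0 ≤ s / p := by positivity
  have ht'n : ‖t'‖ ≤ p - s := by
    rw [ht', norm_smul, Real.norm_of_nonneg (by linarith)]
    calc (1 - s / p) * ‖t‖ ≤ (1 - s / p) * p := by gcongr
      _ = p - s := by field_simp
  have ht'm : t' ∈ Metric.closedBall (0 : B) p := mem_closedBall_zero_iff.2 (by linarith)
  have htt' : ‖t - t'‖ ≤ s := by
    have : t - t' = (s / p) • t := by rw [ht', sub_smul, one_smul, sub_sub_cancel]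
    rw [this, norm_smul, Real.norm_of_nonneg hsp0]
    calc s / p * ‖t‖ ≤ s / p * p := by gcongr
      _ = s := by field_simp
  have hsα : ‖t - t'‖ ^ α ≤ s ^ α := Real.rpow_le_rpow (norm_nonneg _) htt' hα.le
  have h1 := hF.holder_half ht ht'm
  have h2 := hF₂.holder_half ht ht'm
  have hsα0 : 0 < s ^ α := by positivity
  have h3 : ‖P t' - P₂ t'‖ ≤ 2 * D / s + s ^ α := by
    refine ContinuousLinearMap.opNorm_le_of_shell (ε := 2 * s) (c := (2 : ℝ)) (by positivity)
      (by positivity) (by norm_num) fun v hv1 hv2 => ?_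
    -- reduce to vectors of norm `s`
    have hv0 : 0 < ‖v‖ := lt_of_lt_of_le (by rw [Real.norm_ofNat]; positivity) hv1
    set u := (s / ‖v‖) • v with hu
    have hun : ‖u‖ = s := by
      rw [hu, norm_smul, Real.norm_of_nonneg (by positivity)]
      field_simp
    have hvu : v = (‖v‖ / s) • u := by
      rw [hu, smul_smul]
      have : ‖v‖ / s * (s / ‖v‖) = 1 := by field_simp
      rw [this, one_smul]
    have htu : t' + u ∈ Metric.closedBall (0 : B) p :=
      mem_closedBall_zero_iff.2 ((norm_add_le _ _).trans (by rw [hun]; linarith))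
    have e1 := hF.remainder hα.le ht'm htu
    have e2 := hF₂.remainder hα.le ht'm htu
    rw [add_sub_cancel_left, hun] at e1 e2
    have e3 := hD _ htu
    have e4 := hD _ ht'm
    have e5 : (P t' - P₂ t') u = ((F (t' + u) - F₂ (t' + u)) - (F t' - F₂ t')) -
        ((F (t' + u) - F t' - P t' u) - (F₂ (t' + u) - F₂ t' - P₂ t' u)) := by
      simp only [_root_.sub_apply]; abel
    have e6 : ‖(P t' - P₂ t') u‖ ≤ 2 * D + s ^ α * s := by
      rw [e5]
      refine (norm_sub_le _ _).trans ?_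
      have := norm_sub_le (F (t' + u) - F₂ (t' + u)) (F t' - F₂ t')
      have := norm_sub_le (F (t' + u) - F t' - P t' u) (F₂ (t' + u) - F₂ t' - P₂ t' u)
      linarith
    rw [hvu, map_smul, norm_smul, norm_smul, hun, Real.norm_of_nonneg (by positivity)]
    calc ‖v‖ / s * ‖(P t' - P₂ t') u‖ ≤ ‖v‖ / s * (2 * D + s ^ α * s) := by gcongr
      _ = (2 * D / s + s ^ α) * (‖v‖ / s * s) := by field_simp
  have e : P t - P₂ t = (P t - P t') + (P t' - P₂ t') - (P₂ t - P₂ t') := by abel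
  rw [e]
  refine (norm_sub_le _ _).trans ((add_le_add_left (norm_add_le _ _) _).trans ?_)
  nlinarith

end IsAdm

/-- Uniform limits of admissible functions are admissible. -/
theorem IsAdm.exists_limit [CompleteSpace A] {α η p : ℝ} (hα : 0 < α) (hp : 0 < p)
    {F : ℕ → B → A} {P : ℕ → B → B →L[ℝ] A} (hF : ∀ n, IsAdm α η p (F n) (P n)) {D : ℕ → ℝ}
    (hD : Tendsto D atTop (𝓝 0))
    (hFD : ∀ n m, n ≤ m → ∀ t ∈ Metric.closedBall (0 : B) p, ‖F n t - F m t‖ ≤ D n) :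
    ∃ F' P', IsAdm α η p F' P' ∧
      ∀ n, ∀ t ∈ Metric.closedBall (0 : B) p, ‖F n t - F' t‖ ≤ D n := by
  have h0 : (0 : B) ∈ Metric.closedBall (0 : B) p := Metric.mem_closedBall_self hp.le
  have hD0 : ∀ n, 0 ≤ D n := fun n => (norm_nonneg _).trans (hFD n n le_rfl 0 h0)
  have hlimF : ∀ t, ∃ y, t ∈ Metric.closedBall (0 : B) p →
      Tendsto (fun n => F n t) atTop (𝓝 y) := by
    intro t
    by_cases ht : t ∈ Metric.closedBall (0 : B) p
    · have hc : CauchySeq (fun n => F n t) := by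
        refine cauchySeq_of_le_tendsto_0' D (fun n m hnm => ?_) hD
        rw [dist_eq_norm]
        exact hFD n m hnm t ht
      obtain ⟨y, hy⟩ := cauchySeq_tendsto_of_complete hc
      exact ⟨y, fun _ => hy⟩
    · exact ⟨0, fun h => absurd h ht⟩
  choose F' hF' using hlimF
  have hlimP : ∀ t, ∃ y, t ∈ Metric.closedBall (0 : B) p →
      Tendsto (fun n => P n t) atTop (𝓝 y) := by
    intro t
    by_cases ht : t ∈ Metric.closedBall (0 : B) p
    · have hc : CauchySeq (fun n => P n t) := by
        rw [Metric.cauchySeq_iff']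
        intro ε hε
        -- interpolation at a fixed small scale `s`
        obtain ⟨s, hs, hsp, hsε⟩ : ∃ s : ℝ, 0 < s ∧ s ≤ p ∧ 2 * s ^ α < ε / 2 := by
          have h1 : Tendsto (fun s : ℝ => 2 * s ^ α) (𝓝[>] 0) (𝓝 0) := by
            have h2 : ContinuousAt (fun s : ℝ => 2 * s ^ α) 0 :=
              continuousAt_const.mul (Real.continuousAt_rpow_const _ _ (Or.inr hα.le))
            have h3 := h2.tendsto
            rw [Real.zero_rpow hα.ne', mul_zero] at h3
            exact h3.mono_left nhdsWithin_le_nhds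
          obtain ⟨s, hs1, hs2⟩ := ((h1.eventually_lt_const (half_pos hε)).and
            (Ioc_mem_nhdsGT hp)).exists
          exact ⟨s, hs2.1, hs2.2, hs1⟩
        have h4 : Tendsto (fun n => 2 * D n / s) atTop (𝓝 0) := by
          have := (hD.const_mul 2).div_const s
          simpa using this
        obtain ⟨N, hN⟩ := (h4.eventually_lt_const (half_pos hε)).exists
        refine ⟨N, fun n hn => ?_⟩
        rw [dist_comm, dist_eq_norm]
        have := (hF N).interpolate (hF n) hα (hD0 N) (hFD N n hn) hs hsp ht
        linarith
      obtain ⟨y, hy⟩ := cauchySeq_tendsto_of_complete hc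
      exact ⟨y, fun _ => hy⟩
    · exact ⟨0, fun h => absurd h ht⟩
  choose P' hP' using hlimP
  have hhol : ∀ t ∈ Metric.closedBall (0 : B) p, ∀ t₁ ∈ Metric.closedBall (0 : B) p,
      ∀ t₂ ∈ Metric.closedBall (0 : B) p,
        ‖P' t₁ - P' t₂‖ ≤ (1 / 2 - ‖P' t‖) * ‖t₁ - t₂‖ ^ α := fun t ht t₁ h₁ t₂ h₂ =>
    le_of_tendsto_of_tendsto' (((hP' t₁ h₁).sub (hP' t₂ h₂)).norm)
      ((tendsto_const_nhds.sub (hP' t ht).norm).mul_const _)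
      fun n => (hF n).holder t ht t₁ h₁ t₂ h₂
  refine ⟨F', P', ⟨fun t ht => ?_, fun t ht => ?_, hhol, ?_, ?_⟩, fun n t ht => ?_⟩
  · have hrem : ∀ t' ∈ Metric.closedBall (0 : B) p,
        ‖F' t' - F' t - P' t (t' - t)‖ ≤ 1 / 2 * ‖t' - t‖ ^ α * ‖t' - t‖ := fun t' ht' => by
      refine le_of_tendsto' ((((hF' t' ht').sub (hF' t ht)).sub
        (((ContinuousLinearMap.apply ℝ A (t' - t)).continuous.tendsto _).comp (hP' t ht))).norm)
        fun n => (hF n).remainder hα.le ht ht'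
    rw [hasFDerivWithinAt_iff_isLittleO, Asymptotics.isLittleO_iff]
    intro c hc
    have h1 : Tendsto (fun t' : B => 1 / 2 * ‖t' - t‖ ^ α) (𝓝[Metric.closedBall 0 p] t) (𝓝 0) := by
      have h2 : ContinuousAt (fun t' : B => 1 / 2 * ‖t' - t‖ ^ α) t :=
        continuousAt_const.mul (((continuous_id.sub continuous_const).norm.continuousAt).rpow_const
          (Or.inr hα.le))
      have h3 := h2.tendsto
      simp only [sub_self, norm_zero, Real.zero_rpow hα.ne', mul_zero] at h3
      exact h3.mono_left nhdsWithin_le_nhds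
    filter_upwards [h1.eventually_lt_const hc, self_mem_nhdsWithin] with t' h4 h5
    exact (hrem t' h5).trans (mul_le_mul_of_nonneg_right h4.le (norm_nonneg _))
  · exact le_of_tendsto' (hP' t ht).norm fun n => (hF n).norm_le t ht
  · exact le_of_tendsto' (hP' 0 h0).norm fun n => (hF n).iota
  · exact le_of_tendsto' (hF' 0 h0).norm fun n => (hF n).phi
  · refine le_of_tendsto ((tendsto_const_nhds.sub (hF' t ht)).norm) ?_
    filter_upwards [eventually_ge_atTop n] with m hm
    exact hFD n m hm t ht

end Admissible

/-! ### The graph transform of a nearly linear hyperbolic map -/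

section GraphTransform

variable {A B : Type*} [NormedAddCommGroup A] [NormedSpace ℝ A]
  [NormedAddCommGroup B] [NormedSpace ℝ B]

/-- The perturbation by `h` of the block diagonal linear map with blocks `LA`, `LB`. -/
def blockMap (LA : A →L[ℝ] A) (LB : B →L[ℝ] B) (h : A × B → A × B) (z : A × B) : A × B :=
  (LA z.1 + (h z).1, LB z.2 + (h z).2)

/-- The numerical part of the estimate for the derivative at `0` of a graph transform: `y` stands for
`η^α`, and the gain `1 - 10^4 e` makes up for the change of the size `η`. -/
theorem derivative_bound {e y : ℝ} (he : 0 < e) (hy : 0 ≤ y) :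
    (1 - 10 ^ 5 * e) * (1 / 2 * y + 1 / 2 * (e * y)) + 2 * e * y ≤
      1 / 2 * (1 - 10 ^ 4 * e) * y := by
  have h : (1 - 10 ^ 5 * e) * (1 / 2 + 1 / 2 * e) + 2 * e ≤ 1 / 2 * (1 - 10 ^ 4 * e) := by
    nlinarith
  calc _ = ((1 - 10 ^ 5 * e) * (1 / 2 + 1 / 2 * e) + 2 * e) * y := by ring
    _ ≤ _ := mul_le_mul_of_nonneg_right h hy

/-- The numerical part of the estimate for the value at `0` of a graph transform: `s` stands for `η^2`
and `X` for the norm of the parameter that is mapped to `0`. -/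
theorem value_bound {e s X : ℝ} (he : 0 < e) (hel : 10 ^ 5 * e ≤ 1 / 2) (hs : 0 ≤ s)
    (hX0 : 0 ≤ X) (hX : X ≤ 2 * e * s) :
    (1 - 10 ^ 5 * e) * (1 / 10 ^ 3 * s + 1 / 2 * X) + (e * s + e * (1 / 10 ^ 3 * s + X)) ≤
      1 / 10 ^ 3 * (1 - 10 ^ 4 * e) * s := by
  have h1 : (1 - 10 ^ 5 * e) * (1 / 2 * X) ≤ 1 * (1 / 2 * X) := by gcongr; linarith
  have h2 : e * X ≤ 1 * X := by gcongr; linarith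
  have h3 : 0 ≤ e * s := by positivity
  linarith

/-- The block diagonal map contracts `A` and expands `B` at rate `a = 10^5 e`, and the
perturbation `h` is `C^(1+α)`-small, of order `e`, on the ball of radius `10 Q`. The sizes
`η ≤ p ≤ Q` belong to the source and `η' ≤ p'` to the target. The factor `10^5` leaves room for all
errors of order `e`: those of the perturbation, and the changes of the sizes by factors `1 + e`. -/
structure IsStep (α e Q η p η' p' : ℝ) (LA : A →L[ℝ] A) (LB : B →L[ℝ] B) (h : A × B → A × B)
    (dh : A × B → A × B →L[ℝ] A × B) : Prop where
  e_pos : 0 < e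
  e_le : 10 ^ 5 * e ≤ 1 / 2
  α_pos : 0 < α
  α_le : α ≤ 1
  η_pos : 0 < η
  η_le : η ≤ p
  p_le : p ≤ Q
  Q_le : Q ^ α ≤ e
  Q_le_one : Q ≤ 1
  η'_pos : 0 < η'
  η'_le : η' ≤ p'
  p'_le : p' ≤ (1 + e) * p
  η_le' : η ≤ (1 + e) * η'
  contract : ∀ s, ‖LA s‖ ≤ (1 - 10 ^ 5 * e) * ‖s‖
  expand : ∀ t, (1 + 10 ^ 5 * e) * ‖t‖ ≤ ‖LB t‖
  deriv : ∀ z ∈ Metric.closedBall (0 : A × B) (10 * Q), HasFDerivAt h (dh z) z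
  dh_le : ∀ z ∈ Metric.closedBall (0 : A × B) (10 * Q), ‖dh z‖ ≤ e
  dh_holder : ∀ z ∈ Metric.closedBall (0 : A × B) (10 * Q),
    ∀ z' ∈ Metric.closedBall (0 : A × B) (10 * Q), ‖dh z - dh z'‖ ≤ e * ‖z - z'‖ ^ α
  h_zero : ‖h 0‖ ≤ e * η ^ 2
  dh_zero : ‖dh 0‖ ≤ e * η ^ α

namespace IsStep

variable {α e Q η p η' p' : ℝ} {LA : A →L[ℝ] A} {LB : B →L[ℝ] B} {h : A × B → A × B}
  {dh : A × B → A × B →L[ℝ] A × B}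

theorem p_pos (hs : IsStep α e Q η p η' p' LA LB h dh) : 0 < p := hs.η_pos.trans_le hs.η_le

theorem Q_pos (hs : IsStep α e Q η p η' p' LA LB h dh) : 0 < Q := hs.p_pos.trans_le hs.p_le

theorem h_lip (hs : IsStep α e Q η p η' p' LA LB h dh) {z z' : A × B}
    (hz : z ∈ Metric.closedBall (0 : A × B) (10 * Q))
    (hz' : z' ∈ Metric.closedBall (0 : A × B) (10 * Q)) : ‖h z - h z'‖ ≤ e * ‖z - z'‖ :=
  (convex_closedBall 0 _).norm_image_sub_le_of_norm_hasFDerivWithin_le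
    (fun x hx => (hs.deriv x hx).hasFDerivWithinAt) hs.dh_le hz' hz

theorem norm_sub_fst_le (hs : IsStep α e Q η p η' p' LA LB h dh) {z z' : A × B}
    (hz : z ∈ Metric.closedBall (0 : A × B) (10 * Q))
    (hz' : z' ∈ Metric.closedBall (0 : A × B) (10 * Q)) :
    ‖(blockMap LA LB h z).1 - (blockMap LA LB h z').1‖ ≤
      (1 - 10 ^ 5 * e) * ‖z.1 - z'.1‖ + e * max ‖z.1 - z'.1‖ ‖z.2 - z'.2‖ := by
  have h1 := (norm_fst_le (h z - h z')).trans (hs.h_lip hz hz')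
  have h2 : (blockMap LA LB h z).1 - (blockMap LA LB h z').1 =
      LA (z.1 - z'.1) + (h z - h z').1 := by
    simp only [blockMap, map_sub, Prod.fst_sub]; abel
  rw [h2]
  exact (norm_add_le _ _).trans (add_le_add (hs.contract _) h1)

theorem le_norm_sub_snd (hs : IsStep α e Q η p η' p' LA LB h dh) {z z' : A × B}
    (hz : z ∈ Metric.closedBall (0 : A × B) (10 * Q))
    (hz' : z' ∈ Metric.closedBall (0 : A × B) (10 * Q)) :
    (1 + 10 ^ 5 * e) * ‖z.2 - z'.2‖ - e * max ‖z.1 - z'.1‖ ‖z.2 - z'.2‖ ≤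
      ‖(blockMap LA LB h z).2 - (blockMap LA LB h z').2‖ := by
  have h1 := (norm_snd_le (h z - h z')).trans (hs.h_lip hz hz')
  have h2 : LB (z.2 - z'.2) = ((blockMap LA LB h z).2 - (blockMap LA LB h z').2) -
      (h z - h z').2 := by
    simp only [blockMap, map_sub, Prod.snd_sub]; abel
  have h3 := hs.expand (z.2 - z'.2)
  rw [h2] at h3
  have h4 := h3.trans (norm_sub_le _ _)
  have h5 : ‖z - z'‖ = max ‖z.1 - z'.1‖ ‖z.2 - z'.2‖ := rfl
  rw [h5] at h1
  linarith

/-- If the images of two points differ mostly in the contracting direction, so did the points,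
and the difference has been contracted. -/
theorem cone (hs : IsStep α e Q η p η' p' LA LB h dh) {z z' : A × B}
    (hz : z ∈ Metric.closedBall (0 : A × B) (10 * Q))
    (hz' : z' ∈ Metric.closedBall (0 : A × B) (10 * Q))
    (hc : ‖(blockMap LA LB h z).2 - (blockMap LA LB h z').2‖ ≤
      ‖(blockMap LA LB h z).1 - (blockMap LA LB h z').1‖) :
    ‖z.2 - z'.2‖ ≤ ‖z.1 - z'.1‖ ∧
      ‖(blockMap LA LB h z).1 - (blockMap LA LB h z').1‖ ≤
        (1 - 10 ^ 5 * e / 2) * ‖z.1 - z'.1‖ := by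
  have h1 := hs.norm_sub_fst_le hz hz'
  have h2 := hs.le_norm_sub_snd hz hz'
  have he := hs.e_pos
  have h0 := norm_nonneg (z.1 - z'.1)
  have h0' := norm_nonneg (z.2 - z'.2)
  have h3 : ‖z.2 - z'.2‖ ≤ ‖z.1 - z'.1‖ := by
    by_contra! hlt
    rw [max_eq_right hlt.le] at h1 h2
    nlinarith [hs.e_le]
  rw [max_eq_left h3] at h1
  exact ⟨h3, by nlinarith⟩

theorem graph_mem (hs : IsStep α e Q η p η' p' LA LB h dh) {F : B → A} {P : B → B →L[ℝ] A}
    (hF : IsAdm α η p F P) {t : B} (ht : t ∈ Metric.closedBall (0 : B) p) :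
    (F t, t) ∈ Metric.closedBall (0 : A × B) (10 * Q) := by
  have h1 := hF.norm_le_phi hs.p_pos.le ht
  have h2 := mem_closedBall_zero_iff.1 ht
  have h3 := hs.p_le
  have h4 := hs.Q_le_one
  have h5 := hs.η_le
  have h6 := hs.η_pos
  rw [mem_closedBall_zero_iff, Prod.norm_def]
  refine max_le ?_ ?_
  · simp only
    nlinarith
  · simp only
    linarith [hs.Q_pos]

/-- In the maximum norm, the graph of an admissible function is parametrised isometrically by the
expanding coordinate. -/
theorem graph_dist {F : B → A} {P : B → B →L[ℝ] A} (hF : IsAdm α η p F P) {t t' : B}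
    (ht : t ∈ Metric.closedBall (0 : B) p) (ht' : t' ∈ Metric.closedBall (0 : B) p) :
    ‖((F t, t) : A × B) - (F t', t')‖ = ‖t - t'‖ := by
  rw [Prod.mk_sub_mk, Prod.norm_def]
  refine max_eq_right ((hF.lipschitz ht ht').trans ?_)
  simp only
  linarith [norm_nonneg (t - t')]

/-- The graph transform contracts the uniform distance. -/
theorem contraction (hs : IsStep α e Q η p η' p' LA LB h dh) {η₂ : ℝ} {F₁ F₂ G₁ G₂ : B → A}
    {P₁ P₂ : B → B →L[ℝ] A} (hF₁ : IsAdm α η p F₁ P₁) (hF₂ : IsAdm α η p F₂ P₂)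
    (hG₁ : ∀ τ ∈ Metric.closedBall (0 : B) η₂, ∃ t ∈ Metric.closedBall (0 : B) p,
      blockMap LA LB h (F₁ t, t) = (G₁ τ, τ))
    (hG₂ : ∀ τ ∈ Metric.closedBall (0 : B) η₂, ∃ t ∈ Metric.closedBall (0 : B) p,
      blockMap LA LB h (F₂ t, t) = (G₂ τ, τ)) {D : ℝ}
    (hD : ∀ t ∈ Metric.closedBall (0 : B) p, ‖F₁ t - F₂ t‖ ≤ D) {τ : B}
    (hτ : τ ∈ Metric.closedBall (0 : B) η₂) :
    ‖G₁ τ - G₂ τ‖ ≤ (1 - 10 ^ 5 * e / 2) * D := by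
  obtain ⟨t₁, ht₁, h₁⟩ := hG₁ τ hτ
  obtain ⟨t₂, ht₂, h₂⟩ := hG₂ τ hτ
  have z₁ := hs.graph_mem hF₁ ht₁
  have z₂ := hs.graph_mem hF₂ ht₂
  have a1 := hs.norm_sub_fst_le z₁ z₂
  have a2 := hs.le_norm_sub_snd z₁ z₂
  have a3 := hs.cone z₁ z₂
  rw [h₁, h₂] at a1 a2 a3
  simp only [sub_self, norm_zero] at a1 a2 a3
  have a4 := (a3 (norm_nonneg _)).1
  rw [max_eq_left a4] at a1 a2
  have a5 : ‖F₁ t₁ - F₂ t₂‖ ≤ D + 1 / 2 * ‖t₁ - t₂‖ := by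
    have : F₁ t₁ - F₂ t₂ = (F₁ t₁ - F₂ t₁) + (F₂ t₁ - F₂ t₂) := by abel
    rw [this]
    exact (norm_add_le _ _).trans (add_le_add (hD _ ht₁) (hF₂.lipschitz ht₁ ht₂))
  have he := hs.e_pos
  have he' := hs.e_le
  have n1 := norm_nonneg (t₁ - t₂)
  have n2 := norm_nonneg (F₁ t₁ - F₂ t₂)
  set X := ‖F₁ t₁ - F₂ t₂‖
  set Y := ‖t₁ - t₂‖
  have b1 : Y ≤ e * X := by nlinarith
  have b2 : (1 - e / 2) * X ≤ D := by nlinarith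
  have b3 : ‖G₁ τ - G₂ τ‖ ≤ (1 - 10 ^ 5 * e + e) * X := by nlinarith
  refine b3.trans ?_
  have b4 : (1 - 10 ^ 5 * e + e) ≤ (1 - 10 ^ 5 * e / 2) * (1 - e / 2) := by nlinarith
  calc _ ≤ (1 - 10 ^ 5 * e / 2) * (1 - e / 2) * X := by gcongr
    _ = (1 - 10 ^ 5 * e / 2) * ((1 - e / 2) * X) := by ring
    _ ≤ _ := by
      refine mul_le_mul_of_nonneg_left b2 ?_
      linarith

variable [FiniteDimensional ℝ B]

/-- The image of the graph of an admissible function covers the target ball. -/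
theorem exists_preimage (hs : IsStep α e Q η p η' p' LA LB h dh) {F : B → A} {P : B → B →L[ℝ] A}
    (hF : IsAdm α η p F P) {τ : B} (hτ : τ ∈ Metric.closedBall (0 : B) p') :
    ∃ t ∈ Metric.closedBall (0 : B) p, (blockMap LA LB h (F t, t)).2 = τ := by
  have : CompleteSpace B := FiniteDimensional.complete ℝ B
  have he := hs.e_pos
  have hinj : Function.Injective (LB : B →ₗ[ℝ] B) := by
    rw [injective_iff_map_eq_zero]
    intro t ht
    have h1 := hs.expand t
    have h2 : LB t = 0 := ht
    rw [h2, norm_zero] at h1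
    have := norm_nonneg t
    exact norm_eq_zero.1 (by nlinarith)
  let Le : B ≃ₗ[ℝ] B := LinearEquiv.ofInjectiveEndo (LB : B →ₗ[ℝ] B) hinj
  have hLe : ∀ t, LB (Le.symm t) = t := fun t => Le.apply_symm_apply t
  have hLn : ∀ t, ‖Le.symm t‖ ≤ ‖t‖ / (1 + 10 ^ 5 * e) := fun t => by
    rw [le_div_iff₀ (by positivity), mul_comm]
    have := hs.expand (Le.symm t)
    rwa [hLe] at this
  have h00 : (0 : A × B) ∈ Metric.closedBall (0 : A × B) (10 * Q) :=
    Metric.mem_closedBall_self (by linarith [hs.Q_pos])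
  let Φ : B → B := fun t => Le.symm (τ - (h (F t, t)).2)
  have hτn := mem_closedBall_zero_iff.1 hτ
  have hmaps : MapsTo Φ (Metric.closedBall 0 p) (Metric.closedBall 0 p) := by
    intro t ht
    rw [mem_closedBall_zero_iff]
    refine (hLn _).trans ?_
    rw [div_le_iff₀ (by positivity)]
    have h1 := hs.h_lip (hs.graph_mem hF ht) h00
    have h2 : ‖(h (F t, t)).2‖ ≤ ‖h (F t, t)‖ := norm_snd_le _
    have h3 := norm_le_norm_add_norm_sub (h 0) (h (F t, t))
    rw [norm_sub_rev] at h3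
    have h4 := hs.h_zero
    have h5 := norm_sub_le τ (h (F t, t)).2
    have h6 := hF.norm_le_phi hs.p_pos.le ht
    have h7 := mem_closedBall_zero_iff.1 ht
    have h1' : ‖((F t, t) : A × B)‖ = max ‖F t‖ ‖t‖ := rfl
    rw [sub_zero, h1'] at h1
    have hη1 : η ≤ 1 := hs.η_le.trans (hs.p_le.trans hs.Q_le_one)
    have hη2 : η ^ 2 ≤ p := by nlinarith [hs.η_pos, hs.η_le]
    have h8 : max ‖F t‖ ‖t‖ ≤ p := by
      refine max_le ?_ h7
      linarith [hs.p_pos]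
    have h9 : e * max ‖F t‖ ‖t‖ ≤ e * p := by gcongr
    have h10 : e * η ^ 2 ≤ e * p := by gcongr
    have h11 := hs.p'_le
    nlinarith [hs.p_pos]
  have hcontr : ContractingWith (1 / 2) (hmaps.restrict Φ _ _) := by
    refine ⟨by rw [← NNReal.coe_lt_coe]; norm_num, LipschitzWith.of_dist_le_mul ?_⟩
    rintro ⟨t, ht⟩ ⟨t', ht'⟩
    rw [Subtype.dist_eq, Subtype.dist_eq, dist_eq_norm, dist_eq_norm]
    simp only [MapsTo.val_restrict_apply]
    have h1 : Φ t - Φ t' = Le.symm (-((h (F t, t) - h (F t', t')).2)) := by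
      simp only [Φ]
      rw [← map_sub, Prod.snd_sub]
      congr 1
      abel
    rw [h1]
    refine (hLn _).trans ?_
    rw [norm_neg, div_le_iff₀ (by positivity)]
    have h2 := (norm_snd_le _).trans (hs.h_lip (hs.graph_mem hF ht) (hs.graph_mem hF ht'))
    rw [graph_dist hF ht ht'] at h2
    refine h2.trans ?_
    have := norm_nonneg (t - t')
    have h4 := hs.e_le
    have : e ≤ 1 / 2 * (1 + 10 ^ 5 * e) := by linarith
    push_cast
    nlinarith
  obtain ⟨t, ht, hfix, -⟩ := hcontr.exists_fixedPoint' (Metric.isClosed_closedBall.isComplete)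
    hmaps (Metric.mem_closedBall_self hs.p_pos.le) (edist_ne_top _ _)
  refine ⟨t, ht, ?_⟩
  have h1 : LB (Φ t) = LB t := congrArg LB hfix
  simp only [Φ] at h1
  rw [hLe] at h1
  simp only [blockMap]
  rw [← h1]
  abel

set_option maxHeartbeats 1000000 in
/-- The graph transform of an admissible function exists and is admissible. -/
theorem exists_transform (hs : IsStep α e Q η p η' p' LA LB h dh) {F : B → A} {P : B → B →L[ℝ] A}
    (hF : IsAdm α η p F P) : ∃ G P', IsAdm α η' p' G P' ∧
      ∀ τ ∈ Metric.closedBall (0 : B) p', ∃ t ∈ Metric.closedBall (0 : B) p,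
        blockMap LA LB h (F t, t) = (G τ, τ) := by
  have : CompleteSpace B := FiniteDimensional.complete ℝ B
  have he := hs.e_pos
  have hel := hs.e_le
  have hα := hs.α_pos
  have hη := hs.η_pos
  have hp' : 0 < p' := hs.η'_pos.trans_le hs.η'_le
  have h0' : (0 : B) ∈ Metric.closedBall (0 : B) p' := Metric.mem_closedBall_self hp'.le
  have h0 : (0 : B) ∈ Metric.closedBall (0 : B) p := Metric.mem_closedBall_self hs.p_pos.le
  have h00 : (0 : A × B) ∈ Metric.closedBall (0 : A × B) (10 * Q) :=
    Metric.mem_closedBall_self (by linarith [hs.Q_pos])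
  have hr : ∀ τ, ∃ t, τ ∈ Metric.closedBall (0 : B) p' → t ∈ Metric.closedBall (0 : B) p ∧
      (blockMap LA LB h (F t, t)).2 = τ := by
    intro τ
    by_cases hτ : τ ∈ Metric.closedBall (0 : B) p'
    · obtain ⟨t, ht, hh⟩ := hs.exists_preimage hF hτ
      exact ⟨t, fun _ => ⟨ht, hh⟩⟩
    · exact ⟨0, fun h => absurd h hτ⟩
  choose r hr using hr
  -- `r` is a contraction
  have hrl : ∀ τ ∈ Metric.closedBall (0 : B) p', ∀ τ' ∈ Metric.closedBall (0 : B) p',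
      ‖r τ - r τ'‖ ≤ ‖τ - τ'‖ := by
    intro τ hτ τ' hτ'
    obtain ⟨a1, a2⟩ := hr τ hτ
    obtain ⟨b1, b2⟩ := hr τ' hτ'
    have h1 := hs.le_norm_sub_snd (hs.graph_mem hF a1) (hs.graph_mem hF b1)
    rw [a2, b2] at h1
    have h2 := graph_dist hF a1 b1
    rw [Prod.norm_def] at h2
    simp only [Prod.mk_sub_mk] at h2
    simp only at h1
    rw [h2] at h1
    nlinarith [norm_nonneg (r τ - r τ')]
  have hrc : ∀ τ ∈ Metric.closedBall (0 : B) p', Tendsto r (𝓝[Metric.closedBall 0 p'] τ)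
      (𝓝[Metric.closedBall 0 p] (r τ)) := by
    intro τ hτ
    have hlip : LipschitzOnWith 1 r (Metric.closedBall 0 p') := by
      refine LipschitzOnWith.of_dist_le_mul fun x hx y hy => ?_
      rw [dist_eq_norm, dist_eq_norm, NNReal.coe_one, one_mul]
      exact hrl x hx y hy
    exact tendsto_nhdsWithin_iff.2 ⟨hlip.continuousOn τ hτ,
      eventually_mem_nhdsWithin.mono fun x hx => (hr x hx).1⟩
  -- the derivatives along the graph
  let J : B → B →L[ℝ] A × B := fun t => (P t).prod (ContinuousLinearMap.id ℝ B)
  let N : B → B →L[ℝ] A × B := fun t => dh (F t, t) ∘L J t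
  let W : B → B →L[ℝ] B := fun t => LB + ContinuousLinearMap.snd ℝ A B ∘L N t
  let V : B → B →L[ℝ] A := fun t => LA ∘L P t + ContinuousLinearMap.fst ℝ A B ∘L N t
  have hJ1 : ∀ t ∈ Metric.closedBall (0 : B) p, ‖J t‖ ≤ 1 := fun t ht => by
    refine ContinuousLinearMap.opNorm_le_bound _ zero_le_one fun b => ?_
    rw [one_mul]
    change ‖((P t b, b) : A × B)‖ ≤ _
    rw [Prod.norm_def]
    refine max_le ?_ le_rfl
    have := (P t).le_of_opNorm_le (hF.norm_le t ht) b
    simp only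
    linarith [norm_nonneg b]
  have hN1 : ∀ t ∈ Metric.closedBall (0 : B) p, ‖N t‖ ≤ e := fun t ht =>
    ((ContinuousLinearMap.opNorm_comp_le _ _).trans (mul_le_mul (hs.dh_le _ (hs.graph_mem hF ht))
      (hJ1 t ht) (norm_nonneg _) he.le)).trans (mul_one e).le
  have hsnd : ∀ L : B →L[ℝ] A × B, ‖ContinuousLinearMap.snd ℝ A B ∘L L‖ ≤ ‖L‖ := fun L =>
    (ContinuousLinearMap.opNorm_comp_le _ _).trans
      (mul_le_of_le_one_left (norm_nonneg _) (ContinuousLinearMap.norm_snd_le ℝ A B))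
  have hfst : ∀ L : B →L[ℝ] A × B, ‖ContinuousLinearMap.fst ℝ A B ∘L L‖ ≤ ‖L‖ := fun L =>
    (ContinuousLinearMap.opNorm_comp_le _ _).trans
      (mul_le_of_le_one_left (norm_nonneg _) (ContinuousLinearMap.norm_fst_le ℝ A B))
  have hWe : ∀ t ∈ Metric.closedBall (0 : B) p, ∀ b, (1 + 10 ^ 5 * e - e) * ‖b‖ ≤ ‖W t b‖ := by
    intro t ht b
    have h1 := hs.expand b
    have h2 := (ContinuousLinearMap.snd ℝ A B ∘L N t).le_of_opNorm_le ((hsnd _).trans (hN1 t ht)) b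
    have h3 : LB b = W t b - (ContinuousLinearMap.snd ℝ A B ∘L N t) b := by
      simp only [W, _root_.add_apply, add_sub_cancel_right]
    rw [h3] at h1
    have := h1.trans (norm_sub_le _ _)
    linarith
  have hWinj : ∀ t ∈ Metric.closedBall (0 : B) p, Function.Injective (W t : B →ₗ[ℝ] B) := by
    intro t ht
    rw [injective_iff_map_eq_zero]
    intro b hb
    have h1 := hWe t ht b
    have h2 : W t b = 0 := hb
    rw [h2, norm_zero] at h1
    exact norm_eq_zero.1 (by nlinarith [norm_nonneg b])
  have hWinv : ∀ t, ∃ R : B →L[ℝ] B, t ∈ Metric.closedBall (0 : B) p →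
      (∀ b, R (W t b) = b) ∧ ∀ b, W t (R b) = b := by
    intro t
    by_cases ht : t ∈ Metric.closedBall (0 : B) p
    · let Le : B ≃ₗ[ℝ] B := LinearEquiv.ofInjectiveEndo (W t : B →ₗ[ℝ] B) (hWinj t ht)
      exact ⟨Le.toContinuousLinearEquiv.symm, fun _ =>
        ⟨fun b => Le.symm_apply_apply b, fun b => Le.apply_symm_apply b⟩⟩
    · exact ⟨0, fun h => absurd h ht⟩
  choose R hR using hWinv
  let G : B → A := fun τ => (blockMap LA LB h (F (r τ), r τ)).1
  let P' : B → B →L[ℝ] A := fun τ => V (r τ) ∘L R (r τ)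
  have hgraph : ∀ τ ∈ Metric.closedBall (0 : B) p',
      blockMap LA LB h (F (r τ), r τ) = (G τ, τ) := fun τ hτ => Prod.ext rfl (hr τ hτ).2
  have hP'W : ∀ τ ∈ Metric.closedBall (0 : B) p', P' τ ∘L W (r τ) = V (r τ) := by
    intro τ hτ
    ext b
    simp only [P', ContinuousLinearMap.comp_apply, ((hR (r τ)) (hr τ hτ).1).1 b]
  -- cancelling `W` on the right
  have hcancel : ∀ t ∈ Metric.closedBall (0 : B) p, ∀ (L : B →L[ℝ] A) (c : ℝ), 0 ≤ c →
      ‖L ∘L W t‖ ≤ c → ‖L‖ ≤ c / (1 + 10 ^ 5 * e - e) := by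
    intro t ht L c hc hL
    have hpos : 0 < 1 + 10 ^ 5 * e - e := by linarith
    refine ContinuousLinearMap.opNorm_le_bound _ (by positivity) fun b => ?_
    have h1 := (L ∘L W t).le_of_opNorm_le hL (R t b)
    rw [ContinuousLinearMap.comp_apply, ((hR t) ht).2 b] at h1
    have h2 := hWe t ht (R t b)
    rw [((hR t) ht).2 b] at h2
    refine h1.trans ?_
    rw [div_mul_eq_mul_div, le_div_iff₀ hpos]
    nlinarith [norm_nonneg (R t b)]
  have hderiv : ∀ τ ∈ Metric.closedBall (0 : B) p',
      HasFDerivWithinAt G (P' τ) (Metric.closedBall 0 p') τ := by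
    intro τ hτ
    obtain ⟨ht, hUt⟩ := hr τ hτ
    have d1 : HasFDerivWithinAt (fun t => ((F t, t) : A × B)) (J (r τ)) (Metric.closedBall 0 p)
        (r τ) := (hF.deriv _ ht).prodMk (hasFDerivWithinAt_id _ _)
    have d2 : HasFDerivWithinAt (fun t => h (F t, t)) (N (r τ)) (Metric.closedBall 0 p) (r τ) :=
      HasFDerivAt.comp_hasFDerivWithinAt (g := h) (r τ) (hs.deriv _ (hs.graph_mem hF ht)) d1
    have d3 : HasFDerivWithinAt (fun t => (blockMap LA LB h (F t, t)).2) (W (r τ))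
        (Metric.closedBall 0 p) (r τ) :=
      (LB.hasFDerivWithinAt).add ((ContinuousLinearMap.snd ℝ A B).hasFDerivAt.comp_hasFDerivWithinAt
        _ d2)
    have d4 : HasFDerivWithinAt (fun t => (blockMap LA LB h (F t, t)).1) (V (r τ))
        (Metric.closedBall 0 p) (r τ) :=
      (LA.hasFDerivAt.comp_hasFDerivWithinAt _ (hF.deriv _ ht)).add
        ((ContinuousLinearMap.fst ℝ A B).hasFDerivAt.comp_hasFDerivWithinAt _ d2)
    have d5 : HasFDerivWithinAt r (R (r τ) ∘L ContinuousLinearMap.id ℝ B)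
        (Metric.closedBall 0 p') τ := by
      refine HasFDerivWithinAt.of_comp_of_leftInverse (hrc τ hτ) d3 (hasFDerivWithinAt_id τ _)
        ?_ ((hR (r τ)) ht).1 hτ
      filter_upwards [self_mem_nhdsWithin] with x hx
      exact (hr x hx).2
    exact HasFDerivWithinAt.comp (g := fun t => (blockMap LA LB h (F t, t)).1) τ d4 d5
      fun x hx => (hr x hx).1
  obtain ⟨m, k, hm0, hk0, hmk, hm, hk⟩ := hF.exists_bounds hs.p_pos.le
  have hpos : 0 < 1 + 10 ^ 5 * e - e := by linarith
  have hposA : 0 ≤ 1 - 10 ^ 5 * e := by linarith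
  have hLA : ‖LA‖ ≤ 1 - 10 ^ 5 * e := ContinuousLinearMap.opNorm_le_bound _ hposA hs.contract
  have hLAP : ∀ L : B →L[ℝ] A, ‖LA ∘L L‖ ≤ (1 - 10 ^ 5 * e) * ‖L‖ := fun L =>
    (ContinuousLinearMap.opNorm_comp_le _ _).trans
      (mul_le_mul_of_nonneg_right hLA (norm_nonneg _))
  have hV : ∀ t, ‖V t‖ ≤ (1 - 10 ^ 5 * e) * ‖P t‖ + ‖N t‖ := fun t =>
    (norm_add_le _ _).trans (add_le_add (hLAP _) (hfst _))
  set m' := ((1 - 10 ^ 5 * e) * m + e) / (1 + 10 ^ 5 * e - e) with hm'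
  have hm'bound : ∀ τ ∈ Metric.closedBall (0 : B) p', ‖P' τ‖ ≤ m' := by
    intro τ hτ
    have ht := (hr τ hτ).1
    refine hcancel _ ht _ _ (by positivity) ?_
    rw [hP'W τ hτ]
    refine (hV _).trans (add_le_add (mul_le_mul_of_nonneg_left (hm _ ht) hposA) (hN1 _ ht))
  have hm'0 : 0 ≤ m' := by positivity
  have hm'1 : m' ≤ 1 / 2 := by
    rw [hm', div_le_iff₀ hpos]
    nlinarith
  -- Hölder bound
  have hNh : ∀ t ∈ Metric.closedBall (0 : B) p, ∀ t' ∈ Metric.closedBall (0 : B) p,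
      ‖N t - N t'‖ ≤ (3 / 2 * e) * ‖t - t'‖ ^ α := by
    intro t ht t' ht'
    refine (norm_comp_sub_comp_le _ _ _ _).trans ?_
    have h1 := hs.dh_holder _ (hs.graph_mem hF ht) _ (hs.graph_mem hF ht')
    rw [graph_dist hF ht ht'] at h1
    have h2 := hs.dh_le _ (hs.graph_mem hF ht')
    have h3 : ‖J t - J t'‖ ≤ 1 / 2 * ‖t - t'‖ ^ α := by
      refine ContinuousLinearMap.opNorm_le_bound _ (by positivity) fun b => ?_
      have h4 : (J t - J t') b = ((P t - P t') b, 0) := by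
        simp only [J, _root_.sub_apply, ContinuousLinearMap.prod_apply, Prod.mk_sub_mk, sub_self]
      rw [h4, Prod.norm_def, norm_zero]
      exact max_le ((P t - P t').le_of_opNorm_le (hF.holder_half ht ht') b) (by positivity)
    calc _ ≤ (e * ‖t - t'‖ ^ α) * 1 + e * (1 / 2 * ‖t - t'‖ ^ α) :=
          add_le_add (mul_le_mul h1 (hJ1 t ht) (norm_nonneg _) (by positivity))
            (mul_le_mul h2 h3 (norm_nonneg _) he.le)
      _ = _ := by ring
  set k' := ((1 - 10 ^ 5 * e) * k + 3 * e) / (1 + 10 ^ 5 * e - e) with hk'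
  have hk'bound : ∀ τ ∈ Metric.closedBall (0 : B) p', ∀ τ' ∈ Metric.closedBall (0 : B) p',
      ‖P' τ - P' τ'‖ ≤ k' * ‖τ - τ'‖ ^ α := by
    intro τ hτ τ' hτ'
    have ht := (hr τ hτ).1
    have ht' := (hr τ' hτ').1
    have hX : ‖r τ - r τ'‖ ^ α ≤ ‖τ - τ'‖ ^ α :=
      Real.rpow_le_rpow (norm_nonneg _) (hrl τ hτ τ' hτ') hα.le
    have hX0 : 0 ≤ ‖r τ - r τ'‖ ^ α := by positivity
    rw [hk', div_mul_eq_mul_div]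
    refine hcancel _ ht _ _ (by positivity) ?_
    have h1 : (P' τ - P' τ') ∘L W (r τ) =
        (LA ∘L (P (r τ) - P (r τ')) + ContinuousLinearMap.fst ℝ A B ∘L (N (r τ) - N (r τ'))) -
          P' τ' ∘L (ContinuousLinearMap.snd ℝ A B ∘L (N (r τ) - N (r τ'))) := by
      have e1 := hP'W τ hτ
      have e2 := hP'W τ' hτ'
      have e3 : P' τ' ∘L W (r τ) = P' τ' ∘L W (r τ') + P' τ' ∘L (ContinuousLinearMap.snd ℝ A B ∘L
          (N (r τ) - N (r τ'))) := by
        rw [← ContinuousLinearMap.comp_add]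
        congr 1
        simp only [W, ContinuousLinearMap.comp_sub]
        abel
      rw [ContinuousLinearMap.sub_comp, e1, e3, e2]
      simp only [V, ContinuousLinearMap.comp_sub]
      abel
    rw [h1]
    have hn := hNh _ ht _ ht'
    have b1 : ‖LA ∘L (P (r τ) - P (r τ'))‖ ≤ (1 - 10 ^ 5 * e) * (k * ‖r τ - r τ'‖ ^ α) :=
      (hLAP _).trans (mul_le_mul_of_nonneg_left (hk _ ht _ ht') hposA)
    have b2 := (hfst (N (r τ) - N (r τ'))).trans hn
    have b3 : ‖P' τ' ∘L (ContinuousLinearMap.snd ℝ A B ∘L (N (r τ) - N (r τ')))‖ ≤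
        1 * ((3 / 2 * e) * ‖r τ - r τ'‖ ^ α) :=
      (ContinuousLinearMap.opNorm_comp_le _ _).trans (mul_le_mul
        ((hm'bound τ' hτ').trans (hm'1.trans (by norm_num))) ((hsnd _).trans hn)
        (norm_nonneg _) zero_le_one)
    calc _ ≤ ((1 - 10 ^ 5 * e) * (k * ‖r τ - r τ'‖ ^ α) + (3 / 2 * e) * ‖r τ - r τ'‖ ^ α) +
          1 * ((3 / 2 * e) * ‖r τ - r τ'‖ ^ α) :=
          (norm_sub_le _ _).trans (add_le_add ((norm_add_le _ _).trans (add_le_add b1 b2)) b3)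
      _ = ((1 - 10 ^ 5 * e) * k + 3 * e) * ‖r τ - r τ'‖ ^ α := by ring
      _ ≤ _ := by gcongr
  have hk'0 : 0 ≤ k' := by positivity
  have hsum : m' + k' ≤ 1 / 2 := by
    rw [hm', hk', ← add_div, div_le_iff₀ hpos]
    nlinarith
  -- the preimage of `0` is small
  obtain ⟨ht0, hU0⟩ := hr 0 h0'
  have hz0 := hs.graph_mem hF ht0
  have hη1 : η ≤ 1 := hs.η_le.trans (hs.p_le.trans hs.Q_le_one)
  set X := ‖r 0‖ with hX
  have hF0 : ‖F (r 0)‖ ≤ 1 / 10 ^ 3 * η ^ 2 + 1 / 2 * X := hF.norm_le_phi hs.p_pos.le ht0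
  have hzn : ‖((F (r 0), r 0) : A × B)‖ ≤ 1 / 10 ^ 3 * η ^ 2 + X := by
    rw [Prod.norm_def]
    exact max_le (by simp only; linarith [norm_nonneg (r 0)])
      (le_add_of_nonneg_left (by positivity))
  have hhz : ‖h (F (r 0), r 0)‖ ≤ e * η ^ 2 + e * (1 / 10 ^ 3 * η ^ 2 + X) := by
    have h1 := hs.h_lip hz0 h00
    rw [sub_zero] at h1
    have h3 := norm_le_norm_add_norm_sub (h 0) (h (F (r 0), r 0))
    rw [norm_sub_rev] at h3
    have h4 := mul_le_mul_of_nonneg_left hzn he.le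
    linarith [hs.h_zero]
  have hη20 : 0 < η ^ 2 := by positivity
  have hX0 : 0 ≤ X := norm_nonneg _
  have hXle : X ≤ 2 * e * η ^ 2 := by
    have h1 : LB (r 0) = -(h (F (r 0), r 0)).2 := by
      have : LB (r 0) + (h (F (r 0), r 0)).2 = 0 := hU0
      exact eq_neg_of_add_eq_zero_left this
    have h2 := hs.expand (r 0)
    rw [h1, norm_neg] at h2
    have h3 := h2.trans (norm_snd_le _)
    nlinarith
  have hηη : η ^ 2 ≤ (1 + 3 * e) * η' ^ 2 := by
    have h1 : η ^ 2 ≤ ((1 + e) * η') ^ 2 := pow_le_pow_left₀ hη.le hs.η_le' 2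
    have h2 : 0 < η' ^ 2 := pow_pos hs.η'_pos 2
    rw [mul_pow] at h1
    exact h1.trans (mul_le_mul_of_nonneg_right (by nlinarith) h2.le)
  have hηα : η ^ α ≤ (1 + e) * η' ^ α := by
    have h1 : η ^ α ≤ ((1 + e) * η') ^ α := Real.rpow_le_rpow hη.le hs.η_le' hα.le
    rw [Real.mul_rpow (by linarith) hs.η'_pos.le] at h1
    refine h1.trans (mul_le_mul_of_nonneg_right ?_ (Real.rpow_nonneg hs.η'_pos.le _))
    calc (1 + e) ^ α ≤ (1 + e) ^ (1 : ℝ) :=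
          Real.rpow_le_rpow_of_exponent_le (by linarith) hs.α_le
      _ = 1 + e := Real.rpow_one _
  have hη2α : ∀ x : ℝ, 0 ≤ x → x ≤ η ^ 2 → x ^ α ≤ e * η ^ α := by
    intro x hx hxη
    calc x ^ α ≤ (η ^ 2) ^ α := Real.rpow_le_rpow hx hxη hα.le
      _ = η ^ α * η ^ α := by rw [sq, Real.mul_rpow hη.le hη.le]
      _ ≤ e * η ^ α := by
        refine mul_le_mul_of_nonneg_right ?_ (by positivity)
        exact (Real.rpow_le_rpow hη.le (hs.η_le.trans hs.p_le) hα.le).trans hs.Q_le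
  have hηα0 : 0 < η' ^ α := Real.rpow_pos_of_pos hs.η'_pos _
  have hηα1 : 0 < η ^ α := Real.rpow_pos_of_pos hη _
  refine ⟨G, P', IsAdm.of_bounds hsum hderiv hm'bound hk'0 hk'bound ?_ ?_, fun τ hτ =>
    ⟨r τ, (hr τ hτ).1, hgraph τ hτ⟩⟩
  · have h1 : ‖P (r 0)‖ ≤ 1 / 2 * η ^ α + 1 / 2 * (e * η ^ α) := by
      have h2 := hF.holder_half ht0 h0
      rw [sub_zero] at h2
      have h3 := hη2α X hX0 (by nlinarith)
      have h4 := norm_le_norm_add_norm_sub (P 0) (P (r 0))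
      rw [norm_sub_rev] at h4
      linarith [hF.iota]
    have h5 : ‖N (r 0)‖ ≤ 2 * e * η ^ α := by
      have h6 := hs.dh_holder _ hz0 _ h00
      rw [sub_zero] at h6
      have h7 := hη2α ‖((F (r 0), r 0) : A × B)‖ (norm_nonneg _) (by nlinarith)
      have h8 := norm_le_norm_add_norm_sub (dh 0) (dh (F (r 0), r 0))
      rw [norm_sub_rev] at h8
      have h9 : ‖dh (F (r 0), r 0)‖ ≤ 2 * e * η ^ α := by
        have := hs.dh_zero
        have h10 : e * ‖((F (r 0), r 0) : A × B)‖ ^ α ≤ e * (e * η ^ α) := by gcongr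
        have h11 : e * (e * η ^ α) ≤ 1 * (e * η ^ α) :=
          mul_le_mul_of_nonneg_right (by linarith) (by positivity)
        linarith
      exact (ContinuousLinearMap.opNorm_comp_le _ _).trans
        (((mul_le_mul h9 (hJ1 _ ht0) (norm_nonneg _) (by positivity))).trans (mul_one _).le)
    have h11 : ‖P' 0‖ ≤ ((1 - 10 ^ 5 * e) * (1 / 2 * η ^ α + 1 / 2 * (e * η ^ α)) +
        2 * e * η ^ α) / (1 + 10 ^ 5 * e - e) := by
      refine hcancel _ ht0 _ _ (by positivity) ?_
      rw [hP'W 0 h0']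
      exact (hV _).trans (add_le_add (mul_le_mul_of_nonneg_left h1 hposA) h5)
    refine h11.trans ?_
    rw [div_le_iff₀ hpos]
    have h12 : (1 - 10 ^ 5 * e) * (1 / 2 * η ^ α + 1 / 2 * (e * η ^ α)) + 2 * e * η ^ α ≤
        1 / 2 * (1 - 10 ^ 4 * e) * η ^ α := derivative_bound he hηα1.le
    have h13 : (1 - 10 ^ 4 * e) * (1 + e) ≤ 1 + 10 ^ 5 * e - e := by nlinarith
    have h14 : 0 ≤ 1 - 10 ^ 4 * e := by linarith
    calc _ ≤ 1 / 2 * (1 - 10 ^ 4 * e) * η ^ α := h12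
      _ ≤ 1 / 2 * (1 - 10 ^ 4 * e) * ((1 + e) * η' ^ α) := by gcongr
      _ = 1 / 2 * η' ^ α * ((1 - 10 ^ 4 * e) * (1 + e)) := by ring
      _ ≤ _ := by gcongr
  · have h1 : G 0 = LA (F (r 0)) + (h (F (r 0), r 0)).1 := rfl
    rw [h1]
    have h2 := hs.contract (F (r 0))
    have h3 := (norm_fst_le _).trans hhz
    have h4 : (1 - 10 ^ 5 * e) * ‖F (r 0)‖ ≤
        (1 - 10 ^ 5 * e) * (1 / 10 ^ 3 * η ^ 2 + 1 / 2 * X) := by gcongr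
    have h5 : ‖LA (F (r 0)) + (h (F (r 0), r 0)).1‖ ≤ 1 / 10 ^ 3 * (1 - 10 ^ 4 * e) * η ^ 2 := by
      refine ((norm_add_le _ _).trans (add_le_add (h2.trans h4) h3)).trans ?_
      exact value_bound he hel hη20.le hX0 hXle
    refine h5.trans ?_
    have h6 : (1 - 10 ^ 4 * e) * (1 + 3 * e) ≤ 1 := by nlinarith
    have h14 : 0 ≤ 1 - 10 ^ 4 * e := by linarith
    have h7 : 0 < η' ^ 2 := pow_pos hs.η'_pos 2
    calc _ ≤ 1 / 10 ^ 3 * (1 - 10 ^ 4 * e) * ((1 + 3 * e) * η' ^ 2) := by gcongr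
      _ = 1 / 10 ^ 3 * (((1 - 10 ^ 4 * e) * (1 + 3 * e)) * η' ^ 2) := by ring
      _ ≤ 1 / 10 ^ 3 * (1 * η' ^ 2) := by gcongr
      _ = _ := by ring

end IsStep

end GraphTransform

/-! ### Ladder functions -/

section Ladder

variable {Γ γ : ℝ}

theorem le_ladder (hΓ : 0 ≤ Γ) {x : ℝ} (hx : 0 ≤ x) : x ≤ ladder Γ γ x :=
  le_mul_of_one_le_right hx (Real.one_le_exp (by positivity))

theorem ladder_mono (hΓ : 0 ≤ Γ) (hγ : 0 < γ) {x y : ℝ} (hx : 0 ≤ x) (hxy : x ≤ y) :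
    ladder Γ γ x ≤ ladder Γ γ y := by
  have h : x ^ (1 / γ) ≤ y ^ (1 / γ) := Real.rpow_le_rpow hx hxy (by positivity)
  unfold ladder
  have := hx.trans hxy
  gcongr

theorem ladder_strictMono (hΓ : 0 ≤ Γ) (hγ : 0 < γ) {x y : ℝ} (hx : 0 ≤ x) (hxy : x < y) :
    ladder Γ γ x < ladder Γ γ y := by
  have h : x ^ (1 / γ) ≤ y ^ (1 / γ) := Real.rpow_le_rpow hx hxy.le (by positivity)
  have := hx.trans_lt hxy
  calc x * Real.exp (Γ * x ^ (1 / γ)) ≤ x * Real.exp (Γ * y ^ (1 / γ)) := by gcongr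
    _ < y * Real.exp (Γ * y ^ (1 / γ)) := mul_lt_mul_of_pos_right hxy (Real.exp_pos _)

theorem exists_ladder_eq (hΓ : 0 ≤ Γ) (hγ : 0 < γ) {y : ℝ} (hy : 0 < y) :
    ∃ x ∈ Ioi (0 : ℝ), ladder Γ γ x = y := by
  have hc : ContinuousOn (ladder Γ γ) (Icc 0 y) := by
    have h : Continuous (ladder Γ γ) := by
      unfold ladder
      exact continuous_id.mul (Real.continuous_exp.comp (continuous_const.mul
        (Real.continuous_rpow_const (by positivity))))
    exact h.continuousOn
  have h0 : ladder Γ γ 0 = 0 := by simp [ladder]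
  obtain ⟨x, hx, hxy⟩ := intermediate_value_Icc hy.le hc
    (show y ∈ Icc (ladder Γ γ 0) (ladder Γ γ y) from ⟨by rw [h0]; exact hy.le, le_ladder hΓ hy.le⟩)
  refine ⟨x, hx.1.lt_of_ne ?_, hxy⟩
  rintro rfl
  rw [h0] at hxy
  exact hy.ne hxy

theorem ladderInv_pos (hΓ : 0 ≤ Γ) (hγ : 0 < γ) {y : ℝ} (hy : 0 < y) : 0 < ladderInv Γ γ y :=
  Function.invFunOn_mem (exists_ladder_eq hΓ hγ hy)

theorem ladder_ladderInv (hΓ : 0 ≤ Γ) (hγ : 0 < γ) {y : ℝ} (hy : 0 < y) :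
    ladder Γ γ (ladderInv Γ γ y) = y :=
  Function.invFunOn_eq (exists_ladder_eq hΓ hγ hy)

theorem ladderInv_le_self (hΓ : 0 ≤ Γ) (hγ : 0 < γ) {y : ℝ} (hy : 0 < y) : ladderInv Γ γ y ≤ y :=
  (le_ladder hΓ (ladderInv_pos hΓ hγ hy).le).trans (ladder_ladderInv hΓ hγ hy).le

theorem ladderInv_le_of_le_ladder (hΓ : 0 ≤ Γ) (hγ : 0 < γ) {x y : ℝ} (hx : 0 < x) (hy : 0 ≤ y)
    (h : x ≤ ladder Γ γ y) : ladderInv Γ γ x ≤ y := by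
  by_contra! hlt
  have := ladder_strictMono hΓ hγ hy hlt
  rw [ladder_ladderInv hΓ hγ hx] at this
  linarith

theorem iterate_ladderInv_pos (hΓ : 0 ≤ Γ) (hγ : 0 < γ) {y : ℝ} (hy : 0 < y) (n : ℕ) :
    0 < (ladderInv Γ γ)^[n] y := by
  induction n with
  | zero => exact hy
  | succ n ih => rw [Function.iterate_succ_apply']; exact ladderInv_pos hΓ hγ ih

theorem iterate_ladderInv_le (hΓ : 0 ≤ Γ) (hγ : 0 < γ) {y : ℝ} (hy : 0 < y) (n : ℕ) :
    (ladderInv Γ γ)^[n] y ≤ y := by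
  induction n with
  | zero => exact le_rfl
  | succ n ih =>
    rw [Function.iterate_succ_apply']
    exact (ladderInv_le_self hΓ hγ (iterate_ladderInv_pos hΓ hγ hy n)).trans ih

theorem iterate_ladderInv_eq (hΓ : 0 ≤ Γ) (hγ : 0 < γ) {y : ℝ} (hy : 0 < y) (n : ℕ) :
    (ladderInv Γ γ)^[n] y = (ladderInv Γ γ)^[n + 1] y *
      Real.exp (Γ * ((ladderInv Γ γ)^[n + 1] y) ^ (1 / γ)) := by
  rw [Function.iterate_succ_apply']
  exact (ladder_ladderInv hΓ hγ (iterate_ladderInv_pos hΓ hγ hy n)).symm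

/-- Along the backward orbit of the ladder function, `z^(-1/γ)` grows at least linearly. -/
theorem iterate_ladderInv_rpow_le (hΓ : 0 < Γ) (hγ : 0 < γ) {y : ℝ} (hy : 0 < y) (hy1 : y ≤ 1)
    (n : ℕ) : ((ladderInv Γ γ)^[n] y) ^ (1 / γ) ≤
      1 / (1 + Γ / γ * Real.exp (-(Γ / γ)) * n) := by
  set c := Γ / γ * Real.exp (-(Γ / γ)) with hc
  have hc0 : 0 < c := by positivity
  have hz := iterate_ladderInv_pos hΓ.le hγ hy
  have hz1 : ∀ n, (ladderInv Γ γ)^[n] y ≤ 1 := fun n =>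
    (iterate_ladderInv_le hΓ.le hγ hy n).trans hy1
  suffices h : 1 + c * n ≤ 1 / ((ladderInv Γ γ)^[n] y) ^ (1 / γ) by
    rw [le_div_iff₀ (Real.rpow_pos_of_pos (hz n) _)] at h
    rw [le_div_iff₀ (by positivity), mul_comm]
    exact h
  induction n with
  | zero =>
    simp only [Nat.cast_zero, mul_zero, add_zero, Function.iterate_zero, id_eq]
    rw [le_div_iff₀ (Real.rpow_pos_of_pos hy _), one_mul]
    exact Real.rpow_le_one hy.le hy1 (by positivity)
  | succ n ih =>
    set z := (ladderInv Γ γ)^[n] y with hzdef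
    set w := (ladderInv Γ γ)^[n + 1] y with hwdef
    have hw : 0 < w := hz (n + 1)
    have hzw : z = w * Real.exp (Γ * w ^ (1 / γ)) := iterate_ladderInv_eq hΓ.le hγ hy n
    set X := w ^ (1 / γ) with hX
    have hX0 : 0 < X := Real.rpow_pos_of_pos hw _
    have hX1 : X ≤ 1 := Real.rpow_le_one hw.le (hz1 _) (by positivity)
    have hzX : z ^ (1 / γ) = X * Real.exp (Γ / γ * X) := by
      rw [hzw, Real.mul_rpow hw.le (Real.exp_pos _).le, ← Real.exp_mul]
      congr 2
      ring
    rw [hzX, le_div_iff₀ (by positivity)] at ih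
    rw [le_div_iff₀ hX0]
    push_cast
    have e1 : Real.exp (-(Γ / γ)) ≤ Real.exp (-(Γ / γ * X)) := by
      apply Real.exp_le_exp.2
      have : Γ / γ * X ≤ Γ / γ * 1 := by gcongr
      linarith
    have e2 : 1 - Γ / γ * X * Real.exp (-(Γ / γ * X)) ≥ Real.exp (-(Γ / γ * X)) := by
      have h3 := Real.add_one_le_exp (Γ / γ * X)
      have h4 : Real.exp (Γ / γ * X) * Real.exp (-(Γ / γ * X)) = 1 := by
        rw [← Real.exp_add, add_neg_cancel, Real.exp_zero]
      nlinarith [Real.exp_pos (-(Γ / γ * X))]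
    have e3 : c * X ≤ Γ / γ * X * Real.exp (-(Γ / γ * X)) := by
      rw [hc]
      calc _ = Γ / γ * X * Real.exp (-(Γ / γ)) := by ring
        _ ≤ _ := by gcongr
    have e4 : (1 + c * n) * X ≤ Real.exp (-(Γ / γ * X)) := by
      rw [Real.exp_neg, ← one_div, le_div_iff₀ (Real.exp_pos _)]
      linarith
    nlinarith

theorem summable_iterate_ladderInv (hΓ : 0 < Γ) (hγ : 0 < γ) {τ : ℝ} (hτ : 0 < τ) {y : ℝ}
    (hy : 0 < y) (hy1 : y ≤ 1) :
    Summable fun N : ℕ => ((ladderInv Γ γ)^[N] y) ^ (1 / γ + τ) := by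
  set c := Γ / γ * Real.exp (-(Γ / γ)) with hc
  have hc0 : 0 < c := by positivity
  have hq : 1 < 1 + τ * γ := by linarith [mul_pos hτ hγ]
  have hs : Summable fun N : ℕ => (1 / (min 1 c) ^ (1 + τ * γ)) *
      (1 / ((N + 1 : ℕ) : ℝ) ^ (1 + τ * γ)) :=
    (((summable_nat_add_iff 1).2 (Real.summable_one_div_nat_rpow.2 hq))).mul_left _
  have hmin : 0 < min 1 c := lt_min one_pos hc0
  refine Summable.of_nonneg_of_le (fun N => (Real.rpow_pos_of_pos
    (iterate_ladderInv_pos hΓ.le hγ hy N) _).le) (fun N => ?_) hs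
  have hz := iterate_ladderInv_pos hΓ.le hγ hy N
  have h1 := iterate_ladderInv_rpow_le hΓ hγ hy hy1 N
  have e : 1 / γ + τ = 1 / γ * (1 + τ * γ) := by field_simp
  rw [e, Real.rpow_mul hz.le]
  calc _ ≤ (1 / (1 + c * N)) ^ (1 + τ * γ) :=
        Real.rpow_le_rpow (by positivity) h1 (by positivity)
    _ ≤ (1 / (min 1 c * ((N + 1 : ℕ) : ℝ))) ^ (1 + τ * γ) := by
        refine Real.rpow_le_rpow (by positivity) ?_ (by positivity)
        refine one_div_le_one_div_of_le (by positivity) ?_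
        push_cast
        have a1 : min 1 c * (N : ℝ) ≤ c * N := by gcongr; exact min_le_right _ _
        have a2 : min 1 c ≤ 1 := min_le_left _ _
        linarith
    _ = _ := by
        rw [Real.div_rpow zero_le_one (by positivity), Real.mul_rpow hmin.le (by positivity),
          Real.one_rpow]
        field_simp

theorem tendsto_iterate_ladderInv (hΓ : 0 < Γ) (hγ : 0 < γ) {y : ℝ} (hy : 0 < y) (hy1 : y ≤ 1) :
    Tendsto (fun n => (ladderInv Γ γ)^[n] y) atTop (𝓝 0) := by
  have h := (summable_iterate_ladderInv hΓ hγ one_pos hy hy1).tendsto_atTop_zero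
  have hpos : (0 : ℝ) < 1 / γ + 1 := by positivity
  have h2 := h.rpow_const (p := 1 / (1 / γ + 1)) (Or.inr (by positivity))
  rw [Real.zero_rpow (by positivity)] at h2
  refine h2.congr fun n => ?_
  rw [← Real.rpow_mul (iterate_ladderInv_pos hΓ.le hγ hy n).le, mul_one_div_cancel hpos.ne',
    Real.rpow_one]

/-- A contraction factor `1 - 10^5 e / 2`, with `e ≥ 2 Γ w^(1/γ)`, expressed by one step of the
backward orbit of the ladder function. -/
theorem factor_le (hΓ : 0 < Γ) (hγ : 0 < γ) {y e : ℝ} (hy : 0 < y) (n : ℕ)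
    (he : 2 * (Γ * ((ladderInv Γ γ)^[n + 1] y) ^ (1 / γ)) ≤ e) :
    1 - 10 ^ 5 * e / 2 ≤ ((ladderInv Γ γ)^[n + 1] y / (ladderInv Γ γ)^[n] y) ^ 6 := by
  have h := iterate_ladderInv_eq hΓ.le hγ hy n
  have hw := iterate_ladderInv_pos hΓ.le hγ hy (n + 1)
  set w := (ladderInv Γ γ)^[n + 1] y
  set X := Γ * w ^ (1 / γ) with hX
  have hX0 : 0 < X := mul_pos hΓ (Real.rpow_pos_of_pos hw _)
  rw [h, div_mul_cancel_left₀ hw.ne', ← Real.exp_neg, ← Real.exp_nat_mul]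
  have := Real.add_one_le_exp (((6 : ℕ) : ℝ) * -X)
  push_cast at this ⊢
  linarith

theorem ladder_le_of_le (hΓ : 0 ≤ Γ) {x e : ℝ} (hx : 0 ≤ x)
    (he1 : e ≤ 1) (he : 2 * (Γ * x ^ (1 / γ)) ≤ e) : ladder Γ γ x ≤ (1 + e) * x := by
  have h0 : 0 ≤ Γ * x ^ (1 / γ) := by positivity
  have h := Real.abs_exp_sub_one_le (x := Γ * x ^ (1 / γ)) (by rw [abs_of_nonneg h0]; linarith)
  rw [abs_of_nonneg h0] at h
  have h2 := le_of_abs_le h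
  unfold ladder
  rw [mul_comm]
  exact mul_le_mul_of_nonneg_right (by linarith) hx

end Ladder

/-! ### Infinite compositions of graph transforms -/

section StepChain

variable {A B : Type*} [NormedAddCommGroup A] [NormedSpace ℝ A]
  [NormedAddCommGroup B] [NormedSpace ℝ B]

/-- The graph of `G` over the ball of radius `p'` is contained in the image, under a block map, of
the graph of `F` over the ball of radius `p`. -/
def IsImage (LA : A →L[ℝ] A) (LB : B →L[ℝ] B) (h : A × B → A × B) (p p' : ℝ) (F G : B → A) : Prop :=
  ∀ τ ∈ Metric.closedBall (0 : B) p', ∃ t ∈ Metric.closedBall (0 : B) p,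
    blockMap LA LB h (F t, t) = (G τ, τ)

/-- A sequence of steps, the `k`-th from the `(k + 1)`-st chart to the `k`-th one, whose contraction
factors are dominated by the sixth powers of the ratios of a sequence `z` with limit `0`. -/
structure IsStepChain (α : ℝ) (z e Q η p : ℕ → ℝ) (LA : ℕ → A →L[ℝ] A) (LB : ℕ → B →L[ℝ] B)
    (h : ℕ → A × B → A × B) (dh : ℕ → A × B → A × B →L[ℝ] A × B) : Prop where
  step : ∀ k, IsStep α (e k) (Q (k + 1)) (η (k + 1)) (p (k + 1)) (η k) (p k) (LA k) (LB k) (h k)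
    (dh k)
  z_pos : ∀ k, 0 < z k
  z_lim : Tendsto z atTop (𝓝 0)
  factor : ∀ k, 1 - 10 ^ 5 * e k / 2 ≤ (z (k + 1) / z k) ^ 6

namespace IsStepChain

variable {α : ℝ} {z e Q η p : ℕ → ℝ} {LA : ℕ → A →L[ℝ] A} {LB : ℕ → B →L[ℝ] B}
  {h : ℕ → A × B → A × B} {dh : ℕ → A × B → A × B →L[ℝ] A × B}

theorem p_pos (hc : IsStepChain α z e Q η p LA LB h dh) (k : ℕ) : 0 < p k :=
  (hc.step k).η'_pos.trans_le (hc.step k).η'_le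

theorem norm_le_one (hc : IsStepChain α z e Q η p LA LB h dh) {k : ℕ} {F : B → A}
    {P : B → B →L[ℝ] A} (hF : IsAdm α (η k) (p k) F P) {t : B}
    (ht : t ∈ Metric.closedBall (0 : B) (p k)) : ‖F t‖ ≤ 1 := by
  have h1 := hF.norm_le_phi (hc.p_pos k).le ht
  have h2 := mem_closedBall_zero_iff.1 ht
  have s := hc.step k
  have h3 := s.p'_le
  have h4 := s.η'_le
  have h5 := s.p_le.trans s.Q_le_one
  have h6 := s.e_le
  have h7 := s.e_pos
  have h8 : p k ≤ 1 + 1 / 10 ^ 5 := by nlinarith [s.p_pos]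
  have h9 : η k ^ 2 ≤ 2 := by nlinarith [s.η'_pos]
  nlinarith

/-- Two sequences of admissible functions that follow the graph transforms from time `n` to time `j`
are `2 (z n / z j)^6`-close at time `j`, whatever they are at time `n`. -/
theorem dist_le (hc : IsStepChain α z e Q η p LA LB h dh) {F F' : ℕ → B → A}
    {P P' : ℕ → B → B →L[ℝ] A} {j n : ℕ} (hjn : j ≤ n)
    (hF : ∀ k, j ≤ k → k ≤ n → IsAdm α (η k) (p k) (F k) (P k))
    (hF' : ∀ k, j ≤ k → k ≤ n → IsAdm α (η k) (p k) (F' k) (P' k))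
    (hI : ∀ k, j ≤ k → k < n → IsImage (LA k) (LB k) (h k) (p (k + 1)) (p k) (F (k + 1)) (F k))
    (hI' : ∀ k, j ≤ k → k < n →
      IsImage (LA k) (LB k) (h k) (p (k + 1)) (p k) (F' (k + 1)) (F' k)) :
    ∀ t ∈ Metric.closedBall (0 : B) (p j), ‖F j t - F' j t‖ ≤ (z n / z j) ^ 6 * 2 := by
  induction hjn using Nat.decreasingInduction with
  | self =>
    intro t ht
    rw [div_self (hc.z_pos n).ne', one_pow, one_mul]
    have h1 := hc.norm_le_one (hF n le_rfl le_rfl) ht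
    have h2 := hc.norm_le_one (hF' n le_rfl le_rfl) ht
    linarith [norm_sub_le (F n t) (F' n t)]
  | of_succ k hk ih =>
    intro t ht
    have h1 := ih (fun i hi hi' => hF i (by omega) hi') (fun i hi hi' => hF' i (by omega) hi')
      (fun i hi hi' => hI i (by omega) hi') (fun i hi hi' => hI' i (by omega) hi')
    have h2 := (hc.step k).contraction (hF (k + 1) (by omega) hk) (hF' (k + 1) (by omega) hk)
      (hI k le_rfl hk) (hI' k le_rfl hk) h1 ht
    refine h2.trans ?_
    have z0 := hc.z_pos k
    have z1 := hc.z_pos (k + 1)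
    have z2 := hc.z_pos n
    calc _ ≤ (z (k + 1) / z k) ^ 6 * ((z n / z (k + 1)) ^ 6 * 2) := by
          have := hc.factor k
          gcongr
      _ = _ := by
          rw [← mul_assoc, ← mul_pow]
          congr 2
          field_simp

theorem tendsto_bound (hc : IsStepChain α z e Q η p LA LB h dh) (j : ℕ) :
    Tendsto (fun n => (z n / z j) ^ 6 * 2) atTop (𝓝 0) := by
  have h1 := ((hc.z_lim.div_const (z j)).pow 6).mul_const 2
  simpa using h1

/-- Points with backward orbits in the domains are determined by their expanding coordinate. -/
theorem eq_of_orbits (hc : IsStepChain α z e Q η p LA LB h dh) {Z W : ℕ → A × B}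
    (hZ : ∀ k, Z (k + 1) ∈ Metric.closedBall (0 : A × B) (10 * Q (k + 1)))
    (hW : ∀ k, W (k + 1) ∈ Metric.closedBall (0 : A × B) (10 * Q (k + 1)))
    (hZs : ∀ k, blockMap (LA k) (LB k) (h k) (Z (k + 1)) = Z k)
    (hWs : ∀ k, blockMap (LA k) (LB k) (h k) (W (k + 1)) = W k) (h0 : (Z 0).2 = (W 0).2) :
    Z 0 = W 0 := by
  have key : ∀ k, ‖(Z k).2 - (W k).2‖ ≤ ‖(Z k).1 - (W k).1‖ ∧
      ‖(Z 0).1 - (W 0).1‖ ≤ (z k / z 0) ^ 6 * ‖(Z k).1 - (W k).1‖ := by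
    intro k
    induction k with
    | zero =>
      rw [h0, sub_self, norm_zero, div_self (hc.z_pos 0).ne', one_pow, one_mul]
      exact ⟨norm_nonneg _, le_rfl⟩
    | succ k ih =>
      have h1 := (hc.step k).cone (hZ k) (hW k)
      rw [hZs, hWs] at h1
      obtain ⟨h2, h3⟩ := h1 ih.1
      refine ⟨h2, ih.2.trans ?_⟩
      have z0 := hc.z_pos k
      have z1 := hc.z_pos (k + 1)
      have z2 := hc.z_pos 0
      have h4 := hc.factor k
      calc _ ≤ (z k / z 0) ^ 6 * ((1 - 10 ^ 5 * e k / 2) * ‖(Z (k + 1)).1 - (W (k + 1)).1‖) := by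
            gcongr
        _ ≤ (z k / z 0) ^ 6 * ((z (k + 1) / z k) ^ 6 * ‖(Z (k + 1)).1 - (W (k + 1)).1‖) := by
            gcongr
        _ = _ := by
            rw [← mul_assoc, ← mul_pow]
            congr 2
            field_simp
  refine Prod.ext ?_ h0
  rw [← sub_eq_zero, ← norm_le_zero_iff]
  have hlim : Tendsto (fun n => (z (n + 1) / z 0) ^ 6 * 20) atTop (𝓝 0) := by
    have h1 := (((hc.z_lim.comp (tendsto_add_atTop_nat 1)).div_const (z 0)).pow 6).mul_const 20
    simpa using h1
  refine ge_of_tendsto' hlim fun n => (key (n + 1)).2.trans ?_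
  have z0 := hc.z_pos (n + 1)
  have z2 := hc.z_pos 0
  refine mul_le_mul_of_nonneg_left ?_ (by positivity)
  have a1 := (norm_fst_le (Z (n + 1))).trans (mem_closedBall_zero_iff.1 (hZ n))
  have a2 := (norm_fst_le (W (n + 1))).trans (mem_closedBall_zero_iff.1 (hW n))
  have a3 := (hc.step n).Q_le_one
  linarith [norm_sub_le (Z (n + 1)).1 (W (n + 1)).1]

variable [CompleteSpace A] [FiniteDimensional ℝ B]

/-- There is a sequence of admissible functions that is invariant under the graph transforms. -/
theorem exists_invariant (hc : IsStepChain α z e Q η p LA LB h dh) :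
    ∃ (F : ℕ → B → A) (P : ℕ → B → B →L[ℝ] A), (∀ k, IsAdm α (η k) (p k) (F k) (P k)) ∧
      ∀ k, IsImage (LA k) (LB k) (h k) (p (k + 1)) (p k) (F (k + 1)) (F k) := by
  have htr : ∀ k (X : (B → A) × (B → B →L[ℝ] A)), ∃ Y : (B → A) × (B → B →L[ℝ] A),
      IsAdm α (η (k + 1)) (p (k + 1)) X.1 X.2 → IsAdm α (η k) (p k) Y.1 Y.2 ∧
        IsImage (LA k) (LB k) (h k) (p (k + 1)) (p k) X.1 Y.1 := by
    intro k X
    by_cases hX : IsAdm α (η (k + 1)) (p (k + 1)) X.1 X.2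
    · obtain ⟨G, P', h1, h2⟩ := (hc.step k).exists_transform hX
      exact ⟨(G, P'), fun _ => ⟨h1, h2⟩⟩
    · exact ⟨0, fun h => absurd h hX⟩
  choose tr htr using htr
  have hzero : ∀ k, IsAdm α (η k) (p k) (fun _ : B => (0 : A)) (fun _ => 0) := by
    intro k
    have hη := (hc.step k).η'_pos
    refine IsAdm.of_bounds (m := 0) (h := 0) (by norm_num)
      (fun t _ => hasFDerivWithinAt_const _ _ _) (by simp) le_rfl (by simp) ?_ ?_
    · rw [norm_zero]; positivity
    · rw [norm_zero]; positivity
  -- `G m k` is the image of the zero section of chart `k + m` in chart `k`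
  let G : ℕ → ℕ → (B → A) × (B → B →L[ℝ] A) := fun m =>
    Nat.rec (fun _ => (fun _ => 0, fun _ => 0)) (fun _ g k => tr k (g (k + 1))) m
  have hG0 : ∀ k, G 0 k = (fun _ => 0, fun _ => 0) := fun k => rfl
  have hGs : ∀ m k, G (m + 1) k = tr k (G m (k + 1)) := fun m k => rfl
  have hGa : ∀ m k, IsAdm α (η k) (p k) (G m k).1 (G m k).2 := by
    intro m
    induction m with
    | zero => intro k; rw [hG0]; exact hzero k
    | succ m ih => intro k; rw [hGs]; exact (htr k _ (ih (k + 1))).1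
  have hGi : ∀ m k, IsImage (LA k) (LB k) (h k) (p (k + 1)) (p k) (G m (k + 1)).1
      (G (m + 1) k).1 := by
    intro m k
    rw [hGs]
    exact (htr k _ (hGa m (k + 1))).2
  have hclose : ∀ k m m', m ≤ m' → ∀ t ∈ Metric.closedBall (0 : B) (p k),
      ‖(G m k).1 t - (G m' k).1 t‖ ≤ (z (m + k) / z k) ^ 6 * 2 := by
    intro k m m' hmm' t ht
    have h1 := hc.dist_le (j := k) (n := m + k) (by omega)
      (F := fun i => (G (m + k - i) i).1) (F' := fun i => (G (m' + k - i) i).1)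
      (P := fun i => (G (m + k - i) i).2) (P' := fun i => (G (m' + k - i) i).2)
      (fun i _ _ => hGa _ i) (fun i _ _ => hGa _ i)
      (fun i hi hi' => by
        have := hGi (m + k - (i + 1)) i
        have e1 : m + k - (i + 1) + 1 = m + k - i := by omega
        rwa [e1] at this)
      (fun i hi hi' => by
        have := hGi (m' + k - (i + 1)) i
        have e1 : m' + k - (i + 1) + 1 = m' + k - i := by omega
        rwa [e1] at this) t ht
    simpa using h1
  have hlim : ∀ k, ∃ X : (B → A) × (B → B →L[ℝ] A), IsAdm α (η k) (p k) X.1 X.2 ∧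
      ∀ m, ∀ t ∈ Metric.closedBall (0 : B) (p k),
        ‖(G m k).1 t - X.1 t‖ ≤ (z (m + k) / z k) ^ 6 * 2 := by
    intro k
    obtain ⟨F', P', h1, h2⟩ := IsAdm.exists_limit (hc.step k).α_pos (hc.p_pos k)
      (fun m => hGa m k) (D := fun m => (z (m + k) / z k) ^ 6 * 2)
      ((hc.tendsto_bound k).comp (tendsto_add_atTop_nat k)) (hclose k)
    exact ⟨(F', P'), h1, h2⟩
  choose X hX1 hX2 using hlim
  refine ⟨fun k => (X k).1, fun k => (X k).2, hX1, fun k => ?_⟩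
  obtain ⟨G', P', h1, h2⟩ := (hc.step k).exists_transform (hX1 (k + 1))
  have heq : ∀ t ∈ Metric.closedBall (0 : B) (p k), G' t = (X k).1 t := by
    intro t ht
    rw [← sub_eq_zero, ← norm_le_zero_iff]
    have hb : Tendsto (fun m => (1 - 10 ^ 5 * e k / 2) * ((z (m + (k + 1)) / z (k + 1)) ^ 6 * 2) +
        (z (m + 1 + k) / z k) ^ 6 * 2) atTop (𝓝 0) := by
      have a1 := (((hc.tendsto_bound (k + 1)).comp (tendsto_add_atTop_nat (k + 1))).const_mul
        (1 - 10 ^ 5 * e k / 2)).add ((hc.tendsto_bound k).comp (tendsto_add_atTop_nat (1 + k)))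
      rw [mul_zero, add_zero] at a1
      refine a1.congr fun m => ?_
      simp only [Function.comp_apply, add_assoc]
    refine ge_of_tendsto' hb fun m => ?_
    have b1 := (hc.step k).contraction (hX1 (k + 1)) (hGa m (k + 1)) h2 (hGi m k)
      (D := (z (m + (k + 1)) / z (k + 1)) ^ 6 * 2)
      (fun t ht => by rw [norm_sub_rev]; exact hX2 (k + 1) m t ht) ht
    have b2 := hX2 k (m + 1) t ht
    calc _ ≤ ‖G' t - (G (m + 1) k).1 t‖ + ‖(G (m + 1) k).1 t - (X k).1 t‖ :=
          norm_sub_le_norm_sub_add_norm_sub _ _ _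
      _ ≤ _ := add_le_add b1 b2
  intro τ hτ
  obtain ⟨t, ht, h3⟩ := h2 τ hτ
  refine ⟨t, ht, ?_⟩
  simp only
  rw [h3, heq τ hτ]

end IsStepChain

/-- Two admissible functions that are close of order `(y / η)^6` are `C^1`-close of order
`y^(α / 2)` on the ball of radius `η^2`. If `y > η^2`, the bounds at `0` suffice; otherwise one
interpolates at scale `y^2`. -/
theorem IsAdm.core_close {α η p : ℝ} {F F' : B → A} {P P' : B → B →L[ℝ] A}
    (hF : IsAdm α η p F P) (hF' : IsAdm α η p F' P') (hα : 0 < α) (hα1 : α ≤ 1) (hη : 0 < η)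
    (hη1 : η ≤ 1) (hp : η ≤ p) {y : ℝ} (hy : 0 < y) (hyη : y ≤ η)
    (hD : ∀ t ∈ Metric.closedBall (0 : B) p, ‖F t - F' t‖ ≤ (y / η) ^ 6 * 2) {t : B}
    (ht : t ∈ Metric.closedBall (0 : B) (η ^ 2)) :
    ‖F t - F' t‖ ≤ 4 * y ^ (α / 2) ∧ ‖P t - P' t‖ ≤ 6 * y ^ (α / 2) := by
  have hp0 : 0 < p := hη.trans_le hp
  have hη2 : η ^ 2 ≤ η := by nlinarith
  have htp : t ∈ Metric.closedBall (0 : B) p := Metric.closedBall_subset_closedBall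
    (hη2.trans hp) ht
  have h0 : (0 : B) ∈ Metric.closedBall (0 : B) p := Metric.mem_closedBall_self hp0.le
  have htn := mem_closedBall_zero_iff.1 ht
  have hy1 : y ≤ 1 := hyη.trans hη1
  have hle : ∀ c : ℝ, α / 2 ≤ c → y ^ c ≤ y ^ (α / 2) := fun c hc =>
    Real.rpow_le_rpow_of_exponent_ge hy hy1 hc
  have hyle : y ≤ y ^ (α / 2) := by
    have := hle 1 (by linarith)
    rwa [Real.rpow_one] at this
  rcases le_or_gt (η ^ 2) y with hcase | hcase
  · have a1 := hF.norm_le_phi hp0.le htp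
    have a2 := hF'.norm_le_phi hp0.le htp
    have a3 := norm_sub_le (F t) (F' t)
    have b1 := hF.holder_half htp h0
    have b2 := hF'.holder_half htp h0
    rw [sub_zero] at b1 b2
    have hηα : η ^ α ≤ y ^ (α / 2) := by
      have h1 : (η ^ 2) ^ (α / 2) ≤ y ^ (α / 2) :=
        Real.rpow_le_rpow (by positivity) hcase (by positivity)
      rwa [← Real.rpow_natCast, ← Real.rpow_mul hη.le,
        show ((2 : ℕ) : ℝ) * (α / 2) = α by push_cast; ring] at h1
    have htα : ‖t‖ ^ α ≤ y ^ (α / 2) :=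
      (Real.rpow_le_rpow (norm_nonneg _) (htn.trans hη2) hα.le).trans hηα
    have c1 := norm_le_norm_add_norm_sub (P 0) (P t)
    have c2 := norm_le_norm_add_norm_sub (P' 0) (P' t)
    rw [norm_sub_rev] at c1 c2
    have c3 := norm_sub_le (P t) (P' t)
    have := hF.iota
    have := hF'.iota
    constructor <;> linarith [Real.rpow_pos_of_pos hy (α / 2)]
  · -- here `y / η ≤ √y`, so that the uniform distance is at most `2 y^3`
    have h1 : (y / η) ^ 6 ≤ y ^ 3 := by
      have h2 : (y / η) ^ 2 ≤ y := by
        rw [div_pow, div_le_iff₀ (by positivity)]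
        nlinarith
      calc (y / η) ^ 6 = ((y / η) ^ 2) ^ 3 := by ring
        _ ≤ y ^ 3 := by gcongr
    have hD' : ∀ t ∈ Metric.closedBall (0 : B) p, ‖F t - F' t‖ ≤ 2 * y ^ 3 := fun t ht => by
      linarith [hD t ht]
    constructor
    · have h3 : y ^ 3 ≤ y := by nlinarith [mul_pos hy hy]
      linarith [hD' t htp]
    · have h4 := hF.interpolate hF' hα (by positivity) hD' (s := y ^ 2) (by positivity)
        (by nlinarith) htp
      have h5 : 2 * (2 * y ^ 3) / y ^ 2 = 4 * y := by field_simp; norm_num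
      have h6 : (y ^ 2) ^ α ≤ y ^ (α / 2) := by
        rw [← Real.rpow_natCast, ← Real.rpow_mul hy.le]
        exact hle _ (by push_cast; linarith)
      rw [h5] at h4
      linarith

end StepChain

/-! ### Summable splittings and the Lyapunov change of coordinates -/

section Lyapunov

variable {d : ℕ} {M : Type*} [TopologicalSpace M] [ChartedSpace (Euc d) M]
  [RiemannianBundle (fun x : M => TangentSpace (𝓡 d) x)]

/-- The norm of `d_x g ξ`. -/
def dnorm (g : M → M) (x : M) (ξ : TangentSpace (𝓡 d) x) : ℝ := ‖mfderiv (𝓡 d) (𝓡 d) g x ξ‖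

variable [IsManifold (𝓡 d) ∞ M]

theorem dnorm_nonneg (g : M → M) (x : M) (ξ : TangentSpace (𝓡 d) x) : 0 ≤ dnorm g x ξ :=
  norm_nonneg _

theorem dnorm_smul (g : M → M) (x : M) (c : ℝ) (ξ : TangentSpace (𝓡 d) x) :
    dnorm g x (c • ξ) = |c| * dnorm g x ξ := by
  simp only [dnorm]
  rw [map_smul, norm_smul, Real.norm_eq_abs]

theorem dnorm_id (x : M) (ξ : TangentSpace (𝓡 d) x) : dnorm (id : M → M) x ξ = ‖ξ‖ := by
  rw [dnorm, mfderiv_id]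
  rfl

theorem mdifferentiable_diffeo (f : M ≃ₘ^1⟮𝓡 d, 𝓡 d⟯ M) : MDifferentiable (𝓡 d) (𝓡 d) f :=
  f.contMDiff.mdifferentiable one_ne_zero

theorem mdifferentiable_iterate (f : M ≃ₘ^1⟮𝓡 d, 𝓡 d⟯ M) (m : ℕ) :
    MDifferentiable (𝓡 d) (𝓡 d) f^[m] :=
  (f.contMDiff.iterate m).mdifferentiable one_ne_zero

theorem dnorm_iterate_succ (f : M ≃ₘ^1⟮𝓡 d, 𝓡 d⟯ M) (m : ℕ) (x : M) (ξ : TangentSpace (𝓡 d) x) :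
    dnorm f^[m + 1] x ξ = dnorm f^[m] (f x) (mfderiv (𝓡 d) (𝓡 d) f x ξ) := by
  have h : mfderiv (𝓡 d) (𝓡 d) (f^[m] ∘ f) x =
      (mfderiv (𝓡 d) (𝓡 d) f^[m] (f x)) ∘L (mfderiv (𝓡 d) (𝓡 d) f x) :=
    mfderiv_comp x (mdifferentiable_iterate f m (f x)) (mdifferentiable_diffeo f x)
  exact congrArg (fun L : TangentSpace (𝓡 d) x →L[ℝ] TangentSpace (𝓡 d) (f^[m] (f x)) => ‖L ξ‖) h

theorem dnorm_symm_iterate_succ (f : M ≃ₘ^1⟮𝓡 d, 𝓡 d⟯ M) (m : ℕ) (x : M)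
    (ξ : TangentSpace (𝓡 d) x) :
    dnorm f.symm^[m + 1] (f x) (mfderiv (𝓡 d) (𝓡 d) f x ξ) = dnorm f.symm^[m] x ξ := by
  have h : mfderiv (𝓡 d) (𝓡 d) (f.symm^[m + 1] ∘ f) x =
      (mfderiv (𝓡 d) (𝓡 d) f.symm^[m + 1] (f x)) ∘L (mfderiv (𝓡 d) (𝓡 d) f x) :=
    mfderiv_comp x (mdifferentiable_iterate f.symm (m + 1) (f x)) (mdifferentiable_diffeo f x)
  have h1 : dnorm (f.symm^[m + 1] ∘ f) x ξ =
      dnorm f.symm^[m + 1] (f x) (mfderiv (𝓡 d) (𝓡 d) f x ξ) :=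
    congrArg (fun L : TangentSpace (𝓡 d) x →L[ℝ] TangentSpace (𝓡 d) (f.symm^[m + 1] (f x)) =>
      ‖L ξ‖) h
  have h2 : (f.symm^[m + 1] ∘ f : M → M) = f.symm^[m] := by
    funext y
    simp only [Function.comp_apply, Function.iterate_succ, Diffeomorph.symm_apply_apply]
  rw [← h1, h2]

theorem dnorm_symm_apply (f : M ≃ₘ^1⟮𝓡 d, 𝓡 d⟯ M) (x : M) (ξ : TangentSpace (𝓡 d) x) :
    dnorm f.symm (f x) (mfderiv (𝓡 d) (𝓡 d) f x ξ) = ‖ξ‖ := by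
  have := dnorm_symm_iterate_succ f 0 x ξ
  rw [Function.iterate_zero, dnorm_id] at this
  exact this

theorem mfderiv_diffeo_injective (f : M ≃ₘ^1⟮𝓡 d, 𝓡 d⟯ M) (x : M) :
    Function.Injective (mfderiv (𝓡 d) (𝓡 d) f x) := by
  rw [injective_iff_map_eq_zero]
  intro ξ hξ
  have h := dnorm_symm_apply f x ξ
  rw [dnorm, hξ, map_zero, norm_zero] at h
  exact norm_eq_zero.1 h.symm

theorem mfderiv_diffeo_surjective (f : M ≃ₘ^1⟮𝓡 d, 𝓡 d⟯ M) (x : M) :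
    Function.Surjective (mfderiv (𝓡 d) (𝓡 d) f x) := by
  have : IsManifold (𝓡 d) 1 M := IsManifold.of_le (n := ∞) (by simp)
  rw [← f.mfderivToContinuousLinearEquiv_coe one_ne_zero]
  exact (f.mfderivToContinuousLinearEquiv one_ne_zero x).surjective

theorem summableOn_iff {g : M → M} {x : M} {H : Submodule ℝ (TangentSpace (𝓡 d) x)} :
    SummableOn g x H ↔ ∃ K : ℝ, ∀ ξ ∈ H, Summable (fun m : ℕ => dnorm g^[m] x ξ ^ 2) ∧
      ∑' m : ℕ, dnorm g^[m] x ξ ^ 2 ≤ K * ‖ξ‖ ^ 2 := by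
  constructor
  · rintro ⟨K, hK⟩
    refine ⟨K, fun ξ hξ => ?_⟩
    rcases eq_or_ne ξ 0 with rfl | h0
    · have hz : ∀ m : ℕ, dnorm g^[m] x (0 : TangentSpace (𝓡 d) x) ^ 2 = 0 := fun m => by
        rw [dnorm, map_zero, norm_zero, zero_pow two_ne_zero]
      simp only [hz, norm_zero]
      exact ⟨summable_zero, by simp⟩
    · have hn : 0 < ‖ξ‖ := norm_pos_iff.2 h0
      have h1 := hK (‖ξ‖⁻¹ • ξ) (H.smul_mem _ hξ) (by
        rw [norm_smul, norm_inv, norm_norm, inv_mul_cancel₀ hn.ne'])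
      have e : ∀ m : ℕ, dnorm g^[m] x ξ ^ 2 =
          ‖ξ‖ ^ 2 * ‖mfderiv (𝓡 d) (𝓡 d) g^[m] x (‖ξ‖⁻¹ • ξ)‖ ^ 2 := by
        intro m
        have h2 := dnorm_smul g^[m] x ‖ξ‖⁻¹ ξ
        rw [abs_of_pos (by positivity)] at h2
        have h3 : ‖mfderiv (𝓡 d) (𝓡 d) g^[m] x (‖ξ‖⁻¹ • ξ)‖ = ‖ξ‖⁻¹ * dnorm g^[m] x ξ := h2
        rw [h3]
        field_simp
      simp only [e]
      refine ⟨h1.1.mul_left _, ?_⟩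
      rw [tsum_mul_left, mul_comm K]
      exact mul_le_mul_of_nonneg_left h1.2 (by positivity)
  · rintro ⟨K, hK⟩
    refine ⟨K, fun ξ hξ h1 => ⟨(hK ξ hξ).1, (hK ξ hξ).2.trans ?_⟩⟩
    rw [h1, one_pow, mul_one]

theorem SummableOn.summable {g : M → M} {x : M} {H : Submodule ℝ (TangentSpace (𝓡 d) x)}
    (h : SummableOn g x H) {ξ : TangentSpace (𝓡 d) x} (hξ : ξ ∈ H) :
    Summable (fun m : ℕ => dnorm g^[m] x ξ ^ 2) := by
  obtain ⟨K, hK⟩ := summableOn_iff.1 h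
  exact (hK ξ hξ).1

theorem IsSummableSplitting.symm {f : M ≃ₘ^1⟮𝓡 d, 𝓡 d⟯ M} {x : M}
    {H : Submodule ℝ (TangentSpace (𝓡 d) x) × Submodule ℝ (TangentSpace (𝓡 d) x)}
    (h : IsSummableSplitting f x H) : IsSummableSplitting f.symm x (H.2, H.1) :=
  ⟨h.1.symm, h.2.2, h.2.1⟩

theorem IsSummablePoint.symm {f : M ≃ₘ^1⟮𝓡 d, 𝓡 d⟯ M} {x : M} (h : IsSummablePoint f x) :
    IsSummablePoint f.symm x := by
  obtain ⟨H, hH, huniq⟩ := h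
  refine ⟨(H.2, H.1), hH.symm, fun H' hH' => ?_⟩
  have := huniq (H'.2, H'.1) ⟨hH'.1.symm, hH'.2.2, hH'.2.1⟩
  rw [← this]

theorem splitting_spec {f : M ≃ₘ^1⟮𝓡 d, 𝓡 d⟯ M} {x : M} (h : IsSummablePoint f x) :
    IsSummableSplitting f x (splitting f x) :=
  Classical.epsilon_spec h.exists

variable [CompactSpace M] [T2Space M]
  [IsContMDiffRiemannianBundle (𝓡 d) ∞ (Euc d) (fun x : M => TangentSpace (𝓡 d) x)]

theorem exists_norm_mfderiv_le (f : M ≃ₘ^1⟮𝓡 d, 𝓡 d⟯ M) :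
    ∃ K : ℝ, 1 ≤ K ∧ ∀ (x : M) (v : TangentSpace (𝓡 d) x), dnorm f x v ≤ K * ‖v‖ := by
  suffices h : ∃ K : ℝ, 1 ≤ K ∧ ∀ x ∈ (univ : Set M), ∀ v : TangentSpace (𝓡 d) x,
      dnorm f x v ≤ K * ‖v‖ by
    obtain ⟨K, hK, h⟩ := h
    exact ⟨K, hK, fun x => h x (mem_univ x)⟩
  refine isCompact_univ.induction_on (p := fun s : Set M => ∃ K : ℝ, 1 ≤ K ∧ ∀ x ∈ s,
    ∀ v : TangentSpace (𝓡 d) x, dnorm f x v ≤ K * ‖v‖) ?_ ?_ ?_ ?_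
  · exact ⟨1, le_rfl, by simp⟩
  · rintro s t hst ⟨K, hK, h⟩
    exact ⟨K, hK, fun x hx => h x (hst hx)⟩
  · rintro s t ⟨K, hK, h⟩ ⟨K', hK', h'⟩
    refine ⟨max K K', le_max_of_le_left hK, ?_⟩
    rintro x (hx | hx) v
    · exact (h x hx v).trans (mul_le_mul_of_nonneg_right (le_max_left _ _) (norm_nonneg _))
    · exact (h' x hx v).trans (mul_le_mul_of_nonneg_right (le_max_right _ _) (norm_nonneg _))
  · intro x₀ _
    rw [nhdsWithin_univ]
    obtain ⟨C, hC, hCe⟩ := eventually_norm_chartDeriv_lt (d := d) x₀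
    have hcd := contDiffAt_written f x₀
    set h := writtenInExtChartAt (𝓡 d) (𝓡 d) x₀ f with hh
    have hhd : ∀ᶠ y in 𝓝 (extChartAt (𝓡 d) x₀ x₀), DifferentiableAt ℝ h y :=
      (hcd.eventually (by simp)).mono fun p hp => hp.differentiableAt (by simp)
    have hhb : ∀ᶠ y in 𝓝 (extChartAt (𝓡 d) x₀ x₀), ‖fderiv ℝ h y‖ <
        ‖fderiv ℝ h (extChartAt (𝓡 d) x₀ x₀)‖ + 1 :=
      (hcd.fderiv_right (m := 0) (by simp)).continuousAt.norm.eventually_lt continuousAt_const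
        (lt_add_one _)
    set L := ‖fderiv ℝ h (extChartAt (𝓡 d) x₀ x₀)‖ + 1 with hL
    have hmc : ContinuousAt (metricForm (d := d) (f x₀)) (extChartAt (𝓡 d) (f x₀) (f x₀)) :=
      (contDiffOn_metricForm (f x₀)).continuousOn.continuousAt (extChartAt_target_mem_nhds (f x₀))
    have hmb : ∀ᶠ y in 𝓝 (extChartAt (𝓡 d) (f x₀) (f x₀)), ‖metricForm (d := d) (f x₀) y‖ <
        ‖metricForm (d := d) (f x₀) (extChartAt (𝓡 d) (f x₀) (f x₀))‖ + 1 :=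
      hmc.norm.eventually_lt continuousAt_const (lt_add_one _)
    set G := ‖metricForm (d := d) (f x₀) (extChartAt (𝓡 d) (f x₀) (f x₀))‖ + 1 with hG
    have hL0 : 0 < L := by positivity
    have hG0 : 0 < G := by positivity
    have cf : Tendsto f (𝓝 x₀) (𝓝 (f x₀)) := f.continuous.continuousAt
    have ct := (continuousAt_extChartAt (I := 𝓡 d) x₀).tendsto
    refine ⟨_, hCe.and ((ct.eventually hhd).and ((ct.eventually hhb).and
      ((((continuousAt_extChartAt (I := 𝓡 d) (f x₀)).tendsto.comp cf).eventually hmb).and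
      (Filter.Eventually.and (extChartAt_source_mem_nhds (I := 𝓡 d) x₀)
        (cf.eventually (extChartAt_source_mem_nhds (I := 𝓡 d) (f x₀))))))),
      max 1 (Real.sqrt G * (L * C)), le_max_left _ _, ?_⟩
    rintro x ⟨h1, h2, h3, h4, h5, h6⟩ v
    refine le_trans ?_ (mul_le_mul_of_nonneg_right (le_max_right _ _) (norm_nonneg _))
    have e1 := fderiv_written f x₀ h5 h6 h2 v
    have e2 := metricForm_chartDeriv (d := d) (f x₀) h6 (mfderiv (𝓡 d) (𝓡 d) f x v)
    have e3 : ‖chartDeriv (f x₀) (f x) (mfderiv (𝓡 d) (𝓡 d) f x v)‖ ≤ L * (C * ‖v‖) := by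
      rw [← e1]
      refine (ContinuousLinearMap.le_opNorm _ _).trans (mul_le_mul h3.le ?_ (norm_nonneg _) hL0.le)
      exact ContinuousLinearMap.le_of_opNorm_le _ h1.le v
    have e4 : dnorm f x v ^ 2 ≤ G * (L * (C * ‖v‖)) ^ 2 := by
      have e5 : dnorm f x v ^ 2 = ‖mfderiv (𝓡 d) (𝓡 d) f x v‖ ^ 2 := rfl
      rw [e5, ← e2]
      refine (Real.le_norm_self _).trans ((ContinuousLinearMap.le_opNorm₂ _ _ _).trans ?_)
      rw [mul_assoc, ← sq]
      have h4' : ‖metricForm (d := d) (f x₀) (extChartAt (𝓡 d) (f x₀) (f x))‖ ≤ G := h4.le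
      gcongr
    refine (pow_le_pow_iff_left₀ (dnorm_nonneg _ _ _) (by positivity) two_ne_zero).1
      (e4.trans (le_of_eq ?_))
    have e6 := Real.sq_sqrt hG0.le
    linear_combination (-(L * (C * ‖v‖)) ^ 2) * e6

end Lyapunov

/-! ### The differential in Lyapunov coordinates -/

section Adapted

variable {d : ℕ} {M : Type*} [TopologicalSpace M] [ChartedSpace (Euc d) M]
  [RiemannianBundle (fun x : M => TangentSpace (𝓡 d) x)] [IsManifold (𝓡 d) ∞ M]

/-- The differential of `f` maps a summable splitting at `x` to one at `f x`. -/
theorem IsSummableSplitting.map {f : M ≃ₘ^1⟮𝓡 d, 𝓡 d⟯ M} {x : M}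
    {H : Submodule ℝ (TangentSpace (𝓡 d) x) × Submodule ℝ (TangentSpace (𝓡 d) x)}
    (h : IsSummableSplitting f x H) {K : ℝ}
    (hK' : ∀ v : TangentSpace (𝓡 d) x, ‖v‖ ≤ K * dnorm f x v) :
    IsSummableSplitting f (f x)
      (H.1.map ((mfderiv (𝓡 d) (𝓡 d) f x) : TangentSpace (𝓡 d) x →ₗ[ℝ] TangentSpace (𝓡 d) (f x)),
        H.2.map
          ((mfderiv (𝓡 d) (𝓡 d) f x) : TangentSpace (𝓡 d) x →ₗ[ℝ] TangentSpace (𝓡 d) (f x))) := by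
  obtain ⟨hc, h1, h2⟩ := h
  refine ⟨⟨?_, ?_⟩, summableOn_iff.2 ?_, summableOn_iff.2 ?_⟩
  · rw [Submodule.disjoint_def]
    rintro _ ⟨ξ, hξ, rfl⟩ ⟨ξ', hξ', hξξ'⟩
    have e : ξ' = ξ := mfderiv_diffeo_injective f x hξξ'
    subst e
    rw [Submodule.disjoint_def.1 hc.disjoint ξ' hξ hξ', map_zero]
  · rw [codisjoint_iff, eq_top_iff]
    intro w _
    obtain ⟨v, rfl⟩ := mfderiv_diffeo_surjective f x w
    have hv : v ∈ H.1 ⊔ H.2 := by rw [hc.sup_eq_top]; trivial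
    obtain ⟨ξ, hξ, η, hη, rfl⟩ := Submodule.mem_sup.1 hv
    rw [map_add]
    exact Submodule.add_mem_sup ⟨ξ, hξ, rfl⟩ ⟨η, hη, rfl⟩
  · obtain ⟨K₁, hK₁⟩ := summableOn_iff.1 h1
    refine ⟨max K₁ 0 * K ^ 2, ?_⟩
    rintro _ ⟨ξ, hξ, rfl⟩
    obtain ⟨s1, s2⟩ := hK₁ ξ hξ
    have e : ∀ m : ℕ, dnorm f^[m] (f x) (mfderiv (𝓡 d) (𝓡 d) f x ξ) = dnorm f^[m + 1] x ξ :=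
      fun m => (dnorm_iterate_succ f m x ξ).symm
    have s3 : Summable fun m : ℕ => dnorm f^[m + 1] x ξ ^ 2 := (summable_nat_add_iff 1).2 s1
    change Summable (fun m : ℕ => dnorm f^[m] (f x) (mfderiv (𝓡 d) (𝓡 d) f x ξ) ^ 2) ∧
      ∑' m : ℕ, dnorm f^[m] (f x) (mfderiv (𝓡 d) (𝓡 d) f x ξ) ^ 2 ≤
        max K₁ 0 * K ^ 2 * dnorm f x ξ ^ 2
    simp only [e]
    refine ⟨s3, ?_⟩
    have s4 := s1.tsum_eq_zero_add
    have s5 : ‖ξ‖ ^ 2 ≤ K ^ 2 * dnorm f x ξ ^ 2 := by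
      rw [← mul_pow]
      exact pow_le_pow_left₀ (norm_nonneg _) (hK' ξ) 2
    have s6 : K₁ * ‖ξ‖ ^ 2 ≤ max K₁ 0 * (K ^ 2 * dnorm f x ξ ^ 2) :=
      mul_le_mul (le_max_left _ _) s5 (by positivity) (le_max_right _ _)
    nlinarith [sq_nonneg (dnorm f^[0] x ξ)]
  · obtain ⟨K₁, hK₁⟩ := summableOn_iff.1 h2
    refine ⟨1 + max K₁ 0 * K ^ 2, ?_⟩
    rintro _ ⟨ξ, hξ, rfl⟩
    obtain ⟨s1, s2⟩ := hK₁ ξ hξ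
    have e : ∀ m : ℕ, dnorm f.symm^[m + 1] (f x) (mfderiv (𝓡 d) (𝓡 d) f x ξ) =
        dnorm f.symm^[m] x ξ := fun m => dnorm_symm_iterate_succ f m x ξ
    have e0 : dnorm f.symm^[0] (f x) (mfderiv (𝓡 d) (𝓡 d) f x ξ) = dnorm f x ξ := dnorm_id _ _
    have s3 : Summable fun m : ℕ =>
        dnorm f.symm^[m] (f x) (mfderiv (𝓡 d) (𝓡 d) f x ξ) ^ 2 := by
      rw [← summable_nat_add_iff 1]
      simp only [e]
      exact s1
    change Summable (fun m : ℕ => dnorm f.symm^[m] (f x) (mfderiv (𝓡 d) (𝓡 d) f x ξ) ^ 2) ∧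
      ∑' m : ℕ, dnorm f.symm^[m] (f x) (mfderiv (𝓡 d) (𝓡 d) f x ξ) ^ 2 ≤
        (1 + max K₁ 0 * K ^ 2) * dnorm f x ξ ^ 2
    refine ⟨s3, ?_⟩
    rw [s3.tsum_eq_zero_add, e0]
    simp only [e]
    have s5 : ‖ξ‖ ^ 2 ≤ K ^ 2 * dnorm f x ξ ^ 2 := by
      rw [← mul_pow]
      exact pow_le_pow_left₀ (norm_nonneg _) (hK' ξ) 2
    have s6 : K₁ * ‖ξ‖ ^ 2 ≤ max K₁ 0 * (K ^ 2 * dnorm f x ξ ^ 2) :=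
      mul_le_mul (le_max_left _ _) s5 (by positivity) (le_max_right _ _)
    linarith

/-- Where summable splittings are unique, the differential maps one to the other. -/
theorem IsSummableSplitting.map_mem {f : M ≃ₘ^1⟮𝓡 d, 𝓡 d⟯ M} {x : M}
    {H : Submodule ℝ (TangentSpace (𝓡 d) x) × Submodule ℝ (TangentSpace (𝓡 d) x)}
    (h : IsSummableSplitting f x H) {K : ℝ}
    (hK' : ∀ v : TangentSpace (𝓡 d) x, ‖v‖ ≤ K * dnorm f x v)
    {H' : Submodule ℝ (TangentSpace (𝓡 d) (f x)) × Submodule ℝ (TangentSpace (𝓡 d) (f x))}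
    (hx : IsSummablePoint f (f x)) (h' : IsSummableSplitting f (f x) H') :
    (∀ ξ ∈ H.1, mfderiv (𝓡 d) (𝓡 d) f x ξ ∈ H'.1) ∧
      ∀ η ∈ H.2, mfderiv (𝓡 d) (𝓡 d) f x η ∈ H'.2 := by
  have e := hx.unique h' (h.map hK')
  subst e
  exact ⟨fun ξ hξ => Submodule.mem_map_of_mem hξ, fun η hη => Submodule.mem_map_of_mem hη⟩

/-- The linear isomorphism `C : ℝ^d → T_xM` is adapted to the summable splitting `H`: in the
norm transported by `C`, the two summands are orthogonal, and their norms are Lyapunov norms. -/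
structure IsAdapted (f : M ≃ₘ^1⟮𝓡 d, 𝓡 d⟯ M) (x : M)
    (H : Submodule ℝ (TangentSpace (𝓡 d) x) × Submodule ℝ (TangentSpace (𝓡 d) x))
    (C : Euc d ≃L[ℝ] TangentSpace (𝓡 d) x) : Prop where
  split : IsSummableSplitting f x H
  norm_sq : ∀ ξ ∈ H.1, ∀ η ∈ H.2, ‖C.symm (ξ + η)‖ ^ 2 =
    2 * ∑' m : ℕ, dnorm f^[m] x ξ ^ 2 + 2 * ∑' m : ℕ, dnorm f.symm^[m] x η ^ 2

theorem IsLyapunovChange.isAdapted {f : M ≃ₘ^1⟮𝓡 d, 𝓡 d⟯ M}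
    {C : ∀ x : M, Euc d ≃L[ℝ] TangentSpace (𝓡 d) x} (hC : IsLyapunovChange f C) {x : M}
    (hx : IsSummablePoint f x) : IsAdapted f x (splitting f x) (C x) := by
  refine ⟨splitting_spec hx, fun ξ hξ η hη => ?_⟩
  have h := (hC x hx).1 ξ hξ ξ hξ η hη η hη
  simp only [real_inner_self_eq_norm_sq] at h
  exact h

namespace IsAdapted

variable {f : M ≃ₘ^1⟮𝓡 d, 𝓡 d⟯ M} {x : M}
  {H : Submodule ℝ (TangentSpace (𝓡 d) x) × Submodule ℝ (TangentSpace (𝓡 d) x)}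
  {C : Euc d ≃L[ℝ] TangentSpace (𝓡 d) x}
  {H' : Submodule ℝ (TangentSpace (𝓡 d) (f x)) × Submodule ℝ (TangentSpace (𝓡 d) (f x))}
  {C' : Euc d ≃L[ℝ] TangentSpace (𝓡 d) (f x)}

theorem symm (h : IsAdapted f x H C) : IsAdapted f.symm x (H.2, H.1) C := by
  refine ⟨h.split.symm, fun ξ hξ η hη => ?_⟩
  rw [add_comm ξ, h.norm_sq η hη ξ hξ, add_comm]
  rfl

theorem tsum_dnorm_zero (g : M → M) (y : M) :
    ∑' m : ℕ, dnorm (d := d) g^[m] y (0 : TangentSpace (𝓡 d) y) ^ 2 = 0 := by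
  have hz : ∀ m : ℕ, dnorm g^[m] y (0 : TangentSpace (𝓡 d) y) ^ 2 = 0 := fun m => by
    rw [dnorm, map_zero, norm_zero, zero_pow two_ne_zero]
  simp only [hz, tsum_zero]

theorem norm_sq_fst (h : IsAdapted f x H C) {ξ : TangentSpace (𝓡 d) x} (hξ : ξ ∈ H.1) :
    ‖C.symm ξ‖ ^ 2 = 2 * ∑' m : ℕ, dnorm f^[m] x ξ ^ 2 := by
  have := h.norm_sq ξ hξ 0 H.2.zero_mem
  rwa [add_zero, tsum_dnorm_zero, mul_zero, add_zero] at this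

theorem norm_sq_snd (h : IsAdapted f x H C) {η : TangentSpace (𝓡 d) x} (hη : η ∈ H.2) :
    ‖C.symm η‖ ^ 2 = 2 * ∑' m : ℕ, dnorm f.symm^[m] x η ^ 2 :=
  h.symm.norm_sq_fst hη

theorem norm_sq_add (h : IsAdapted f x H C) {ξ η : TangentSpace (𝓡 d) x} (hξ : ξ ∈ H.1)
    (hη : η ∈ H.2) : ‖C.symm (ξ + η)‖ ^ 2 = ‖C.symm ξ‖ ^ 2 + ‖C.symm η‖ ^ 2 := by
  rw [h.norm_sq ξ hξ η hη, h.norm_sq_fst hξ, h.norm_sq_snd hη]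

theorem exists_add (h : IsAdapted f x H C) (v : TangentSpace (𝓡 d) x) :
    ∃ ξ ∈ H.1, ∃ η ∈ H.2, ξ + η = v := by
  have hv : v ∈ H.1 ⊔ H.2 := by rw [h.split.1.sup_eq_top]; trivial
  exact Submodule.mem_sup.1 hv

theorem sq_le_fst (h : IsAdapted f x H C) {ξ : TangentSpace (𝓡 d) x} (hξ : ξ ∈ H.1) :
    2 * ‖ξ‖ ^ 2 ≤ ‖C.symm ξ‖ ^ 2 := by
  rw [h.norm_sq_fst hξ]
  have h1 := (h.split.2.1.summable hξ).le_tsum 0 (fun _ _ => sq_nonneg _)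
  have h2 : dnorm f^[0] x ξ = ‖ξ‖ := dnorm_id _ _
  rw [h2] at h1
  linarith

theorem sq_le_snd (h : IsAdapted f x H C) {η : TangentSpace (𝓡 d) x} (hη : η ∈ H.2) :
    2 * ‖η‖ ^ 2 ≤ ‖C.symm η‖ ^ 2 := h.symm.sq_le_fst hη

theorem norm_le (h : IsAdapted f x H C) (v : TangentSpace (𝓡 d) x) : ‖v‖ ≤ ‖C.symm v‖ := by
  obtain ⟨ξ, hξ, η, hη, rfl⟩ := h.exists_add v
  refine (pow_le_pow_iff_left₀ (norm_nonneg _) (norm_nonneg _) two_ne_zero).1 ?_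
  rw [h.norm_sq_add hξ hη]
  have h1 := h.sq_le_fst hξ
  have h2 := h.sq_le_snd hη
  have h3 := norm_add_le ξ η
  have h4 : ‖ξ + η‖ ^ 2 ≤ (‖ξ‖ + ‖η‖) ^ 2 := pow_le_pow_left₀ (norm_nonneg _) h3 2
  nlinarith [sq_nonneg (‖ξ‖ - ‖η‖)]

theorem norm_map_le (h : IsAdapted f x H C) (a : Euc d) : ‖C a‖ ≤ ‖a‖ := by
  have := h.norm_le (C a)
  rwa [ContinuousLinearEquiv.symm_apply_apply] at this

theorem norm_sq_map_fst (h : IsAdapted f x H C) (h' : IsAdapted f (f x) H' C')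
    (hm : ∀ ξ ∈ H.1, mfderiv (𝓡 d) (𝓡 d) f x ξ ∈ H'.1) {ξ : TangentSpace (𝓡 d) x} (hξ : ξ ∈ H.1) :
    ‖C'.symm (mfderiv (𝓡 d) (𝓡 d) f x ξ)‖ ^ 2 = ‖C.symm ξ‖ ^ 2 - 2 * ‖ξ‖ ^ 2 := by
  rw [h'.norm_sq_fst (hm ξ hξ), h.norm_sq_fst hξ, (h.split.2.1.summable hξ).tsum_eq_zero_add]
  have h2 : dnorm f^[0] x ξ = ‖ξ‖ := dnorm_id _ _
  simp only [← dnorm_iterate_succ, h2]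
  ring

theorem norm_sq_map_snd (h : IsAdapted f x H C) (h' : IsAdapted f (f x) H' C')
    (hm : ∀ η ∈ H.2, mfderiv (𝓡 d) (𝓡 d) f x η ∈ H'.2) {η : TangentSpace (𝓡 d) x} (hη : η ∈ H.2) :
    ‖C'.symm (mfderiv (𝓡 d) (𝓡 d) f x η)‖ ^ 2 = ‖C.symm η‖ ^ 2 + 2 * dnorm f x η ^ 2 := by
  rw [h'.norm_sq_snd (hm η hη), h.norm_sq_snd hη,
    (h'.split.2.2.summable (hm η hη)).tsum_eq_zero_add]
  have h2 : dnorm f.symm^[0] (f x) (mfderiv (𝓡 d) (𝓡 d) f x η) = dnorm f x η := dnorm_id _ _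
  simp only [dnorm_symm_iterate_succ, h2]
  ring

variable {K : ℝ}

theorem norm_sq_map_le (h : IsAdapted f x H C) (h' : IsAdapted f (f x) H' C')
    (hm₁ : ∀ ξ ∈ H.1, mfderiv (𝓡 d) (𝓡 d) f x ξ ∈ H'.1)
    (hm₂ : ∀ η ∈ H.2, mfderiv (𝓡 d) (𝓡 d) f x η ∈ H'.2)
    (hK : ∀ v : TangentSpace (𝓡 d) x, dnorm f x v ≤ K * ‖v‖) (v : TangentSpace (𝓡 d) x) :
    ‖C'.symm (mfderiv (𝓡 d) (𝓡 d) f x v)‖ ^ 2 ≤ (1 + K ^ 2) * ‖C.symm v‖ ^ 2 := by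
  obtain ⟨ξ, hξ, η, hη, rfl⟩ := h.exists_add v
  rw [map_add, h'.norm_sq_add (hm₁ ξ hξ) (hm₂ η hη), h.norm_sq_add hξ hη,
    h.norm_sq_map_fst h' hm₁ hξ, h.norm_sq_map_snd h' hm₂ hη]
  have h1 : dnorm f x η ^ 2 ≤ K ^ 2 * ‖η‖ ^ 2 := by
    rw [← mul_pow]
    exact pow_le_pow_left₀ (dnorm_nonneg _ _ _) (hK η) 2
  have h2 := h.sq_le_snd hη
  nlinarith [sq_nonneg ‖ξ‖, sq_nonneg K, sq_nonneg ‖C.symm ξ‖,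
    mul_le_mul_of_nonneg_left h2 (sq_nonneg K),
    mul_nonneg (sq_nonneg K) (sq_nonneg ‖C.symm ξ‖)]

theorem norm_map_le_mul (h : IsAdapted f x H C) (h' : IsAdapted f (f x) H' C')
    (hm₁ : ∀ ξ ∈ H.1, mfderiv (𝓡 d) (𝓡 d) f x ξ ∈ H'.1)
    (hm₂ : ∀ η ∈ H.2, mfderiv (𝓡 d) (𝓡 d) f x η ∈ H'.2) (hK1 : 1 ≤ K)
    (hK : ∀ v : TangentSpace (𝓡 d) x, dnorm f x v ≤ K * ‖v‖) (v : TangentSpace (𝓡 d) x) :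
    ‖C'.symm (mfderiv (𝓡 d) (𝓡 d) f x v)‖ ≤ (1 + K) * ‖C.symm v‖ := by
  refine (pow_le_pow_iff_left₀ (norm_nonneg _) (by positivity) two_ne_zero).1 ?_
  have h1 := h.norm_sq_map_le h' hm₁ hm₂ hK v
  rw [mul_pow]
  nlinarith [mul_nonneg (zero_le_one.trans hK1) (sq_nonneg ‖C.symm v‖)]

/-- A bound for `C⁻¹` at `x` gives one at `f x`. -/
theorem norm_symm_map_le (h : IsAdapted f x H C) (h' : IsAdapted f (f x) H' C')
    (hm₁ : ∀ ξ ∈ H.1, mfderiv (𝓡 d) (𝓡 d) f x ξ ∈ H'.1)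
    (hm₂ : ∀ η ∈ H.2, mfderiv (𝓡 d) (𝓡 d) f x η ∈ H'.2) (hK1 : 1 ≤ K)
    (hK : ∀ v : TangentSpace (𝓡 d) x, dnorm f x v ≤ K * ‖v‖)
    (hK' : ∀ v : TangentSpace (𝓡 d) x, ‖v‖ ≤ K * dnorm f x v) {N : ℝ} (hN0 : 0 ≤ N)
    (hN : ∀ v, ‖C.symm v‖ ≤ N * ‖v‖) (w : TangentSpace (𝓡 d) (f x)) :
    ‖C'.symm w‖ ≤ K * (1 + K) * N * ‖w‖ := by
  obtain ⟨v, rfl⟩ := mfderiv_diffeo_surjective f x w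
  calc ‖C'.symm (mfderiv (𝓡 d) (𝓡 d) f x v)‖ ≤ (1 + K) * ‖C.symm v‖ :=
        h.norm_map_le_mul h' hm₁ hm₂ hK1 hK v
    _ ≤ (1 + K) * (N * ‖v‖) := by gcongr; exact hN v
    _ ≤ (1 + K) * (N * (K * dnorm f x v)) := by gcongr; exact hK' v
    _ = K * (1 + K) * N * dnorm f x v := by ring
    _ = _ := rfl

/-- The rate at which `f` contracts the first summand in Lyapunov norms; `N` is a bound for the
norm of `C⁻¹`. -/
theorem contract (h : IsAdapted f x H C) (h' : IsAdapted f (f x) H' C')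
    (hm : ∀ ξ ∈ H.1, mfderiv (𝓡 d) (𝓡 d) f x ξ ∈ H'.1) {N : ℝ} (hN1 : 1 ≤ N)
    (hN : ∀ v, ‖C.symm v‖ ≤ N * ‖v‖) {ξ : TangentSpace (𝓡 d) x} (hξ : ξ ∈ H.1) :
    ‖C'.symm (mfderiv (𝓡 d) (𝓡 d) f x ξ)‖ ≤ (1 - 1 / N ^ 2) * ‖C.symm ξ‖ := by
  have h1 : 1 / N ^ 2 ≤ 1 := by
    rw [div_le_one (by positivity)]
    exact one_le_pow₀ hN1
  refine (pow_le_pow_iff_left₀ (norm_nonneg _) (mul_nonneg (by linarith) (norm_nonneg _))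
    two_ne_zero).1 ?_
  rw [h.norm_sq_map_fst h' hm hξ, mul_pow]
  have h2 : ‖C.symm ξ‖ ^ 2 ≤ N ^ 2 * ‖ξ‖ ^ 2 := by
    rw [← mul_pow]
    exact pow_le_pow_left₀ (norm_nonneg _) (hN ξ) 2
  have h3 : 1 / N ^ 2 * ‖C.symm ξ‖ ^ 2 ≤ ‖ξ‖ ^ 2 := by
    rw [one_div_mul_eq_div, div_le_iff₀ (by positivity)]
    linarith
  nlinarith [mul_nonneg (sq_nonneg (1 / N ^ 2)) (sq_nonneg ‖C.symm ξ‖)]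

/-- The rate at which `f` expands the second summand in Lyapunov norms. -/
theorem expand (h : IsAdapted f x H C) (h' : IsAdapted f (f x) H' C')
    (hm : ∀ η ∈ H.2, mfderiv (𝓡 d) (𝓡 d) f x η ∈ H'.2) {N : ℝ} (hN1 : 1 ≤ N)
    (hN : ∀ v, ‖C.symm v‖ ≤ N * ‖v‖) (hK1 : 1 ≤ K)
    (hK' : ∀ v : TangentSpace (𝓡 d) x, ‖v‖ ≤ K * dnorm f x v)
    {η : TangentSpace (𝓡 d) x} (hη : η ∈ H.2) :
    (1 + 1 / (2 * K ^ 2 * N ^ 2)) * ‖C.symm η‖ ≤ ‖C'.symm (mfderiv (𝓡 d) (𝓡 d) f x η)‖ := by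
  refine (pow_le_pow_iff_left₀ (by positivity) (norm_nonneg _) two_ne_zero).1 ?_
  rw [h.norm_sq_map_snd h' hm hη, mul_pow]
  have hN2 : 1 ≤ N ^ 2 := one_le_pow₀ hN1
  have hK2 : 1 ≤ K ^ 2 := one_le_pow₀ hK1
  have h2 : ‖C.symm η‖ ^ 2 ≤ N ^ 2 * (K ^ 2 * dnorm f x η ^ 2) := by
    rw [← mul_pow, ← mul_pow]
    exact pow_le_pow_left₀ (norm_nonneg _) ((hN η).trans
      (mul_le_mul_of_nonneg_left (hK' η) (by linarith))) 2
  set u := 1 / (2 * K ^ 2 * N ^ 2) with hu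
  have hu0 : 0 < u := by positivity
  have hu1 : u ≤ 1 := by
    rw [hu, div_le_one (by positivity)]
    nlinarith
  have h3 : 2 * u * ‖C.symm η‖ ^ 2 ≤ dnorm f x η ^ 2 := by
    have : 2 * u = 1 / (K ^ 2 * N ^ 2) := by rw [hu]; field_simp
    rw [this, one_div_mul_eq_div, div_le_iff₀ (by positivity)]
    linarith
  have h4 : u ^ 2 * ‖C.symm η‖ ^ 2 ≤ u * ‖C.symm η‖ ^ 2 := by
    gcongr
    nlinarith
  nlinarith [sq_nonneg (dnorm f x η), mul_nonneg hu0.le (sq_nonneg ‖C.symm η‖)]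

end IsAdapted

end Adapted

/-! ### Estimates for the diffeomorphism in Pesin charts -/

section Perturbation

variable {A B E : Type*} [NormedAddCommGroup A] [NormedSpace ℝ A]
  [NormedAddCommGroup B] [NormedSpace ℝ B] [NormedAddCommGroup E] [NormedSpace ℝ E]

/-- The deviation of the map `cy ∘ g ∘ cx` from the linear map `L`. Half of the Hölder exponent
`β` of the derivative of `g` is traded for a small factor `Q^(β/2)`. -/
theorem exists_perturbation (J : (A × B) ≃L[ℝ] E) (hJ₁ : ∀ z, ‖z‖ ≤ ‖J z‖)
    (hJ₂ : ∀ z, ‖J z‖ ≤ 2 * ‖z‖) {β r H K N Q δ : ℝ} (hβ : β ∈ Ioo (0 : ℝ) 1) (hH : 0 ≤ H)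
    (hK : 0 ≤ K) (hN : 0 ≤ N) (hQ : 0 ≤ Q) (hQr : 20 * Q < r) (hδ : 0 ≤ δ)
    (cx cy L c' c'' : E →L[ℝ] E) (hcx : ∀ a, ‖cx a‖ ≤ ‖a‖) (hcy : ∀ a, ‖cy a‖ ≤ N * ‖a‖)
    (hL : ∀ a, ‖L a‖ ≤ (1 + K) * ‖a‖) (hc'' : ∀ a, cy (c'' a) = a)
    (hc : ∀ a, ‖c' a - c'' a‖ ≤ (H + 1) * δ * ‖a‖) (g : E → E) (dg : E → E →L[ℝ] E)
    (hg : ∀ u ∈ Metric.ball (0 : E) r, HasFDerivAt g (dg u) u ∧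
      ∀ u' ∈ Metric.ball (0 : E) r, ‖dg u - dg u'‖ ≤ H * ‖u - u'‖ ^ β)
    (hg0 : ‖g 0‖ ≤ H * δ) (hdg0 : ∀ a, ‖dg 0 (cx a) - c' (L a)‖ ≤ H * δ * ‖a‖) :
    ∃ (h : A × B → A × B) (dh : A × B → A × B →L[ℝ] A × B),
      (∀ z, J (h z) = cy (g (cx (J z))) - L (J z)) ∧
      (∀ z ∈ Metric.closedBall (0 : A × B) (10 * Q), HasFDerivAt h (dh z) z) ∧
      (∀ z ∈ Metric.closedBall (0 : A × B) (10 * Q),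
        ∀ z' ∈ Metric.closedBall (0 : A × B) (10 * Q),
          ‖dh z - dh z'‖ ≤ 80 * N * H * Q ^ (β / 2) * ‖z - z'‖ ^ (β / 2)) ∧
      ‖h 0‖ ≤ N * H * δ ∧ ‖dh 0‖ ≤ 2 * N * (2 * H + 1) * (1 + K) * δ := by
  have hJs : ∀ w, ‖J.symm w‖ ≤ ‖w‖ := fun w => by
    have := hJ₁ (J.symm w)
    rwa [J.apply_symm_apply] at this
  set Ji : E →L[ℝ] A × B := (J.symm : E →L[ℝ] A × B) with hJi
  set Jc : A × B →L[ℝ] E := (J : A × B →L[ℝ] E) with hJc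
  have hmem : ∀ z ∈ Metric.closedBall (0 : A × B) (10 * Q), cx (J z) ∈ Metric.ball (0 : E) r := by
    intro z hz
    rw [mem_closedBall_zero_iff] at hz
    rw [mem_ball_zero_iff]
    linarith [hcx (J z), hJ₂ z]
  refine ⟨fun z => J.symm (cy (g (cx (J z))) - L (J z)),
    fun z => Ji ∘L ((cy ∘L dg (cx (J z)) ∘L cx - L) ∘L Jc), fun z => J.apply_symm_apply _,
    fun z hz => ?_, fun z hz z' hz' => ?_, ?_, ?_⟩
  · have h1 : HasFDerivAt (fun z => cx (J z)) (cx ∘L Jc) z := (cx ∘L Jc).hasFDerivAt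
    have h2 := (cy.hasFDerivAt (x := g (cx (J z)))).comp z ((hg _ (hmem z hz)).1.comp z h1)
    have h3 : HasFDerivAt (fun z => L (J z)) (L ∘L Jc) z := (L ∘L Jc).hasFDerivAt
    exact (Ji.hasFDerivAt).comp z (h2.sub h3)
  · refine ContinuousLinearMap.opNorm_le_bound _ (by positivity) fun w => ?_
    have h1 := (hg _ (hmem z hz)).2 _ (hmem z' hz')
    have h2 : (Ji ∘L ((cy ∘L dg (cx (J z)) ∘L cx - L) ∘L Jc) -
        Ji ∘L ((cy ∘L dg (cx (J z')) ∘L cx - L) ∘L Jc)) w =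
        J.symm (cy ((dg (cx (J z)) - dg (cx (J z'))) (cx (J w)))) := by
      simp only [hJi, hJc, _root_.sub_apply, ContinuousLinearMap.comp_apply,
        ContinuousLinearEquiv.coe_coe, map_sub]
      abel
    have h3 : ‖cx (J z) - cx (J z')‖ ≤ 2 * ‖z - z'‖ := by
      rw [← map_sub, ← map_sub]
      exact (hcx _).trans (hJ₂ _)
    have h4 : ‖z - z'‖ ≤ 20 * Q := by
      rw [mem_closedBall_zero_iff] at hz hz'
      linarith [norm_sub_le z z']
    have h5 : ‖cx (J z) - cx (J z')‖ ^ β ≤ 40 * Q ^ (β / 2) * ‖z - z'‖ ^ (β / 2) := by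
      have e1 : (2 : ℝ) ^ β ≤ 2 := by
        simpa using Real.rpow_le_rpow_of_exponent_le (x := 2) (by norm_num) hβ.2.le
      have e2 : (20 : ℝ) ^ (β / 2) ≤ 20 := by
        simpa using Real.rpow_le_rpow_of_exponent_le (x := 20) (y := β / 2) (z := 1) (by norm_num)
          (by linarith [hβ.2])
      have e3 : ‖z - z'‖ ^ β = ‖z - z'‖ ^ (β / 2) * ‖z - z'‖ ^ (β / 2) := by
        rw [← Real.rpow_add_of_nonneg (norm_nonneg _) (by linarith [hβ.1]) (by linarith [hβ.1])]
        ring_nf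
      calc ‖cx (J z) - cx (J z')‖ ^ β ≤ (2 * ‖z - z'‖) ^ β :=
            Real.rpow_le_rpow (norm_nonneg _) h3 hβ.1.le
        _ = 2 ^ β * (‖z - z'‖ ^ (β / 2) * ‖z - z'‖ ^ (β / 2)) := by
            rw [Real.mul_rpow (by norm_num) (norm_nonneg _), e3]
        _ ≤ 2 * ((20 * Q) ^ (β / 2) * ‖z - z'‖ ^ (β / 2)) := by
            gcongr
            linarith [hβ.1]
        _ = 2 * (20 ^ (β / 2) * Q ^ (β / 2) * ‖z - z'‖ ^ (β / 2)) := by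
            rw [Real.mul_rpow (by norm_num) hQ]
        _ ≤ 2 * (20 * Q ^ (β / 2) * ‖z - z'‖ ^ (β / 2)) := by gcongr
        _ = _ := by ring
    calc _ = ‖J.symm (cy ((dg (cx (J z)) - dg (cx (J z'))) (cx (J w))))‖ := congrArg _ h2
      _ ≤ ‖cy ((dg (cx (J z)) - dg (cx (J z'))) (cx (J w)))‖ := hJs _
      _ ≤ N * ‖(dg (cx (J z)) - dg (cx (J z'))) (cx (J w))‖ := hcy _
      _ ≤ N * (H * (40 * Q ^ (β / 2) * ‖z - z'‖ ^ (β / 2)) * (2 * ‖w‖)) := by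
          gcongr
          refine (ContinuousLinearMap.le_opNorm _ _).trans ?_
          gcongr
          · exact h1.trans (by gcongr)
          · exact (hcx _).trans (hJ₂ _)
      _ = _ := by ring
  · have h1 : J.symm (cy (g (cx (J 0))) - L (J 0)) = J.symm (cy (g 0)) := by
      simp only [map_zero, sub_zero]
    calc _ = ‖J.symm (cy (g 0))‖ := congrArg _ h1
      _ ≤ ‖cy (g 0)‖ := hJs _
      _ ≤ N * ‖g 0‖ := hcy _
      _ ≤ N * (H * δ) := by gcongr
      _ = _ := by ring
  · refine ContinuousLinearMap.opNorm_le_bound _ (by positivity) fun w => ?_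
    have h1 : (Ji ∘L ((cy ∘L dg (cx (J 0)) ∘L cx - L) ∘L Jc)) w =
        J.symm (cy (dg 0 (cx (J w)) - c' (L (J w))) + cy (c' (L (J w)) - c'' (L (J w)))) := by
      simp only [hJi, hJc, _root_.sub_apply, ContinuousLinearMap.comp_apply,
        ContinuousLinearEquiv.coe_coe, map_sub, map_zero, hc'', map_add]
      abel
    calc _ = ‖J.symm (cy (dg 0 (cx (J w)) - c' (L (J w))) +
              cy (c' (L (J w)) - c'' (L (J w))))‖ := congrArg _ h1
      _ ≤ ‖cy (dg 0 (cx (J w)) - c' (L (J w))) + cy (c' (L (J w)) - c'' (L (J w)))‖ := hJs _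
      _ ≤ ‖cy (dg 0 (cx (J w)) - c' (L (J w)))‖ + ‖cy (c' (L (J w)) - c'' (L (J w)))‖ :=
          norm_add_le _ _
      _ ≤ N * ‖dg 0 (cx (J w)) - c' (L (J w))‖ + N * ‖c' (L (J w)) - c'' (L (J w))‖ :=
          add_le_add (hcy _) (hcy _)
      _ ≤ N * (H * δ * (2 * ‖w‖)) + N * ((H + 1) * δ * ((1 + K) * (2 * ‖w‖))) := by
          gcongr
          · exact (hdg0 _).trans (by gcongr; exact hJ₂ w)
          · refine (hc _).trans ?_
            gcongr
            exact (hL _).trans (by gcongr; exact hJ₂ w)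
      _ ≤ _ := by
          have : 0 ≤ N * H * δ * K * ‖w‖ := by positivity
          nlinarith

end Perturbation

/-! ### The diffeomorphism as a nearly linear map -/

section PesinChart

variable {d : ℕ} {M : Type*} [TopologicalSpace M] [ChartedSpace (Euc d) M]
  [RiemannianBundle (fun x : M => TangentSpace (𝓡 d) x)] [IsManifold (𝓡 d) ∞ M]

/-- The base points `x₁`, `x₂` and the linear isomorphisms `C₁`, `C₂` of `ℝ^d` with the tangent
spaces there differ by less than `D`, measured in one of the frames. -/
def CloseFrames (F : Framing d M) {x₁ x₂ : M} (C₁ : Euc d ≃L[ℝ] TangentSpace (𝓡 d) x₁)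
    (C₂ : Euc d ≃L[ℝ] TangentSpace (𝓡 d) x₂) (D : ℝ) : Prop :=
  ∃ j, x₁ ∈ F.dom j ∧ x₂ ∈ F.dom j ∧
    riemannianEDist (𝓡 d) x₁ x₂ +
      ENNReal.ofReal
        ‖((F.Θ j x₁ : TangentSpace (𝓡 d) x₁ →L[ℝ] Euc d) ∘L
            (C₁ : Euc d →L[ℝ] TangentSpace (𝓡 d) x₁)) -
          ((F.Θ j x₂ : TangentSpace (𝓡 d) x₂ →L[ℝ] Euc d) ∘L
            (C₂ : Euc d →L[ℝ] TangentSpace (𝓡 d) x₂))‖ <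
      ENNReal.ofReal D

variable {F : Framing d M} {x₁ x₂ : M} {C₁ : Euc d ≃L[ℝ] TangentSpace (𝓡 d) x₁}
  {C₂ : Euc d ≃L[ℝ] TangentSpace (𝓡 d) x₂} {D : ℝ}

theorem CloseFrames.symm (h : CloseFrames F C₁ C₂ D) : CloseFrames F C₂ C₁ D := by
  obtain ⟨j, h1, h2, h3⟩ := h
  refine ⟨j, h2, h1, ?_⟩
  rwa [riemannianEDist_comm, norm_sub_rev]

theorem CloseFrames.edist_lt (h : CloseFrames F C₁ C₂ D) :
    riemannianEDist (𝓡 d) x₁ x₂ < ENNReal.ofReal D := by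
  obtain ⟨j, -, -, h3⟩ := h
  exact lt_of_le_of_lt le_self_add h3

theorem CloseFrames.toReal_le (h : CloseFrames F C₁ C₂ D) (hD : 0 ≤ D) :
    (riemannianEDist (𝓡 d) x₁ x₂).toReal ≤ D :=
  ENNReal.toReal_le_of_le_ofReal hD h.edist_lt.le

theorem CloseFrames.exists_norm_sub_le (h : CloseFrames F C₁ C₂ D) :
    ∃ j, x₁ ∈ F.dom j ∧ x₂ ∈ F.dom j ∧
      ∀ a : Euc d, ‖F.Θ j x₁ (C₁ a) - F.Θ j x₂ (C₂ a)‖ ≤ D * ‖a‖ := by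
  obtain ⟨j, h1, h2, h3⟩ := h
  refine ⟨j, h1, h2, fun a => ?_⟩
  have h4 := lt_of_le_of_lt le_add_self h3
  have h5 := ((ENNReal.ofReal_lt_ofReal_iff_of_nonneg (norm_nonneg _)).1 h4).le
  have h6 := (ContinuousLinearMap.le_opNorm
    (((F.Θ j x₁ : TangentSpace (𝓡 d) x₁ →L[ℝ] Euc d) ∘L
            (C₁ : Euc d →L[ℝ] TangentSpace (𝓡 d) x₁)) -
          ((F.Θ j x₂ : TangentSpace (𝓡 d) x₂ →L[ℝ] Euc d) ∘L
            (C₂ : Euc d →L[ℝ] TangentSpace (𝓡 d) x₂))) a)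
  exact h6.trans (mul_le_mul_of_nonneg_right h5 (norm_nonneg _))

theorem CloseFrames.norm_symm_le (h : CloseFrames F C₁ C₂ D) {N : ℝ} (hN0 : 0 ≤ N)
    (hN : ∀ v, ‖C₁.symm v‖ ≤ N * ‖v‖) (hND : N * D ≤ 1 / 2) (v : TangentSpace (𝓡 d) x₂) :
    ‖C₂.symm v‖ ≤ 2 * N * ‖v‖ := by
  obtain ⟨j, -, -, h1⟩ := h.exists_norm_sub_le
  set a := C₂.symm v with ha
  have e : v = C₂ a := (C₂.apply_symm_apply v).symm
  have h2 := hN (C₁ a)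
  rw [C₁.symm_apply_apply, ← (F.Θ j x₁).norm_map] at h2
  have h3 : ‖F.Θ j x₁ (C₁ a)‖ ≤ ‖v‖ + D * ‖a‖ := by
    have h4 := norm_le_norm_add_norm_sub (F.Θ j x₂ (C₂ a)) (F.Θ j x₁ (C₁ a))
    rw [norm_sub_rev (F.Θ j x₂ (C₂ a)), (F.Θ j x₂).norm_map, ← e] at h4
    rw [e] at h4 ⊢
    exact h4.trans (by gcongr; exact h1 a)
  have h5 : N * ‖F.Θ j x₁ (C₁ a)‖ ≤ N * (‖v‖ + D * ‖a‖) := by gcongr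
  have h6 : N * D * ‖a‖ ≤ 1 / 2 * ‖a‖ := by gcongr
  linarith

/-- The contraction rate `10^5 e` of the diffeomorphism in the Pesin chart at a point where
`‖C₀⁻¹‖ ≤ N`; here `K` bounds the differential and its inverse. -/
def rate (K N : ℝ) : ℝ := 1 / (2 * 10 ^ 5 * K ^ 2 * N ^ 2)

theorem rate_pos {K N : ℝ} (hK : 1 ≤ K) (hN : 1 ≤ N) : 0 < rate K N := by
  unfold rate
  positivity

theorem rate_le {K N : ℝ} (hK : 1 ≤ K) (hN : 1 ≤ N) : 10 ^ 5 * rate K N ≤ 1 / 2 := by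
  have h : 10 ^ 5 * rate K N = 1 / 2 * (1 / (K ^ 2 * N ^ 2)) := by unfold rate; field_simp
  have h2 : 1 / (K ^ 2 * N ^ 2) ≤ 1 := by
    rw [div_le_one (by positivity)]
    exact one_le_mul_of_one_le_of_one_le (one_le_pow₀ hK) (one_le_pow₀ hN)
  linarith

theorem rate_eq {K N : ℝ} : 10 ^ 5 * rate K N = 1 / (2 * K ^ 2 * N ^ 2) := by
  unfold rate
  field_simp

theorem rate_le_one_div {K N : ℝ} (hK : 1 ≤ K) (hN : 1 ≤ N) :
    10 ^ 5 * rate K N ≤ 1 / N ^ 2 := by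
  rw [rate_eq]
  refine one_div_le_one_div_of_le (by positivity) ?_
  have := one_le_pow₀ (n := 2) hK
  have h2 : 0 < N ^ 2 := by positivity
  nlinarith

variable {f : M ≃ₘ^1⟮𝓡 d, 𝓡 d⟯ M} {x y : M}
  {H : Submodule ℝ (TangentSpace (𝓡 d) x) × Submodule ℝ (TangentSpace (𝓡 d) x)}
  {C : Euc d ≃L[ℝ] TangentSpace (𝓡 d) x}
  {H' : Submodule ℝ (TangentSpace (𝓡 d) (f x)) × Submodule ℝ (TangentSpace (𝓡 d) (f x))}
  {C' : Euc d ≃L[ℝ] TangentSpace (𝓡 d) (f x)}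
  {A B : Type*} [NormedAddCommGroup A] [NormedSpace ℝ A]
  [NormedAddCommGroup B] [NormedSpace ℝ B]

/-- The differential, read in Lyapunov coordinates, is block diagonal, with a contracting and an
expanding block. -/
theorem IsAdapted.exists_blocks (h : IsAdapted f x H C) (h' : IsAdapted f (f x) H' C')
    (hm₁ : ∀ ξ ∈ H.1, mfderiv (𝓡 d) (𝓡 d) f x ξ ∈ H'.1)
    (hm₂ : ∀ η ∈ H.2, mfderiv (𝓡 d) (𝓡 d) f x η ∈ H'.2) {K N : ℝ} (hK1 : 1 ≤ K)
    (hK' : ∀ v : TangentSpace (𝓡 d) x, ‖v‖ ≤ K * dnorm f x v) (hN1 : 1 ≤ N)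
    (hN : ∀ v, ‖C.symm v‖ ≤ N * ‖v‖) (J : (A × B) ≃L[ℝ] Euc d)
    (hJA : ∀ a : A, ‖J (a, 0)‖ = ‖a‖) (hJB : ∀ b : B, ‖J (0, b)‖ = ‖b‖)
    (hJ₁ : ∀ a : A, C (J (a, 0)) ∈ H.1) (hJ₂ : ∀ b : B, C (J (0, b)) ∈ H.2)
    (hJ₁' : ∀ z : A × B, C' (J z) ∈ H'.1 → z.2 = 0)
    (hJ₂' : ∀ z : A × B, C' (J z) ∈ H'.2 → z.1 = 0) :
    ∃ (LA : A →L[ℝ] A) (LB : B →L[ℝ] B),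
      (∀ a b, C'.symm (mfderiv (𝓡 d) (𝓡 d) f x (C (J (a, b)))) = J (LA a, LB b)) ∧
      (∀ a, ‖LA a‖ ≤ (1 - 10 ^ 5 * rate K N) * ‖a‖) ∧
      ∀ b, (1 + 10 ^ 5 * rate K N) * ‖b‖ ≤ ‖LB b‖ := by
  set L : A × B →L[ℝ] A × B := (J.symm : Euc d →L[ℝ] A × B) ∘L
    (C'.symm : TangentSpace (𝓡 d) (f x) →L[ℝ] Euc d) ∘L (mfderiv (𝓡 d) (𝓡 d) f x) ∘L
    (C : Euc d →L[ℝ] TangentSpace (𝓡 d) x) ∘L (J : A × B →L[ℝ] Euc d) with hL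
  have hLJ : ∀ z, J (L z) = C'.symm (mfderiv (𝓡 d) (𝓡 d) f x (C (J z))) := fun z =>
    J.apply_symm_apply _
  have hCL : ∀ z, C' (J (L z)) = mfderiv (𝓡 d) (𝓡 d) f x (C (J z)) := fun z => by
    rw [hLJ, ContinuousLinearEquiv.apply_symm_apply]
  have hA : ∀ a : A, (L (a, 0)).2 = 0 := fun a =>
    hJ₁' _ (by rw [hCL]; exact hm₁ _ (hJ₁ a))
  have hB : ∀ b : B, (L (0, b)).1 = 0 := fun b =>
    hJ₂' _ (by rw [hCL]; exact hm₂ _ (hJ₂ b))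
  have eA : ∀ a : A, L (a, 0) = ((L (a, 0)).1, 0) := fun a => Prod.ext rfl (hA a)
  have eB : ∀ b : B, L (0, b) = (0, (L (0, b)).2) := fun b => Prod.ext (hB b) rfl
  refine ⟨(ContinuousLinearMap.fst ℝ A B) ∘L L ∘L (ContinuousLinearMap.inl ℝ A B),
    (ContinuousLinearMap.snd ℝ A B) ∘L L ∘L (ContinuousLinearMap.inr ℝ A B),
    fun a b => ?_, fun a => ?_, fun b => ?_⟩
  · rw [← hLJ]
    congr 1
    have : L (a, b) = L (a, 0) + L (0, b) := by rw [← map_add]; simp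
    rw [this, eA, eB]
    simp
  · have h1 := h.contract h' hm₁ hN1 hN (hJ₁ a)
    rw [ContinuousLinearEquiv.symm_apply_apply, hJA, ← hLJ, eA, hJA] at h1
    refine h1.trans (mul_le_mul_of_nonneg_right ?_ (norm_nonneg _))
    linarith [rate_le_one_div hK1 hN1]
  · have h1 := h.expand h' hm₂ hN1 hN hK1 hK' (hJ₂ b)
    rw [ContinuousLinearEquiv.symm_apply_apply, hJB, ← hLJ, eB, hJB] at h1
    rw [rate_eq]
    exact h1

variable [CompactSpace M] [T2Space M]
  [IsContMDiffRiemannianBundle (𝓡 d) ∞ (Euc d) (fun x : M => TangentSpace (𝓡 d) x)]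

/-- The constant of the smallness condition under which a diffeomorphism is a nearly linear
hyperbolic map in Pesin charts; `K` bounds the differential and its inverse, and `H` is the
constant of `HasTransfer`. -/
def smallness (K H : ℝ) : ℝ := 1024 * K * (1 + K) ^ 2 * (2 * H + 1)

set_option maxHeartbeats 1000000 in
/-- In Pesin charts around `x` and around a point `y` near `f x`, the diffeomorphism is a
nearly linear hyperbolic map. -/
theorem IsAdapted.exists_isStep {β Γ γ r₀ r K T N Q η p η' p' : ℝ}
    (hβ : β ∈ Ioo (0 : ℝ) 1) (hΓ : 0 < Γ) (hK1 : 1 ≤ K)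
    (hK : ∀ v : TangentSpace (𝓡 d) x, dnorm f x v ≤ K * ‖v‖)
    (hK' : ∀ v : TangentSpace (𝓡 d) x, ‖v‖ ≤ K * dnorm f x v) (hT : 0 ≤ T)
    (htr : HasTransfer f F β r₀ r T x y)
    (h : IsAdapted f x H C) (h' : IsAdapted f (f x) H' C')
    (hm₁ : ∀ ξ ∈ H.1, mfderiv (𝓡 d) (𝓡 d) f x ξ ∈ H'.1)
    (hm₂ : ∀ η ∈ H.2, mfderiv (𝓡 d) (𝓡 d) f x η ∈ H'.2)
    {C'' : Euc d ≃L[ℝ] TangentSpace (𝓡 d) y}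
    (hclose : CloseFrames F C' C'' (η' ^ 4 * η' ^ 4)) (hN1 : 1 ≤ N)
    (hN : ∀ v, ‖C.symm v‖ ≤ N * ‖v‖) (J : (A × B) ≃L[ℝ] Euc d)
    (hJ : ∀ z, ‖J z‖ ^ 2 = ‖z.1‖ ^ 2 + ‖z.2‖ ^ 2)
    (hJ₁ : ∀ a : A, C (J (a, 0)) ∈ H.1) (hJ₂ : ∀ b : B, C (J (0, b)) ∈ H.2)
    (hJ₁' : ∀ z : A × B, C' (J z) ∈ H'.1 → z.2 = 0)
    (hJ₂' : ∀ z : A × B, C' (J z) ∈ H'.2 → z.1 = 0)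
    (hη : 0 < η) (hηp : η ≤ p) (hpQ : p ≤ Q) (hη' : 0 < η') (hηp' : η' ≤ p')
    (hp' : p' ≤ ladder Γ γ p) (hηη' : η ≤ ladder Γ γ η') (hηη : η' ≤ ladder Γ γ η)
    (hγ : 0 < γ) (hQ1 : 10 * Q ≤ 1) (hQr : 20 * Q < r)
    (hsmall : smallness K T * N * Q ^ (β / 2) ≤ rate K N / 2)
    (hlad : 2 * (Γ * Q ^ (1 / γ)) ≤ rate K N) :
    ∃ (LA : A →L[ℝ] A) (LB : B →L[ℝ] B) (u : A × B → A × B) (du : A × B → A × B →L[ℝ] A × B),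
      IsStep (β / 2) (rate K N) Q η p η' p' LA LB u du ∧
      ∀ z ∈ Metric.closedBall (0 : A × B) (10 * Q),
        expMap y (C'' (J (blockMap LA LB u z))) = f (expMap x (C (J z))) ∧
          ‖C'' (J (blockMap LA LB u z))‖ < r₀ := by
  have hQ0 : 0 < Q := hη.trans_le (hηp.trans hpQ)
  have hJ1 : ∀ z, ‖z‖ ≤ ‖J z‖ := fun z => by
    refine max_le ?_ ?_ <;>
    refine (pow_le_pow_iff_left₀ (norm_nonneg _) (norm_nonneg _) two_ne_zero).1 ?_ <;>
    rw [hJ] <;> nlinarith [sq_nonneg ‖z.1‖, sq_nonneg ‖z.2‖]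
  have hJ2 : ∀ z, ‖J z‖ ≤ 2 * ‖z‖ := fun z => by
    refine (pow_le_pow_iff_left₀ (norm_nonneg _) (by positivity) two_ne_zero).1 ?_
    rw [hJ, mul_pow]
    have h1 : ‖z.1‖ ^ 2 ≤ ‖z‖ ^ 2 := pow_le_pow_left₀ (norm_nonneg _) (_root_.norm_fst_le z) 2
    have h2 : ‖z.2‖ ^ 2 ≤ ‖z‖ ^ 2 := pow_le_pow_left₀ (norm_nonneg _) (_root_.norm_snd_le z) 2
    nlinarith [sq_nonneg ‖z‖]
  have hJA : ∀ a : A, ‖J (a, 0)‖ = ‖a‖ := fun a => by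
    have := hJ (a, 0)
    simp only [norm_zero, ne_eq, OfNat.ofNat_ne_zero, not_false_eq_true, zero_pow, add_zero] at this
    exact (pow_left_inj₀ (norm_nonneg _) (norm_nonneg _) two_ne_zero).1 this
  have hJB : ∀ b : B, ‖J (0, b)‖ = ‖b‖ := fun b => by
    have := hJ (0, b)
    simp only [norm_zero, ne_eq, OfNat.ofNat_ne_zero, not_false_eq_true, zero_pow, zero_add] at this
    exact (pow_left_inj₀ (norm_nonneg _) (norm_nonneg _) two_ne_zero).1 this
  set e := rate K N with he
  have he0 : 0 < e := rate_pos hK1 hN1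
  have he1 : 10 ^ 5 * e ≤ 1 / 2 := rate_le hK1 hN1
  set P := Q ^ (β / 2) with hP
  have hP0 : 0 < P := Real.rpow_pos_of_pos hQ0 _
  set D := η' ^ 4 * η' ^ 4 with hD
  have hD0 : 0 < D := by positivity
  -- the ladder function is almost the identity on the sizes that occur
  have hladle : ∀ t, 0 ≤ t → t ≤ Q → ladder Γ γ t ≤ (1 + e) * t := fun t ht htQ =>
    ladder_le_of_le hΓ.le ht (by linarith) (le_trans (by gcongr) hlad)
  have hη'η : η' ≤ (1 + e) * η := hηη.trans (hladle η hη.le (hηp.trans hpQ))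
  have hηη2 : η ≤ (1 + e) * η' := by
    rcases le_total η η' with h1 | h1
    · nlinarith
    · exact hηη'.trans (hladle η' hη'.le (h1.trans (hηp.trans hpQ)))
  have hη'2 : η' ≤ 2 * η := by nlinarith
  -- the deviation of the base points is of higher order than the sizes
  set X := η ^ (β / 2) with hX
  have hη1 : η ≤ 1 := by linarith
  have hX0 : 0 < X := Real.rpow_pos_of_pos hη _
  have hXP : X ≤ P := Real.rpow_le_rpow hη.le (hηp.trans hpQ) (by linarith [hβ.1])
  have hηX : η ≤ X := by
    simpa using Real.rpow_le_rpow_of_exponent_ge hη hη1 (by linarith [hβ.2] : β / 2 ≤ 1)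
  have hD8 : D ≤ 256 * (η ^ 2 * η) := by
    calc D = η' ^ 8 := by rw [hD]; ring
      _ ≤ (2 * η) ^ 8 := by gcongr
      _ = 256 * (η ^ 2 * η * η ^ 5) := by ring
      _ ≤ 256 * (η ^ 2 * η * 1) := by
          gcongr
          exact pow_le_one₀ hη.le hη1
      _ = _ := by ring
  have hD2 : D ≤ 256 * P * η ^ 2 := by
    refine hD8.trans ?_
    have : η ^ 2 * η ≤ η ^ 2 * P := by gcongr; exact hηX.trans hXP
    linarith
  have hDX : D ≤ 256 * P * X := by
    refine hD2.trans ?_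
    have : η ^ 2 ≤ 1 * X := by
      rw [sq]
      exact mul_le_mul hη1 hηX hη.le zero_le_one
    rw [one_mul] at this
    gcongr
  have hDP : D ≤ 256 * P := hD2.trans (by
    have : η ^ 2 ≤ 1 := pow_le_one₀ hη.le hη1
    have : 256 * P * η ^ 2 ≤ 256 * P * 1 := by gcongr
    linarith)
  set Nf := K * (1 + K) * N with hNf
  have hNf0 : 0 < Nf := by positivity
  have hsm : 1024 * ((1 + K) * (2 * T + 1)) * Nf * P ≤ e / 2 := by
    refine le_trans (le_of_eq ?_) hsmall
    rw [smallness, hNf]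
    ring
  have hk1 : 1 ≤ (1 + K) * (2 * T + 1) := by nlinarith
  have hNfP : 1024 * Nf * P ≤ e / 2 := by
    refine le_trans ?_ hsm
    have : 1024 * Nf * P * 1 ≤ 1024 * Nf * P * ((1 + K) * (2 * T + 1)) := by gcongr
    linarith
  have hNfTP : 1024 * T * Nf * P ≤ e / 2 := by
    refine le_trans ?_ hsm
    have : 1024 * Nf * P * T ≤ 1024 * Nf * P * ((1 + K) * (2 * T + 1)) := by
      gcongr
      nlinarith
    linarith
  have hNfD : Nf * D ≤ 1 / 2 := by
    have : Nf * D ≤ Nf * (256 * P) := by gcongr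
    have : 0 < Nf * P := by positivity
    linarith
  have hC'N : ∀ v, ‖C'.symm v‖ ≤ Nf * ‖v‖ :=
    h.norm_symm_map_le h' hm₁ hm₂ hK1 hK hK' (by linarith) hN
  have hC''N := hclose.norm_symm_le hNf0.le hC'N hNfD
  have hδ := hclose.toReal_le hD0.le
  obtain ⟨j, hj1, hj2, hj3⟩ := hclose.exists_norm_sub_le
  obtain ⟨LA, LB, hblock, hLA, hLB⟩ := h.exists_blocks h' hm₁ hm₂ hK1 hK' hN1 hN J hJA hJB
    hJ₁ hJ₂ hJ₁' hJ₂'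
  obtain ⟨θx, θf, θy, g, dg, hg, hg0, hdg0, hΘ⟩ := htr
  set cx : Euc d →L[ℝ] Euc d := ((θx : TangentSpace (𝓡 d) x ≃L[ℝ] Euc d) :
    TangentSpace (𝓡 d) x →L[ℝ] Euc d) ∘L (C : Euc d →L[ℝ] TangentSpace (𝓡 d) x) with hcx
  set c' : Euc d →L[ℝ] Euc d := ((θf : TangentSpace (𝓡 d) (f x) ≃L[ℝ] Euc d) :
    TangentSpace (𝓡 d) (f x) →L[ℝ] Euc d) ∘L (C' : Euc d →L[ℝ] TangentSpace (𝓡 d) (f x)) with hc'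
  set c'' : Euc d →L[ℝ] Euc d := ((θy : TangentSpace (𝓡 d) y ≃L[ℝ] Euc d) :
    TangentSpace (𝓡 d) y →L[ℝ] Euc d) ∘L (C'' : Euc d →L[ℝ] TangentSpace (𝓡 d) y) with hc''
  set cy : Euc d →L[ℝ] Euc d := (C''.symm : TangentSpace (𝓡 d) y →L[ℝ] Euc d) ∘L
    ((θy.symm : Euc d ≃L[ℝ] TangentSpace (𝓡 d) y) : Euc d →L[ℝ] TangentSpace (𝓡 d) y) with hcy
  set L : Euc d →L[ℝ] Euc d := (C'.symm : TangentSpace (𝓡 d) (f x) →L[ℝ] Euc d) ∘L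
    (mfderiv (𝓡 d) (𝓡 d) f x) ∘L (C : Euc d →L[ℝ] TangentSpace (𝓡 d) x) with hL
  have ecx : ∀ a, cx a = θx (C a) := fun a => rfl
  have ec' : ∀ a, c' a = θf (C' a) := fun a => rfl
  have ec'' : ∀ a, c'' a = θy (C'' a) := fun a => rfl
  have ecy : ∀ a, cy a = C''.symm (θy.symm a) := fun a => rfl
  have eL : ∀ a, L a = C'.symm (mfderiv (𝓡 d) (𝓡 d) f x (C a)) := fun a => rfl
  have e1 : ∀ a, ‖cx a‖ ≤ ‖a‖ := fun a => by
    rw [ecx, θx.norm_map]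
    exact h.norm_map_le a
  obtain ⟨u, du, hu, hu1, hu2, hu3, hu4⟩ := exists_perturbation J hJ1 hJ2 (r := r) (K := K)
    (N := 2 * Nf) hβ hT (by linarith) (by positivity) hQ0.le hQr hD0.le cx cy L c' c'' e1
    (fun a => by
      have := hC''N (θy.symm a)
      rwa [LinearIsometryEquiv.norm_map] at this)
    (fun a => by
      have := h.norm_map_le_mul h' hm₁ hm₂ hK1 hK (C a)
      rwa [ContinuousLinearEquiv.symm_apply_apply] at this)
    (fun a => by rw [ecy, ec'', LinearIsometryEquiv.symm_apply_apply,
      ContinuousLinearEquiv.symm_apply_apply])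
    (fun a => by
      have i1 := hΘ j hj1 hj2 (F.Θ j (f x) (C' a))
      rw [LinearIsometryEquiv.symm_apply_apply, LinearIsometryEquiv.norm_map] at i1
      have i2 : ‖C' a‖ ≤ ‖a‖ := h'.norm_map_le a
      have i3 : ‖θy ((F.Θ j y).symm (F.Θ j (f x) (C' a))) - θy (C'' a)‖ ≤ D * ‖a‖ := by
        rw [← map_sub, θy.norm_map, ← (F.Θ j y).norm_map, map_sub,
          LinearIsometryEquiv.apply_symm_apply]
        exact hj3 a
      rw [ec', ec'']
      have i4 := norm_sub_le_norm_sub_add_norm_sub (θf (C' a))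
        (θy ((F.Θ j y).symm (F.Θ j (f x) (C' a)))) (θy (C'' a))
      have i5 : T * (riemannianEDist (𝓡 d) (f x) y).toReal * ‖C' a‖ ≤ T * D * ‖a‖ := by gcongr
      linarith)
    g dg (fun z hz => ⟨(hg z hz).2.2.1, (hg z hz).2.2.2⟩)
    (hg0.trans (by gcongr))
    (fun a => by
      have i1 := hdg0 (C a)
      rw [ecx, ec', eL, ContinuousLinearEquiv.apply_symm_apply]
      refine i1.trans ?_
      gcongr
      exact h.norm_map_le a)
  have hdz : ‖du 0‖ ≤ e / 2 * X := by
    refine hu4.trans ?_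
    calc 2 * (2 * Nf) * (2 * T + 1) * (1 + K) * D
        ≤ 2 * (2 * Nf) * (2 * T + 1) * (1 + K) * (256 * P * X) := by gcongr
      _ = 1024 * ((1 + K) * (2 * T + 1)) * Nf * P * X := by ring
      _ ≤ e / 2 * X := by gcongr
  have hho : ∀ z ∈ Metric.closedBall (0 : A × B) (10 * Q),
      ∀ z' ∈ Metric.closedBall (0 : A × B) (10 * Q),
      ‖du z - du z'‖ ≤ e / 2 * ‖z - z'‖ ^ (β / 2) := fun z hz z' hz' => by
    refine (hu2 z hz z' hz').trans ?_
    gcongr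
    have : 0 ≤ T * Nf * P := by positivity
    linarith
  have hz0 : (0 : A × B) ∈ Metric.closedBall (0 : A × B) (10 * Q) :=
    Metric.mem_closedBall_self (by positivity)
  refine ⟨LA, LB, u, du, ⟨he0, he1, by linarith [hβ.1], by linarith [hβ.2], hη, hηp, hpQ, ?_,
    by linarith, hη', hηp', hp'.trans (hladle p (hη.le.trans hηp) hpQ), hηη2, hLA, hLB, hu1,
    fun z hz => ?_, fun z hz z' hz' => (hho z hz z' hz').trans (by gcongr; linarith), ?_,
    hdz.trans (by gcongr; linarith)⟩, fun z hz => ?_⟩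
  · have i1 : 1 ≤ Nf := by
      rw [hNf]
      exact one_le_mul_of_one_le_of_one_le
        (one_le_mul_of_one_le_of_one_le hK1 (by linarith)) hN1
    have i2 : 1 * P ≤ Nf * P := by gcongr
    change P ≤ e
    linarith
  · have i1 := hho z hz 0 hz0
    rw [sub_zero] at i1
    rw [mem_closedBall_zero_iff] at hz
    have i2 : ‖z‖ ^ (β / 2) ≤ 1 := Real.rpow_le_one (norm_nonneg _) (hz.trans hQ1)
      (by linarith [hβ.1])
    have i3 : X ≤ 1 := Real.rpow_le_one hη.le hη1 (by linarith [hβ.1])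
    have i4 := norm_le_norm_add_norm_sub (du 0) (du z)
    rw [norm_sub_rev] at i4
    have i5 : e / 2 * ‖z‖ ^ (β / 2) ≤ e / 2 * 1 := by gcongr
    have i6 : e / 2 * X ≤ e / 2 * 1 := by gcongr
    linarith
  · refine hu3.trans ?_
    calc 2 * Nf * T * D ≤ 2 * Nf * T * (256 * P * η ^ 2) := by gcongr
      _ = 512 * T * Nf * P * η ^ 2 := by ring
      _ ≤ e * η ^ 2 := by
          gcongr
          have : 0 ≤ T * Nf * P := by positivity
          linarith
  · have i1 : J (blockMap LA LB u z) = cy (g (cx (J z))) := by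
      have i2 : blockMap LA LB u z = (LA z.1, LB z.2) + u z := rfl
      rw [i2, map_add, hu, ← hblock]
      change L (J z) + _ = _
      abel
    have i3 : cx (J z) ∈ Metric.ball (0 : Euc d) r := by
      rw [mem_closedBall_zero_iff] at hz
      rw [mem_ball_zero_iff]
      linarith [e1 (J z), hJ2 z]
    obtain ⟨i4, i5, -, -⟩ := hg _ i3
    rw [i1, ecy, ContinuousLinearEquiv.apply_symm_apply, i4, ecx,
      LinearIsometryEquiv.symm_apply_apply, LinearIsometryEquiv.norm_map]
    exact ⟨rfl, i5⟩

end PesinChart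

/-! ### Admissible manifolds as graphs -/

section Graphs

variable {A B : Type*} [NormedAddCommGroup A] [NormedSpace ℝ A]
  [NormedAddCommGroup B] [NormedSpace ℝ B] {M : Type*}

theorem dBall_eq_of_hasFDerivWithinAt {F : B → A} {P : B →L[ℝ] A} {q : ℝ} (hq : 0 < q) {t : B}
    (ht : t ∈ Metric.closedBall (0 : B) q)
    (h : HasFDerivWithinAt F P (Metric.closedBall 0 q) t) : dBall q F t = P := by
  refine h.fderivWithin (uniqueDiffOn_convex (convex_closedBall 0 q) ?_ t ht)
  exact ⟨0, Metric.ball_subset_interior_closedBall (Metric.mem_ball_self hq)⟩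

namespace IsAdm

variable {α β η p q Q : ℝ} {F : B → A} {P : B → B →L[ℝ] A}

theorem of_representing (hF : IsRepresenting (β / 2) p Q F) (hF' : AdmissibleBounds β η p F) :
    IsAdm (β / 2) η p F (dBall p F) := by
  obtain ⟨m, h, _, hh, hmh, h1, h2⟩ := hF'.sigma
  exact .of_bounds hmh
    (fun t ht => ((hF.contDiff.differentiableOn one_ne_zero) t ht).hasFDerivWithinAt)
    h1 hh h2 hF'.iota hF'.phi

theorem dBall_eq (hF : IsAdm α η p F P) (hq : 0 < q) (hqp : q ≤ p) {t : B}
    (ht : t ∈ Metric.closedBall (0 : B) q) : dBall q F t = P t :=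
  dBall_eq_of_hasFDerivWithinAt hq ht
    ((hF.deriv t (Metric.closedBall_subset_closedBall hqp ht)).mono
      (Metric.closedBall_subset_closedBall hqp))

theorem norm_le_size (hF : IsAdm α η p F P) (hη : 0 < η) (hηp : η ≤ p) (hp1 : p ≤ 1) {t : B}
    (ht : t ∈ Metric.closedBall (0 : B) p) : ‖F t‖ ≤ p := by
  have h1 := hF.norm_le_phi (hη.le.trans hηp) ht
  have h2 := mem_closedBall_zero_iff.1 ht
  nlinarith

theorem representing (hF : IsAdm α η p F P) (hα : 0 < α) (hη : 0 < η) (hηp : η ≤ p) (hp1 : p ≤ 1)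
    (hpQ : p ≤ Q) (hq : 0 < q) (hqp : q ≤ p) : IsRepresenting α q Q F := by
  have hsub : Metric.closedBall (0 : B) q ⊆ Metric.closedBall 0 p :=
    Metric.closedBall_subset_closedBall hqp
  have hud : UniqueDiffOn ℝ (Metric.closedBall (0 : B) q) :=
    uniqueDiffOn_convex (convex_closedBall 0 q)
      ⟨0, Metric.ball_subset_interior_closedBall (Metric.mem_ball_self hq)⟩
  refine ⟨?_, ⟨1 / 2, fun t₁ h₁ t₂ h₂ => ?_⟩, fun t ht =>
    (hF.norm_le_size hη hηp hp1 (hsub ht)).trans hpQ⟩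
  · have hc : ContinuousOn P (Metric.closedBall 0 q) := by
      intro t ht
      rw [ContinuousWithinAt, tendsto_iff_norm_sub_tendsto_zero]
      have h1 : Tendsto (fun t' => 1 / 2 * ‖t' - t‖ ^ α) (𝓝[Metric.closedBall 0 q] t) (𝓝 0) := by
        have h2 : Continuous fun t' : B => 1 / 2 * ‖t' - t‖ ^ α :=
          continuous_const.mul (((continuous_id.sub continuous_const).norm).rpow_const
            fun _ => Or.inr hα.le)
        have h3 := (h2.tendsto t).mono_left (nhdsWithin_le_nhds (s := Metric.closedBall 0 q))
        simpa [Real.zero_rpow hα.ne'] using h3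
      refine squeeze_zero' (Eventually.of_forall fun _ => norm_nonneg _) ?_ h1
      filter_upwards [self_mem_nhdsWithin] with t' ht'
      exact hF.holder_half (hsub ht') (hsub ht)
    rw [show (1 : ℕ∞ω) = 0 + 1 from rfl, contDiffOn_succ_iff_hasFDerivWithinAt_of_uniqueDiffOn hud]
    exact ⟨by simp, P, contDiffOn_zero.2 hc, fun t ht => (hF.deriv t (hsub ht)).mono hsub⟩
  · rw [hF.dBall_eq hq hqp h₁, hF.dBall_eq hq hqp h₂]
    exact hF.holder_half (hsub h₁) (hsub h₂)

theorem admissibleBounds (hF : IsAdm (β / 2) η p F P) (hp : 0 < p) : AdmissibleBounds β η p F := by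
  obtain ⟨m, h, hm, hh, hmh, h1, h2⟩ := hF.exists_bounds hp.le
  refine ⟨⟨m, h, hm, hh, hmh, fun t ht => ?_, fun t₁ ht₁ t₂ ht₂ => ?_⟩, ?_, hF.phi⟩
  · rw [hF.dBall_eq hp le_rfl ht]
    exact h1 t ht
  · rw [hF.dBall_eq hp le_rfl ht₁, hF.dBall_eq hp le_rfl ht₂]
    exact h2 t₁ ht₁ t₂ ht₂
  · rw [hF.dBall_eq hp le_rfl (Metric.mem_closedBall_self hp.le)]
    exact hF.iota

end IsAdm

/-- The image under the chart `Φ` of the graph of `F` over the ball of radius `p`. -/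
def graphSet (Φ : A × B → M) (p : ℝ) (F : B → A) : Set M :=
  (fun t => Φ (F t, t)) '' Metric.closedBall 0 p

/-- `V` is the manifold of size `p` in the chart `Φ` that is represented by `F`: a `u`-manifold if
`B` is the unstable factor, and an `s`-manifold if `B` is the stable factor. -/
def IsGraph (Φ : A × B → M) (α p Q : ℝ) (F : B → A) (V : Set M) : Prop :=
  0 < p ∧ p ≤ Q ∧ IsRepresenting α p Q F ∧ V = graphSet Φ p F

/-- `V` is an admissible manifold of size `p` in the chart `Φ`. -/
def IsAdmGraph (Φ : A × B → M) (β η p Q : ℝ) (V : Set M) : Prop :=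
  ∃ F, IsGraph Φ (β / 2) p Q F V ∧ AdmissibleBounds β η p F

/-- The points whose backward orbit stays in the charts `Φ k`. -/
def limitSet (φi : M → M) (Φ : ℕ → A × B → M) (p : ℝ) (Q : ℕ → ℝ) : Set M :=
  {m | m ∈ Φ 0 '' Metric.closedBall 0 p ∧
    ∀ k : ℕ, φi^[k] m ∈ Φ k '' Metric.closedBall 0 (10 * Q k)}

/-- A sequence of charts `Φ k`, injective on `D k`, in which the map `φ` (with inverse `φi`), from
the `(k + 1)`-st to the `k`-th chart, is a step of a chain. -/
structure IsChartChain (φ φi : M → M) (α : ℝ) (z e Q η p : ℕ → ℝ) (LA : ℕ → A →L[ℝ] A)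
    (LB : ℕ → B →L[ℝ] B) (h : ℕ → A × B → A × B) (dh : ℕ → A × B → A × B →L[ℝ] A × B)
    (Φ : ℕ → A × B → M) (D : ℕ → Set (A × B)) : Prop
    extends IsStepChain α z e Q η p LA LB h dh where
  left_inv : Function.LeftInverse φi φ
  right_inv : Function.RightInverse φi φ
  p_zero_le : p 0 ≤ Q 0
  Q_zero_le_one : Q 0 ≤ 1
  injOn : ∀ k, InjOn (Φ k) (D k)
  ball_subset : ∀ k, Metric.closedBall 0 (10 * Q k) ⊆ D k
  map : ∀ k, ∀ w ∈ Metric.closedBall (0 : A × B) (10 * Q (k + 1)),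
    blockMap (LA k) (LB k) (h k) w ∈ D k ∧
      Φ k (blockMap (LA k) (LB k) (h k) w) = φ (Φ (k + 1) w)

namespace IsChartChain

variable {φ φi : M → M} {β : ℝ} {z e Q η p : ℕ → ℝ} {LA : ℕ → A →L[ℝ] A}
  {LB : ℕ → B →L[ℝ] B} {h : ℕ → A × B → A × B} {dh : ℕ → A × B → A × B →L[ℝ] A × B}
  {Φ : ℕ → A × B → M} {D : ℕ → Set (A × B)}

section

variable (hc : IsChartChain φ φi (β / 2) z e Q η p LA LB h dh Φ D)
include hc

theorem η_pos (k : ℕ) : 0 < η k := (hc.step k).η'_pos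

theorem η_le (k : ℕ) : η k ≤ p k := (hc.step k).η'_le

theorem p_le : ∀ k, p k ≤ Q k
  | 0 => hc.p_zero_le
  | k + 1 => (hc.step k).p_le

theorem Q_le_one : ∀ k, Q k ≤ 1
  | 0 => hc.Q_zero_le_one
  | k + 1 => (hc.step k).Q_le_one

theorem mem_ball {k : ℕ} {F : B → A} {P : B → B →L[ℝ] A} (hF : IsAdm (β / 2) (η k) (p k) F P)
    {t : B} (ht : t ∈ Metric.closedBall (0 : B) (p k)) :
    (F t, t) ∈ Metric.closedBall (0 : A × B) (p k) := by
  rw [mem_closedBall_zero_iff, Prod.norm_def]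
  exact max_le (hF.norm_le_size (hc.η_pos k) (hc.η_le k) ((hc.p_le k).trans (hc.Q_le_one k)) ht)
    (mem_closedBall_zero_iff.1 ht)

theorem ball_subset_ball (k : ℕ) :
    Metric.closedBall (0 : A × B) (p k) ⊆ Metric.closedBall 0 (10 * Q k) :=
  Metric.closedBall_subset_closedBall (by
    linarith [hc.p_le k, (hc.η_pos k).trans_le (hc.η_le k)])

theorem subset_image_iff {k : ℕ} {F G : B → A} {P P' : B → B →L[ℝ] A}
    (hF : IsAdm (β / 2) (η (k + 1)) (p (k + 1)) F P) (hG : IsAdm (β / 2) (η k) (p k) G P') :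
    graphSet (Φ k) (p k) G ⊆ φ '' graphSet (Φ (k + 1)) (p (k + 1)) F ↔
      IsImage (LA k) (LB k) (h k) (p (k + 1)) (p k) F G := by
  constructor
  · intro hsub τ hτ
    obtain ⟨_, ⟨t, ht, rfl⟩, h1⟩ := hsub ⟨τ, hτ, rfl⟩
    refine ⟨t, ht, ?_⟩
    obtain ⟨h2, h3⟩ := hc.map k _ (hc.ball_subset_ball (k + 1) (hc.mem_ball hF ht))
    exact hc.injOn k h2 (hc.ball_subset k (hc.ball_subset_ball k (hc.mem_ball hG hτ)))
      (h3.trans h1)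
  · rintro hI _ ⟨τ, hτ, rfl⟩
    obtain ⟨t, ht, h1⟩ := hI τ hτ
    obtain ⟨h2, h3⟩ := hc.map k _ (hc.ball_subset_ball (k + 1) (hc.mem_ball hF ht))
    refine ⟨_, ⟨t, ht, rfl⟩, ?_⟩
    simp only
    rw [← h3, h1]

theorem isGraph {k : ℕ} {F : B → A} {P : B → B →L[ℝ] A}
    (hF : IsAdm (β / 2) (η k) (p k) F P) : IsGraph (Φ k) (β / 2) (p k) (Q k) F
      (graphSet (Φ k) (p k) F) :=
  ⟨hc.p_pos k, hc.p_le k, hF.representing (hc.step 0).α_pos (hc.η_pos k) (hc.η_le k)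
    ((hc.p_le k).trans (hc.Q_le_one k)) (hc.p_le k) (hc.p_pos k) le_rfl, rfl⟩

theorem isAdmGraph_iff {k : ℕ} {V : Set M} : IsAdmGraph (Φ k) β (η k) (p k) (Q k) V ↔
    ∃ F P, IsAdm (β / 2) (η k) (p k) F P ∧ V = graphSet (Φ k) (p k) F := by
  constructor
  · rintro ⟨F, ⟨-, -, hr, hV⟩, hb⟩
    exact ⟨F, _, .of_representing hr hb, hV⟩
  · rintro ⟨F, P, hF, rfl⟩
    exact ⟨F, hc.isGraph hF, hF.admissibleBounds (hc.p_pos k)⟩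

theorem eqOn_of_graphSet_eq {k : ℕ} {F G : B → A} {q : ℝ}
    (hF : ∀ t ∈ Metric.closedBall (0 : B) q, (F t, t) ∈ D k)
    (hG : ∀ t ∈ Metric.closedBall (0 : B) q, (G t, t) ∈ D k)
    (hFG : graphSet (Φ k) q F = graphSet (Φ k) q G) : EqOn F G (Metric.closedBall 0 q) := by
  intro t ht
  have h1 : Φ k (F t, t) ∈ graphSet (Φ k) q G := hFG ▸ ⟨t, ht, rfl⟩
  obtain ⟨t', ht', h2⟩ := h1
  have h3 := hc.injOn k (hG t' ht') (hF t ht) h2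
  rw [Prod.mk.injEq] at h3
  rw [← h3.1, h3.2]

variable [FiniteDimensional ℝ B]

/-- The graph transform of an admissible manifold exists and is unique. -/
theorem existsUnique_transform {k : ℕ} {V : Set M}
    (hV : IsAdmGraph (Φ (k + 1)) β (η (k + 1)) (p (k + 1)) (Q (k + 1)) V) :
    ∃! W, IsAdmGraph (Φ k) β (η k) (p k) (Q k) W ∧ W ⊆ φ '' V := by
  obtain ⟨F, P, hF, rfl⟩ := hc.isAdmGraph_iff.1 hV
  obtain ⟨G, P', hG, hI⟩ := (hc.step k).exists_transform hF
  refine ⟨graphSet (Φ k) (p k) G,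
    ⟨hc.isAdmGraph_iff.2 ⟨G, P', hG, rfl⟩, (hc.subset_image_iff hF hG).2 hI⟩, ?_⟩
  rintro W ⟨hW, hWs⟩
  obtain ⟨G', P'', hG', rfl⟩ := hc.isAdmGraph_iff.1 hW
  have hI' := (hc.subset_image_iff hF hG').1 hWs
  refine image_congr fun t ht => ?_
  have h1 := (hc.step k).contraction hF hF hI' hI (D := 0) (by simp) ht
  rw [mul_zero, norm_le_zero_iff, sub_eq_zero] at h1
  simp only [h1]

/-- The iterated graph transforms of an admissible manifold, along a chain. -/
theorem exists_sequence {T : ℕ → Set M → Set M}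
    (hT : ∀ k V, IsAdmGraph (Φ (k + 1)) β (η (k + 1)) (p (k + 1)) (Q (k + 1)) V →
      IsAdmGraph (Φ k) β (η k) (p k) (Q k) (T k V) ∧ T k V ⊆ φ '' V)
    {it : ℕ → Set M → Set M} (h0 : ∀ V, it 0 V = V) (hs : ∀ n V, it (n + 1) V = it n (T n V))
    (n : ℕ) (V : Set M) (hV : IsAdmGraph (Φ n) β (η n) (p n) (Q n) V) :
    ∃ (F : ℕ → B → A) (P : ℕ → B → B →L[ℝ] A),
      (∀ k, k ≤ n → IsAdm (β / 2) (η k) (p k) (F k) (P k)) ∧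
      (∀ k, k < n → IsImage (LA k) (LB k) (h k) (p (k + 1)) (p k) (F (k + 1)) (F k)) ∧
      V = graphSet (Φ n) (p n) (F n) ∧ it n V = graphSet (Φ 0) (p 0) (F 0) := by
  induction n generalizing V with
  | zero =>
    obtain ⟨F, P, hF, rfl⟩ := hc.isAdmGraph_iff.1 hV
    refine ⟨fun _ => F, fun _ => P, fun k hk => ?_, fun k hk => absurd hk (by omega), rfl, h0 _⟩
    obtain rfl : k = 0 := by omega
    exact hF
  | succ n ih =>
    obtain ⟨h1, h2⟩ := hT n V hV
    obtain ⟨F, P, hF, hI, h3, h4⟩ := ih _ h1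
    obtain ⟨F', P', hF', rfl⟩ := hc.isAdmGraph_iff.1 hV
    have e1 : Function.update F (n + 1) F' (n + 1) = F' := Function.update_self _ _ _
    have e2 : Function.update P (n + 1) P' (n + 1) = P' := Function.update_self _ _ _
    have e3 : ∀ k, k ≤ n → Function.update F (n + 1) F' k = F k := fun k hk =>
      Function.update_of_ne (by omega) _ _
    have e4 : ∀ k, k ≤ n → Function.update P (n + 1) P' k = P k := fun k hk =>
      Function.update_of_ne (by omega) _ _
    refine ⟨Function.update F (n + 1) F', Function.update P (n + 1) P', fun k hk => ?_,
      fun k hk => ?_, by rw [e1], ?_⟩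
    · rcases hk.eq_or_lt with rfl | hk
      · rw [e1, e2]
        exact hF'
      · rw [e3 k (by omega), e4 k (by omega)]
        exact hF k (by omega)
    · rw [e3 k (by omega)]
      rcases (Nat.lt_succ_iff.1 hk).eq_or_lt with rfl | hk'
      · rw [e1]
        refine (hc.subset_image_iff hF' (hF k le_rfl)).1 ?_
        rw [← h3]
        exact h2
      · rw [e3 (k + 1) (by omega)]
        exact hI k hk'
    · rw [e3 0 (by omega), hs, h4]

variable [CompleteSpace A]

/-- The iterated graph transforms converge to any invariant sequence of admissible manifolds. -/
theorem exists_tendsto {T : ℕ → Set M → Set M}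
    (hT : ∀ k V, IsAdmGraph (Φ (k + 1)) β (η (k + 1)) (p (k + 1)) (Q (k + 1)) V →
      IsAdmGraph (Φ k) β (η k) (p k) (Q k) (T k V) ∧ T k V ⊆ φ '' V)
    {it : ℕ → Set M → Set M} (h0 : ∀ V, it 0 V = V) (hs : ∀ n V, it (n + 1) V = it n (T n V))
    {F : ℕ → B → A} {P : ℕ → B → B →L[ℝ] A}
    (hF : ∀ k, IsAdm (β / 2) (η k) (p k) (F k) (P k))
    (hI : ∀ k, IsImage (LA k) (LB k) (h k) (p (k + 1)) (p k) (F (k + 1)) (F k))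
    {W : ℕ → Set M} (hW : ∀ n, IsAdmGraph (Φ n) β (η n) (p n) (Q n) (W n)) :
    ∃ G : ℕ → B → A, (∀ n, IsGraph (Φ 0) (β / 2) (p 0) (Q 0) (G n) (it n (W n))) ∧
      TendstoUniformlyOn G (F 0) atTop (Metric.closedBall 0 (p 0)) := by
  choose X X' hX hXI _ hXit using fun n => hc.exists_sequence hT h0 hs n (W n) (hW n)
  refine ⟨fun n => X n 0, fun n => ?_, ?_⟩
  · rw [hXit]
    exact hc.isGraph (hX n 0 (Nat.zero_le _))
  · rw [Metric.tendstoUniformlyOn_iff]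
    intro ε hε
    filter_upwards [(hc.tendsto_bound 0).eventually (gt_mem_nhds hε)] with n hn t ht
    rw [dist_eq_norm]
    exact lt_of_le_of_lt (hc.dist_le (Nat.zero_le n) (fun k _ _ => hF k)
      (fun k _ hk => hX n k hk) (fun k _ _ => hI k) (fun k _ hk => hXI n k hk) t ht) hn

/-- The orbit of a point of an invariant graph. -/
theorem exists_orbit {F : ℕ → B → A} {P : ℕ → B → B →L[ℝ] A}
    (hF : ∀ k, IsAdm (β / 2) (η k) (p k) (F k) (P k))
    (hI : ∀ k, IsImage (LA k) (LB k) (h k) (p (k + 1)) (p k) (F (k + 1)) (F k)) {t : B}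
    (ht : t ∈ Metric.closedBall (0 : B) (p 0)) :
    ∃ τ : ℕ → B, τ 0 = t ∧ (∀ k, τ k ∈ Metric.closedBall (0 : B) (p k)) ∧
      (∀ k, blockMap (LA k) (LB k) (h k) (F (k + 1) (τ (k + 1)), τ (k + 1)) = (F k (τ k), τ k)) ∧
      ∀ k, φi^[k] (Φ 0 (F 0 t, t)) = Φ k (F k (τ k), τ k) := by
  have hI' : ∀ k (τ : B), ∃ t, τ ∈ Metric.closedBall (0 : B) (p k) →
      t ∈ Metric.closedBall (0 : B) (p (k + 1)) ∧
        blockMap (LA k) (LB k) (h k) (F (k + 1) t, t) = (F k τ, τ) := by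
    intro k τ
    by_cases hτ : τ ∈ Metric.closedBall (0 : B) (p k)
    · obtain ⟨t, h1, h2⟩ := hI k τ hτ
      exact ⟨t, fun _ => ⟨h1, h2⟩⟩
    · exact ⟨0, fun h => absurd h hτ⟩
  choose nx hnx using hI'
  let τ : ℕ → B := fun k => Nat.rec t (fun k s => nx k s) k
  have hτs : ∀ k, τ (k + 1) = nx k (τ k) := fun k => rfl
  have hτ : ∀ k, τ k ∈ Metric.closedBall (0 : B) (p k) := by
    intro k
    induction k with
    | zero => exact ht
    | succ k ih => rw [hτs]; exact (hnx k _ ih).1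
  have hb : ∀ k, blockMap (LA k) (LB k) (h k) (F (k + 1) (τ (k + 1)), τ (k + 1)) =
      (F k (τ k), τ k) := fun k => by
    rw [hτs]
    exact (hnx k _ (hτ k)).2
  refine ⟨τ, rfl, hτ, hb, fun k => ?_⟩
  induction k with
  | zero => rfl
  | succ k ih =>
    rw [Function.iterate_succ_apply', ih, ← hb k,
      (hc.map k _ (hc.ball_subset_ball _ (hc.mem_ball (hF (k + 1)) (hτ (k + 1))))).2, hc.left_inv]

/-- The invariant graph consists of the points whose backward orbits stay in the charts. -/
theorem limitSet_eq {F : ℕ → B → A} {P : ℕ → B → B →L[ℝ] A}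
    (hF : ∀ k, IsAdm (β / 2) (η k) (p k) (F k) (P k))
    (hI : ∀ k, IsImage (LA k) (LB k) (h k) (p (k + 1)) (p k) (F (k + 1)) (F k)) :
    limitSet φi Φ (p 0) Q = graphSet (Φ 0) (p 0) (F 0) := by
  ext m
  constructor
  · rintro ⟨⟨w, hw, rfl⟩, horb⟩
    choose Z hZ hZo using horb
    have hZ0 : Z 0 = w := hc.injOn 0 (hc.ball_subset 0 (hZ 0))
      (hc.ball_subset 0 (hc.ball_subset_ball 0 hw)) (hZo 0)
    have hw2 : w.2 ∈ Metric.closedBall (0 : B) (p 0) :=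
      mem_closedBall_zero_iff.2 ((norm_snd_le w).trans (mem_closedBall_zero_iff.1 hw))
    obtain ⟨τ, hτ0, hτ, hτs, -⟩ := hc.exists_orbit hF hI hw2
    have hZs : ∀ k, blockMap (LA k) (LB k) (h k) (Z (k + 1)) = Z k := by
      intro k
      obtain ⟨h1, h2⟩ := hc.map k _ (hZ (k + 1))
      refine hc.injOn k h1 (hc.ball_subset k (hZ k)) ?_
      rw [h2, hZo, hZo, Function.iterate_succ_apply', hc.right_inv]
    have h3 := hc.eq_of_orbits (Z := Z) (W := fun k => (F k (τ k), τ k)) (fun k => hZ (k + 1))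
      (fun k => hc.ball_subset_ball _ (hc.mem_ball (hF (k + 1)) (hτ (k + 1)))) hZs hτs
      (by rw [hZ0, hτ0])
    refine ⟨w.2, hw2, ?_⟩
    rw [hZ0] at h3
    rw [h3]
  · rintro ⟨t, ht, rfl⟩
    refine ⟨⟨_, hc.mem_ball (hF 0) ht, rfl⟩, fun k => ?_⟩
    obtain ⟨τ, -, hτ, -, h1⟩ := hc.exists_orbit hF hI ht
    exact ⟨_, hc.ball_subset_ball k (hc.mem_ball (hF k) (hτ k)), (h1 k).symm⟩

/-- Charts along a chain carry admissible manifolds, each contained in the image of the next one;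
the first of them is the limit set. -/
theorem exists_invariant_graphs :
    ∃ (F : ℕ → B → A) (P : ℕ → B → B →L[ℝ] A),
      (∀ k, IsAdm (β / 2) (η k) (p k) (F k) (P k)) ∧
      (∀ k, IsImage (LA k) (LB k) (h k) (p (k + 1)) (p k) (F (k + 1)) (F k)) ∧
      limitSet φi Φ (p 0) Q = graphSet (Φ 0) (p 0) (F 0) := by
  obtain ⟨F, P, hF, hI⟩ := hc.exists_invariant
  exact ⟨F, P, hF, hI, hc.limitSet_eq hF hI⟩

theorem isAdmGraph_limitSet :
    IsAdmGraph (Φ 0) β (η 0) (p 0) (Q 0) (limitSet φi Φ (p 0) Q) := by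
  obtain ⟨F, P, hF, -, he⟩ := hc.exists_invariant_graphs
  exact hc.isAdmGraph_iff.2 ⟨F 0, P 0, hF 0, he⟩

theorem image_limitSet_subset :
    φi '' limitSet φi Φ (p 0) Q ⊆
      limitSet φi (fun k => Φ (k + 1)) (p 1) (fun k => Q (k + 1)) := by
  obtain ⟨F, P, hF, hI, he⟩ := hc.exists_invariant_graphs
  rintro _ ⟨m, hm, rfl⟩
  refine ⟨?_, fun k => hm.2 (k + 1)⟩
  rw [he] at hm
  obtain ⟨t, ht, rfl⟩ := hm
  obtain ⟨τ, -, hτ, -, h1⟩ := hc.exists_orbit hF hI ht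
  exact ⟨_, hc.mem_ball (hF 1) (hτ 1), (h1 1).symm⟩

/-- The part of the limit set over a smaller ball does not depend on the representing function. -/
theorem exists_core {q : ℝ} (hq : 0 < q) (hqp : q ≤ p 0) {F : B → A} {P : B → B →L[ℝ] A}
    (hF : IsAdm (β / 2) (η 0) (p 0) F P) :
    IsGraph (Φ 0) (β / 2) q (Q 0) F {m | ∃ G, IsGraph (Φ 0) (β / 2) (p 0) (Q 0) G
      (graphSet (Φ 0) (p 0) F) ∧ m ∈ graphSet (Φ 0) q G} := by
  refine ⟨hq, hqp.trans (hc.p_le 0), hF.representing (hc.step 0).α_pos (hc.η_pos 0) (hc.η_le 0)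
    ((hc.p_le 0).trans (hc.Q_le_one 0)) (hc.p_le 0) hq hqp, ?_⟩
  ext m
  constructor
  · rintro ⟨G, ⟨-, -, hG, hGF⟩, t, ht, rfl⟩
    refine ⟨t, ht, ?_⟩
    have h1 := hc.eqOn_of_graphSet_eq (k := 0) (F := F) (G := G) (q := p 0)
      (fun t ht => hc.ball_subset 0 (hc.ball_subset_ball 0 (hc.mem_ball hF ht)))
      (fun t ht => hc.ball_subset 0 (mem_closedBall_zero_iff.2 (max_le ?_ ?_))) hGF
      (Metric.closedBall_subset_closedBall hqp ht)
    · simp only [h1]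
    · linarith [hG.bound t ht, hc.p_le 0, hc.p_pos 0]
    · linarith [mem_closedBall_zero_iff.1 ht, hc.p_le 0, hc.p_pos 0]
  · rintro hm
    exact ⟨F, hc.isGraph hF, hm⟩

/-- The limit sets of two chart chains with the same first `N + 1` charts are close. -/
theorem core_close {z' e' Q' η' p' : ℕ → ℝ} {LA' : ℕ → A →L[ℝ] A}
    {LB' : ℕ → B →L[ℝ] B} {h' : ℕ → A × B → A × B} {dh' : ℕ → A × B → A × B →L[ℝ] A × B}
    {Φ' : ℕ → A × B → M} {D' : ℕ → Set (A × B)}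
    (hc' : IsChartChain φ φi (β / 2) z' e' Q' η' p' LA' LB' h' dh' Φ' D') {N : ℕ}
    (hη : ∀ k ≤ N, η' k = η k) (hp : ∀ k ≤ N, p' k = p k)
    (hΦ : ∀ k ≤ N, Φ' k = Φ k) (hz0 : z 0 = η 0) (hzN : z N ≤ η 0) :
    ∃ F G, IsGraph (Φ 0) (β / 2) (η 0 ^ 2) (Q 0) F {m | ∃ G, IsGraph (Φ 0) (β / 2) (p 0) (Q 0) G
        (limitSet φi Φ (p 0) Q) ∧ m ∈ graphSet (Φ 0) (η 0 ^ 2) G} ∧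
      IsGraph (Φ 0) (β / 2) (η 0 ^ 2) (Q 0) G {m | ∃ G, IsGraph (Φ 0) (β / 2) (p 0) (Q 0) G
        (limitSet φi Φ' (p' 0) Q') ∧ m ∈ graphSet (Φ 0) (η 0 ^ 2) G} ∧
      C1Close (η 0 ^ 2) (10 * z N ^ (β / 4)) F G := by
  obtain ⟨F, P, hF, hI, he⟩ := hc.exists_invariant_graphs
  obtain ⟨F', P', hF', hI', he'⟩ := hc'.exists_invariant_graphs
  have hη0 := hc.η_pos 0
  have hη1 : η 0 ≤ 1 := (hc.η_le 0).trans ((hc.p_le 0).trans (hc.Q_le_one 0))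
  have hq : 0 < η 0 ^ 2 := by positivity
  have hqp : η 0 ^ 2 ≤ p 0 := le_trans (by nlinarith) (hc.η_le 0)
  have hFk : ∀ k ≤ N, IsAdm (β / 2) (η k) (p k) (F' k) (P' k) := fun k hk => by
    have := hF' k
    rwa [hη k hk, hp k hk] at this
  have hIk : ∀ k < N, IsImage (LA k) (LB k) (h k) (p (k + 1)) (p k) (F' (k + 1)) (F' k) := by
    intro k hk
    refine (hc.subset_image_iff (hFk (k + 1) hk) (hFk k hk.le)).1 ?_
    have := (hc'.subset_image_iff (hF' (k + 1)) (hF' k)).2 (hI' k)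
    rwa [hΦ k hk.le, hΦ (k + 1) hk, hp k hk.le, hp (k + 1) hk] at this
  have hN := hFk 0 (Nat.zero_le N)
  rw [hp 0 (Nat.zero_le N), hΦ 0 (Nat.zero_le N)] at he'
  rw [he, hp 0 (Nat.zero_le N), he']
  refine ⟨F 0, F' 0, hc.exists_core hq hqp (hF 0), hc.exists_core hq hqp hN,
    4 * z N ^ (β / 4), 6 * z N ^ (β / 4), ?_, ?_, by ring_nf; rfl, fun t ht => ?_⟩
  · have := hc.z_pos N
    positivity
  · have := hc.z_pos N
    positivity
  · have hd := hc.dist_le (Nat.zero_le N) (fun k _ _ => hF k) (fun k _ hk => hFk k hk)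
      (fun k _ _ => hI k) (fun k _ hk => hIk k hk)
    rw [hz0] at hd
    have h1 := (hF 0).core_close hN (hc.step 0).α_pos (hc.step 0).α_le hη0 hη1 (hc.η_le 0)
      (hc.z_pos N) hzN hd ht
    rw [(hF 0).dBall_eq hq hqp ht, hN.dBall_eq hq hqp ht]
    rw [show β / 2 / 2 = β / 4 by ring] at h1
    exact h1

end

end IsChartChain

end Graphs

/-! ### Chains of Pesin charts -/

section Smallness

variable {β Γ γ : ℝ}

/-- If the scalar `s` is below a threshold, all sizes `Q ≤ s N^(-2γ)` are small compared with the
contraction rate, which is of order `N^(-2)`: as `γ > 5 / β`, the power `N Q^(β/2)` is of smaller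
order than that, and `Q^(1/γ)` is at most of the same order, with a small constant. -/
theorem exists_scalar_small (hβ : 0 < β) (hΓ : 0 < Γ) (hγ : 5 / β < γ) {K c ρ : ℝ} (hK : 1 ≤ K)
    (hc : 0 < c) (hρ : 0 < ρ) : ∃ s₀ > 0, ∀ s, 0 < s → s < s₀ → ∀ N, 1 ≤ N → ∀ Q, 0 < Q →
      Q ≤ s / N ^ (2 * γ) → Q < ρ ∧ c * N * Q ^ (β / 2) ≤ rate K N / 2 ∧
        2 * (Γ * Q ^ (1 / γ)) ≤ rate K N := by
  have hγ0 : 0 < γ := lt_trans (by positivity) hγ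
  set X := 1 / (4 * 10 ^ 5 * K ^ 2 * c) with hX
  set Y := 1 / (4 * 10 ^ 5 * K ^ 2 * Γ) with hY
  have hX0 : 0 < X := by positivity
  have hY0 : 0 < Y := by positivity
  refine ⟨min ρ (min (X ^ (2 / β)) (Y ^ γ)), by positivity, fun s hs hs0 N hN Q hQ hQs => ?_⟩
  have hN0 : 0 < N := by linarith
  obtain ⟨h1, h2⟩ := lt_min_iff.1 hs0
  obtain ⟨h2, h3⟩ := lt_min_iff.1 h2
  have hpow : ∀ a : ℝ, 0 ≤ a → Q ^ a ≤ s ^ a / N ^ (2 * γ * a) := fun a ha => by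
    rw [Real.rpow_mul hN0.le, ← Real.div_rpow hs.le (by positivity)]
    exact Real.rpow_le_rpow hQ.le hQs ha
  refine ⟨?_, ?_, ?_⟩
  · refine lt_of_le_of_lt (hQs.trans ?_) h1
    exact div_le_self hs.le (Real.one_le_rpow hN (by positivity))
  · have hs1 : s ^ (β / 2) ≤ X := by
      have := Real.rpow_le_rpow hs.le h2.le (by positivity : 0 ≤ β / 2)
      rwa [← Real.rpow_mul hX0.le, show 2 / β * (β / 2) = 1 by field_simp, Real.rpow_one] at this
    have hγβ : (3 : ℝ) ≤ 2 * γ * (β / 2) := by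
      rw [div_lt_iff₀ hβ] at hγ
      linarith
    have hN3 : N ^ 3 ≤ N ^ (2 * γ * (β / 2)) := by
      rw [← Real.rpow_natCast]
      exact Real.rpow_le_rpow_of_exponent_le hN (by exact_mod_cast hγβ)
    have hQ3 : Q ^ (β / 2) ≤ X / N ^ 3 := (hpow _ (by positivity)).trans (by gcongr)
    calc c * N * Q ^ (β / 2) ≤ c * N * (X / N ^ 3) := by gcongr
      _ = rate K N / 2 := by
          rw [hX, rate]
          field_simp
          norm_num
  · have hs1 : s ^ (1 / γ) ≤ Y := by
      have := Real.rpow_le_rpow hs.le h3.le (by positivity : 0 ≤ 1 / γ)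
      rwa [← Real.rpow_mul hY0.le, show γ * (1 / γ) = 1 by field_simp, Real.rpow_one] at this
    have hQ2 : Q ^ (1 / γ) ≤ Y / N ^ 2 := by
      have := hpow (1 / γ) (by positivity)
      rw [show 2 * γ * (1 / γ) = ((2 : ℕ) : ℝ) by push_cast; field_simp, Real.rpow_natCast] at this
      exact this.trans (by gcongr)
    calc 2 * (Γ * Q ^ (1 / γ)) ≤ 2 * (Γ * (Y / N ^ 2)) := by gcongr
      _ = rate K N := by
          rw [hY, rate]
          field_simp
          norm_num

end Smallness

section ChartChains

variable {d : ℕ} {M : Type*} [TopologicalSpace M] [CompactSpace M] [T2Space M]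
  [ChartedSpace (Euc d) M]
  [RiemannianBundle (fun x : M => TangentSpace (𝓡 d) x)] [IsManifold (𝓡 d) ∞ M]
  [IsContMDiffRiemannianBundle (𝓡 d) ∞ (Euc d) (fun x : M => TangentSpace (𝓡 d) x)]

/-- Uniform constants for a diffeomorphism and its inverse: `K` bounds the differentials, the
exponential maps are injective on balls of radius `r₀`, and `r`, `T` are the radius and the
constant of the estimates in exponential coordinates. -/
structure HasBounds (f : M ≃ₘ^1⟮𝓡 d, 𝓡 d⟯ M) (F : Framing d M) (β K r₀ r T : ℝ) : Prop where
  one_le : 1 ≤ K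
  r₀_pos : 0 < r₀
  r_pos : 0 < r
  T_nonneg : 0 ≤ T
  le : ∀ (x : M) (v : TangentSpace (𝓡 d) x), dnorm f x v ≤ K * ‖v‖
  le_symm : ∀ (x : M) (v : TangentSpace (𝓡 d) x), dnorm f.symm x v ≤ K * ‖v‖
  inj : ∀ (x : M) (v w : TangentSpace (𝓡 d) x), ‖v‖ < r₀ → ‖w‖ < r₀ →
    expMap x v = expMap x w → v = w
  transfer : ∀ x y, riemannianEDist (𝓡 d) (f x) y < ENNReal.ofReal r →
    HasTransfer f F β r₀ r T x y
  transfer_symm : ∀ x y, riemannianEDist (𝓡 d) (f.symm x) y < ENNReal.ofReal r →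
    HasTransfer f.symm F β r₀ r T x y

theorem exists_hasBounds {β : ℝ} (hβ : 0 < β) (hβ1 : β ≤ 1) (f : M ≃ₘ^1⟮𝓡 d, 𝓡 d⟯ M)
    (hf : HolderDifferential β f) (F : Framing d M) : ∃ K r₀ r T, HasBounds f F β K r₀ r T := by
  obtain ⟨K₁, hK₁, h1⟩ := exists_norm_mfderiv_le f
  obtain ⟨K₂, hK₂, h2⟩ := exists_norm_mfderiv_le f.symm
  obtain ⟨r₀, hr₀, hinj⟩ := exists_expMap_injective F
  obtain ⟨r₁, hr₁, T₁, hT₁, ht₁⟩ := exists_hasTransfer hβ hβ1 f hf F hr₀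
  obtain ⟨r₂, hr₂, T₂, hT₂, ht₂⟩ := exists_hasTransfer hβ hβ1 f.symm (hf.symm hβ) F hr₀
  refine ⟨max K₁ K₂, r₀, min r₁ r₂, max T₁ T₂, le_max_of_le_left hK₁, hr₀, lt_min hr₁ hr₂,
    le_max_of_le_left hT₁.le, fun x v => (h1 x v).trans ?_, fun x v => (h2 x v).trans ?_, hinj,
    fun x y h => (ht₁ x y (h.trans_le ?_)).mono (min_le_left _ _) (le_max_left _ _),
    fun x y h => (ht₂ x y (h.trans_le ?_)).mono (min_le_right _ _) (le_max_right _ _)⟩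
  · exact mul_le_mul_of_nonneg_right (le_max_left _ _) (norm_nonneg _)
  · exact mul_le_mul_of_nonneg_right (le_max_right _ _) (norm_nonneg _)
  · exact ENNReal.ofReal_le_ofReal (min_le_left _ _)
  · exact ENNReal.ofReal_le_ofReal (min_le_right _ _)

variable {f : M ≃ₘ^1⟮𝓡 d, 𝓡 d⟯ M} {F : Framing d M} {β Γ γ K r₀ r T : ℝ}

/-- The bounds are symmetric, so that stable manifolds are the unstable manifolds of the inverse. -/
theorem HasBounds.symm (h : HasBounds f F β K r₀ r T) : HasBounds f.symm F β K r₀ r T :=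
  ⟨h.one_le, h.r₀_pos, h.r_pos, h.T_nonneg, h.le_symm, h.le, h.inj, h.transfer_symm, h.transfer⟩

theorem HasBounds.norm_le (h : HasBounds f F β K r₀ r T) (x : M) (v : TangentSpace (𝓡 d) x) :
    ‖v‖ ≤ K * dnorm f x v := by
  have h1 := h.le_symm (f x) (mfderiv (𝓡 d) (𝓡 d) f x v)
  rwa [dnorm_symm_apply] at h1

/-- The dimension of the stable space is constant along summable orbits. -/
theorem sdim_map (h : HasBounds f F β K r₀ r T) {x : M} (hx : IsSummablePoint f x)
    (hfx : IsSummablePoint f (f x)) : sdim f (f x) = sdim f x := by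
  have h1 := hfx.unique (splitting_spec hfx) ((splitting_spec hx).map (h.norm_le x))
  rw [sdim, sdim, h1]
  exact (Submodule.equivMapOfInjective _ (mfderiv_diffeo_injective f x) _).finrank_eq.symm

/-- Smallness conditions on the size `Q` of a Pesin chart where `‖C₀⁻¹‖ = N`. -/
structure IsSmallSize (β Γ γ K r₀ r T N Q : ℝ) : Prop where
  le_one : 10 * Q ≤ 1
  lt_r : 20 * Q < r
  lt_r₀ : 20 * Q < r₀
  small : smallness K T * N * Q ^ (β / 2) ≤ rate K N / 2
  ladder : 2 * (Γ * Q ^ (1 / γ)) ≤ rate K N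

theorem exists_isSmallSize (hβ : 0 < β) (hΓ : 0 < Γ) (hγ : 5 / β < γ)
    (h : HasBounds f F β K r₀ r T) : ∃ s₀ > 0, ∀ s, 0 < s → s < s₀ → ∀ N, 1 ≤ N → ∀ Q, 0 < Q →
      Q ≤ s / N ^ (2 * γ) → IsSmallSize β Γ γ K r₀ r T N Q := by
  have hK := h.one_le
  have hT := h.T_nonneg
  have hr := h.r_pos
  have hr₀ := h.r₀_pos
  have hc : 0 < smallness K T := by unfold smallness; positivity
  obtain ⟨s₀, hs₀, hs⟩ := exists_scalar_small hβ hΓ hγ hK hc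
    (ρ := min (1 / 10) (min (r / 20) (r₀ / 20))) (by positivity)
  refine ⟨s₀, hs₀, fun s h1 h2 N hN Q hQ hQs => ?_⟩
  obtain ⟨h3, h4, h5⟩ := hs s h1 h2 N hN Q hQ hQs
  obtain ⟨h6, h7⟩ := lt_min_iff.1 h3
  obtain ⟨h7, h8⟩ := lt_min_iff.1 h7
  exact ⟨by linarith, by linarith, by linarith, h4, h5⟩

variable {A B : Type*} [NormedAddCommGroup A] [NormedSpace ℝ A]
  [NormedAddCommGroup B] [NormedSpace ℝ B]

/-- A sequence of adapted charts in which each one is close to the image of the next one, with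
sizes that vary as prescribed by the ladder function, is a chart chain. -/
theorem exists_isChartChain (hb : HasBounds f F β K r₀ r T) (hβ : β ∈ Ioo (0 : ℝ) 1) (hΓ : 0 < Γ)
    (hγ : 0 < γ) (x : ℕ → M) (C : ∀ k, Euc d ≃L[ℝ] TangentSpace (𝓡 d) (x k))
    (H : ∀ k, Submodule ℝ (TangentSpace (𝓡 d) (x k)) × Submodule ℝ (TangentSpace (𝓡 d) (x k)))
    (hA : ∀ k, IsAdapted f (x k) (H k) (C k))
    (C' : ∀ k, Euc d ≃L[ℝ] TangentSpace (𝓡 d) (f (x (k + 1))))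
    (H' : ∀ k, Submodule ℝ (TangentSpace (𝓡 d) (f (x (k + 1)))) ×
      Submodule ℝ (TangentSpace (𝓡 d) (f (x (k + 1)))))
    (hA' : ∀ k, IsAdapted f (f (x (k + 1))) (H' k) (C' k))
    (hsum : ∀ k, IsSummablePoint f (f (x (k + 1)))) (J : (A × B) ≃L[ℝ] Euc d)
    (hJ : ∀ w, ‖J w‖ ^ 2 = ‖w.1‖ ^ 2 + ‖w.2‖ ^ 2)
    (hJ₁ : ∀ k (a : A), C k (J (a, 0)) ∈ (H k).1) (hJ₂ : ∀ k (b : B), C k (J (0, b)) ∈ (H k).2)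
    (hJ₁' : ∀ k (w : A × B), C' k (J w) ∈ (H' k).1 → w.2 = 0)
    (hJ₂' : ∀ k (w : A × B), C' k (J w) ∈ (H' k).2 → w.1 = 0) {Q η p : ℕ → ℝ}
    (hclose : ∀ k, CloseFrames F (C' k) (C k) (η k ^ 4 * η k ^ 4)) (N : ℕ → ℝ)
    (hN1 : ∀ k, 1 ≤ N k) (hN : ∀ k v, ‖(C k).symm v‖ ≤ N k * ‖v‖) (hη : ∀ k, 0 < η k)
    (hηp : ∀ k, η k ≤ p k) (hpQ : ∀ k, p k ≤ Q k)
    (hsmall : ∀ k, IsSmallSize β Γ γ K r₀ r T (N k) (Q k))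
    (hp' : ∀ k, p k ≤ ladder Γ γ (p (k + 1))) (hηη' : ∀ k, η (k + 1) ≤ ladder Γ γ (η k))
    (hηη : ∀ k, η k ≤ ladder Γ γ (η (k + 1))) :
    ∃ (e : ℕ → ℝ) (LA : ℕ → A →L[ℝ] A) (LB : ℕ → B →L[ℝ] B) (u : ℕ → A × B → A × B)
      (du : ℕ → A × B → A × B →L[ℝ] A × B) (D : ℕ → Set (A × B)),
      IsChartChain f f.symm (β / 2) (fun k => (ladderInv Γ γ)^[k] (η 0)) e Q η p LA LB u du
        (fun k w => expMap (x k) (C k (J w))) D := by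
  have hQ1 : ∀ k, Q k ≤ 1 := fun k => by
    linarith [(hsmall k).le_one, (hη k).trans_le ((hηp k).trans (hpQ k))]
  have hstep : ∀ k, ∃ (LA : A →L[ℝ] A) (LB : B →L[ℝ] B) (u : A × B → A × B)
      (du : A × B → A × B →L[ℝ] A × B),
      IsStep (β / 2) (rate K (N (k + 1))) (Q (k + 1)) (η (k + 1)) (p (k + 1)) (η k) (p k)
        LA LB u du ∧
      ∀ w ∈ Metric.closedBall (0 : A × B) (10 * Q (k + 1)),
        expMap (x k) (C k (J (blockMap LA LB u w))) = f (expMap (x (k + 1)) (C (k + 1) (J w))) ∧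
          ‖C k (J (blockMap LA LB u w))‖ < r₀ := by
    intro k
    have h1 := hsmall (k + 1)
    obtain ⟨hm₁, hm₂⟩ := (hA (k + 1)).split.map_mem (hb.norm_le (x (k + 1))) (hsum k) (hA' k).split
    have hk : riemannianEDist (𝓡 d) (f (x (k + 1))) (x k) < ENNReal.ofReal r := by
      refine (hclose k).edist_lt.trans_le (ENNReal.ofReal_le_ofReal ?_)
      have h2 : η k ≤ 2 * η (k + 1) := by
        have h3 : η (k + 1) ≤ Q (k + 1) := (hηp _).trans (hpQ _)
        have h4 := rate_le hb.one_le (hN1 (k + 1))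
        have h5 : ladder Γ γ (η (k + 1)) ≤ (1 + rate K (N (k + 1))) * η (k + 1) := by
          refine ladder_le_of_le hΓ.le (hη _).le (by linarith) (le_trans ?_ h1.ladder)
          have := hη (k + 1)
          gcongr
        have h6 := (hηη k).trans h5
        nlinarith [hη (k + 1)]
      have h3 : η k ≤ 1 := (hηp k).trans ((hpQ k).trans (hQ1 k))
      have h4 : η k ^ 4 * η k ^ 4 ≤ η k := by
        rw [← pow_add]
        exact pow_le_of_le_one (hη k).le h3 (by norm_num)
      have h5 := (hηp (k + 1)).trans (hpQ (k + 1))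
      linarith [h1.lt_r, hη (k + 1)]
    exact (hA (k + 1)).exists_isStep hβ hΓ hb.one_le (hb.le _) (hb.norm_le _) hb.T_nonneg
      (hb.transfer _ _ hk) (hA' k) hm₁ hm₂ (hclose k) (hN1 _) (hN _) J hJ (hJ₁ _) (hJ₂ _) (hJ₁' k)
      (hJ₂' k) (hη _) (hηp _) (hpQ _) (hη k) (hηp k) (hp' k) (hηη' k) (hηη k) hγ h1.le_one h1.lt_r
      h1.small h1.ladder
  choose LA LB u du hs hmap using hstep
  have hη1 : η 0 ≤ 1 := (hηp 0).trans ((hpQ 0).trans (hQ1 0))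
  have hz : ∀ k, 0 < (ladderInv Γ γ)^[k] (η 0) := iterate_ladderInv_pos hΓ.le hγ (hη 0)
  have hzη : ∀ k, (ladderInv Γ γ)^[k] (η 0) ≤ η k := by
    intro k
    induction k with
    | zero => exact le_rfl
    | succ k ih =>
      rw [Function.iterate_succ_apply']
      exact ladderInv_le_of_le_ladder hΓ.le hγ (hz k) (hη (k + 1)).le (ih.trans (hηη k))
  refine ⟨fun k => rate K (N (k + 1)), LA, LB, u, du, fun k => {w | ‖C k (J w)‖ < r₀},
    ⟨⟨hs, hz, tendsto_iterate_ladderInv hΓ hγ (hη 0) hη1, fun k => ?_⟩, f.left_inv, f.right_inv,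
      hpQ 0, hQ1 0, fun k w hw w' hw' h => ?_, fun k w hw => ?_, fun k w hw =>
      ⟨(hmap k w hw).2, (hmap k w hw).1⟩⟩⟩
  · refine factor_le hΓ hγ (hη 0) k (le_trans ?_ (hsmall (k + 1)).ladder)
    have h1 := (hzη (k + 1)).trans ((hηp _).trans (hpQ (k + 1)))
    have := hz (k + 1)
    gcongr
  · have h1 := hb.inj _ _ _ hw hw' h
    exact J.injective ((C k).injective h1)
  · have h1 := (hA k).norm_map_le (J w)
    have h2 : ‖J w‖ ≤ 2 * ‖w‖ := by
      refine (pow_le_pow_iff_left₀ (norm_nonneg _) (by positivity) two_ne_zero).1 ?_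
      rw [hJ, mul_pow]
      have h1 : ‖w.1‖ ^ 2 ≤ ‖w‖ ^ 2 := pow_le_pow_left₀ (norm_nonneg _) (_root_.norm_fst_le w) 2
      have h2 : ‖w.2‖ ^ 2 ≤ ‖w‖ ^ 2 := pow_le_pow_left₀ (norm_nonneg _) (_root_.norm_snd_le w) 2
      nlinarith [sq_nonneg ‖w‖]
    rw [mem_closedBall_zero_iff] at hw
    change ‖C k (J w)‖ < r₀
    linarith [(hsmall k).lt_r₀]

end ChartChains

/-! ### Stable and unstable coordinates -/

section Coordinates

/-- The decomposition `ℝ^s × ℝ^(d-s) = ℝ^d`. -/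
def joinEquiv (d s : ℕ) : (EucS d s × EucU d s) ≃L[ℝ] Euc d :=
  LinearEquiv.toContinuousLinearEquiv
    { toFun := fun w => joinSU w.1 w.2
      invFun := fun v => (WithLp.toLp 2 fun i => v i.1, WithLp.toLp 2 fun i => v i.1)
      map_add' := fun w w' => by
        ext i
        simp only [joinSU, Prod.fst_add, Prod.snd_add, PiLp.add_apply]
        split_ifs <;> rfl
      map_smul' := fun c w => by
        ext i
        simp only [joinSU, Prod.smul_fst, Prod.smul_snd, PiLp.smul_apply, RingHom.id_apply]
        split_ifs <;> rfl
      left_inv := fun w => by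
        refine Prod.ext ?_ ?_
        · ext i
          simp [joinSU, i.2]
        · ext i
          have := i.2
          simp only [joinSU]
          rw [dif_neg this]
      right_inv := fun v => by
        ext i
        simp only [joinSU]
        split_ifs <;> rfl }

theorem norm_sq_joinSU {d s : ℕ} (a : EucS d s) (b : EucU d s) :
    ‖joinSU a b‖ ^ 2 = ‖a‖ ^ 2 + ‖b‖ ^ 2 := by
  rw [EuclideanSpace.norm_sq_eq, EuclideanSpace.norm_sq_eq, EuclideanSpace.norm_sq_eq,
    ← Fintype.sum_subtype_add_sum_subtype (fun i : Fin d => (i : ℕ) < s)]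
  congr 1
  · refine Finset.sum_congr rfl fun i _ => ?_
    simp [joinSU, i.2]
  · refine Finset.sum_congr rfl fun i _ => ?_
    have := i.2
    simp only [joinSU]
    rw [dif_neg this]

/-- The decomposition of `ℝ^d`, with the unstable factor first. -/
def joinEquivSwap (d s : ℕ) : (EucU d s × EucS d s) ≃L[ℝ] Euc d :=
  (ContinuousLinearEquiv.prodComm ℝ (EucU d s) (EucS d s)).trans (joinEquiv d s)

theorem joinEquivSwap_apply {d s : ℕ} (w : EucU d s × EucS d s) :
    joinEquivSwap d s w = joinSU w.2 w.1 := rfl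

variable {X : Type*}

theorem image_box (d s : ℕ) (q : ℝ) (ψ : Euc d → X) :
    ψ '' box d s q = (fun w : EucS d s × EucU d s => ψ (joinSU w.1 w.2)) ''
      Metric.closedBall 0 q := by
  ext m
  constructor
  · rintro ⟨_, ⟨a, b, ha, hb, rfl⟩, rfl⟩
    exact ⟨(a, b), mem_closedBall_zero_iff.2 (max_le ha hb), rfl⟩
  · rintro ⟨w, hw, rfl⟩
    have h := mem_closedBall_zero_iff.1 hw
    exact ⟨_, ⟨w.1, w.2, (norm_fst_le w).trans h, (norm_snd_le w).trans h, rfl⟩, rfl⟩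

theorem image_box_swap (d s : ℕ) (q : ℝ) (ψ : Euc d → X) :
    ψ '' box d s q = (fun w : EucU d s × EucS d s => ψ (joinSU w.2 w.1)) ''
      Metric.closedBall 0 q := by
  ext m
  constructor
  · rintro ⟨_, ⟨a, b, ha, hb, rfl⟩, rfl⟩
    exact ⟨(b, a), mem_closedBall_zero_iff.2 (max_le hb ha), rfl⟩
  · rintro ⟨w, hw, rfl⟩
    have h := mem_closedBall_zero_iff.1 hw
    exact ⟨_, ⟨w.2, w.1, (norm_snd_le w).trans h, (norm_fst_le w).trans h, rfl⟩, rfl⟩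

variable {d : ℕ} {M : Type*} [TopologicalSpace M] [ChartedSpace (Euc d) M]
  [RiemannianBundle (fun x : M => TangentSpace (𝓡 d) x)] [IsManifold (𝓡 d) ∞ M]

theorem IsLyapunovChange.joinSU_mem {f : M ≃ₘ^1⟮𝓡 d, 𝓡 d⟯ M}
    {C : ∀ x : M, Euc d ≃L[ℝ] TangentSpace (𝓡 d) x} (hC : IsLyapunovChange f C) {x : M}
    (hx : IsSummablePoint f x) {s : ℕ} (hs : sdim f x = s) (a : EucS d s) (b : EucU d s) :
    (C x (joinSU a b) ∈ (splitting f x).1 ↔ b = 0) ∧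
      (C x (joinSU a b) ∈ (splitting f x).2 ↔ a = 0) := by
  subst hs
  rw [(hC x hx).2.1, (hC x hx).2.2]
  refine ⟨⟨fun h => ?_, ?_⟩, ⟨fun h => ?_, ?_⟩⟩
  · ext i
    have h1 := h i.1 i.2
    simp only [joinSU] at h1
    rw [dif_neg i.2] at h1
    exact h1
  · rintro rfl i hi
    simp [joinSU, hi]
  · ext i
    have h1 := h i.1 i.2
    simp only [joinSU] at h1
    rw [dif_pos i.2] at h1
    exact h1
  · rintro rfl i hi
    simp [joinSU, hi]

theorem IsAdapted.one_le_norm {f : M ≃ₘ^1⟮𝓡 d, 𝓡 d⟯ M} {x : M}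
    {H : Submodule ℝ (TangentSpace (𝓡 d) x) × Submodule ℝ (TangentSpace (𝓡 d) x)}
    {C : Euc d ≃L[ℝ] TangentSpace (𝓡 d) x} (h : IsAdapted f x H C) (hd : 2 ≤ d) :
    1 ≤ ‖(C.symm : TangentSpace (𝓡 d) x →L[ℝ] Euc d)‖ := by
  have : Nontrivial (Euc d) := by
    have : Nonempty (Fin d) := ⟨⟨0, by omega⟩⟩
    infer_instance
  obtain ⟨a, ha⟩ := exists_ne (0 : Euc d)
  have h1 := (C.symm : TangentSpace (𝓡 d) x →L[ℝ] Euc d).le_opNorm (C a)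
  have h2 : (C.symm : TangentSpace (𝓡 d) x →L[ℝ] Euc d) (C a) = a := C.symm_apply_apply a
  rw [h2] at h1
  have h3 := h.norm_map_le a
  have h4 : 0 < ‖a‖ := norm_pos_iff.2 ha
  have h5 := mul_le_mul_of_nonneg_left h3
    (norm_nonneg (C.symm : TangentSpace (𝓡 d) x →L[ℝ] Euc d))
  nlinarith

end Coordinates

/-! ### Limit manifolds of chains of double charts -/

section LimitManifolds

variable {d : ℕ} {M : Type*} [TopologicalSpace M] [ChartedSpace (Euc d) M]
  [RiemannianBundle (fun x : M => TangentSpace (𝓡 d) x)] [IsManifold (𝓡 d) ∞ M]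

namespace Setup

variable {S : Setup d M} {K r₀ r T : ℝ}

theorem Q_le (S : Setup d M) (x : M) (hs : 0 ≤ S.κ.scalar) :
    S.Q x ≤ S.κ.scalar / ‖((S.C x).symm : TangentSpace (𝓡 d) x →L[ℝ] Euc d)‖ ^ (2 * S.κ.γ) :=
  Real.sSup_le (fun _ hq => hq.2) (by positivity)

/-- The conditions on the calibration under which the graph transforms contract. -/
structure IsFine (S : Setup d M) (K r₀ r T : ℝ) : Prop where
  two_le : 2 ≤ d
  β_mem : S.κ.β ∈ Ioo (0 : ℝ) 1
  Γ_pos : 0 < S.κ.Γ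
  γ_pos : 0 < S.κ.γ
  lyapunov : IsLyapunovChange S.f S.C
  bounds : HasBounds S.f S.frame S.κ.β K r₀ r T
  small : ∀ x, 1 ≤ ‖((S.C x).symm : TangentSpace (𝓡 d) x →L[ℝ] Euc d)‖ → 0 < S.Q x →
    IsSmallSize S.κ.β S.κ.Γ S.κ.γ K r₀ r T
      ‖((S.C x).symm : TangentSpace (𝓡 d) x →L[ℝ] Euc d)‖ (S.Q x)

/-- The sequence of double charts is the past of a chain. -/
def IsPast (S : Setup d M) (a : ℕ → DoubleChart M) : Prop :=
  ∀ k, S.IsDoubleChart (a k) ∧ S.Edge (a (k + 1)) (a k)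

/-- The sequence of double charts is the future of a chain. -/
def IsFuture (S : Setup d M) (a : ℕ → DoubleChart M) : Prop :=
  ∀ k, S.IsDoubleChart (a k) ∧ S.Edge (a k) (a (k + 1))

theorem IsChain.isPast {v : ℤ → DoubleChart M} (hv : S.IsChain v) : S.IsPast (past v) := by
  intro k
  refine ⟨(hv _).1, ?_⟩
  have h := (hv (-((k + 1 : ℕ) : ℤ))).2
  rwa [show -((k + 1 : ℕ) : ℤ) + 1 = -(k : ℤ) by push_cast; ring] at h

theorem IsChain.isFuture {v : ℤ → DoubleChart M} (hv : S.IsChain v) : S.IsFuture (future v) :=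
  fun k => ⟨(hv _).1, (hv (k : ℤ)).2⟩

theorem IsChain.shift {v : ℤ → DoubleChart M} (hv : S.IsChain v) (j : ℤ) :
    S.IsChain fun i => v (i + j) := by
  intro i
  refine ⟨(hv _).1, ?_⟩
  have h := (hv (i + j)).2
  rwa [show i + j + 1 = i + 1 + j by ring] at h

theorem IsPast.sdim_eq {a : ℕ → DoubleChart M} (ha : S.IsPast a) (k : ℕ) :
    sdim S.f (a k).x = sdim S.f (a 0).x := by
  induction k with
  | zero => rfl
  | succ k ih => rw [(ha k).2.sdim_eq, ih]

theorem IsFuture.sdim_eq {a : ℕ → DoubleChart M} (ha : S.IsFuture a) (k : ℕ) :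
    sdim S.f (a k).x = sdim S.f (a 0).x := by
  induction k with
  | zero => rfl
  | succ k ih => rw [← (ha k).2.sdim_eq, ih]

theorem IsDoubleChart.η_pos {v : DoubleChart M} (hv : S.IsDoubleChart v) : 0 < v.η :=
  lt_min hv.1.2.1 hv.2.2.1

theorem Edge.η_le {v w : DoubleChart M} (h : S.Edge v w) (hv : S.IsDoubleChart v)
    (hw : S.IsDoubleChart w) (hΓ : 0 ≤ S.κ.Γ) (hγ : 0 < S.κ.γ) :
    w.η ≤ ladder S.κ.Γ S.κ.γ v.η ∧ v.η ≤ ladder S.κ.Γ S.κ.γ w.η := by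
  have h1 : w.pu ≤ ladder S.κ.Γ S.κ.γ v.pu := h.pu_eq.trans_le (min_le_left _ _)
  have h2 : v.ps ≤ ladder S.κ.Γ S.κ.γ w.ps := h.ps_eq.trans_le (min_le_left _ _)
  obtain ⟨⟨-, hvs, hvsQ⟩, -, hvu, hvuQ⟩ := hv
  obtain ⟨⟨-, hws, hwsQ⟩, -, hwu, hwuQ⟩ := hw
  unfold DoubleChart.η
  constructor
  · rcases le_total v.pu v.ps with hc | hc
    · rw [min_eq_right hc]
      exact (min_le_right _ _).trans h1
    · rw [min_eq_left hc]
      rcases le_total (ladder S.κ.Γ S.κ.γ w.ps) (S.Q v.x) with hc' | hc'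
      · have e := h.ps_eq
        rw [min_eq_left hc'] at e
        exact (min_le_left _ _).trans ((le_ladder hΓ hws.le).trans
          (e.ge.trans (le_ladder hΓ hvs.le)))
      · have e := h.ps_eq
        rw [min_eq_right hc'] at e
        exact (min_le_right _ _).trans (h1.trans (ladder_mono hΓ hγ hvu.le (by rw [e]; exact hvuQ)))
  · rcases le_total w.ps w.pu with hc | hc
    · rw [min_eq_left hc]
      exact (min_le_left _ _).trans h2
    · rw [min_eq_right hc]
      rcases le_total (ladder S.κ.Γ S.κ.γ v.pu) (S.Q w.x) with hc' | hc'
      · have e := h.pu_eq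
        rw [min_eq_left hc'] at e
        exact (min_le_right _ _).trans ((le_ladder hΓ hvu.le).trans
          (e.ge.trans (le_ladder hΓ hwu.le)))
      · have e := h.pu_eq
        rw [min_eq_right hc'] at e
        exact (min_le_left _ _).trans (h2.trans (ladder_mono hΓ hγ hws.le (by rw [e]; exact hwsQ)))

/-- The points whose past stays in the charts `a k`. -/
def uLimit (S : Setup d M) (a : ℕ → DoubleChart M) : Set M :=
  {p | p ∈ S.ψ (a 0).x '' box d (sdim S.f (a 0).x) (a 0).pu ∧
    ∀ k : ℕ, S.f.symm^[k] p ∈ S.ψ (a k).x '' box d (sdim S.f (a k).x) (10 * S.Q (a k).x)}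

/-- The points whose future stays in the charts `a k`. -/
def sLimit (S : Setup d M) (a : ℕ → DoubleChart M) : Set M :=
  {p | p ∈ S.ψ (a 0).x '' box d (sdim S.f (a 0).x) (a 0).ps ∧
    ∀ k : ℕ, S.f^[k] p ∈ S.ψ (a k).x '' box d (sdim S.f (a k).x) (10 * S.Q (a k).x)}

/-- The chart `ψ_x` on `ℝ^s × ℝ^(d-s)`. -/
def uChart (S : Setup d M) (s : ℕ) (x : M) (w : EucS d s × EucU d s) : M :=
  S.ψ x (joinSU w.1 w.2)

/-- The chart `ψ_x` on `ℝ^(d-s) × ℝ^s`. -/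
def sChart (S : Setup d M) (s : ℕ) (x : M) (w : EucU d s × EucS d s) : M :=
  S.ψ x (joinSU w.2 w.1)

theorem uLimit_eq {a : ℕ → DoubleChart M} {s : ℕ} (hs : ∀ k, sdim S.f (a k).x = s) :
    S.uLimit a = limitSet S.f.symm (fun k => S.uChart s (a k).x) (a 0).pu
      (fun k => S.Q (a k).x) := by
  unfold uLimit limitSet
  simp only [hs, image_box]
  rfl

theorem sLimit_eq {a : ℕ → DoubleChart M} {s : ℕ} (hs : ∀ k, sdim S.f (a k).x = s) :
    S.sLimit a = limitSet S.f (fun k => S.sChart s (a k).x) (a 0).ps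
      (fun k => S.Q (a k).x) := by
  unfold sLimit limitSet
  simp only [hs, image_box_swap]
  rfl

theorem isUAdmissible_iff {v : DoubleChart M} {s : ℕ} (hs : sdim S.f v.x = s) {V : Set M} :
    S.IsUAdmissible v V ↔ IsAdmGraph (S.uChart s v.x) S.κ.β v.η v.pu (S.Q v.x) V := by
  subst hs
  rfl

theorem isSAdmissible_iff {v : DoubleChart M} {s : ℕ} (hs : sdim S.f v.x = s) {V : Set M} :
    S.IsSAdmissible v V ↔ IsAdmGraph (S.sChart s v.x) S.κ.β v.η v.ps (S.Q v.x) V := by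
  subst hs
  rfl

variable [CompactSpace M] [T2Space M]
  [IsContMDiffRiemannianBundle (𝓡 d) ∞ (Euc d) (fun x : M => TangentSpace (𝓡 d) x)]

theorem IsPast.exists_isChartChain {a : ℕ → DoubleChart M} (ha : S.IsPast a)
    (hS : S.IsFine K r₀ r T) {s : ℕ} (hs : ∀ k, sdim S.f (a k).x = s) :
    ∃ e LA LB u du D, IsChartChain S.f S.f.symm (S.κ.β / 2)
      (fun k => (ladderInv S.κ.Γ S.κ.γ)^[k] (a 0).η) e (fun k => S.Q (a k).x) (fun k => (a k).η)
      (fun k => (a k).pu) LA LB u du (fun k => S.uChart s (a k).x) D := by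
  have hsum : ∀ k, IsSummablePoint S.f (a k).x := fun k => (ha k).1.1.1
  have hsum' : ∀ k, IsSummablePoint S.f (S.f (a (k + 1)).x) := fun k =>
    (ha k).2.overlap_fwd.1.1
  have hA := fun k => hS.lyapunov.isAdapted (hsum k)
  have hN1 := fun k => (hA k).one_le_norm hS.two_le
  have hs' : ∀ k, sdim S.f (S.f (a (k + 1)).x) = s := fun k => by
    rw [sdim_map hS.bounds (hsum (k + 1)) (hsum' k), hs]
  exact SummableOrbits.exists_isChartChain hS.bounds hS.β_mem hS.Γ_pos hS.γ_pos
    (fun k => (a k).x) (fun k => S.C (a k).x) (fun k => splitting S.f (a k).x) hA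
    (fun k => S.C (S.f (a (k + 1)).x)) (fun k => splitting S.f (S.f (a (k + 1)).x))
    (fun k => hS.lyapunov.isAdapted (hsum' k)) hsum' (joinEquiv d s)
    (fun w => norm_sq_joinSU w.1 w.2)
    (fun k b => (hS.lyapunov.joinSU_mem (hsum k) (hs k) b 0).1.2 rfl)
    (fun k b => (hS.lyapunov.joinSU_mem (hsum k) (hs k) 0 b).2.2 rfl)
    (fun k w => (hS.lyapunov.joinSU_mem (hsum' k) (hs' k) w.1 w.2).1.1)
    (fun k w => (hS.lyapunov.joinSU_mem (hsum' k) (hs' k) w.1 w.2).2.1)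
    (fun k => (ha k).2.overlap_fwd.2.2.2.2)
    (fun k => ‖((S.C (a k).x).symm : TangentSpace (𝓡 d) (a k).x →L[ℝ] Euc d)‖) hN1
    (fun k v => ((S.C (a k).x).symm : TangentSpace (𝓡 d) (a k).x →L[ℝ] Euc d).le_opNorm v)
    (fun k => (ha k).1.η_pos) (fun k => min_le_right _ _) (fun k => (ha k).1.2.2.2)
    (fun k => hS.small _ (hN1 k) ((ha k).1.2.2.1.trans_le (ha k).1.2.2.2))
    (fun k => (ha k).2.pu_eq.trans_le (min_le_left _ _))
    (fun k => ((ha k).2.η_le (ha (k + 1)).1 (ha k).1 hS.Γ_pos.le hS.γ_pos).2)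
    (fun k => ((ha k).2.η_le (ha (k + 1)).1 (ha k).1 hS.Γ_pos.le hS.γ_pos).1)

theorem IsFuture.exists_isChartChain {a : ℕ → DoubleChart M} (ha : S.IsFuture a)
    (hS : S.IsFine K r₀ r T) {s : ℕ} (hs : ∀ k, sdim S.f (a k).x = s) :
    ∃ e LA LB u du D, IsChartChain S.f.symm S.f (S.κ.β / 2)
      (fun k => (ladderInv S.κ.Γ S.κ.γ)^[k] (a 0).η) e (fun k => S.Q (a k).x) (fun k => (a k).η)
      (fun k => (a k).ps) LA LB u du (fun k => S.sChart s (a k).x) D := by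
  have hsum : ∀ k, IsSummablePoint S.f (a k).x := fun k => (ha k).1.1.1
  have hsum' : ∀ k, IsSummablePoint S.f (S.f.symm (a (k + 1)).x) := fun k =>
    (ha k).2.overlap_bwd.2.1.1
  have hA := fun k => (hS.lyapunov.isAdapted (hsum k)).symm
  have hN1 := fun k => (hA k).one_le_norm hS.two_le
  have hs' : ∀ k, sdim S.f (S.f.symm (a (k + 1)).x) = s := fun k => by
    have h1 := sdim_map hS.bounds (hsum' k) (by rw [S.f.apply_symm_apply]; exact hsum (k + 1))
    rw [S.f.apply_symm_apply, hs] at h1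
    exact h1.symm
  exact SummableOrbits.exists_isChartChain hS.bounds.symm hS.β_mem hS.Γ_pos hS.γ_pos
    (fun k => (a k).x) (fun k => S.C (a k).x)
    (fun k => ((splitting S.f (a k).x).2, (splitting S.f (a k).x).1)) hA
    (fun k => S.C (S.f.symm (a (k + 1)).x))
    (fun k => ((splitting S.f (S.f.symm (a (k + 1)).x)).2,
      (splitting S.f (S.f.symm (a (k + 1)).x)).1))
    (fun k => (hS.lyapunov.isAdapted (hsum' k)).symm) (fun k => (hsum' k).symm)
    (joinEquivSwap d s) (fun w => by
      rw [joinEquivSwap_apply, norm_sq_joinSU, add_comm])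
    (fun k b => (hS.lyapunov.joinSU_mem (hsum k) (hs k) 0 b).2.2 rfl)
    (fun k b => (hS.lyapunov.joinSU_mem (hsum k) (hs k) b 0).1.2 rfl)
    (fun k w => (hS.lyapunov.joinSU_mem (hsum' k) (hs' k) w.2 w.1).2.1)
    (fun k w => (hS.lyapunov.joinSU_mem (hsum' k) (hs' k) w.2 w.1).1.1)
    (fun k => CloseFrames.symm (ha k).2.overlap_bwd.2.2.2.2)
    (fun k => ‖((S.C (a k).x).symm : TangentSpace (𝓡 d) (a k).x →L[ℝ] Euc d)‖) hN1
    (fun k v => ((S.C (a k).x).symm : TangentSpace (𝓡 d) (a k).x →L[ℝ] Euc d).le_opNorm v)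
    (fun k => (ha k).1.η_pos) (fun k => min_le_left _ _) (fun k => (ha k).1.1.2.2)
    (fun k => hS.small _ (hN1 k) ((ha k).1.2.2.1.trans_le (ha k).1.2.2.2))
    (fun k => (ha k).2.ps_eq.trans_le (min_le_left _ _))
    (fun k => ((ha k).2.η_le (ha k).1 (ha (k + 1)).1 hS.Γ_pos.le hS.γ_pos).1)
    (fun k => ((ha k).2.η_le (ha k).1 (ha (k + 1)).1 hS.Γ_pos.le hS.γ_pos).2)

end Setup

end LimitManifolds

/-! ### Graph transforms along chains of double charts -/

section GraphTransforms

variable {d : ℕ} {M : Type*} [TopologicalSpace M] [CompactSpace M] [T2Space M]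
  [ChartedSpace (Euc d) M]
  [RiemannianBundle (fun x : M => TangentSpace (𝓡 d) x)] [IsManifold (𝓡 d) ∞ M]
  [IsContMDiffRiemannianBundle (𝓡 d) ∞ (Euc d) (fun x : M => TangentSpace (𝓡 d) x)]

namespace Setup

variable {S : Setup d M} {K r₀ r T : ℝ} {a b : ℕ → DoubleChart M}

namespace IsPast

variable (ha : S.IsPast a) (hS : S.IsFine K r₀ r T)
include ha hS

/-- The graph transform along an edge of a backward chain is well defined. -/
theorem existsUnique_uTransform (k : ℕ) {V : Set M} (hV : S.IsUAdmissible (a (k + 1)) V) :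
    ∃! W, S.IsUTransform (a k) V W := by
  obtain ⟨e, LA, LB, u, du, D, hc⟩ := ha.exists_isChartChain hS ha.sdim_eq
  have h1 := hc.existsUnique_transform ((isUAdmissible_iff (ha.sdim_eq (k + 1))).1 hV)
  simpa only [IsUTransform, isUAdmissible_iff (ha.sdim_eq k)] using h1

theorem isUAdmissible_uLimit : S.IsUAdmissible (a 0) (S.uLimit a) := by
  obtain ⟨e, LA, LB, u, du, D, hc⟩ := ha.exists_isChartChain hS ha.sdim_eq
  rw [uLimit_eq ha.sdim_eq, isUAdmissible_iff rfl]
  exact hc.isAdmGraph_limitSet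

theorem uConverges {W : ℕ → Set M} (hW : ∀ n, S.IsUAdmissible (a n) (W n)) :
    S.UConverges (a 0) (fun n => S.uIter a n (W n)) (S.uLimit a) := by
  obtain ⟨e, LA, LB, u, du, D, hc⟩ := ha.exists_isChartChain hS ha.sdim_eq
  obtain ⟨F, P, hF, hI, he⟩ := hc.exists_invariant_graphs
  rw [uLimit_eq ha.sdim_eq]
  obtain ⟨G, hG, hlim⟩ := hc.exists_tendsto (T := fun k => S.uTransform (a k)) (it := S.uIter a)
    (fun k V hV => by
      have h1 := Classical.epsilon_spec (ha.existsUnique_uTransform hS k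
        ((isUAdmissible_iff (ha.sdim_eq (k + 1))).2 hV)).exists
      exact ⟨(isUAdmissible_iff (ha.sdim_eq k)).1 h1.1, h1.2⟩)
    (fun V => rfl) (fun n V => rfl) hF hI
    (fun n => (isUAdmissible_iff (ha.sdim_eq n)).1 (hW n))
  exact ⟨G, F 0, hG, he ▸ hc.isGraph (hF 0), hlim⟩

theorem image_uLimit_subset : S.f.symm '' S.uLimit a ⊆ S.uLimit fun k => a (k + 1) := by
  obtain ⟨e, LA, LB, u, du, D, hc⟩ := ha.exists_isChartChain hS ha.sdim_eq
  rw [uLimit_eq ha.sdim_eq, uLimit_eq fun k => ha.sdim_eq (k + 1)]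
  exact hc.image_limitSet_subset

/-- Summable variations: limits along backward chains that agree up to time `N` have `C^1`-close leaf
cores. -/
theorem uC1DistLE (hb : S.IsPast b) {N : ℕ} (hab : ∀ k ≤ N, b k = a k) :
    S.UC1DistLE (a 0).x ((a 0).η ^ 2) (S.uCore (a 0) (S.uLimit a)) (S.uCore (a 0) (S.uLimit b))
      (10 * ((ladderInv S.κ.Γ S.κ.γ)^[N] (a 0).η) ^ (S.κ.β / 4)) := by
  have hsb : ∀ k, sdim S.f (b k).x = sdim S.f (a 0).x := fun k => by
    rw [hb.sdim_eq, hab 0 (Nat.zero_le N)]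
  obtain ⟨e, LA, LB, u, du, D, hc⟩ := ha.exists_isChartChain hS ha.sdim_eq
  obtain ⟨e', LA', LB', u', du', D', hc'⟩ := hb.exists_isChartChain hS hsb
  rw [uLimit_eq ha.sdim_eq, uLimit_eq hsb]
  exact hc.core_close hc' (fun k hk => by rw [hab k hk]) (fun k hk => by rw [hab k hk])
    (fun k hk => by simp only [hab k hk]) rfl
    (iterate_ladderInv_le hS.Γ_pos.le hS.γ_pos (ha 0).1.η_pos N)

end IsPast

namespace IsFuture

variable (ha : S.IsFuture a) (hS : S.IsFine K r₀ r T)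
include ha hS

/-- The graph transform along an edge of a forward chain is well defined. -/
theorem existsUnique_sTransform (k : ℕ) {V : Set M} (hV : S.IsSAdmissible (a (k + 1)) V) :
    ∃! W, S.IsSTransform (a k) V W := by
  obtain ⟨e, LA, LB, u, du, D, hc⟩ := ha.exists_isChartChain hS ha.sdim_eq
  have h1 := hc.existsUnique_transform ((isSAdmissible_iff (ha.sdim_eq (k + 1))).1 hV)
  simpa only [IsSTransform, isSAdmissible_iff (ha.sdim_eq k)] using h1

theorem isSAdmissible_sLimit : S.IsSAdmissible (a 0) (S.sLimit a) := by
  obtain ⟨e, LA, LB, u, du, D, hc⟩ := ha.exists_isChartChain hS ha.sdim_eq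
  rw [sLimit_eq ha.sdim_eq, isSAdmissible_iff rfl]
  exact hc.isAdmGraph_limitSet

theorem sConverges {W : ℕ → Set M} (hW : ∀ n, S.IsSAdmissible (a n) (W n)) :
    S.SConverges (a 0) (fun n => S.sIter a n (W n)) (S.sLimit a) := by
  obtain ⟨e, LA, LB, u, du, D, hc⟩ := ha.exists_isChartChain hS ha.sdim_eq
  obtain ⟨F, P, hF, hI, he⟩ := hc.exists_invariant_graphs
  rw [sLimit_eq ha.sdim_eq]
  obtain ⟨G, hG, hlim⟩ := hc.exists_tendsto (T := fun k => S.sTransform (a k)) (it := S.sIter a)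
    (fun k V hV => by
      have h1 := Classical.epsilon_spec (ha.existsUnique_sTransform hS k
        ((isSAdmissible_iff (ha.sdim_eq (k + 1))).2 hV)).exists
      exact ⟨(isSAdmissible_iff (ha.sdim_eq k)).1 h1.1, h1.2⟩)
    (fun V => rfl) (fun n V => rfl) hF hI
    (fun n => (isSAdmissible_iff (ha.sdim_eq n)).1 (hW n))
  exact ⟨G, F 0, hG, he ▸ hc.isGraph (hF 0), hlim⟩

theorem image_sLimit_subset : S.f '' S.sLimit a ⊆ S.sLimit fun k => a (k + 1) := by
  obtain ⟨e, LA, LB, u, du, D, hc⟩ := ha.exists_isChartChain hS ha.sdim_eq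
  rw [sLimit_eq ha.sdim_eq, sLimit_eq fun k => ha.sdim_eq (k + 1)]
  exact hc.image_limitSet_subset

theorem sC1DistLE (hb : S.IsFuture b) {N : ℕ} (hab : ∀ k ≤ N, b k = a k) :
    S.SC1DistLE (a 0).x ((a 0).η ^ 2) (S.sCore (a 0) (S.sLimit a)) (S.sCore (a 0) (S.sLimit b))
      (10 * ((ladderInv S.κ.Γ S.κ.γ)^[N] (a 0).η) ^ (S.κ.β / 4)) := by
  have hsb : ∀ k, sdim S.f (b k).x = sdim S.f (a 0).x := fun k => by
    rw [hb.sdim_eq, hab 0 (Nat.zero_le N)]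
  obtain ⟨e, LA, LB, u, du, D, hc⟩ := ha.exists_isChartChain hS ha.sdim_eq
  obtain ⟨e', LA', LB', u', du', D', hc'⟩ := hb.exists_isChartChain hS hsb
  rw [sLimit_eq ha.sdim_eq, sLimit_eq hsb]
  exact hc.core_close hc' (fun k hk => by rw [hab k hk]) (fun k hk => by rw [hab k hk])
    (fun k hk => by simp only [hab k hk]) rfl
    (iterate_ladderInv_le hS.Γ_pos.le hS.γ_pos (ha 0).1.η_pos N)

end IsFuture

end Setup

/-- For small `ε` the conditions on the calibration hold. -/
theorem exists_isFine {β Γ γ : ℝ} (hβ : β ∈ Ioo (0 : ℝ) 1) (hΓ : 0 < Γ) (hγ : 5 / β < γ)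
    (hd : 2 ≤ d) (f : M ≃ₘ^1⟮𝓡 d, 𝓡 d⟯ M) (hf : HolderDifferential β f) (F : Framing d M) :
    ∃ K r₀ r T, ∃ ε₀ > 0, ∀ ε ∈ Ioo 0 ε₀, ∀ (root : ℝ → ℝ)
      (C : ∀ x : M, Euc d ≃L[ℝ] TangentSpace (𝓡 d) x), IsLyapunovChange f C →
      Setup.IsFine (⟨⟨β, Γ, γ, ε, root⟩, f, C, F⟩ : Setup d M) K r₀ r T := by
  obtain ⟨K, r₀, r, T, hb⟩ := exists_hasBounds hβ.1 hβ.2.le f hf F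
  obtain ⟨s₀, hs₀, hs⟩ := exists_isSmallSize hβ.1 hΓ hγ hb
  have hβ0 := hβ.1
  refine ⟨K, r₀, r, T, min 1 s₀, lt_min one_pos hs₀, fun ε hε root C hC =>
    ⟨hd, hβ, hΓ, lt_trans (by positivity) hγ, hC, hb, fun x hN hQ => ?_⟩⟩
  have hε0 : 0 < ε := hε.1
  obtain ⟨hε1, hε2⟩ := lt_min_iff.1 hε.2
  have hscal : Calibration.scalar ⟨β, Γ, γ, ε, root⟩ = 1 / 3 ^ (6 / β) * ε ^ (90 / β) := rfl
  have h0 : 0 < Calibration.scalar ⟨β, Γ, γ, ε, root⟩ := by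
    rw [hscal]
    positivity
  have h1 : Calibration.scalar ⟨β, Γ, γ, ε, root⟩ < s₀ := by
    rw [hscal]
    have h2 : ε ^ (90 / β) ≤ ε := by
      have h3 : 1 ≤ 90 / β := by
        rw [le_div_iff₀ hβ0]
        linarith [hβ.2]
      simpa using Real.rpow_le_rpow_of_exponent_ge hε0 hε1.le h3
    have h4 : 1 / (3 : ℝ) ^ (6 / β) ≤ 1 := by
      rw [div_le_one (by positivity)]
      exact Real.one_le_rpow (by norm_num) (by positivity)
    calc _ ≤ 1 * ε := by gcongr
      _ < s₀ := by linarith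
  exact hs _ h0 h1 _ hN _ hQ (Setup.Q_le _ x h0.le)

end GraphTransforms

end SummableOrbits

end

open SummableOrbits in
theorem proposition3 (β Γ γ : ℝ) (hβ : β ∈ Set.Ioo (0 : ℝ) 1) (hΓ : 0 < Γ) (hγ : 5 / β < γ) :
    ∃ C₁ τ : ℝ, 0 < C₁ ∧ 0 < τ ∧
      (∀ η ∈ Set.Ioc (0 : ℝ) 1,
        Summable fun N : ℕ => ((ladderInv Γ γ)^[N] η) ^ (1 / γ + τ)) ∧
      ∀ (d : ℕ), 2 ≤ d →
      ∀ (M : Type*) [TopologicalSpace M] [T2Space M] [CompactSpace M] [ChartedSpace (Euc d) M]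
        [IsManifold (𝓡 d) ∞ M] [RiemannianBundle (fun x : M => TangentSpace (𝓡 d) x)]
        [IsContMDiffRiemannianBundle (𝓡 d) ∞ (Euc d) (fun x : M => TangentSpace (𝓡 d) x)]
        (f : M ≃ₘ^1⟮𝓡 d, 𝓡 d⟯ M) (_ : HolderDifferential β f) (frame : Framing d M),
      ∃ ε₀ > 0, ∀ ε ∈ Set.Ioo 0 ε₀,
      ∀ (root : ℝ → ℝ) (_ : IsLadderRoot Γ γ root)
        (C : ∀ x : M, Euc d ≃L[ℝ] TangentSpace (𝓡 d) x) (_ : IsLyapunovChange f C)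
        (S : Setup d M) (_ : S = ⟨⟨β, Γ, γ, ε, root⟩, f, C, frame⟩),
      ∃ Vu Vs : (ℕ → DoubleChart M) → Set M,
        -- for every chain and all admissible starting manifolds:
        (∀ v : ℤ → DoubleChart M, S.IsChain v →
          -- the graph transforms along the chain are well defined
          ((∀ i V, S.IsUAdmissible (v i) V → ∃! W, S.IsUTransform (v (i + 1)) V W) ∧
            (∀ i V, S.IsSAdmissible (v (i + 1)) V → ∃! W, S.IsSTransform (v i) V W)) ∧
          -- their iterates converge, to limits that do not depend on the starting manifolds
          ((∀ W : ℕ → Set M, (∀ n, S.IsUAdmissible (past v n) (W n)) →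
              S.UConverges (v 0) (fun n => S.uIter (past v) n (W n)) (Vu (past v))) ∧
            (∀ W : ℕ → Set M, (∀ n, S.IsSAdmissible (future v n) (W n)) →
              S.SConverges (v 0) (fun n => S.sIter (future v) n (W n)) (Vs (future v)))) ∧
          -- the limits are admissible
          (S.IsUAdmissible (v 0) (Vu (past v)) ∧ S.IsSAdmissible (v 0) (Vs (future v))) ∧
          -- the limits are invariant
          (f '' Vs (future v) ⊆ Vs (future fun i => v (i + 1)) ∧
            f.symm '' Vu (past v) ⊆ Vu (past fun i => v (i - 1))) ∧
          -- the limits are characterised by the orbits of their points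
          (Vs (future v) = {p | p ∈ S.ψ (v 0).x '' box d (sdim f (v 0).x) (v 0).ps ∧
              ∀ k : ℕ, f^[k] p ∈
                S.ψ (v k).x '' box d (sdim f (v k).x) (10 * S.Q (v k).x)} ∧
            Vu (past v) = {p | p ∈ S.ψ (v 0).x '' box d (sdim f (v 0).x) (v 0).pu ∧
              ∀ k : ℕ, f.symm^[k] p ∈
                S.ψ (v (-k)).x '' box d (sdim f (v (-k)).x) (10 * S.Q (v (-k)).x)})) ∧
        -- summable variations of the leaf cores
        (∀ v w : ℤ → DoubleChart M, S.IsChain v → S.IsChain w →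
          ∀ N : ℕ, (∀ i : ℤ, |i| ≤ N → v i = w i) →
            S.UC1DistLE (v 0).x ((v 0).η ^ 2)
              (S.uCore (v 0) (Vu (past v))) (S.uCore (v 0) (Vu (past w)))
              (C₁ * ((ladderInv Γ γ)^[N] (v 0).η) ^ (1 / γ + τ)) ∧
            S.SC1DistLE (v 0).x ((v 0).η ^ 2)
              (S.sCore (v 0) (Vs (future v))) (S.sCore (v 0) (Vs (future w)))
              (C₁ * ((ladderInv Γ γ)^[N] (v 0).η) ^ (1 / γ + τ))) := by
  have hβ0 := hβ.1
  have hγ0 : 0 < γ := lt_trans (by positivity) hγ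
  have hτ : 0 < β / 4 - 1 / γ := by
    rw [div_lt_iff₀ hβ0] at hγ
    rw [sub_pos, div_lt_div_iff₀ hγ0 (by norm_num)]
    linarith
  -- the exponent `1 / γ + τ = β / 4` is the one of `IsAdm.core_close`, with `α = β / 2`
  refine ⟨10, β / 4 - 1 / γ, by norm_num, hτ,
    fun η hη => summable_iterate_ladderInv hΓ hγ0 hτ hη.1 hη.2, ?_⟩
  intro d hd M _ _ _ _ _ _ _ f hf frame
  obtain ⟨K, r₀, r, T, ε₀, hε₀, hfine⟩ := exists_isFine hβ hΓ hγ hd f hf frame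
  refine ⟨ε₀, hε₀, fun ε hε root _ C hC S hSdef => ?_⟩
  have hS : S.IsFine K r₀ r T := hSdef ▸ hfine ε hε root C hC
  obtain ⟨hSf, hSΓ, hSγ, hSβ⟩ : S.f = f ∧ S.κ.Γ = Γ ∧ S.κ.γ = γ ∧ S.κ.β = β := by
    subst hSdef
    exact ⟨rfl, rfl, rfl, rfl⟩
  clear hSdef
  subst hSf hSΓ hSγ hSβ
  refine ⟨S.uLimit, S.sLimit, fun v hv => ⟨⟨fun i V hV => ?_, fun i V hV => ?_⟩,
    ⟨fun W hW => hv.isPast.uConverges hS hW, fun W hW => hv.isFuture.sConverges hS hW⟩,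
    ⟨hv.isPast.isUAdmissible_uLimit hS, hv.isFuture.isSAdmissible_sLimit hS⟩, ⟨?_, ?_⟩,
    ⟨rfl, rfl⟩⟩, fun v w hv hw N hvw => ?_⟩
  · -- the step from `v i` to `v (i + 1)` is the last one in the past of the shifted chain
    have e1 : past (fun j => v (j + (i + 1))) 0 = v (i + 1) := by
      simp only [past]
      congr 1
      simp
    have e2 : past (fun j => v (j + (i + 1))) 1 = v i := by
      simp only [past]
      congr 1
      push_cast
      ring
    have h1 := (hv.shift (i + 1)).isPast.existsUnique_uTransform hS 0 (V := V)
    rw [zero_add, e1, e2] at h1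
    exact h1 hV
  · have e1 : future (fun j => v (j + i)) 0 = v i := by
      simp only [future]
      congr 1
      simp
    have e2 : future (fun j => v (j + i)) 1 = v (i + 1) := by
      simp only [future]
      congr 1
      push_cast
      ring
    have h1 := (hv.shift i).isFuture.existsUnique_sTransform hS 0 (V := V)
    rw [zero_add, e1, e2] at h1
    exact h1 hV
  · have h1 := hv.isFuture.image_sLimit_subset hS
    have e1 : (fun k => future v (k + 1)) = future fun i => v (i + 1) := by
      funext k
      simp only [future]
      congr 1
    rwa [e1] at h1
  · have h1 := hv.isPast.image_uLimit_subset hS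
    have e1 : (fun k => past v (k + 1)) = past fun i => v (i - 1) := by
      funext k
      simp only [past]
      congr 1
      push_cast
      ring
    rwa [e1] at h1
  · have e : 1 / S.κ.γ + (S.κ.β / 4 - 1 / S.κ.γ) = S.κ.β / 4 := by ring
    rw [e]
    refine ⟨hv.isPast.uC1DistLE hS hw.isPast fun k hk => ?_,
      hv.isFuture.sC1DistLE hS hw.isFuture fun k hk => ?_⟩
    · refine (hvw _ ?_).symm
      rw [abs_neg, Nat.abs_cast]
      exact_mod_cast hk
    · refine (hvw _ ?_).symm
      rw [Nat.abs_cast]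
      exact_mod_cast hk
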